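/- Let $p$ be a prime, let $G$ be a finite group and let $F$ be a field of characteristic $p$ which is a splitting field of the group algebra $FH$ for every subgroup $H\le G$. Let $e$ be an idempotent of the center $Z(FG)$ and let $B=FGe$ (for instance a block algebra of $FG$). Let $T^\Delta(B,B)$ be the free abelian group on the isomorphism classes of indecomposable $p$-permutation $(B,B)$-bimodules that are projective as left and as right modules; it is a ring, with $[M]\cdot[N]=[M\otimes_B N]$ and identity element $[B]$. Let $Pr(B,B)$ be the subgroup spanned by the classes of the projective indecomposable $(B,B)$-bimodules (that is, $F[G\times G]$-modules); it is an ideal of $T^\Delta(B,B)$. For a field $k$ put $kT^\Delta(B,B)=k\otimes_{\mathbb Z}T^\Delta(B,B)$ and $kPr(B,B)=k\otimes_{\mathbb Z}Pr(B,B)\subseteq kT^\Delta(B,B)$. Let $l=l(B)$ be the number of isomorphism classes of simple $B$-modules. There exist pairwise orthogonal primitive idempotents $\varepsilon_1,\dots,\varepsilon_l$ of $B$ such that $FG\varepsilon_1,\dots,FG\varepsilon_l$ is a complete list of pairwise non-isomorphic projective indecomposable $B$-modules; for any choice of these, put $P_{ij}=FG\varepsilon_i\otimes_F\varepsilon_jFG$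 and let $C=(\dim_F\varepsilon_iFG\varepsilon_j)_{1\le i,j\le l}$ be the Cartan matrix of $B$. A primitive idempotent of a (not necessarily unital) ring is a non-zero idempotent that is not the sum of two non-zero orthogonal idempotents of the ring. (1) Let $k$ be a field of characteristic different from $p$. Then there is a multiplicative $k$-linear isomorphism $kPr(B,B)\cong\mathrm{Mat}_l(k)$; in particular $kPr(B,B)$ has an identity element $1_{kPr(B,B)}$, every primitive decomposition of $1_{kPr(B,B)}$ in $kPr(B,B)$ (finite set of pairwise orthogonal primitive idempotents with sum $1_{kPr(B,B)}$) has cardinality $l$, and any two primitive idempotents of $kPr(B,B)$ are conjugate by a unit of $kPr(B,B)$. The matrix $C$ is invertible over $k$, and with $(c'_{ij})=C^{-1}\in\mathrm{Mat}_l(k)$ one has $$1_{kPr(B,B)}=\sum_{i,j=1}^{l}c'_{ij}\,[P_{ij}],$$ and the $l$ elements $\sum_{j=1}^{l}c'_{ij}[P_{ij}]$, $1\le i\le l$, form a primitive decomposition of $1_{kPr(B,B)}$ in $kPr(B,B)$. Moreover, $1_{kPr(B,B)}$ is a central idempotent of $kT^\Delta(B,B)$, and $kPr(B,B)=kT^\Delta(B,B)\cdot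 1_{kPr(B,B)}$; if $e\neq 0$, then $1_{kPr(B,B)}$ is a primitive idempotent of $Z(kT^\Delta(B,B))$, i.e. $kPr(B,B)$ is a block algebra of $kT^\Delta(B,B)$. (2) The ring $Pr(B,B)$ has an identity element if and only if every block algebra of $FG$ which is a direct summand of $B$ has defect $0$. -/

import Mathlib

open scoped TensorProduct MonoidAlgebra

universe u v w

namespace PPermutation

section Grothendieck

open Algebra

variable {S : Type w} [Semiring S]

theorem grothendieck_lift_of {A : Type w} [AddCommGroup A] (f : S →+ A) (x : S) :
    GrothendieckAddGroup.lift f (GrothendieckAddGroup.of x) = f x :=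
  DFunLike.congr_fun (GrothendieckAddGroup.lift.symm_apply_apply f) x

theorem grothendieck_ext {A : Type w} [AddCommGroup A] {f g : GrothendieckAddGroup S →+ A}
    (h : ∀ s, f (GrothendieckAddGroup.of s) = g (GrothendieckAddGroup.of s)) : f = g := by
  apply GrothendieckAddGroup.lift.symm.injective
  ext x
  exact h x

/-- The biadditive extension of the multiplication of a semiring to its Grothendieck group. -/
noncomputable def grothendieckMul :
    GrothendieckAddGroup S →+ GrothendieckAddGroup S →+ GrothendieckAddGroup S :=
  GrothendieckAddGroup.lift
    { toFun := fun s => GrothendieckAddGroup.lift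
        (GrothendieckAddGroup.of.comp (AddMonoidHom.mulLeft s))
      map_zero' := grothendieck_ext fun x => by
        rw [grothendieck_lift_of]; simp
      map_add' := fun s t => grothendieck_ext fun x => by
        rw [AddMonoidHom.add_apply, grothendieck_lift_of, grothendieck_lift_of,
          grothendieck_lift_of]
        simp [add_mul] }

theorem grothendieckMul_of (s t : S) :
    grothendieckMul (GrothendieckAddGroup.of s) (GrothendieckAddGroup.of t)
      = GrothendieckAddGroup.of (s * t) := by
  rw [grothendieckMul, grothendieck_lift_of]
  exact grothendieck_lift_of _ _

/-- The Grothendieck ring of a (not necessarily commutative) semiring. -/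
noncomputable abbrev grothendieckRing : Ring (GrothendieckAddGroup S) :=
  { (inferInstance : AddCommGroup (GrothendieckAddGroup S)) with
    mul := fun x y => grothendieckMul x y
    one := GrothendieckAddGroup.of 1
    left_distrib := fun x y z => map_add (grothendieckMul x) y z
    right_distrib := fun x y z => by
      change grothendieckMul (x + y) z = _
      rw [map_add]; rfl
    zero_mul := fun x => by
      change grothendieckMul 0 x = 0
      simp
    mul_zero := fun x => map_zero (grothendieckMul x)
    mul_assoc := fun x y z => by
      change grothendieckMul (grothendieckMul x y) z = grothendieckMul x (grothendieckMul y z)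
      have h1 : ∀ s t : S, grothendieckMul
          (grothendieckMul (GrothendieckAddGroup.of s) (GrothendieckAddGroup.of t)) z =
          grothendieckMul (GrothendieckAddGroup.of s)
            (grothendieckMul (GrothendieckAddGroup.of t) z) := fun s t =>
        DFunLike.congr_fun (f := grothendieckMul (grothendieckMul (GrothendieckAddGroup.of s)
          (GrothendieckAddGroup.of t))) (g := (grothendieckMul (GrothendieckAddGroup.of s)).comp
            (grothendieckMul (GrothendieckAddGroup.of t))) (grothendieck_ext fun r => by
              rw [AddMonoidHom.comp_apply, grothendieckMul_of, grothendieckMul_of,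
                grothendieckMul_of, grothendieckMul_of, mul_assoc]) z
      have h2 : ∀ s : S, grothendieckMul (grothendieckMul (GrothendieckAddGroup.of s) y) z =
          grothendieckMul (GrothendieckAddGroup.of s) (grothendieckMul y z) := fun s =>
        DFunLike.congr_fun (f := (grothendieckMul.flip z).comp
          (grothendieckMul (GrothendieckAddGroup.of s)))
          (g := (grothendieckMul (GrothendieckAddGroup.of s)).comp (grothendieckMul.flip z))
          (grothendieck_ext fun t => h1 s t) y
      exact DFunLike.congr_fun (f := (grothendieckMul.flip z).comp (grothendieckMul.flip y))
        (g := grothendieckMul.flip (grothendieckMul y z)) (grothendieck_ext fun s => h2 s) x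
    one_mul := fun x => by
      change grothendieckMul (GrothendieckAddGroup.of 1) x = x
      have : grothendieckMul (GrothendieckAddGroup.of (1 : S)) = AddMonoidHom.id _ :=
        grothendieck_ext fun s => by rw [grothendieckMul_of, one_mul]; rfl
      rw [this]; rfl
    mul_one := fun x => by
      change grothendieckMul.flip (GrothendieckAddGroup.of 1) x = x
      have : grothendieckMul.flip (GrothendieckAddGroup.of (1 : S)) = AddMonoidHom.id _ :=
        grothendieck_ext fun s => by
          rw [AddMonoidHom.flip_apply, grothendieckMul_of, mul_one]; rfl
      rw [this]; rfl }

end Grothendieck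

section Projective

variable {F : Type u} [Field F] {Γ : Type v} [Group Γ] [Fintype Γ]

theorem module_projective_iff {M : Type w} [AddCommGroup M] [Module F M] [Module F[Γ] M]
    [IsScalarTower F F[Γ] M] :
    Module.Projective F[Γ] M ↔ ∃ θ : M →ₗ[F] M, ∀ m,
      ∑ g : Γ, MonoidAlgebra.single g (1 : F) • θ (MonoidAlgebra.single g⁻¹ (1 : F) • m) = m := by
  classical
  constructor
  · intro hM
    obtain ⟨s, hs⟩ := Module.projective_def'.1 hM
    let c1 : F[Γ] →ₗ[F] F :=
      (Finsupp.lapply 1).comp (MonoidAlgebra.coeffLinearEquiv F).toLinearMap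
    let T : (M →₀ F[Γ]) →ₗ[F] M :=
      Finsupp.lsum F (fun x : M => (LinearMap.toSpanSingleton F M x).comp c1)
    have hT : ∀ m : M →₀ F[Γ],
        ∑ g : Γ, MonoidAlgebra.single g (1 : F) • T (MonoidAlgebra.single g⁻¹ (1 : F) • m)
          = Finsupp.linearCombination F[Γ] id m := by
      intro m
      induction m using Finsupp.induction_linear with
      | zero => simp
      | add f g hf hg => simp only [smul_add, map_add, Finset.sum_add_distrib, hf, hg]
      | single x a =>
        have h1 : ∀ g : Γ, T (MonoidAlgebra.single g⁻¹ (1 : F) • Finsupp.single x a)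
            = a.coeff g • x := by
          intro g
          rw [Finsupp.smul_single, smul_eq_mul, Finsupp.lsum_single]
          simp [c1]
        simp only [h1, Finsupp.linearCombination_single, id]
        have h2 : a = ∑ g : Γ, MonoidAlgebra.single g (a.coeff g) := by
          ext g
          simp
        conv_rhs => rw [h2, Finset.sum_smul]
        refine Finset.sum_congr rfl fun g _ => ?_
        rw [← algebraMap_smul F[Γ] (a.coeff g) x, smul_smul]
        simp
    refine ⟨T.comp (s.restrictScalars F), fun m => ?_⟩
    simp only [LinearMap.comp_apply, LinearMap.restrictScalars_apply, map_smul]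
    rw [hT]
    exact DFunLike.congr_fun hs m
  · rintro ⟨θ, hθ⟩
    refine Module.Projective.of_lifting_property'' fun f hf => ?_
    obtain ⟨s, hs⟩ := LinearMap.exists_rightInverse_of_surjective (f.restrictScalars F)
      (LinearMap.range_eq_top.2 hf)
    have hs' : ∀ m, f (s m) = m := fun m => DFunLike.congr_fun hs m
    let t : M →ₗ[F] (M →₀ F[Γ]) := ∑ g : Γ,
      (Algebra.lsmul F F (M →₀ F[Γ]) (MonoidAlgebra.single g (1 : F))).comp
        (s.comp (θ.comp (Algebra.lsmul F F M (MonoidAlgebra.single g⁻¹ (1 : F)))))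
    have ht : ∀ m, t m = ∑ g : Γ, MonoidAlgebra.single g (1 : F) •
        s (θ (MonoidAlgebra.single g⁻¹ (1 : F) • m)) := fun m => by
      simp only [t, LinearMap.sum_apply]
      rfl
    refine ⟨MonoidAlgebra.equivariantOfLinearOfComm t fun h m => ?_, ?_⟩
    · rw [ht, ht, Finset.smul_sum]
      refine Fintype.sum_bijective (h⁻¹ * ·) (Group.mulLeft_bijective h⁻¹) _ _ fun g => ?_
      simp only [smul_smul, MonoidAlgebra.single_mul_single, mul_inv_rev, inv_inv, one_mul,
        mul_inv_cancel_left]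
    · ext m
      rw [LinearMap.comp_apply, MonoidAlgebra.equivariantOfLinearOfComm_apply, ht, map_sum]
      simp only [map_smul, hs', hθ, LinearMap.id_apply]

theorem projective_iff {V : Type w} [AddCommGroup V] [Module F V] (ρ : Representation F Γ V) :
    Module.Projective F[Γ] ρ.asModule ↔
      ∃ θ : V →ₗ[F] V, ∀ v, ∑ g : Γ, ρ g (θ (ρ g⁻¹ v)) = v := by
  rw [module_projective_iff]
  refine exists_congr fun θ => forall_congr' fun v => ?_
  simp only [Representation.single_smul, one_smul]
  rfl

end Projective


section Bimodules

variable {F : Type u} [Field F]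

/-- A representation `ρ` of a finite group `Γ` over `F` is a `p`-permutation module
(`p` being the characteristic of `F`) if it is isomorphic to a direct summand, i.e. a retract, of
the permutation module `F[X]` of a finite `Γ`-set `X`. -/
def IsPPermutation {Γ : Type v} [Group Γ] {V : Type w} [AddCommGroup V] [Module F V]
    (ρ : Representation F Γ V) : Prop :=
  ∃ (X : Type v) (_ : Finite X) (_ : MulAction Γ X)
    (i : ρ.IntertwiningMap (Representation.ofMulAction F Γ X))
    (r : (Representation.ofMulAction F Γ X).IntertwiningMap ρ), ∀ v, r (i v) = v

/-- The `F`-linear extension `F[X] → V` of a map `X → V`. -/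
noncomputable def linExt {X : Type v} {V : Type w} [AddCommGroup V] [Module F V] (f : X → V) :
    F[X] →ₗ[F] V :=
  (Finsupp.linearCombination F f).comp (MonoidAlgebra.coeffLinearEquiv F).toLinearMap

@[simp]
theorem linExt_single {X : Type v} {V : Type w} [AddCommGroup V] [Module F V] (f : X → V)
    (x : X) (a : F) : linExt f (MonoidAlgebra.single x a) = a • f x := by
  simp [linExt]

theorem linExt_ext {X : Type v} {V : Type w} [AddCommGroup V] [Module F V] {f g : F[X] →ₗ[F] V}
    (h : ∀ x, f (MonoidAlgebra.single x 1) = g (MonoidAlgebra.single x 1)) : f = g := by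
  ext x
  exact h x

variable {G : Type v} [Group G]

/-- The left `FG`-module underlying an `(FG,FG)`-bimodule; bimodules are viewed as representations
of `G × G` through `(g, h) m = g m h⁻¹`. -/
abbrev leftRep {V : Type w} [AddCommGroup V] [Module F V] (ρ : Representation F (G × G) V) :
    Representation F G V :=
  ρ.comp (MonoidHom.inl G G)

/-- The right `FG`-module underlying an `(FG,FG)`-bimodule, turned into a left `FG`-module through
`h ↦ h⁻¹`. -/
abbrev rightRep {V : Type w} [AddCommGroup V] [Module F V] (ρ : Representation F (G × G) V) :
    Representation F G V :=
  ρ.comp (MonoidHom.inr G G)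

/-- The `F`-linear extension of `g ↦ g⁻¹` to the group algebra. -/
noncomputable def invol (x : F[G]) : F[G] := MonoidAlgebra.mapDomain (fun g => g⁻¹) x

/-- Left multiplication by an element of `FG` on an `(FG,FG)`-bimodule. -/
noncomputable abbrev leftAct {V : Type w} [AddCommGroup V] [Module F V]
    (ρ : Representation F (G × G) V) (x : F[G]) : Module.End F V :=
  (leftRep ρ).asAlgebraHom x

/-- Right multiplication by an element of `FG` on an `(FG,FG)`-bimodule. -/
noncomputable abbrev rightAct {V : Type w} [AddCommGroup V] [Module F V]
    (ρ : Representation F (G × G) V) (x : F[G]) : Module.End F V :=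
  (rightRep ρ).asAlgebraHom (invol x)

/-- For a central idempotent `e` of `FG`, the predicate that an `(FG,FG)`-bimodule is a finitely
generated `(FGe,FGe)`-bimodule which is a `p`-permutation module for `G × G` and perfect,
i.e. projective as a left and as a right module. -/
structure IsPerfectPPermutation (e : F[G]) {V : Type w} [AddCommGroup V] [Module F V]
    (ρ : Representation F (G × G) V) : Prop where
  finite : Module.Finite F V
  pPermutation : IsPPermutation ρ
  left_projective : Module.Projective F[G] (leftRep ρ).asModule
  right_projective : Module.Projective F[G] (rightRep ρ).asModule
  left_e : ∀ v, leftAct ρ e v = v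
  right_e : ∀ v, rightAct ρ e v = v

section tensor

variable {V W : Type w} {X : Type*} [AddCommGroup V] [Module F V] [AddCommGroup W] [Module F W]
  [AddCommGroup X] [Module F X]
  (ρ : Representation F (G × G) V) (σ : Representation F (G × G) W)

/-- The underlying space of `V ⊗_{FG} W`: the quotient of `V ⊗_F W` by the span of the elements
`v h⁻¹ ⊗ h w - v ⊗ w`, i.e. by the relations `v h ⊗ w = v ⊗ h w`. -/
abbrev TensorSpace : Type w :=
  ((rightRep ρ).tprod (leftRep σ)).Coinvariants

/-- The class of `v ⊗ w` in `V ⊗_{FG} W`. -/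
noncomputable def tmk : V →ₗ[F] W →ₗ[F] TensorSpace ρ σ :=
  (TensorProduct.mk F V W).compr₂ (Representation.Coinvariants.mk _)

theorem tmk_balanced (h : G) (v : V) (w : W) :
    tmk ρ σ (ρ (1, h) v) (σ (h, 1) w) = tmk ρ σ v w :=
  Representation.Coinvariants.mk_self_apply ((rightRep ρ).tprod (leftRep σ)) h (v ⊗ₜ[F] w)

variable {ρ σ}

theorem tensor_ext {f g : TensorSpace ρ σ →ₗ[F] X}
    (h : ∀ v w, f (tmk ρ σ v w) = g (tmk ρ σ v w)) : f = g := by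
  apply Representation.Coinvariants.hom_ext
  apply TensorProduct.ext'
  exact h

/-- The linear map on `V ⊗_{FG} W` induced by a balanced bilinear map. -/
noncomputable def tlift (f : V →ₗ[F] W →ₗ[F] X)
    (hf : ∀ h v w, f (ρ (1, h) v) (σ (h, 1) w) = f v w) : TensorSpace ρ σ →ₗ[F] X :=
  Representation.Coinvariants.lift _ (TensorProduct.lift f) fun h => TensorProduct.ext' fun v w =>
    hf h v w

@[simp]
theorem tlift_tmk (f : V →ₗ[F] W →ₗ[F] X)
    (hf : ∀ h v w, f (ρ (1, h) v) (σ (h, 1) w) = f v w) (v : V) (w : W) :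
    tlift f hf (tmk ρ σ v w) = f v w := rfl

theorem rep_comm (ρ : Representation F (G × G) V) (g h : G) (v : V) :
    ρ (g, 1) (ρ (1, h) v) = ρ (1, h) (ρ (g, 1) v) := by
  rw [← Module.End.mul_apply, ← Module.End.mul_apply, ← map_mul, ← map_mul]
  simp

theorem rep_split (ρ : Representation F (G × G) V) (g h : G) (v : V) :
    ρ (g, h) v = ρ (g, 1) (ρ (1, h) v) := by
  rw [← Module.End.mul_apply, ← map_mul]
  simp

variable (ρ σ)

/-- The `(FG,FG)`-bimodule `V ⊗_{FG} W`, with `(g, h) (v ⊗ w) = g v ⊗ w h⁻¹`. -/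
noncomputable def tensorRep : Representation F (G × G) (TensorSpace ρ σ) where
  toFun x := tlift ((tmk ρ σ).compl₁₂ (ρ (x.1, 1)) (σ (1, x.2))) fun h v w => by
    simp only [LinearMap.compl₁₂_apply]
    rw [rep_comm, ← rep_comm σ, tmk_balanced]
  map_one' := tensor_ext fun v w => by
    simp only [tlift_tmk, LinearMap.compl₁₂_apply, Prod.fst_one, Prod.snd_one]
    rw [show ((1 : G), (1 : G)) = 1 from rfl]
    simp
  map_mul' x y := tensor_ext fun v w => by
    rw [Module.End.mul_apply]
    simp only [tlift_tmk, LinearMap.compl₁₂_apply, Prod.fst_mul, Prod.snd_mul]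
    rw [← Module.End.mul_apply, ← Module.End.mul_apply, ← map_mul, ← map_mul]
    simp

@[simp]
theorem tensorRep_tmk (x : G × G) (v : V) (w : W) :
    tensorRep ρ σ x (tmk ρ σ v w) = tmk ρ σ (ρ (x.1, 1) v) (σ (1, x.2) w) := rfl

theorem leftAct_tmk (x : F[G]) (v : V) (w : W) :
    leftAct (tensorRep ρ σ) x (tmk ρ σ v w) = tmk ρ σ (leftAct ρ x v) w := by
  induction x using MonoidAlgebra.induction_linear with
  | zero => simp
  | add x y hx hy => simp only [map_add, LinearMap.add_apply, hx, hy]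
  | single g a =>
    simp only [Representation.asAlgebraHom_single, LinearMap.smul_apply, map_smul,
      MonoidHom.comp_apply, MonoidHom.inl_apply, tensorRep_tmk]
    rw [show ((1 : G), (1 : G)) = 1 from rfl]
    simp

theorem rightAct_tmk (x : F[G]) (v : V) (w : W) :
    rightAct (tensorRep ρ σ) x (tmk ρ σ v w) = tmk ρ σ v (rightAct σ x w) := by
  unfold rightAct
  generalize invol x = y
  induction y using MonoidAlgebra.induction_linear with
  | zero => simp
  | add x y hx hy => simp only [map_add, LinearMap.add_apply, hx, hy]
  | single g a =>
    simp only [Representation.asAlgebraHom_single, LinearMap.smul_apply, map_smul,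
      MonoidHom.comp_apply, MonoidHom.inr_apply, tensorRep_tmk]
    rw [show ((1 : G), (1 : G)) = 1 from rfl]
    simp

theorem tmk_act (x : F[G]) (v : V) (w : W) :
    tmk ρ σ (rightAct ρ x v) w = tmk ρ σ v (leftAct σ x w) := by
  unfold rightAct
  induction x using MonoidAlgebra.induction_linear with
  | zero => simp [invol]
  | add x y hx hy =>
    simp only [invol, MonoidAlgebra.mapDomain_add, map_add, LinearMap.add_apply] at hx hy ⊢
    rw [hx, hy]
  | single g a =>
    simp only [invol, MonoidAlgebra.mapDomain_single, Representation.asAlgebraHom_single,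
      LinearMap.smul_apply, map_smul, MonoidHom.comp_apply, MonoidHom.inl_apply,
      MonoidHom.inr_apply]
    rw [← tmk_balanced ρ σ g (ρ (1, g⁻¹) v), ← Module.End.mul_apply, ← map_mul]
    rw [Prod.mk_mul_mk, mul_inv_cancel, one_mul, show ((1 : G), (1 : G)) = 1 from rfl]
    simp

end tensor


section closure

variable {V W X : Type w} [AddCommGroup V] [Module F V] [AddCommGroup W] [Module F W]
  {ρ : Representation F (G × G) V} {σ : Representation F (G × G) W}

theorem intertwine {Γ : Type v} [Group Γ] {V W : Type*} [AddCommGroup V] [Module F V]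
    [AddCommGroup W] [Module F W]
    {ρ : Representation F Γ V} {σ : Representation F Γ W} (f : ρ.IntertwiningMap σ) (g : Γ)
    (v : V) : f (ρ g v) = σ g (f v) :=
  LinearMap.congr_fun (f.isIntertwining' g) v

/-- The orbit relation of `G` on `X × Y` for `h (x, y) = (x h⁻¹, h y)`. -/
def middleSetoid (G X Y : Type v) [Group G] [MulAction (G × G) X] [MulAction (G × G) Y] :
    Setoid (X × Y) where
  r s t := ∃ h : G, ((1, h) : G × G) • s.1 = t.1 ∧ ((h, 1) : G × G) • s.2 = t.2
  iseqv :=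
    { refl := fun s => ⟨1, one_smul _ _, one_smul _ _⟩
      symm := by
        rintro s t ⟨h, h1, h2⟩
        refine ⟨h⁻¹, ?_, ?_⟩
        · rw [← h1, smul_smul]; simp [← Prod.one_eq_mk]
        · rw [← h2, smul_smul]; simp [← Prod.one_eq_mk]
      trans := by
        rintro s t u ⟨h, h1, h2⟩ ⟨k, k1, k2⟩
        refine ⟨k * h, ?_, ?_⟩
        · rw [← k1, ← h1, smul_smul]; simp
        · rw [← k2, ← h2, smul_smul]; simp }

theorem smul_split {X : Type v} [MulAction (G × G) X] (g h : G) (x : X) :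
    ((1, h) : G × G) • ((g, 1) : G × G) • x = ((g, 1) : G × G) • ((1, h) : G × G) • x := by
  rw [smul_smul, smul_smul]; simp

/-- The action of `G × G` on the orbits of `G` on `X × Y`. -/
@[reducible] def middleAction (G X Y : Type v) [Group G] [MulAction (G × G) X]
    [MulAction (G × G) Y] : MulAction (G × G) (Quotient (middleSetoid G X Y)) where
  smul x := Quotient.map (fun s => (((x.1, 1) : G × G) • s.1, ((1, x.2) : G × G) • s.2)) (by
    rintro s t ⟨h, h1, h2⟩
    refine ⟨h, ?_, ?_⟩
    · rw [← h1, smul_split]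
    · rw [← h2, smul_split])
  one_smul q := by
    induction q using Quotient.inductionOn with
    | h s => exact congrArg _ (Prod.ext (one_smul (G × G) s.1) (one_smul (G × G) s.2))
  mul_smul x y q := by
    induction q using Quotient.inductionOn with
    | h s =>
      refine congrArg _ (Prod.ext ?_ ?_)
      · change ((x.1 * y.1, 1) : G × G) • s.1 = ((x.1, 1) : G × G) • ((y.1, 1) : G × G) • s.1
        rw [smul_smul]; simp
      · change ((1, x.2 * y.2) : G × G) • s.2 = ((1, x.2) : G × G) • ((1, y.2) : G × G) • s.2
        rw [smul_smul]; simp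

theorem isPPermutation_iff {Γ : Type v} [Group Γ] {V : Type w} [AddCommGroup V] [Module F V]
    {ρ : Representation F Γ V} : IsPPermutation ρ ↔
      ∃ (X : Type v) (_ : Finite X) (_ : MulAction Γ X) (i : V →ₗ[F] F[X]) (r : F[X] →ₗ[F] V),
        (∀ g v, i (ρ g v) = Representation.ofMulAction F Γ X g (i v)) ∧
        (∀ g x, r (MonoidAlgebra.single (g • x) 1) = ρ g (r (MonoidAlgebra.single x 1))) ∧
        ∀ v, r (i v) = v := by
  constructor
  · rintro ⟨X, hX, hX', i, r, h⟩
    refine ⟨X, hX, hX', i.toLinearMap, r.toLinearMap, fun g v => intertwine i g v, fun g x => ?_, h⟩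
    have := intertwine r g (MonoidAlgebra.single x 1)
    rwa [Representation.ofMulAction_single] at this
  · rintro ⟨X, hX, hX', i, r, hi, hr, h⟩
    refine ⟨X, hX, hX', ⟨i, fun g => LinearMap.ext (hi g)⟩, ⟨r, fun g => linExt_ext fun x => ?_⟩, h⟩
    rw [LinearMap.comp_apply, LinearMap.comp_apply, Representation.ofMulAction_single, hr]

theorem IsPPermutation.tensor (hρ : IsPPermutation ρ) (hσ : IsPPermutation σ) :
    IsPPermutation (tensorRep ρ σ) := by
  rw [isPPermutation_iff] at hρ hσ ⊢
  obtain ⟨X, _, _, i, r, hi, hr, hir⟩ := hρ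
  obtain ⟨Y, _, _, j, s, hj, hs, hjs⟩ := hσ
  let Q := Quotient (middleSetoid G X Y)
  let act : MulAction (G × G) Q := middleAction G X Y
  let q : X → Y → Q := fun x y => Quotient.mk _ (x, y)
  have hq : ∀ (a b : G) x y, q (((a, 1) : G × G) • x) (((1, b) : G × G) • y)
      = ((a, b) : G × G) • q x y := fun a b x y => rfl
  have hq' : ∀ (h : G) x y, q (((1, h) : G × G) • x) (((h, 1) : G × G) • y) = q x y :=
    fun h x y => Quotient.sound ((middleSetoid G X Y).iseqv.symm ⟨h, rfl, rfl⟩)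
  have hqs : ∀ z : Q, ∃ x y, q x y = z := fun z => by
    induction z using Quotient.inductionOn with
    | h t => exact ⟨t.1, t.2, rfl⟩
  obtain ⟨π, hπ⟩ : ∃ π : F[Q] →ₗ[F] TensorSpace ρ σ, ∀ x y, π (MonoidAlgebra.single (q x y) 1) =
      tmk ρ σ (r (MonoidAlgebra.single x 1)) (s (MonoidAlgebra.single y 1)) := by
    refine ⟨linExt fun z => Quotient.liftOn z (fun t => tmk ρ σ (r (MonoidAlgebra.single t.1 1))
      (s (MonoidAlgebra.single t.2 1))) ?_, fun x y => by simp [q]⟩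
    rintro a b ⟨h, h1, h2⟩
    rw [← h1, ← h2, hr, hs, tmk_balanced]
  have hQ : Finite Q := Quotient.finite _
  clear_value q act Q
  let β : F[X] →ₗ[F] F[Y] →ₗ[F] F[Q] :=
    linExt fun x => linExt fun y => MonoidAlgebra.single (q x y) 1
  have hβ : ∀ x y, β (MonoidAlgebra.single x 1) (MonoidAlgebra.single y 1)
      = MonoidAlgebra.single (q x y) 1 := fun x y => by simp [β]
  clear_value β
  have hβ' : ∀ h : G, β.compl₁₂ (Representation.ofMulAction F (G × G) X (1, h))
      (Representation.ofMulAction F (G × G) Y (h, 1)) = β := fun h =>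
    linExt_ext fun x => linExt_ext fun y => by
      simp only [LinearMap.compl₁₂_apply, Representation.ofMulAction_single, hβ, hq']
  have hπβ : β.compr₂ π = (tmk ρ σ).compl₁₂ r s :=
    linExt_ext fun x => linExt_ext fun y => by
      simp only [LinearMap.compr₂_apply, LinearMap.compl₁₂_apply, hβ, hπ]
  have hπβ' : ∀ a b, π (β a b) = tmk ρ σ (r a) (s b) := fun a b =>
    LinearMap.congr_fun₂ hπβ a b
  obtain ⟨ι, hι⟩ : ∃ ι : TensorSpace ρ σ →ₗ[F] F[Q], ∀ v w, ι (tmk ρ σ v w) = β (i v) (j w) :=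
    ⟨tlift (X := F[Q]) (β.compl₁₂ i j : V →ₗ[F] W →ₗ[F] F[Q]) fun h v w => by
      rw [LinearMap.compl₁₂_apply, LinearMap.compl₁₂_apply, hi, hj]
      exact LinearMap.congr_fun₂ (hβ' h) (i v) (j w), fun v w => rfl⟩
  have hβ'' : ∀ a b : G, β.compl₁₂ (Representation.ofMulAction F (G × G) X (a, 1))
      (Representation.ofMulAction F (G × G) Y (1, b)) =
      β.compr₂ (Representation.ofMulAction F (G × G) Q (a, b)) := fun a b =>
    linExt_ext fun x => linExt_ext fun y => by
      simp only [LinearMap.compl₁₂_apply, LinearMap.compr₂_apply,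
        Representation.ofMulAction_single, hβ, hq]
  refine ⟨Q, hQ, inferInstance, ι, π, fun g => ?_, fun g z => ?_, fun v => ?_⟩
  · refine LinearMap.congr_fun (f := ι ∘ₗ tensorRep ρ σ g)
      (g := Representation.ofMulAction F (G × G) Q g ∘ₗ ι) (tensor_ext fun v w => ?_)
    rw [LinearMap.comp_apply, LinearMap.comp_apply, tensorRep_tmk, hι, hι, hi, hj]
    exact LinearMap.congr_fun₂ (hβ'' g.1 g.2) (i v) (j w)
  · obtain ⟨x, y, rfl⟩ := hqs z
    rw [hπ, tensorRep_tmk, ← hr, ← hs, ← hπ, hq]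
  · refine LinearMap.congr_fun (f := π ∘ₗ ι) (g := LinearMap.id) (tensor_ext fun v w => ?_) v
    rw [LinearMap.comp_apply, hι, hπβ', hir, hjs]
    rfl

theorem IsPPermutation.of_retract {Γ : Type v} [Group Γ] {V W : Type w} [AddCommGroup V]
    [Module F V] [AddCommGroup W] [Module F W]
    {ρ : Representation F Γ V} {σ : Representation F Γ W} (hσ : IsPPermutation σ)
    (i : ρ.IntertwiningMap σ) (r : σ.IntertwiningMap ρ) (h : ∀ v, r (i v) = v) :
    IsPPermutation ρ := by
  obtain ⟨Y, _, _, j, s, hjs⟩ := hσ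
  exact ⟨Y, inferInstance, inferInstance, j.comp i, r.comp s, fun v => by
    simp only [Representation.IntertwiningMap.comp_apply, hjs, h]⟩

theorem projective_of_retract {Γ : Type v} [Group Γ] [Finite Γ] {V W : Type*} [AddCommGroup V]
    [Module F V] [AddCommGroup W] [Module F W]
    {ρ : Representation F Γ V} {σ : Representation F Γ W}
    (hσ : Module.Projective F[Γ] σ.asModule)
    (i : ρ.IntertwiningMap σ) (r : σ.IntertwiningMap ρ) (h : ∀ v, r (i v) = v) :
    Module.Projective F[Γ] ρ.asModule := by
  cases nonempty_fintype Γ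
  rw [projective_iff] at hσ ⊢
  obtain ⟨θ, hθ⟩ := hσ
  refine ⟨r.toLinearMap ∘ₗ θ ∘ₗ i.toLinearMap, fun v => ?_⟩
  have h1 : ∀ g : Γ, ρ g ((r.toLinearMap ∘ₗ θ ∘ₗ i.toLinearMap) (ρ g⁻¹ v))
      = r.toLinearMap (σ g (θ (σ g⁻¹ (i v)))) := fun g => by
    simp only [LinearMap.comp_apply, Representation.IntertwiningMap.toLinearMap_apply, intertwine]
  rw [Finset.sum_congr rfl fun g _ => h1 g, ← map_sum, hθ]
  exact h v

end closure

section closure2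

variable {V W : Type w} [AddCommGroup V] [Module F V] [AddCommGroup W] [Module F W]
  {ρ : Representation F (G × G) V} {σ : Representation F (G × G) W}

theorem rep_left_mul (ρ : Representation F (G × G) V) (g h : G) (v : V) :
    ρ (g, 1) (ρ (h, 1) v) = ρ (g * h, 1) v := by
  rw [← Module.End.mul_apply, ← map_mul]; simp

theorem rep_right_mul (ρ : Representation F (G × G) V) (g h : G) (v : V) :
    ρ (1, g) (ρ (1, h) v) = ρ (1, g * h) v := by
  rw [← Module.End.mul_apply, ← map_mul]; simp

/-- An averaging operator on a tensor product of bimodules. -/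
noncomputable def tensorAvg [Fintype G] (θ : V →ₗ[F] V) (η : W →ₗ[F] W) :
    TensorSpace ρ σ →ₗ[F] TensorSpace ρ σ :=
  tlift (∑ h : G, (tmk ρ σ).compl₁₂ (θ ∘ₗ ρ (1, h)) (η ∘ₗ σ (h, 1))) fun k v w => by
    simp only [LinearMap.sum_apply, LinearMap.compl₁₂_apply, LinearMap.comp_apply]
    refine Fintype.sum_bijective (· * k) (Group.mulRight_bijective k) _ _ fun h => ?_
    rw [rep_right_mul, rep_left_mul]

theorem tensorAvg_tmk [Fintype G] (θ : V →ₗ[F] V) (η : W →ₗ[F] W) (v : V) (w : W) :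
    tensorAvg θ η (tmk ρ σ v w) = ∑ h : G, tmk ρ σ (θ (ρ (1, h) v)) (η (σ (h, 1) w)) := by
  rw [tensorAvg, tlift_tmk]
  simp only [LinearMap.sum_apply, LinearMap.compl₁₂_apply, LinearMap.comp_apply]

theorem tensor_left_projective [Finite G]
    (hρ : Module.Projective F[G] (leftRep ρ).asModule)
    (hσ : Module.Projective F[G] (leftRep σ).asModule) :
    Module.Projective F[G] (leftRep (tensorRep ρ σ)).asModule := by
  cases nonempty_fintype G
  rw [projective_iff] at hρ hσ ⊢
  obtain ⟨θ, hθ⟩ := hρ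
  obtain ⟨η, hη⟩ := hσ
  simp only [MonoidHom.comp_apply, MonoidHom.inl_apply] at hθ hη ⊢
  refine ⟨tensorAvg θ η, fun v => ?_⟩
  have key : ∑ g : G, (tensorRep ρ σ (g, 1)) ∘ₗ tensorAvg θ η ∘ₗ (tensorRep ρ σ (g⁻¹, 1))
      = LinearMap.id := tensor_ext fun v w => by
    simp only [LinearMap.sum_apply, LinearMap.comp_apply, tensorRep_tmk, tensorAvg_tmk, map_sum,
      ← Prod.one_eq_mk, map_one, Module.End.one_apply, LinearMap.id_apply, ← rep_comm]
    rw [Finset.sum_comm]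
    simp only [← LinearMap.sum_apply, ← map_sum, hθ]
    have h1 : ∀ h : G, tmk ρ σ (ρ (1, h) v) (η (σ (h, 1) w))
        = tmk ρ σ v (σ (h⁻¹, 1) (η (σ (h⁻¹⁻¹, 1) w))) := fun h => by
      rw [← tmk_balanced ρ σ h v, rep_left_mul, inv_inv, mul_inv_cancel, ← Prod.one_eq_mk, map_one,
        Module.End.one_apply]
    rw [Finset.sum_congr rfl fun h _ => h1 h, ← map_sum]
    congr 1
    exact (Equiv.sum_comp (Equiv.inv G) fun g => σ (g, 1) (η (σ (g⁻¹, 1) w))).trans (hη w)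
  have := LinearMap.congr_fun key v
  simpa only [LinearMap.sum_apply, LinearMap.comp_apply, LinearMap.id_apply] using this

theorem tensor_right_projective [Finite G]
    (hρ : Module.Projective F[G] (rightRep ρ).asModule)
    (hσ : Module.Projective F[G] (rightRep σ).asModule) :
    Module.Projective F[G] (rightRep (tensorRep ρ σ)).asModule := by
  cases nonempty_fintype G
  rw [projective_iff] at hρ hσ ⊢
  obtain ⟨θ, hθ⟩ := hρ
  obtain ⟨η, hη⟩ := hσ
  simp only [MonoidHom.comp_apply, MonoidHom.inr_apply] at hθ hη ⊢
  refine ⟨tensorAvg θ η, fun v => ?_⟩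
  have key : ∑ g : G, (tensorRep ρ σ (1, g)) ∘ₗ tensorAvg θ η ∘ₗ (tensorRep ρ σ (1, g⁻¹))
      = LinearMap.id := tensor_ext fun v w => by
    simp only [LinearMap.sum_apply, LinearMap.comp_apply, tensorRep_tmk, tensorAvg_tmk, map_sum,
      ← Prod.one_eq_mk, map_one, Module.End.one_apply, LinearMap.id_apply, rep_comm σ]
    rw [Finset.sum_comm]
    simp only [← map_sum, hη]
    have h1 : ∀ h : G, tmk ρ σ (θ (ρ (1, h) v)) (σ (h, 1) w)
        = tmk ρ σ (ρ (1, h⁻¹) (θ (ρ (1, h⁻¹⁻¹) v))) w := fun h => by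
      rw [← tmk_balanced ρ σ h⁻¹ _ (σ (h, 1) w), rep_left_mul, inv_inv, inv_mul_cancel,
        ← Prod.one_eq_mk, map_one, Module.End.one_apply]
    rw [Finset.sum_congr rfl fun h _ => h1 h]
    simp only [← LinearMap.sum_apply, ← map_sum]
    congr 2
    exact (Equiv.sum_comp (Equiv.inv G) fun g => ρ (1, g) (θ (ρ (1, g⁻¹) v))).trans (hθ v)
  have := LinearMap.congr_fun key v
  simpa only [LinearMap.sum_apply, LinearMap.comp_apply, LinearMap.id_apply] using this

theorem IsPerfectPPermutation.tensor [Finite G] {e : F[G]} (hρ : IsPerfectPPermutation e ρ)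
    (hσ : IsPerfectPPermutation e σ) : IsPerfectPPermutation e (tensorRep ρ σ) where
  finite := by
    have := hρ.finite
    have := hσ.finite
    infer_instance
  pPermutation := hρ.pPermutation.tensor hσ.pPermutation
  left_projective := tensor_left_projective hρ.left_projective hσ.left_projective
  right_projective := tensor_right_projective hρ.right_projective hσ.right_projective
  left_e v := by
    refine LinearMap.congr_fun (f := leftAct (tensorRep ρ σ) e) (g := LinearMap.id)
      (tensor_ext fun v w => ?_) v
    rw [leftAct_tmk, hρ.left_e]; rfl
  right_e v := by
    refine LinearMap.congr_fun (f := rightAct (tensorRep ρ σ) e) (g := LinearMap.id)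
      (tensor_ext fun v w => ?_) v
    rw [rightAct_tmk, hσ.right_e]; rfl

theorem IsPPermutation.prod {Γ : Type v} [Group Γ] {ρ : Representation F Γ V}
    {σ : Representation F Γ W} (hρ : IsPPermutation ρ) (hσ : IsPPermutation σ) :
    IsPPermutation (ρ.prod σ) := by
  rw [isPPermutation_iff] at hρ hσ ⊢
  obtain ⟨X, _, _, i, r, hi, hr, hir⟩ := hρ
  obtain ⟨Y, _, _, j, s, hj, hs, hjs⟩ := hσ
  obtain ⟨il, il1⟩ : ∃ il : F[X] →ₗ[F] F[X ⊕ Y], ∀ x, il (MonoidAlgebra.single x 1)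
      = MonoidAlgebra.single (Sum.inl x) 1 :=
    ⟨linExt fun x => MonoidAlgebra.single (Sum.inl x) 1, fun x => by simp⟩
  obtain ⟨ir, ir1⟩ : ∃ ir : F[Y] →ₗ[F] F[X ⊕ Y], ∀ x, ir (MonoidAlgebra.single x 1)
      = MonoidAlgebra.single (Sum.inr x) 1 :=
    ⟨linExt fun x => MonoidAlgebra.single (Sum.inr x) 1, fun x => by simp⟩
  have hil : ∀ g x, il (Representation.ofMulAction F Γ X g x)
      = Representation.ofMulAction F Γ (X ⊕ Y) g (il x) := fun g =>
    LinearMap.congr_fun (f := il ∘ₗ Representation.ofMulAction F Γ X g)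
      (g := Representation.ofMulAction F Γ (X ⊕ Y) g ∘ₗ il) (linExt_ext fun x => by
        rw [LinearMap.comp_apply, LinearMap.comp_apply, Representation.ofMulAction_single, il1, il1,
          Representation.ofMulAction_single, Sum.smul_inl])
  have hir' : ∀ g x, ir (Representation.ofMulAction F Γ Y g x)
      = Representation.ofMulAction F Γ (X ⊕ Y) g (ir x) := fun g =>
    LinearMap.congr_fun (f := ir ∘ₗ Representation.ofMulAction F Γ Y g)
      (g := Representation.ofMulAction F Γ (X ⊕ Y) g ∘ₗ ir) (linExt_ext fun x => by
        rw [LinearMap.comp_apply, LinearMap.comp_apply, Representation.ofMulAction_single, ir1, ir1,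
          Representation.ofMulAction_single, Sum.smul_inr])
  obtain ⟨π, hπl, hπr⟩ : ∃ π : F[X ⊕ Y] →ₗ[F] V × W,
      (∀ x, π (MonoidAlgebra.single (Sum.inl x) 1) = (r (MonoidAlgebra.single x 1), 0)) ∧
      (∀ y, π (MonoidAlgebra.single (Sum.inr y) 1) = (0, s (MonoidAlgebra.single y 1))) :=
    ⟨linExt (Sum.elim (fun x => (r (MonoidAlgebra.single x 1), 0))
      (fun y => (0, s (MonoidAlgebra.single y 1)))), fun x => by simp, fun y => by simp⟩
  have h1 : ∀ x, π (il x) = (r x, 0) :=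
    LinearMap.congr_fun (f := π ∘ₗ il) (g := LinearMap.inl F V W ∘ₗ r)
      (linExt_ext fun x => by simp [hπl, il1])
  have h2 : ∀ x, π (ir x) = (0, s x) :=
    LinearMap.congr_fun (f := π ∘ₗ ir) (g := LinearMap.inr F V W ∘ₗ s)
      (linExt_ext fun x => by simp [hπr, ir1])
  refine ⟨X ⊕ Y, inferInstance, inferInstance, (il ∘ₗ i).coprod (ir ∘ₗ j), π,
    fun g v => ?_, fun g z => ?_, fun v => ?_⟩
  · rw [Representation.prod_apply_apply, LinearMap.coprod_apply, LinearMap.coprod_apply, map_add]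
    simp only [LinearMap.comp_apply, hi, hj, hil, hir']
  · rw [Representation.prod_apply_apply]
    rcases z with x | y
    · rw [Sum.smul_inl, hπl, hπl, hr]; simp
    · rw [Sum.smul_inr, hπr, hπr, hs]; simp
  · rw [LinearMap.coprod_apply, LinearMap.comp_apply, LinearMap.comp_apply, map_add, h1, h2, hir,
      hjs]
    simp

theorem prod_projective {Γ : Type v} [Group Γ] [Finite Γ] {ρ : Representation F Γ V}
    {σ : Representation F Γ W} (hρ : Module.Projective F[Γ] ρ.asModule)
    (hσ : Module.Projective F[Γ] σ.asModule) :
    Module.Projective F[Γ] (ρ.prod σ).asModule := by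
  cases nonempty_fintype Γ
  rw [projective_iff] at hρ hσ ⊢
  obtain ⟨θ, hθ⟩ := hρ
  obtain ⟨η, hη⟩ := hσ
  refine ⟨θ.prodMap η, fun v => Prod.ext ?_ ?_⟩
  · rw [Prod.fst_sum]
    exact hθ v.1
  · rw [Prod.snd_sum]
    exact hη v.2

theorem asAlgebraHom_prod (ρ : Representation F G V) (σ : Representation F G W) (x : F[G])
    (v : V × W) : (ρ.prod σ).asAlgebraHom x v = (ρ.asAlgebraHom x v.1, σ.asAlgebraHom x v.2) := by
  induction x using MonoidAlgebra.induction_linear with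
  | zero => simp [Prod.zero_eq_mk]
  | add x y hx hy => simp [map_add, hx, hy]
  | single g a =>
    simp only [Representation.asAlgebraHom_single, LinearMap.smul_apply]
    rfl

theorem leftRep_prod (ρ : Representation F (G × G) V) (σ : Representation F (G × G) W) :
    leftRep (ρ.prod σ) = (leftRep ρ).prod (leftRep σ) := rfl

theorem rightRep_prod (ρ : Representation F (G × G) V) (σ : Representation F (G × G) W) :
    rightRep (ρ.prod σ) = (rightRep ρ).prod (rightRep σ) := rfl

theorem IsPerfectPPermutation.prod [Finite G] {e : F[G]} (hρ : IsPerfectPPermutation e ρ)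
    (hσ : IsPerfectPPermutation e σ) : IsPerfectPPermutation e (ρ.prod σ) where
  finite := by
    have := hρ.finite
    have := hσ.finite
    infer_instance
  pPermutation := hρ.pPermutation.prod hσ.pPermutation
  left_projective := by
    rw [leftRep_prod]
    exact prod_projective hρ.left_projective hσ.left_projective
  right_projective := by
    rw [rightRep_prod]
    exact prod_projective hρ.right_projective hσ.right_projective
  left_e v := by
    unfold leftAct
    rw [leftRep_prod, asAlgebraHom_prod, hρ.left_e, hσ.left_e]
  right_e v := by
    unfold rightAct
    rw [rightRep_prod, asAlgebraHom_prod]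
    exact Prod.ext (hρ.right_e v.1) (hσ.right_e v.2)

theorem IsPerfectPPermutation.of_subsingleton [Finite G] {e : F[G]} [Subsingleton V]
    (ρ : Representation F (G × G) V) : IsPerfectPPermutation e ρ where
  finite := inferInstance
  pPermutation := isPPermutation_iff.2 ⟨PUnit, inferInstance, inferInstance, 0, 0,
    fun _ _ => by simp, fun _ _ => Subsingleton.elim _ _, fun _ => Subsingleton.elim _ _⟩
  left_projective := by
    cases nonempty_fintype G
    exact (projective_iff _).2 ⟨0, fun _ => Subsingleton.elim _ _⟩
  right_projective := by
    cases nonempty_fintype G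
    exact (projective_iff _).2 ⟨0, fun _ => Subsingleton.elim _ _⟩
  left_e _ := Subsingleton.elim _ _
  right_e _ := Subsingleton.elim _ _

end closure2

section regular

/-- A central idempotent of the group algebra `FG`. -/
structure CentralIdempotent (F : Type u) [Field F] (G : Type v) [Group G] where
  val : F[G]
  central : ∀ x : F[G], val * x = x * val
  idem : val * val = val

/-- The group algebra `FG` as an `(FG,FG)`-bimodule, `(g, h) x = g x h⁻¹`. -/
noncomputable def regularRep (F : Type u) [Field F] (G : Type v) [Group G] :
    Representation F (G × G) F[G] where
  toFun x := LinearMap.mulLeft F (MonoidAlgebra.single x.1 (1 : F)) ∘ₗ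
    LinearMap.mulRight F (MonoidAlgebra.single x.2⁻¹ (1 : F))
  map_one' := by
    ext x
    simp [← MonoidAlgebra.one_def]
  map_mul' x y := LinearMap.ext fun z => by
    simp only [LinearMap.comp_apply, LinearMap.mulLeft_apply, LinearMap.mulRight_apply,
      Module.End.mul_apply, Prod.fst_mul, Prod.snd_mul, mul_inv_rev]
    rw [← one_mul (1 : F), ← MonoidAlgebra.single_mul_single, ← MonoidAlgebra.single_mul_single]
    simp only [mul_assoc, one_mul]

theorem regularRep_apply (x : G × G) (z : F[G]) : regularRep F G x z =
    MonoidAlgebra.single x.1 (1 : F) * (z * MonoidAlgebra.single x.2⁻¹ (1 : F)) := rfl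

/-- The left ideal `FG a`. -/
noncomputable def leftIdeal (a : F[G]) : Submodule F F[G] :=
  LinearMap.range (LinearMap.mulRight F a)

/-- The right ideal `a FG`. -/
noncomputable def rightIdeal (a : F[G]) : Submodule F F[G] :=
  LinearMap.range (LinearMap.mulLeft F a)

theorem mem_leftIdeal {a : F[G]} (ha : a * a = a) {x : F[G]} :
    x ∈ leftIdeal a ↔ x * a = x := by
  constructor
  · rintro ⟨y, rfl⟩
    rw [LinearMap.mulRight_apply, mul_assoc, ha]
  · intro h
    exact ⟨x, h⟩

theorem mem_rightIdeal {a : F[G]} (ha : a * a = a) {x : F[G]} :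
    x ∈ rightIdeal a ↔ a * x = x := by
  constructor
  · rintro ⟨y, rfl⟩
    rw [LinearMap.mulLeft_apply, ← mul_assoc, ha]
  · intro h
    exact ⟨x, h⟩

/-- The projection `x ↦ x a` onto `FG a`. -/
noncomputable def projL (a : F[G]) : F[G] →ₗ[F] leftIdeal a :=
  (LinearMap.mulRight F a).rangeRestrict

/-- The projection `x ↦ a x` onto `a FG`. -/
noncomputable def projR (a : F[G]) : F[G] →ₗ[F] rightIdeal a :=
  (LinearMap.mulLeft F a).rangeRestrict

theorem coe_projL (a x : F[G]) : (projL a x : F[G]) = x * a := rfl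

theorem coe_projR (a x : F[G]) : (projR a x : F[G]) = a * x := rfl

/-- `FGe` as an `(FG,FG)`-bimodule. -/
noncomputable def blockRep (e : CentralIdempotent F G) :
    Representation F (G × G) (leftIdeal e.val) :=
  (regularRep F G).subrepresentation (leftIdeal e.val) fun g x hx => by
    rw [mem_leftIdeal e.idem] at hx
    rw [Submodule.mem_comap, mem_leftIdeal e.idem, regularRep_apply, mul_assoc, mul_assoc, ← e.central,
      ← mul_assoc x, hx]

theorem coe_blockRep (e : CentralIdempotent F G) (g : G × G) (x : leftIdeal e.val) :
    (blockRep e g x : F[G]) = regularRep F G g x := rfl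

theorem leftAct_blockRep (e : CentralIdempotent F G) (x : F[G]) (y : leftIdeal e.val) :
    (leftAct (blockRep e) x y : F[G]) = x * y := by
  induction x using MonoidAlgebra.induction_linear with
  | zero => simp
  | add x z hx hz => simp [map_add, add_mul, hx, hz]
  | single g a =>
    simp only [Representation.asAlgebraHom_single, LinearMap.smul_apply, MonoidHom.comp_apply,
      MonoidHom.inl_apply, Submodule.coe_smul, coe_blockRep, regularRep_apply]
    rw [inv_one, ← MonoidAlgebra.one_def, mul_one, ← smul_mul_assoc, MonoidAlgebra.smul_single,
      smul_eq_mul, mul_one]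

theorem rightAct_blockRep (e : CentralIdempotent F G) (x : F[G]) (y : leftIdeal e.val) :
    (rightAct (blockRep e) x y : F[G]) = y * x := by
  unfold rightAct
  induction x using MonoidAlgebra.induction_linear with
  | zero => simp [invol]
  | add x z hx hz =>
    simp only [invol, MonoidAlgebra.mapDomain_add] at hx hz ⊢
    simp [map_add, mul_add, hx, hz]
  | single g a =>
    simp only [invol, MonoidAlgebra.mapDomain_single]
    simp only [Representation.asAlgebraHom_single, LinearMap.smul_apply, MonoidHom.comp_apply,
      MonoidHom.inr_apply, Submodule.coe_smul, coe_blockRep, regularRep_apply]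
    rw [inv_inv, ← MonoidAlgebra.one_def, one_mul, ← mul_smul_comm, MonoidAlgebra.smul_single,
      smul_eq_mul, mul_one]

/-- The action of `G × G` on `G` by `(g, h) x = g x h⁻¹`. -/
@[reducible] def twoSidedAction (G : Type v) [Group G] : MulAction (G × G) G where
  smul x z := x.1 * z * x.2⁻¹
  one_smul z := by change 1 * z * 1⁻¹ = z; simp
  mul_smul x y z := by
    change (x.1 * y.1) * z * (x.2 * y.2)⁻¹ = x.1 * (y.1 * z * y.2⁻¹) * x.2⁻¹
    simp [mul_assoc]

theorem regularRep_single (x : G × G) (z : G) (a : F) :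
    regularRep F G x (MonoidAlgebra.single z a) = MonoidAlgebra.single (x.1 * z * x.2⁻¹) a := by
  rw [regularRep_apply, MonoidAlgebra.single_mul_single, MonoidAlgebra.single_mul_single]
  simp [mul_assoc]

/-- The coefficient of an element of `FG` at the identity. -/
noncomputable def coeffOne (F : Type u) [Field F] (G : Type v) [Group G] : F[G] →ₗ[F] F :=
  linExt (V := F) (fun g => open Classical in if g = 1 then 1 else 0)

theorem sum_coeffOne_left [Fintype G] (x : F[G]) :
    ∑ g : G, coeffOne F G (MonoidAlgebra.single g⁻¹ (1 : F) * x) • MonoidAlgebra.single g (1 : F)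
      = x := by
  classical
  induction x using MonoidAlgebra.induction_linear with
  | zero => simp
  | add x y hx hy => simp only [mul_add, map_add, add_smul, Finset.sum_add_distrib, hx, hy]
  | single g a =>
    rw [Finset.sum_eq_single g]
    · simp [coeffOne]
    · intro b _ hb
      have : b⁻¹ * g ≠ 1 := fun h => hb (inv_mul_eq_one.1 h)
      simp [coeffOne, this]
    · simp

theorem sum_coeffOne_right [Fintype G] (x : F[G]) :
    ∑ g : G, coeffOne F G (x * MonoidAlgebra.single g (1 : F)) • MonoidAlgebra.single g⁻¹ (1 : F)
      = x := by
  classical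
  induction x using MonoidAlgebra.induction_linear with
  | zero => simp
  | add x y hx hy => simp only [add_mul, map_add, add_smul, Finset.sum_add_distrib, hx, hy]
  | single g a =>
    rw [Finset.sum_eq_single g⁻¹]
    · simp [coeffOne]
    · intro b _ hb
      have : g * b ≠ 1 := fun h => hb (eq_inv_of_mul_eq_one_right h)
      simp [coeffOne, this]
    · simp

theorem blockRep_perfect [Finite G] (e : CentralIdempotent F G) :
    IsPerfectPPermutation e.val (blockRep e) where
  finite := inferInstance
  pPermutation := by
    rw [isPPermutation_iff]
    let act := twoSidedAction G
    have h1 : ∀ g z, regularRep F G g z = Representation.ofMulAction F (G × G) G g z := fun g =>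
      LinearMap.congr_fun (linExt_ext fun x => by
        rw [regularRep_single, Representation.ofMulAction_single]; rfl)
    refine ⟨G, inferInstance, act, (leftIdeal e.val).subtype, projL e.val, fun g v => ?_,
      fun g x => ?_, fun v => ?_⟩
    · rw [← h1]; rfl
    · rw [← Representation.ofMulAction_single, ← h1]
      apply Subtype.ext
      rw [coe_blockRep, coe_projL, coe_projL, regularRep_apply, regularRep_apply]
      simp only [mul_assoc, e.central]
    · apply Subtype.ext
      exact (mem_leftIdeal e.idem).1 v.2
  left_projective := by
    cases nonempty_fintype G
    rw [projective_iff]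
    refine ⟨(coeffOne F G ∘ₗ (leftIdeal e.val).subtype).smulRight (projL e.val 1),
      fun v => Subtype.ext ?_⟩
    rw [AddSubmonoidClass.coe_finsetSum]
    have h : ∀ g : G, ((leftRep (blockRep e) g (((coeffOne F G ∘ₗ
        (leftIdeal e.val).subtype).smulRight (projL e.val 1)) (leftRep (blockRep e) g⁻¹ v)) :
          leftIdeal e.val) : F[G]) = (coeffOne F G (MonoidAlgebra.single g⁻¹ (1 : F) * v.1) •
            MonoidAlgebra.single g (1 : F)) * e.val := fun g => by
      rw [LinearMap.smulRight_apply, map_smul, Submodule.coe_smul, smul_mul_assoc]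
      simp only [MonoidHom.comp_apply, MonoidHom.inl_apply, coe_blockRep, regularRep_apply,
        coe_projL, LinearMap.comp_apply, Submodule.subtype_apply, inv_one, ← MonoidAlgebra.one_def,
        mul_one, one_mul]
    rw [Finset.sum_congr rfl fun g _ => h g, ← Finset.sum_mul, sum_coeffOne_left]
    exact (mem_leftIdeal e.idem).1 v.2
  right_projective := by
    cases nonempty_fintype G
    rw [projective_iff]
    refine ⟨(coeffOne F G ∘ₗ (leftIdeal e.val).subtype).smulRight (projL e.val 1),
      fun v => Subtype.ext ?_⟩
    rw [AddSubmonoidClass.coe_finsetSum]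
    have h : ∀ g : G, ((rightRep (blockRep e) g (((coeffOne F G ∘ₗ
        (leftIdeal e.val).subtype).smulRight (projL e.val 1)) (rightRep (blockRep e) g⁻¹ v)) :
          leftIdeal e.val) : F[G]) = e.val * (coeffOne F G (v.1 * MonoidAlgebra.single g (1 : F)) •
            MonoidAlgebra.single g⁻¹ (1 : F)) := fun g => by
      rw [LinearMap.smulRight_apply, map_smul, Submodule.coe_smul, mul_smul_comm]
      simp only [MonoidHom.comp_apply, MonoidHom.inr_apply, coe_blockRep, regularRep_apply,
        coe_projL, LinearMap.comp_apply, Submodule.subtype_apply, inv_inv, ← MonoidAlgebra.one_def,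
        one_mul]
    rw [Finset.sum_congr rfl fun g _ => h g, ← Finset.mul_sum, sum_coeffOne_right, e.central]
    exact (mem_leftIdeal e.idem).1 v.2
  left_e v := Subtype.ext (by
    rw [leftAct_blockRep, e.central]
    exact (mem_leftIdeal e.idem).1 v.2)
  right_e v := Subtype.ext (by
    rw [rightAct_blockRep]
    exact (mem_leftIdeal e.idem).1 v.2)

/-- The left ideal `FG a` as a left `FG`-module. -/
noncomputable def leftIdealRep (a : F[G]) : Representation F G (leftIdeal a) where
  toFun g := (LinearMap.mulLeft F (MonoidAlgebra.single g (1 : F))).restrict (by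
    rintro _ ⟨y, rfl⟩
    exact ⟨MonoidAlgebra.single g (1 : F) * y, by simp [mul_assoc]⟩)
  map_one' := LinearMap.ext fun x => Subtype.ext (by
    simp [LinearMap.restrict_apply, ← MonoidAlgebra.one_def])
  map_mul' g h := LinearMap.ext fun x => Subtype.ext (by
    simp only [LinearMap.restrict_apply, LinearMap.mulLeft_apply, Module.End.mul_apply]
    rw [← mul_assoc, MonoidAlgebra.single_mul_single, one_mul])

/-- The right ideal `b FG` as a left `FG`-module, `h y = y h⁻¹`. -/
noncomputable def rightIdealRep (b : F[G]) : Representation F G (rightIdeal b) where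
  toFun g := (LinearMap.mulRight F (MonoidAlgebra.single g⁻¹ (1 : F))).restrict (by
    rintro _ ⟨y, rfl⟩
    exact ⟨y * MonoidAlgebra.single g⁻¹ (1 : F), by simp [mul_assoc]⟩)
  map_one' := LinearMap.ext fun x => Subtype.ext (by
    simp [LinearMap.restrict_apply, ← MonoidAlgebra.one_def])
  map_mul' g h := LinearMap.ext fun x => Subtype.ext (by
    simp only [LinearMap.restrict_apply, LinearMap.mulRight_apply, Module.End.mul_apply]
    rw [mul_assoc, MonoidAlgebra.single_mul_single, one_mul, mul_inv_rev])

theorem coe_leftIdealRep (a : F[G]) (g : G) (x : leftIdeal a) :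
    (leftIdealRep a g x : F[G]) = MonoidAlgebra.single g (1 : F) * x := rfl

theorem coe_rightIdealRep (a : F[G]) (g : G) (x : rightIdeal a) :
    (rightIdealRep a g x : F[G]) = x * MonoidAlgebra.single g⁻¹ (1 : F) := rfl

/-- The space `FG a ⊗_F b FG`. -/
def PairSpace (a b : F[G]) : Type (max u v) := leftIdeal a ⊗[F] rightIdeal b

noncomputable instance (a b : F[G]) : AddCommGroup (PairSpace a b) :=
  inferInstanceAs (AddCommGroup (leftIdeal a ⊗[F] rightIdeal b))

noncomputable instance (a b : F[G]) : Module F (PairSpace a b) :=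
  inferInstanceAs (Module F (leftIdeal a ⊗[F] rightIdeal b))

instance [Finite G] (a b : F[G]) : Module.Finite F (PairSpace a b) :=
  inferInstanceAs (Module.Finite F (leftIdeal a ⊗[F] rightIdeal b))

/-- The element `x ⊗ y` of `FG a ⊗_F b FG`. -/
noncomputable def pmk (a b : F[G]) : leftIdeal a →ₗ[F] rightIdeal b →ₗ[F] PairSpace a b :=
  TensorProduct.mk F (leftIdeal a) (rightIdeal b)

theorem pair_ext {a b : F[G]} {X : Type*} [AddCommGroup X] [Module F X]
    {f g : PairSpace a b →ₗ[F] X} (h : ∀ x y, f (pmk a b x y) = g (pmk a b x y)) : f = g :=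
  TensorProduct.ext' (M := leftIdeal a) (N := rightIdeal b) (g := f) (h := g) h

/-- The linear map on `FG a ⊗_F b FG` induced by a bilinear map. -/
noncomputable def plift {a b : F[G]} {X : Type*} [AddCommGroup X] [Module F X]
    (f : leftIdeal a →ₗ[F] rightIdeal b →ₗ[F] X) : PairSpace a b →ₗ[F] X :=
  TensorProduct.lift f

theorem plift_pmk {a b : F[G]} {X : Type*} [AddCommGroup X] [Module F X]
    (f : leftIdeal a →ₗ[F] rightIdeal b →ₗ[F] X) (x : leftIdeal a) (y : rightIdeal b) :
    plift f (pmk a b x y) = f x y := rfl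

/-- The `(FG,FG)`-bimodule `FG a ⊗_F b FG`, with `(g, h) (x ⊗ y) = g x ⊗ y h⁻¹`. -/
noncomputable def pairRep (a b : F[G]) : Representation F (G × G) (PairSpace a b) where
  toFun g := plift ((pmk a b).compl₁₂ (leftIdealRep a g.1) (rightIdealRep b g.2))
  map_one' := pair_ext fun x y => by
    rw [plift_pmk, LinearMap.compl₁₂_apply, Prod.fst_one, Prod.snd_one, map_one, map_one]
    rfl
  map_mul' g h := pair_ext fun x y => by
    rw [Module.End.mul_apply, plift_pmk, plift_pmk, LinearMap.compl₁₂_apply,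
      LinearMap.compl₁₂_apply, plift_pmk, LinearMap.compl₁₂_apply, Prod.fst_mul, Prod.snd_mul,
      map_mul, map_mul]
    rfl

theorem pairRep_pmk (a b : F[G]) (g : G × G) (x : leftIdeal a) (y : rightIdeal b) :
    pairRep a b g (pmk a b x y) = pmk a b (leftIdealRep a g.1 x) (rightIdealRep b g.2 y) := rfl

theorem leftAct_pairRep (a b : F[G]) (x : F[G]) (m : leftIdeal a) (n : rightIdeal b) :
    leftAct (pairRep a b) x (pmk a b m n) = pmk a b ((leftIdealRep a).asAlgebraHom x m) n := by
  induction x using MonoidAlgebra.induction_linear with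
  | zero => simp
  | add x z hx hz => simp [map_add, hx, hz]
  | single g c =>
    simp only [Representation.asAlgebraHom_single, LinearMap.smul_apply, MonoidHom.comp_apply,
      MonoidHom.inl_apply, pairRep_pmk, map_one, Module.End.one_apply, map_smul]

theorem rightAct_pairRep (a b : F[G]) (x : F[G]) (m : leftIdeal a) (n : rightIdeal b) :
    rightAct (pairRep a b) x (pmk a b m n) =
      pmk a b m ((rightIdealRep b).asAlgebraHom (invol x) n) := by
  unfold rightAct
  generalize invol x = z
  induction z using MonoidAlgebra.induction_linear with
  | zero => simp
  | add x z hx hz => simp [map_add, hx, hz]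
  | single g c =>
    simp only [Representation.asAlgebraHom_single, LinearMap.smul_apply, MonoidHom.comp_apply,
      MonoidHom.inr_apply, pairRep_pmk, map_one, Module.End.one_apply, map_smul]

theorem leftIdealRep_act (a : F[G]) (x : F[G]) (m : leftIdeal a) :
    ((leftIdealRep a).asAlgebraHom x m : F[G]) = x * m := by
  induction x using MonoidAlgebra.induction_linear with
  | zero => simp
  | add x z hx hz => simp [map_add, add_mul, hx, hz]
  | single g c =>
    rw [Representation.asAlgebraHom_single, LinearMap.smul_apply, Submodule.coe_smul,
      coe_leftIdealRep, ← smul_mul_assoc, MonoidAlgebra.smul_single, smul_eq_mul, mul_one]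

theorem rightIdealRep_act (a : F[G]) (x : F[G]) (m : rightIdeal a) :
    ((rightIdealRep a).asAlgebraHom (invol x) m : F[G]) = m * x := by
  induction x using MonoidAlgebra.induction_linear with
  | zero => simp [invol]
  | add x z hx hz =>
    simp only [invol, MonoidAlgebra.mapDomain_add] at hx hz ⊢
    simp [map_add, mul_add, hx, hz]
  | single g c =>
    simp only [invol, MonoidAlgebra.mapDomain_single]
    rw [Representation.asAlgebraHom_single, LinearMap.smul_apply, Submodule.coe_smul,
      coe_rightIdealRep, ← mul_smul_comm, MonoidAlgebra.smul_single, smul_eq_mul, mul_one, inv_inv]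

theorem pairRep_pPermutation [Finite G] {a b : F[G]} (ha : a * a = a) (hb : b * b = b) :
    IsPPermutation (pairRep a b) := by
  rw [isPPermutation_iff]
  obtain ⟨β, hβ⟩ : ∃ β : F[G] →ₗ[F] F[G] →ₗ[F] F[G × G], ∀ x y,
      β (MonoidAlgebra.single x 1) (MonoidAlgebra.single y 1) = MonoidAlgebra.single (x, y⁻¹) 1 :=
    ⟨linExt fun x => linExt fun y => MonoidAlgebra.single (x, y⁻¹) 1, fun x y => by simp⟩
  obtain ⟨r, hr⟩ : ∃ r : F[G × G] →ₗ[F] PairSpace a b, ∀ x y,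
      r (MonoidAlgebra.single (x, y) 1) =
        pmk a b (projL a (MonoidAlgebra.single x 1)) (projR b (MonoidAlgebra.single y⁻¹ 1)) :=
    ⟨linExt fun z => pmk a b (projL a (MonoidAlgebra.single z.1 1))
      (projR b (MonoidAlgebra.single z.2⁻¹ 1)), fun x y => by simp⟩
  have h1 : β.compr₂ r = (pmk a b).compl₁₂ (projL a) (projR b) :=
    linExt_ext fun x => linExt_ext fun y => by
      rw [LinearMap.compr₂_apply, hβ, hr, inv_inv, LinearMap.compl₁₂_apply]
  have h2 : ∀ g : G × G, β.compl₁₂ (LinearMap.mulLeft F (MonoidAlgebra.single g.1 (1 : F)))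
      (LinearMap.mulRight F (MonoidAlgebra.single g.2⁻¹ (1 : F))) =
        β.compr₂ (Representation.ofMulAction F (G × G) (G × G) g) := fun g =>
    linExt_ext fun x => linExt_ext fun y => by
      rw [LinearMap.compl₁₂_apply, LinearMap.compr₂_apply, hβ, LinearMap.mulLeft_apply,
        LinearMap.mulRight_apply, MonoidAlgebra.single_mul_single, MonoidAlgebra.single_mul_single,
        one_mul, hβ, Representation.ofMulAction_single, mul_inv_rev, inv_inv]
      rfl
  obtain ⟨i, hi⟩ : ∃ i : PairSpace a b →ₗ[F] F[G × G], ∀ x y, i (pmk a b x y) = β x.1 y.1 :=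
    ⟨plift (β.compl₁₂ (leftIdeal a).subtype (rightIdeal b).subtype), fun x y => rfl⟩
  refine ⟨G × G, inferInstance, inferInstance, i, r,
    fun g => LinearMap.congr_fun (f := i ∘ₗ pairRep a b g)
      (g := Representation.ofMulAction F (G × G) (G × G) g ∘ₗ i) (pair_ext fun x y => ?_),
    fun g z => ?_,
    LinearMap.congr_fun (f := r ∘ₗ i) (g := LinearMap.id) (pair_ext fun x y => ?_)⟩
  · rw [LinearMap.comp_apply, LinearMap.comp_apply, pairRep_pmk, hi, hi]
    exact LinearMap.congr_fun₂ (h2 g) x.1 y.1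
  · rw [show z = (z.1, z.2) from rfl, show g • (z.1, z.2) = (g.1 * z.1, g.2 * z.2) from rfl, hr, hr,
      pairRep_pmk]
    refine congrArg₂ (fun s t => pmk a b s t) (Subtype.ext ?_) (Subtype.ext ?_)
    · rw [coe_leftIdealRep, coe_projL, coe_projL, ← mul_assoc, MonoidAlgebra.single_mul_single,
        one_mul]
    · rw [coe_rightIdealRep, coe_projR, coe_projR, mul_assoc, MonoidAlgebra.single_mul_single,
        one_mul, mul_inv_rev]
  · rw [LinearMap.comp_apply, hi]
    refine (LinearMap.congr_fun₂ h1 x.1 y.1).trans ?_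
    rw [LinearMap.compl₁₂_apply]
    exact congrArg₂ (fun s t => pmk a b s t) (Subtype.ext ((mem_leftIdeal ha).1 x.2))
      (Subtype.ext ((mem_rightIdeal hb).1 y.2))

theorem pairRep_perfect [Finite G] (e : CentralIdempotent F G) {a b : F[G]} (ha : a * a = a)
    (hb : b * b = b) (hea : e.val * a = a) (heb : e.val * b = b) :
    IsPerfectPPermutation e.val (pairRep a b) where
  finite := inferInstance
  pPermutation := pairRep_pPermutation ha hb
  left_projective := by
    cases nonempty_fintype G
    rw [projective_iff]
    let θ : leftIdeal a →ₗ[F] leftIdeal a :=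
      (coeffOne F G ∘ₗ (leftIdeal a).subtype).smulRight (projL a 1)
    have hθ : ∀ x, ∑ g : G, leftIdealRep a g (θ (leftIdealRep a g⁻¹ x)) = x := fun x => by
      apply Subtype.ext
      rw [AddSubmonoidClass.coe_finsetSum]
      simp only [θ, LinearMap.smulRight_apply, map_smul, Submodule.coe_smul, coe_leftIdealRep,
        LinearMap.comp_apply, Submodule.subtype_apply, coe_projL, one_mul, ← smul_mul_assoc]
      rw [← Finset.sum_mul, sum_coeffOne_left]
      exact (mem_leftIdeal ha).1 x.2
    refine ⟨plift ((pmk a b).compl₁₂ θ LinearMap.id), fun v => ?_⟩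
    have := LinearMap.congr_fun (f := ∑ g : G, leftRep (pairRep a b) g ∘ₗ
      plift ((pmk a b).compl₁₂ θ LinearMap.id) ∘ₗ leftRep (pairRep a b) g⁻¹)
        (g := LinearMap.id) (pair_ext fun x y => by
          simp only [LinearMap.sum_apply, LinearMap.comp_apply, MonoidHom.comp_apply,
            MonoidHom.inl_apply, pairRep_pmk, map_one, Module.End.one_apply, plift_pmk,
            LinearMap.compl₁₂_apply, LinearMap.id_apply]
          simp only [← LinearMap.sum_apply, ← map_sum, hθ]) v
    simpa only [LinearMap.sum_apply, LinearMap.comp_apply, LinearMap.id_apply] using this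
  right_projective := by
    cases nonempty_fintype G
    rw [projective_iff]
    let θ : rightIdeal b →ₗ[F] rightIdeal b :=
      (coeffOne F G ∘ₗ (rightIdeal b).subtype).smulRight (projR b 1)
    have hθ : ∀ x, ∑ g : G, rightIdealRep b g (θ (rightIdealRep b g⁻¹ x)) = x := fun x => by
      apply Subtype.ext
      rw [AddSubmonoidClass.coe_finsetSum]
      simp only [θ, LinearMap.smulRight_apply, map_smul, Submodule.coe_smul, coe_rightIdealRep,
        LinearMap.comp_apply, Submodule.subtype_apply, coe_projR, mul_one, ← mul_smul_comm, inv_inv]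
      rw [← Finset.mul_sum, sum_coeffOne_right]
      exact (mem_rightIdeal hb).1 x.2
    refine ⟨plift ((pmk a b).compl₁₂ LinearMap.id θ), fun v => ?_⟩
    have := LinearMap.congr_fun (f := ∑ g : G, rightRep (pairRep a b) g ∘ₗ
      plift ((pmk a b).compl₁₂ LinearMap.id θ) ∘ₗ rightRep (pairRep a b) g⁻¹)
        (g := LinearMap.id) (pair_ext fun x y => by
          simp only [LinearMap.sum_apply, LinearMap.comp_apply, MonoidHom.comp_apply,
            MonoidHom.inr_apply, pairRep_pmk, map_one, Module.End.one_apply, plift_pmk,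
            LinearMap.compl₁₂_apply, LinearMap.id_apply]
          simp only [← map_sum, hθ]) v
    simpa only [LinearMap.sum_apply, LinearMap.comp_apply, LinearMap.id_apply] using this
  left_e v := by
    refine LinearMap.congr_fun (f := leftAct (pairRep a b) e.val) (g := LinearMap.id)
      (pair_ext fun x y => ?_) v
    rw [leftAct_pairRep]
    refine congrArg (fun s => pmk a b s y) (Subtype.ext ?_)
    rw [leftIdealRep_act, ← (mem_leftIdeal ha).1 x.2, ← mul_assoc, e.central, mul_assoc, hea]
  right_e v := by
    refine LinearMap.congr_fun (f := rightAct (pairRep a b) e.val) (g := LinearMap.id)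
      (pair_ext fun x y => ?_) v
    rw [rightAct_pairRep]
    refine congrArg (fun s => pmk a b x s) (Subtype.ext ?_)
    rw [rightIdealRep_act, ← e.central, ← (mem_rightIdeal hb).1 y.2, ← mul_assoc, heb]

end regular

section isos

variable {U V W : Type w} [AddCommGroup U] [Module F U] [AddCommGroup V] [Module F V]
  [AddCommGroup W] [Module F W]

theorem equiv_of_inverse {Γ : Type v} [Group Γ] {V W : Type*} [AddCommGroup V] [Module F V]
    [AddCommGroup W] [Module F W]
    {ρ : Representation F Γ V} {σ : Representation F Γ W} (f : V →ₗ[F] W) (g : W →ₗ[F] V)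
    (hf : ∀ x, f ∘ₗ ρ x = σ x ∘ₗ f) (h1 : f ∘ₗ g = LinearMap.id) (h2 : g ∘ₗ f = LinearMap.id) :
    Nonempty (ρ.Equiv σ) :=
  ⟨Representation.Equiv.mk (LinearEquiv.ofLinearMap f g h1 h2) hf⟩

theorem tensor_congr {U' V' : Type w} [AddCommGroup U'] [Module F U'] [AddCommGroup V']
    [Module F V'] {ρ : Representation F (G × G) U} {σ : Representation F (G × G) V}
    {ρ' : Representation F (G × G) U'} {σ' : Representation F (G × G) V'}
    (h1 : Nonempty (ρ.Equiv ρ')) (h2 : Nonempty (σ.Equiv σ')) :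
    Nonempty ((tensorRep ρ σ).Equiv (tensorRep ρ' σ')) := by
  obtain ⟨a⟩ := h1
  obtain ⟨b⟩ := h2
  have ha : ∀ g x, a.toLinearEquiv (ρ g x) = ρ' g (a.toLinearEquiv x) := fun g x =>
    intertwine a.toIntertwiningMap g x
  have hb : ∀ g x, b.toLinearEquiv (σ g x) = σ' g (b.toLinearEquiv x) := fun g x =>
    intertwine b.toIntertwiningMap g x
  have ha' : ∀ g x, a.toLinearEquiv.symm (ρ' g x) = ρ g (a.toLinearEquiv.symm x) := fun g x =>
    intertwine a.symm.toIntertwiningMap g x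
  have hb' : ∀ g x, b.toLinearEquiv.symm (σ' g x) = σ g (b.toLinearEquiv.symm x) := fun g x =>
    intertwine b.symm.toIntertwiningMap g x
  generalize a.toLinearEquiv = a' at ha ha'
  generalize b.toLinearEquiv = b' at hb hb'
  obtain ⟨f, hf⟩ : ∃ f : TensorSpace ρ σ →ₗ[F] TensorSpace ρ' σ', ∀ v w,
      f (tmk ρ σ v w) = tmk ρ' σ' (a' v) (b' w) :=
    ⟨tlift ((tmk ρ' σ').compl₁₂ a'.toLinearMap b'.toLinearMap) fun h v w => by
      simp only [LinearMap.compl₁₂_apply, LinearEquiv.coe_coe, ha, hb, tmk_balanced], fun _ _ => rfl⟩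
  obtain ⟨g, hg⟩ : ∃ g : TensorSpace ρ' σ' →ₗ[F] TensorSpace ρ σ, ∀ v w,
      g (tmk ρ' σ' v w) = tmk ρ σ (a'.symm v) (b'.symm w) :=
    ⟨tlift ((tmk ρ σ).compl₁₂ a'.symm.toLinearMap b'.symm.toLinearMap) fun h v w => by
      simp only [LinearMap.compl₁₂_apply, LinearEquiv.coe_coe, ha', hb', tmk_balanced],
      fun _ _ => rfl⟩
  refine equiv_of_inverse f g
    (fun x => tensor_ext fun v w => ?_) (tensor_ext fun v w => ?_) (tensor_ext fun v w => ?_)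
  · rw [LinearMap.comp_apply, LinearMap.comp_apply, tensorRep_tmk, hf, hf, tensorRep_tmk, ha, hb]
  · rw [LinearMap.comp_apply, hg, hf, LinearEquiv.apply_symm_apply, LinearEquiv.apply_symm_apply]
    rfl
  · rw [LinearMap.comp_apply, hf, hg, LinearEquiv.symm_apply_apply, LinearEquiv.symm_apply_apply]
    rfl

theorem prod_congr {Γ : Type v} [Group Γ] {U' V' : Type w} [AddCommGroup U'] [Module F U']
    [AddCommGroup V'] [Module F V'] {ρ : Representation F Γ U} {σ : Representation F Γ V}
    {ρ' : Representation F Γ U'} {σ' : Representation F Γ V'}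
    (h1 : Nonempty (ρ.Equiv ρ')) (h2 : Nonempty (σ.Equiv σ')) :
    Nonempty ((ρ.prod σ).Equiv (ρ'.prod σ')) := by
  obtain ⟨a⟩ := h1
  obtain ⟨b⟩ := h2
  refine ⟨Representation.Equiv.mk (a.toLinearEquiv.prodCongr b.toLinearEquiv) fun g =>
    LinearMap.ext fun x => Prod.ext ?_ ?_⟩
  · exact intertwine a.toIntertwiningMap g x.1
  · exact intertwine b.toIntertwiningMap g x.2

theorem prod_comm_iso {Γ : Type v} [Group Γ] (ρ : Representation F Γ U)
    (σ : Representation F Γ V) : Nonempty ((ρ.prod σ).Equiv (σ.prod ρ)) :=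
  ⟨Representation.Equiv.mk (LinearEquiv.prodComm F U V) fun _ => rfl⟩

theorem prod_assoc_iso {Γ : Type v} [Group Γ] (ρ : Representation F Γ U)
    (σ : Representation F Γ V) (τ : Representation F Γ W) :
    Nonempty (((ρ.prod σ).prod τ).Equiv (ρ.prod (σ.prod τ))) :=
  ⟨Representation.Equiv.mk (LinearEquiv.prodAssoc F U V W) fun _ => rfl⟩

theorem zero_prod_iso {Γ : Type v} [Group Γ] [Subsingleton U] (ρ : Representation F Γ U)
    (σ : Representation F Γ V) : Nonempty ((ρ.prod σ).Equiv σ) :=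
  equiv_of_inverse (LinearMap.snd F U V) (LinearMap.inr F U V) (fun _ => rfl) rfl
    (LinearMap.ext fun _ => Prod.ext (Subsingleton.elim _ _) rfl)

theorem subsingleton_iso {Γ : Type v} [Group Γ] [Subsingleton U] [Subsingleton V]
    (ρ : Representation F Γ U) (σ : Representation F Γ V) : Nonempty (ρ.Equiv σ) :=
  equiv_of_inverse 0 0 (fun _ => LinearMap.ext fun _ => Subsingleton.elim _ _)
    (LinearMap.ext fun _ => Subsingleton.elim _ _) (LinearMap.ext fun _ => Subsingleton.elim _ _)

theorem tensor_subsingleton_left [Subsingleton U] (ρ : Representation F (G × G) U)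
    (σ : Representation F (G × G) V) : Subsingleton (TensorSpace ρ σ) := by
  refine subsingleton_of_forall_eq 0 fun x => ?_
  refine LinearMap.congr_fun (f := LinearMap.id) (g := 0) (tensor_ext fun v w => ?_) x
  rw [Subsingleton.elim v 0]; simp

theorem tensor_subsingleton_right [Subsingleton V] (ρ : Representation F (G × G) U)
    (σ : Representation F (G × G) V) : Subsingleton (TensorSpace ρ σ) := by
  refine subsingleton_of_forall_eq 0 fun x => ?_
  refine LinearMap.congr_fun (f := LinearMap.id) (g := 0) (tensor_ext fun v w => ?_) x
  rw [Subsingleton.elim w 0]; simp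

theorem tensor_prod_iso (ρ : Representation F (G × G) U) (σ : Representation F (G × G) V)
    (τ : Representation F (G × G) W) :
    Nonempty ((tensorRep ρ (σ.prod τ)).Equiv ((tensorRep ρ σ).prod (tensorRep ρ τ))) := by
  let f : TensorSpace ρ (σ.prod τ) →ₗ[F] TensorSpace ρ σ × TensorSpace ρ τ :=
    (tlift ((tmk ρ σ).compl₂ (LinearMap.fst F V W)) fun h v w => tmk_balanced ρ σ h v w.1).prod
      (tlift ((tmk ρ τ).compl₂ (LinearMap.snd F V W)) fun h v w => tmk_balanced ρ τ h v w.2)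
  let g : TensorSpace ρ σ × TensorSpace ρ τ →ₗ[F] TensorSpace ρ (σ.prod τ) :=
    (tlift ((tmk ρ (σ.prod τ)).compl₂ (LinearMap.inl F V W)) fun h v w => by
      have := tmk_balanced ρ (σ.prod τ) h v (w, 0)
      simp only [Representation.prod_apply_apply, map_zero] at this
      exact this).coprod
    (tlift ((tmk ρ (σ.prod τ)).compl₂ (LinearMap.inr F V W)) fun h v w => by
      have := tmk_balanced ρ (σ.prod τ) h v (0, w)
      simp only [Representation.prod_apply_apply, map_zero] at this
      exact this)
  have hf : ∀ u v, f (tmk ρ (σ.prod τ) u v) = (tmk ρ σ u v.1, tmk ρ τ u v.2) := fun _ _ => rfl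
  have hg1 : ∀ u v, g (tmk ρ σ u v, 0) = tmk ρ (σ.prod τ) u (v, 0) := fun u v => by
    rw [LinearMap.coprod_apply, map_zero, add_zero]; rfl
  have hg2 : ∀ u v, g (0, tmk ρ τ u v) = tmk ρ (σ.prod τ) u (0, v) := fun u v => by
    rw [LinearMap.coprod_apply, map_zero, zero_add]; rfl
  clear_value f g
  refine equiv_of_inverse f g (fun x => tensor_ext fun v w => ?_)
    (LinearMap.prod_ext (tensor_ext fun v w => ?_) (tensor_ext fun v w => ?_))
    (tensor_ext fun v w => ?_)
  · rw [LinearMap.comp_apply, LinearMap.comp_apply, tensorRep_tmk, hf, hf,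
      Representation.prod_apply_apply, Representation.prod_apply_apply, tensorRep_tmk,
      tensorRep_tmk]
  · simp only [LinearMap.comp_apply, LinearMap.inl_apply, hg1, hf, LinearMap.id_apply, map_zero]
  · simp only [LinearMap.comp_apply, LinearMap.inr_apply, hg2, hf, LinearMap.id_apply, map_zero]
  · rw [LinearMap.comp_apply, hf, ← Prod.fst_add_snd (tmk ρ σ v w.1, tmk ρ τ v w.2), map_add, hg1,
      hg2, ← map_add, Prod.mk_add_mk, add_zero, zero_add]
    rfl

set_option maxHeartbeats 800000 in
theorem prod_tensor_iso (ρ : Representation F (G × G) U) (σ : Representation F (G × G) V)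
    (τ : Representation F (G × G) W) :
    Nonempty ((tensorRep (ρ.prod σ) τ).Equiv ((tensorRep ρ τ).prod (tensorRep σ τ))) := by
  let f : TensorSpace (ρ.prod σ) τ →ₗ[F] TensorSpace ρ τ × TensorSpace σ τ :=
    (tlift ((tmk ρ τ) ∘ₗ (LinearMap.fst F U V)) fun h v w => tmk_balanced ρ τ h v.1 w).prod
      (tlift ((tmk σ τ) ∘ₗ (LinearMap.snd F U V)) fun h v w => tmk_balanced σ τ h v.2 w)
  let g : TensorSpace ρ τ × TensorSpace σ τ →ₗ[F] TensorSpace (ρ.prod σ) τ :=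
    (tlift ((tmk (ρ.prod σ) τ) ∘ₗ (LinearMap.inl F U V)) fun h v w => by
      have := tmk_balanced (ρ.prod σ) τ h (v, 0) w
      simp only [Representation.prod_apply_apply, map_zero] at this
      exact this).coprod
    (tlift ((tmk (ρ.prod σ) τ) ∘ₗ (LinearMap.inr F U V)) fun h v w => by
      have := tmk_balanced (ρ.prod σ) τ h (0, v) w
      simp only [Representation.prod_apply_apply, map_zero] at this
      exact this)
  have hf : ∀ u v, f (tmk (ρ.prod σ) τ u v) = (tmk ρ τ u.1 v, tmk σ τ u.2 v) := fun _ _ => rfl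
  have hg1 : ∀ u v, g (tmk ρ τ u v, 0) = tmk (ρ.prod σ) τ (u, 0) v := fun u v => by
    rw [LinearMap.coprod_apply, map_zero, add_zero]; rfl
  have hg2 : ∀ u v, g (0, tmk σ τ u v) = tmk (ρ.prod σ) τ (0, u) v := fun u v => by
    rw [LinearMap.coprod_apply, map_zero, zero_add]; rfl
  clear_value f g
  refine equiv_of_inverse f g (fun x => tensor_ext fun v w => ?_)
    (LinearMap.prod_ext (tensor_ext fun v w => ?_) (tensor_ext fun v w => ?_))
    (tensor_ext fun v w => ?_)
  · rw [LinearMap.comp_apply, LinearMap.comp_apply, tensorRep_tmk, hf, hf]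
    rfl
  · rw [LinearMap.comp_apply, LinearMap.comp_apply, LinearMap.inl_apply, hg1, hf, map_zero,
      LinearMap.zero_apply, LinearMap.id_comp, LinearMap.inl_apply]
  · rw [LinearMap.comp_apply, LinearMap.comp_apply, LinearMap.inr_apply, hg2, hf, map_zero,
      LinearMap.zero_apply, LinearMap.id_comp, LinearMap.inr_apply]
  · have h1 : (tmk ρ τ v.1 w, tmk σ τ v.2 w) = (tmk ρ τ v.1 w, 0) + (0, tmk σ τ v.2 w) := by
      rw [Prod.mk_add_mk, add_zero, zero_add]
    have h2 : ((v.1, 0) + (0, v.2) : U × V) = v := by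
      rw [Prod.mk_add_mk, add_zero, zero_add]
    rw [LinearMap.comp_apply, hf, h1, map_add, hg1, hg2, ← LinearMap.add_apply, ← map_add, h2,
      LinearMap.id_apply]

theorem tensor_assoc_iso (ρ : Representation F (G × G) U) (σ : Representation F (G × G) V)
    (τ : Representation F (G × G) W) :
    Nonempty ((tensorRep (tensorRep ρ σ) τ).Equiv (tensorRep ρ (tensorRep σ τ))) := by
  let A := TensorSpace (tensorRep ρ σ) τ
  let B := TensorSpace ρ (tensorRep σ τ)
  let f1 : U →ₗ[F] V →ₗ[F] W →ₗ[F] B := LinearMap.mk₂ F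
    (fun u v => tmk ρ (tensorRep σ τ) u ∘ₗ tmk σ τ v)
    (fun _ _ _ => LinearMap.ext fun _ => by simp) (fun _ _ _ => LinearMap.ext fun _ => by simp)
    (fun _ _ _ => LinearMap.ext fun _ => by simp) (fun _ _ _ => LinearMap.ext fun _ => by simp)
  have hf1 : ∀ u v w, f1 u v w = tmk ρ (tensorRep σ τ) u (tmk σ τ v w) := fun _ _ _ => rfl
  let f2 : TensorSpace ρ σ →ₗ[F] W →ₗ[F] B := tlift f1 fun h u v => LinearMap.ext fun w => by
    rw [hf1, hf1, ← tmk_balanced ρ (tensorRep σ τ) h u, tensorRep_tmk, ← Prod.one_eq_mk, map_one]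
    rfl
  have hf2 : ∀ u v w, f2 (tmk ρ σ u v) w = tmk ρ (tensorRep σ τ) u (tmk σ τ v w) :=
    fun _ _ _ => rfl
  obtain ⟨f, hf⟩ : ∃ f : A →ₗ[F] B, ∀ u v w, f (tmk (tensorRep ρ σ) τ (tmk ρ σ u v) w)
      = tmk ρ (tensorRep σ τ) u (tmk σ τ v w) :=
    ⟨tlift f2 fun h u w => LinearMap.congr_fun
      (f := (f2.flip (τ (h, 1) w)) ∘ₗ tensorRep ρ σ (1, h)) (g := f2.flip w)
        (tensor_ext fun u v => by
          rw [LinearMap.comp_apply, LinearMap.flip_apply, LinearMap.flip_apply, tensorRep_tmk, hf2,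
            hf2, tmk_balanced, ← Prod.one_eq_mk, map_one]
          rfl) u, fun _ _ _ => rfl⟩
  let g1 : U →ₗ[F] V →ₗ[F] W →ₗ[F] A := LinearMap.mk₂ F
    (fun u v => tmk (tensorRep ρ σ) τ (tmk ρ σ u v))
    (fun _ _ _ => LinearMap.ext fun _ => by simp) (fun _ _ _ => LinearMap.ext fun _ => by simp)
    (fun _ _ _ => LinearMap.ext fun _ => by simp) (fun _ _ _ => LinearMap.ext fun _ => by simp)
  have hg1 : ∀ u v w, g1 u v w = tmk (tensorRep ρ σ) τ (tmk ρ σ u v) w := fun _ _ _ => rfl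
  have hg1' : ∀ u h v w, g1 u (σ (1, h) v) (τ (h, 1) w) = g1 u v w := fun u h v w => by
    rw [hg1, hg1, ← tmk_balanced (tensorRep ρ σ) τ h _ w, tensorRep_tmk, ← Prod.one_eq_mk, map_one]
    rfl
  let g2 : U →ₗ[F] TensorSpace σ τ →ₗ[F] A :=
    { toFun := fun u => tlift (g1 u) (hg1' u)
      map_add' := fun u u' => tensor_ext fun v w => by
        simp only [tlift_tmk, map_add, LinearMap.add_apply]
      map_smul' := fun c u => tensor_ext fun v w => by
        simp only [tlift_tmk, map_smul, LinearMap.smul_apply, RingHom.id_apply] }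
  have hg2 : ∀ u v w, g2 u (tmk σ τ v w) = tmk (tensorRep ρ σ) τ (tmk ρ σ u v) w :=
    fun _ _ _ => rfl
  obtain ⟨g, hg⟩ : ∃ g : B →ₗ[F] A, ∀ u v w, g (tmk ρ (tensorRep σ τ) u (tmk σ τ v w))
      = tmk (tensorRep ρ σ) τ (tmk ρ σ u v) w :=
    ⟨tlift g2 fun h u x => LinearMap.congr_fun
      (f := g2 (ρ (1, h) u) ∘ₗ tensorRep σ τ (h, 1)) (g := g2 u) (tensor_ext fun v w => by
        rw [LinearMap.comp_apply, tensorRep_tmk, hg2, hg2, tmk_balanced, ← Prod.one_eq_mk, map_one]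
        rfl) x, fun _ _ _ => rfl⟩
  have extA : ∀ {X : Type w} [AddCommGroup X] [Module F X] {p q : A →ₗ[F] X},
      (∀ u v w, p (tmk (tensorRep ρ σ) τ (tmk ρ σ u v) w) =
        q (tmk (tensorRep ρ σ) τ (tmk ρ σ u v) w)) → p = q := fun {X} _ _ {p q} h =>
    tensor_ext fun x w => LinearMap.congr_fun
      (f := p ∘ₗ (tmk (tensorRep ρ σ) τ).flip w) (g := q ∘ₗ (tmk (tensorRep ρ σ) τ).flip w)
      (tensor_ext fun u v => h u v w) x
  have extB : ∀ {X : Type w} [AddCommGroup X] [Module F X] {p q : B →ₗ[F] X},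
      (∀ u v w, p (tmk ρ (tensorRep σ τ) u (tmk σ τ v w)) =
        q (tmk ρ (tensorRep σ τ) u (tmk σ τ v w))) → p = q := fun {X} _ _ {p q} h =>
    tensor_ext fun u x => LinearMap.congr_fun
      (f := p ∘ₗ tmk ρ (tensorRep σ τ) u) (g := q ∘ₗ tmk ρ (tensorRep σ τ) u)
      (tensor_ext fun v w => h u v w) x
  refine equiv_of_inverse f g (fun x => extA fun u v w => ?_) (extB fun u v w => ?_)
    (extA fun u v w => ?_)
  · rw [LinearMap.comp_apply, LinearMap.comp_apply, tensorRep_tmk, tensorRep_tmk, hf, hf,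
      tensorRep_tmk, tensorRep_tmk, ← Prod.one_eq_mk, map_one]
  · rw [LinearMap.comp_apply, hg, hf]; rfl
  · rw [LinearMap.comp_apply, hf, hg]; rfl

theorem one_tensor_iso (e : CentralIdempotent F G) {V : Type (max u v)} [AddCommGroup V]
    [Module F V] {σ : Representation F (G × G) V} (hσ : IsPerfectPPermutation e.val σ) :
    Nonempty ((tensorRep (blockRep e) σ).Equiv σ) := by
  let f1 : leftIdeal e.val →ₗ[F] V →ₗ[F] V :=
    (leftRep σ).asAlgebraHom.toLinearMap ∘ₗ (leftIdeal e.val).subtype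
  have hf1 : ∀ x v, f1 x v = leftAct σ x v := fun _ _ => rfl
  have hsing : ∀ g : G, leftAct σ (MonoidAlgebra.single g 1) = σ (g, 1) := fun g => by
    rw [leftAct, Representation.asAlgebraHom_single_one]; rfl
  have hmul : ∀ x y, leftAct σ (x * y) = leftAct σ x * leftAct σ y := fun x y => map_mul _ x y
  let f : TensorSpace (blockRep e) σ →ₗ[F] V := tlift f1 fun h x v => by
    rw [hf1, hf1, coe_blockRep, regularRep_apply, ← MonoidAlgebra.one_def, one_mul, ← hsing h,
      ← Module.End.mul_apply, ← hmul, mul_assoc, MonoidAlgebra.single_mul_single, one_mul,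
      inv_mul_cancel, ← MonoidAlgebra.one_def, mul_one]
  have hf : ∀ x v, f (tmk (blockRep e) σ x v) = leftAct σ x v := fun _ _ => rfl
  let u : leftIdeal e.val := projL e.val 1
  have hu : (u : F[G]) = e.val := by rw [coe_projL, one_mul]
  refine equiv_of_inverse f (tmk (blockRep e) σ u) (fun g => tensor_ext fun x v => ?_)
    (LinearMap.ext fun v => ?_) (tensor_ext fun x v => ?_)
  · rw [LinearMap.comp_apply, LinearMap.comp_apply, tensorRep_tmk, hf, hf, coe_blockRep,
      regularRep_apply, inv_one, ← MonoidAlgebra.one_def, mul_one, hmul, hsing,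
      Module.End.mul_apply]
    have hc : ∀ y : F[G], leftAct σ y (σ (1, g.2) v) = σ (1, g.2) (leftAct σ y v) := fun y => by
      induction y using MonoidAlgebra.induction_linear with
      | zero => simp
      | add y z hy hz => simp [map_add, hy, hz]
      | single k c =>
        simp only [Representation.asAlgebraHom_single, LinearMap.smul_apply, map_smul,
          MonoidHom.comp_apply, MonoidHom.inl_apply, rep_comm]
    rw [hc, ← rep_split]
  · rw [LinearMap.comp_apply, hf, hu, hσ.left_e]; rfl
  · rw [LinearMap.comp_apply, hf, ← tmk_act, LinearMap.id_apply]
    refine congrArg (fun s => tmk (blockRep e) σ s v) (Subtype.ext ?_)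
    rw [rightAct_blockRep, hu, e.central]
    exact (mem_leftIdeal e.idem).1 x.2

theorem tensor_one_iso (e : CentralIdempotent F G) {V : Type (max u v)} [AddCommGroup V]
    [Module F V] {σ : Representation F (G × G) V} (hσ : IsPerfectPPermutation e.val σ) :
    Nonempty ((tensorRep σ (blockRep e)).Equiv σ) := by
  have hsing : ∀ g : G, rightAct σ (MonoidAlgebra.single g 1) = σ (1, g⁻¹) := fun g => by
    rw [rightAct, invol, MonoidAlgebra.mapDomain_single, Representation.asAlgebraHom_single_one]
    rfl
  have hadd : ∀ x y, rightAct σ (x + y) = rightAct σ x + rightAct σ y := fun x y => by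
    rw [rightAct, invol, MonoidAlgebra.mapDomain_add, map_add]; rfl
  have hsmul : ∀ (g : G) (c : F), rightAct σ (MonoidAlgebra.single g c) = c • σ (1, g⁻¹) :=
    fun g c => by
      rw [rightAct, invol, MonoidAlgebra.mapDomain_single, Representation.asAlgebraHom_single]
      rfl
  have hzero : rightAct σ 0 = 0 := by
    rw [rightAct, invol, MonoidAlgebra.mapDomain_zero, map_zero]
  have hmul : ∀ x y v, rightAct σ (x * y) v = rightAct σ y (rightAct σ x v) := fun x y v => by
    induction x using MonoidAlgebra.induction_linear with
    | zero => rw [zero_mul, hzero]; simp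
    | add x z hx hz => rw [add_mul, hadd, hadd, LinearMap.add_apply, LinearMap.add_apply, hx, hz,
        map_add]
    | single g c =>
      induction y using MonoidAlgebra.induction_linear with
      | zero => rw [mul_zero, hzero]; simp
      | add y z hy hz => rw [mul_add, hadd, hadd, LinearMap.add_apply, LinearMap.add_apply, hy, hz]
      | single h d =>
        rw [MonoidAlgebra.single_mul_single, hsmul, hsmul, hsmul, LinearMap.smul_apply,
          LinearMap.smul_apply, LinearMap.smul_apply, map_smul, rep_right_mul, smul_smul,
          mul_inv_rev, mul_comm c d]
  have hc : ∀ (y : F[G]) (g : G) (v : V), rightAct σ y (σ (g, 1) v) = σ (g, 1) (rightAct σ y v) :=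
    fun y g v => by
      induction y using MonoidAlgebra.induction_linear with
      | zero => rw [hzero]; simp
      | add y z hy hz => rw [hadd, LinearMap.add_apply, LinearMap.add_apply, map_add, hy, hz]
      | single k c => rw [hsmul, LinearMap.smul_apply, LinearMap.smul_apply, map_smul, rep_comm]
  let f1 : V →ₗ[F] leftIdeal e.val →ₗ[F] V := LinearMap.mk₂ F (fun v x => rightAct σ x v)
    (fun _ _ _ => map_add _ _ _) (fun _ _ _ => map_smul _ _ _)
    (fun _ x y => by rw [Submodule.coe_add, hadd]; rfl)
    (fun c v x => by
      rw [Submodule.coe_smul]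
      have : c • (x : F[G]) = MonoidAlgebra.single (1 : G) c * (x : F[G]) := by
        rw [← mul_one c, ← smul_eq_mul, ← MonoidAlgebra.smul_single, smul_mul_assoc,
          ← MonoidAlgebra.one_def, one_mul, smul_eq_mul, mul_one]
      rw [this, hmul, hsmul, inv_one, ← Prod.one_eq_mk, map_one, LinearMap.smul_apply, map_smul]
      rfl)
  have hf1 : ∀ v x, f1 v x = rightAct σ x v := fun _ _ => rfl
  let f : TensorSpace σ (blockRep e) →ₗ[F] V := tlift f1 fun h v x => by
    rw [hf1, hf1, coe_blockRep, regularRep_apply, inv_one, ← MonoidAlgebra.one_def, mul_one, hmul,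
      hsing, rep_right_mul, inv_mul_cancel, ← Prod.one_eq_mk, map_one]
    rfl
  have hf : ∀ v x, f (tmk σ (blockRep e) v x) = rightAct σ x v := fun _ _ => rfl
  let u : leftIdeal e.val := projL e.val 1
  have hu : (u : F[G]) = e.val := by rw [coe_projL, one_mul]
  refine equiv_of_inverse f ((tmk σ (blockRep e)).flip u) (fun g => tensor_ext fun v x => ?_)
    (LinearMap.ext fun v => ?_) (tensor_ext fun v x => ?_)
  · rw [LinearMap.comp_apply, LinearMap.comp_apply, tensorRep_tmk, hf, hf, coe_blockRep,
      regularRep_apply, ← MonoidAlgebra.one_def, one_mul, hmul, hsing, inv_inv, hc, ← rep_comm,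
      ← rep_split]
  · rw [LinearMap.comp_apply, LinearMap.flip_apply, hf, hu, hσ.right_e]; rfl
  · rw [LinearMap.comp_apply, hf, LinearMap.flip_apply, tmk_act, LinearMap.id_apply]
    refine congrArg (fun s => tmk σ (blockRep e) v s) (Subtype.ext ?_)
    rw [leftAct_blockRep, hu]
    exact (mem_leftIdeal e.idem).1 x.2

end isos

section trivialSource

/-- A perfect `p`-permutation `(B,B)`-bimodule, for `B = FGe`. -/
structure PerfectBimod (e : CentralIdempotent F G) where
  carrier : Type (max u v)
  [addCommGroup : AddCommGroup carrier]
  [module : Module F carrier]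
  rep : Representation F (G × G) carrier
  perfect : IsPerfectPPermutation e.val rep

attribute [instance] PerfectBimod.addCommGroup PerfectBimod.module

/-- Isomorphism of bimodules. -/
instance PerfectBimod.setoid (e : CentralIdempotent F G) : Setoid (PerfectBimod e) where
  r M N := Nonempty (M.rep.Equiv N.rep)
  iseqv :=
    { refl := fun M => ⟨Representation.Equiv.refl M.rep⟩
      symm := fun ⟨f⟩ => ⟨f.symm⟩
      trans := fun ⟨f⟩ ⟨g⟩ => ⟨f.trans g⟩ }

/-- Isomorphism classes of perfect `p`-permutation `(B,B)`-bimodules, for `B = FGe`. -/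
def IsoClass (e : CentralIdempotent F G) : Type (max u v + 1) :=
  Quotient (PerfectBimod.setoid e)

variable [Finite G]

/-- The direct sum of bimodules. -/
noncomputable def PerfectBimod.add {e : CentralIdempotent F G} (M N : PerfectBimod e) :
    PerfectBimod e :=
  ⟨M.carrier × N.carrier, M.rep.prod N.rep, M.perfect.prod N.perfect⟩

/-- The tensor product over `FG`, which is also the tensor product over `B`, of bimodules. -/
noncomputable def PerfectBimod.mul {e : CentralIdempotent F G} (M N : PerfectBimod e) :
    PerfectBimod e :=
  ⟨TensorSpace M.rep N.rep, tensorRep M.rep N.rep, M.perfect.tensor N.perfect⟩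

/-- The zero bimodule. -/
noncomputable def PerfectBimod.zero (e : CentralIdempotent F G) : PerfectBimod e :=
  ⟨PUnit, 1, .of_subsingleton _⟩

/-- The bimodule `B = FGe`. -/
noncomputable def PerfectBimod.one (e : CentralIdempotent F G) : PerfectBimod e :=
  ⟨leftIdeal e.val, blockRep e, blockRep_perfect e⟩

instance (e : CentralIdempotent F G) : Subsingleton (PerfectBimod.zero e).carrier :=
  inferInstanceAs (Subsingleton PUnit)

noncomputable instance (e : CentralIdempotent F G) : Add (IsoClass e) :=
  ⟨Quotient.map₂ PerfectBimod.add fun _ _ h _ _ h' => prod_congr h h'⟩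

noncomputable instance (e : CentralIdempotent F G) : Mul (IsoClass e) :=
  ⟨Quotient.map₂ PerfectBimod.mul fun _ _ h _ _ h' => tensor_congr h h'⟩

noncomputable instance (e : CentralIdempotent F G) : Zero (IsoClass e) :=
  ⟨Quotient.mk _ (PerfectBimod.zero e)⟩

noncomputable instance (e : CentralIdempotent F G) : One (IsoClass e) :=
  ⟨Quotient.mk _ (PerfectBimod.one e)⟩

/-- Isomorphism classes form a semiring under direct sum and tensor product. -/
noncomputable instance (e : CentralIdempotent F G) : Semiring (IsoClass e) where
  nsmul := nsmulRec
  npow := npowRec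
  add_assoc := by
    rintro ⟨a⟩ ⟨b⟩ ⟨c⟩
    exact Quotient.sound (prod_assoc_iso _ _ _)
  zero_add := by
    rintro ⟨a⟩
    exact Quotient.sound (zero_prod_iso (U := (PerfectBimod.zero e).carrier) _ _)
  add_zero := by
    rintro ⟨a⟩
    exact Quotient.sound (((prod_comm_iso _ _).map2 Representation.Equiv.trans)
      (zero_prod_iso (U := (PerfectBimod.zero e).carrier) _ _))
  add_comm := by
    rintro ⟨a⟩ ⟨b⟩
    exact Quotient.sound (prod_comm_iso _ _)
  left_distrib := by
    rintro ⟨a⟩ ⟨b⟩ ⟨c⟩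
    exact Quotient.sound (tensor_prod_iso _ _ _)
  right_distrib := by
    rintro ⟨a⟩ ⟨b⟩ ⟨c⟩
    exact Quotient.sound (prod_tensor_iso _ _ _)
  zero_mul := by
    rintro ⟨a⟩
    have := tensor_subsingleton_left (PerfectBimod.zero e).rep a.rep
    exact Quotient.sound (subsingleton_iso (U := TensorSpace (PerfectBimod.zero e).rep a.rep)
      (V := (PerfectBimod.zero e).carrier) _ _)
  mul_zero := by
    rintro ⟨a⟩
    have := tensor_subsingleton_right a.rep (PerfectBimod.zero e).rep
    exact Quotient.sound (subsingleton_iso (U := TensorSpace a.rep (PerfectBimod.zero e).rep)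
      (V := (PerfectBimod.zero e).carrier) _ _)
  mul_assoc := by
    rintro ⟨a⟩ ⟨b⟩ ⟨c⟩
    exact Quotient.sound (tensor_assoc_iso _ _ _)
  one_mul := by
    rintro ⟨a⟩
    exact Quotient.sound (one_tensor_iso e a.perfect)
  mul_one := by
    rintro ⟨a⟩
    exact Quotient.sound (tensor_one_iso e a.perfect)

/-- The ring `T^Δ(B,B)`, for `B = FGe`: the Grothendieck group, with respect to direct sums, of
perfect `p`-permutation `(B,B)`-bimodules, with multiplication induced by `⊗_B`. By the
Krull-Schmidt theorem, it is the free abelian group on the isomorphism classes of indecomposable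
perfect `p`-permutation `(B,B)`-bimodules. -/
def TDelta (e : CentralIdempotent F G) : Type (max u v + 1) :=
  Algebra.GrothendieckAddGroup (IsoClass e)

/-- The ring structure of `T^Δ(B,B)`. -/
noncomputable def TDelta.ringStructure (e : CentralIdempotent F G) : Ring (TDelta e) :=
  grothendieckRing (S := IsoClass e)

noncomputable instance (e : CentralIdempotent F G) : Ring (TDelta e) :=
  TDelta.ringStructure e

/-- The class `[M]` in `T^Δ(B,B)`. -/
noncomputable def PerfectBimod.cls {e : CentralIdempotent F G} (M : PerfectBimod e) : TDelta e :=
  Algebra.GrothendieckAddGroup.of (M := IsoClass e) (Quotient.mk _ M)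

/-- A module is indecomposable if it is non-zero and is not the direct sum of two non-zero
submodules. -/
def IsIndecomposable (R : Type*) [Ring R] (M : Type*) [AddCommGroup M] [Module R M] : Prop :=
  Nontrivial M ∧ ∀ U W : Submodule R M, IsCompl U W → U = ⊥ ∨ W = ⊥

/-- `Pr(B,B)`: the subgroup of `T^Δ(B,B)` spanned by the classes of the projective indecomposable
bimodules. -/
noncomputable def Pr (e : CentralIdempotent F G) : Submodule ℤ (TDelta e) :=
  Submodule.span ℤ {x | ∃ M : PerfectBimod e, Module.Projective F[G × G] M.rep.asModule ∧
    IsIndecomposable F[G × G] M.rep.asModule ∧ M.cls = x}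

/-- `k T^Δ(B,B) = k ⊗_ℤ T^Δ(B,B)`. -/
abbrev kTDelta (k : Type*) [Field k] (e : CentralIdempotent F G) := k ⊗[ℤ] TDelta e

/-- `k Pr(B,B)`, the `k`-span of `Pr(B,B)` in `k T^Δ(B,B)`. -/
noncomputable abbrev kPr (k : Type*) [Field k] (e : CentralIdempotent F G) :
    Submodule k (kTDelta k e) :=
  (Pr e).baseChange k

end trivialSource

/-- `x` is a primitive idempotent of the (not necessarily unital) subring `A`: a non-zero
idempotent of `A` which is not the sum of two non-zero orthogonal idempotents of `A`. -/
def IsPrimitiveIn {R : Type*} [Ring R] (A : Set R) (x : R) : Prop :=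
  x ∈ A ∧ x * x = x ∧ x ≠ 0 ∧ ∀ a ∈ A, ∀ b ∈ A, a * a = a → b * b = b → a * b = 0 → b * a = 0 →
    a + b = x → a = 0 ∨ b = 0

/-- Simple `B`-modules, for `B = FGe`: simple `FG`-modules on which `e` acts as the identity. -/
structure SimpleMod (e : CentralIdempotent F G) where
  carrier : Type (max u v)
  [addCommGroup : AddCommGroup carrier]
  [module : Module F[G] carrier]
  simple : IsSimpleModule F[G] carrier
  e_smul : ∀ s : carrier, e.val • s = s

attribute [instance] SimpleMod.addCommGroup SimpleMod.module

/-- Isomorphism of simple `B`-modules. -/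
instance SimpleMod.setoid (e : CentralIdempotent F G) : Setoid (SimpleMod e) where
  r S T := Nonempty (S.carrier ≃ₗ[F[G]] T.carrier)
  iseqv :=
    { refl := fun S => ⟨LinearEquiv.refl F[G] S.carrier⟩
      symm := fun ⟨f⟩ => ⟨f.symm⟩
      trans := fun ⟨f⟩ ⟨g⟩ => ⟨f.trans g⟩ }

/-- `l(B)`, the number of isomorphism classes of simple `B`-modules, for `B = FGe`. -/
noncomputable def numSimple (e : CentralIdempotent F G) : ℕ :=
  Nat.card (Quotient (SimpleMod.setoid e))

/-- Pairwise orthogonal primitive idempotents `ε₁, …, εₙ` of `B = FGe` such that the left ideals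
`Pᵢ = FG εᵢ` form a complete list of pairwise non-isomorphic projective indecomposable
`B`-modules. -/
structure PIMSystem (e : CentralIdempotent F G) (n : ℕ) where
  ε : Fin n → F[G]
  primitive : ∀ i, IsPrimitiveIn {x | e.val * x = x} (ε i)
  orthogonal : ∀ i j, i ≠ j → ε i * ε j = 0
  not_iso : ∀ i j, Nonempty (Ideal.span {ε i} ≃ₗ[F[G]] Ideal.span {ε j}) → i = j
  complete : ∀ (M : Type (max u v)) [AddCommGroup M] [Module F[G] M], Module.Finite F[G] M →
    Module.Projective F[G] M → IsIndecomposable F[G] M → (∀ m : M, e.val • m = m) →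
      ∃ i, Nonempty (M ≃ₗ[F[G]] Ideal.span {ε i})

/-- The class of `P_{ij} = FG εᵢ ⊗_F εⱼ FG` in `T^Δ(B,B)`. -/
noncomputable def PIMSystem.cls [Finite G] {e : CentralIdempotent F G} {n : ℕ}
    (s : PIMSystem e n) (i j : Fin n) : TDelta e :=
  PerfectBimod.cls ⟨PairSpace (s.ε i) (s.ε j), pairRep (s.ε i) (s.ε j),
    pairRep_perfect e (s.primitive i).2.1 (s.primitive j).2.1 (s.primitive i).1
      (s.primitive j).1⟩

/-- The Cartan matrix `c_{ij} = dim_F (εᵢ FG εⱼ)` of `B`, with entries in `k`. -/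
noncomputable def PIMSystem.cartan {e : CentralIdempotent F G} {n : ℕ} (s : PIMSystem e n)
    (k : Type*) [Field k] : Matrix (Fin n) (Fin n) k :=
  .of fun i j => (Module.finrank F (LinearMap.range
    (LinearMap.mulLeft F (s.ε i) ∘ₗ LinearMap.mulRight F (s.ε j))) : k)

/-- The field `F` is a splitting field for the group algebras `FH` of all subgroups `H` of `G`:
every simple `FH`-module has only scalar endomorphisms. -/
def IsSplittingFor (F : Type u) [Field F] (G : Type v) [Group G] : Prop :=
  ∀ (H : Subgroup G) (S : Type (max u v)) [AddCommGroup S] [Module F[H] S],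
    IsSimpleModule F[H] S → ∀ f : S →ₗ[F[H]] S, ∃ c : F, ∀ s, f s = algebraMap F F[H] c • s

/-- `a` is fixed under conjugation by the elements of `D`. -/
def IsFixedBy (D : Subgroup G) (a : F[G]) : Prop :=
  ∀ d ∈ D, MonoidAlgebra.single d (1 : F) * a * MonoidAlgebra.single d⁻¹ (1 : F) = a

/-- The relative trace map `a ↦ ∑_{g ∈ G/D} g a g⁻¹` from `(FG)^D` to `(FG)^G = Z(FG)`. -/
noncomputable def relTrace (D : Subgroup G) (a : F[G]) : F[G] :=
  ∑ᶠ q : G ⧸ D, MonoidAlgebra.single q.out (1 : F) * a * MonoidAlgebra.single q.out⁻¹ (1 : F)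

/-- `b` lies in the image of the relative trace map from `(FG)^D`. -/
def InTraceIdeal (D : Subgroup G) (b : F[G]) : Prop :=
  ∃ a : F[G], IsFixedBy D a ∧ relTrace D a = b

/-- A block idempotent of `FG`: a primitive idempotent of the center of `FG`. -/
def IsBlockIdempotent (b : F[G]) : Prop :=
  IsPrimitiveIn (Set.center F[G]) b

/-- `D` is a defect group of the block idempotent `b`: a minimal subgroup such that `b` is in the
image of the relative trace map from `(FG)^D`. -/
def IsDefectGroup (b : F[G]) (D : Subgroup G) : Prop :=
  Minimal (fun D : Subgroup G => InTraceIdeal D b) D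

/-- The block with block idempotent `b` has defect `d`, i.e. defect groups of order `p ^ d`. -/
def HasDefect (p : ℕ) (b : F[G]) (d : ℕ) : Prop :=
  ∃ D : Subgroup G, IsDefectGroup b D ∧ Nat.card D = p ^ d

end Bimodules

end PPermutation

open PPermutation

/-!
The classes of the bimodules `P_{ij} = FG ε_i ⊗ ε_j FG` form a `ℤ`-basis of `Pr(B,B)`
(`PIMSystem.Pr_eq_span`, `PIMSystem.exists_coord`), and they multiply by
`[P_{ij}] [P_{kl}] = c_{jk} [P_{il}]` (`PIMSystem.cls_mul_cls`), since
`ε_j FG ⊗_{FG} FG ε_k ≅ ε_j FG ε_k`. So `Pr(B,B)` is the group of integral `l × l`-matrices with the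
multiplication `X * Y = X C Y`. Everything depends on the invertibility of the Cartan matrix `C`.

*Fields of characteristic other than `p`.* If `C` is invertible over `k`, then `X ↦ ∑ (X C⁻¹) i j
[P_{ij}]` identifies the matrix algebra with `k Pr(B,B)`, and the assertions are transported from
facts on matrices through the ideal property of `k Pr(B,B)` (`IsMatrixIdeal`). That `C` divides a
power of `p` over `ℤ` (`PIMSystem.exists_cartanInt_mul`) is derived without characteristic zero:
there are finite `G`-sets `X` and `Y` such that the stabilizers of `X` and `Y` have orders prime to
`p`, and `X` and the union of `Y` with `p ^ a` trivial points are isomorphic on restriction to every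
cyclic subgroup of order prime to `p` (`exists_gSets`). For a simple module `S`, the modules
`F[X] ⊗ S` and `F[Y] ⊗ S` are projective, and `F[X] ⊗ S` has the composition factors of the sum of
`F[Y] ⊗ S` and `p ^ a` copies of `S`, because composition factors are determined by the restrictions
to cyclic subgroups of order prime to `p` (`rankOf_eq_of_regular`). Since the multiplicities in
projective modules are integral combinations of the columns of `C`, this gives an integral matrix
`D` with `C D = p ^ a`.

*Defect zero.* By the multiplication rule, `Pr(B,B)` has an identity element if and only if `C` is
invertible over `ℤ`. All blocks of `B` have defect `0` if and only if `e` is a trace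
`∑ g a g⁻¹`, and then simple `B`-modules are projective, so that `C` is invertible over `ℤ`.
Conversely, suppose that `C` is invertible over `F`. An element `a` with `∑ g a g⁻¹ = 0` has trace
zero on projective modules, hence on all `B`-modules (`PIMSystem.traceOf_eq_zero`). A conjugacy
class whose centralizers have order divisible by `p` provides such elements `a`, and evaluating the
trace on the permutation module of a Sylow subgroup shows, with a formula for coefficients of
`p`-power powers (`coeff_pow_char_pow`), that the coefficient of `e` at this class vanishes. The
remaining class sums are multiples of traces, and so `e` is a trace (`PIMSystem.exists_fullTrace_eq`).
-/

namespace PPermutation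

/-! ### Primitive idempotents of finite-dimensional algebras -/

section PrimitiveIdempotents

/-- The idempotents `ε` and `ε'` are equivalent: they are the two products `a b` and `b a` of
elements `a ∈ ε A ε'` and `b ∈ ε' A ε`. -/
def IdemEquiv {A : Type*} [Ring A] (ε ε' : A) : Prop :=
  ∃ a b : A, ε * a = a ∧ a * ε' = a ∧ ε' * b = b ∧ b * ε = b ∧ a * b = ε ∧ b * a = ε'

theorem IsPrimitiveIn.eq_zero_or_eq {A : Type*} [Ring A] {ε f : A}
    (hε : IsPrimitiveIn Set.univ ε) (hf : f * f = f) (h1 : ε * f = f) (h2 : f * ε = f) :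
    f = 0 ∨ f = ε := by
  obtain ⟨-, hi, -, h⟩ := hε
  rcases h f trivial (ε - f) trivial hf (by noncomm_ring; simp [hi, hf, h1, h2])
    (by rw [mul_sub, h2, hf, sub_self]) (by rw [sub_mul, h1, hf, sub_self])
    (by abel) with h | h
  · exact Or.inl h
  · exact Or.inr (sub_eq_zero.1 h).symm

theorem isPrimitiveIn_univ_of {A : Type*} [Ring A] {e ε : A} (hε : e * ε = ε)
    (h : IsPrimitiveIn {x | e * x = x} ε) : IsPrimitiveIn Set.univ ε := by
  obtain ⟨-, hi, h0, h⟩ := h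
  refine ⟨trivial, hi, h0, fun a _ b _ ha hb hab hba hs => ?_⟩
  have h1 : ∀ c, ε * c = c → e * c = c := fun c hc => by rw [← hc, ← mul_assoc, hε]
  exact h a (h1 a (by rw [← hs, add_mul, ha, hba, add_zero])) b
    (h1 b (by rw [← hs, add_mul, hb, hab, zero_add])) ha hb hab hba hs

theorem isPrimitiveIn_of_univ {A : Type*} [Ring A] {e ε : A} (hε : e * ε = ε)
    (h : IsPrimitiveIn Set.univ ε) : IsPrimitiveIn {x | e * x = x} ε :=
  ⟨hε, h.2.1, h.2.2.1, fun a _ b _ => h.2.2.2 a trivial b trivial⟩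

/-- An idempotent of a finite-dimensional algebra lying in a subset `A` is a sum of pairwise
orthogonal primitive idempotents of `A`. -/
theorem exists_primitive_decomposition (F : Type*) {R : Type*} [Field F] [Ring R] [Algebra F R]
    [FiniteDimensional F R] (A : Set R) (f : R) (hfA : f ∈ A) (hf : f * f = f) :
    ∃ (n : ℕ) (η : Fin n → R), (∀ i, IsPrimitiveIn A (η i)) ∧
      (∀ i, f * η i = η i ∧ η i * f = η i) ∧
      (∀ i j, i ≠ j → η i * η j = 0) ∧ ∑ i, η i = f := by
  suffices H : ∀ (d : ℕ) (f : R), f ∈ A → f * f = f →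
      Module.finrank F (LinearMap.range (LinearMap.mulLeft F f)) = d →
      ∃ (n : ℕ) (η : Fin n → R), (∀ i, IsPrimitiveIn A (η i)) ∧
      (∀ i, f * η i = η i ∧ η i * f = η i) ∧
      (∀ i j, i ≠ j → η i * η j = 0) ∧ ∑ i, η i = f from H _ f hfA hf rfl
  intro d
  induction d using Nat.strong_induction_on with
  | _ d ih =>
  intro f hfA hf hd
  by_cases h0 : f = 0
  · exact ⟨0, Fin.elim0, fun i => i.elim0, fun i => i.elim0, fun i => i.elim0, by simp [h0]⟩
  by_cases hp : IsPrimitiveIn A f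
  · exact ⟨1, fun _ => f, fun _ => hp, fun _ => ⟨hf, hf⟩,
      fun i j hij => absurd (Subsingleton.elim i j) hij, by simp⟩
  have : ∃ a ∈ A, ∃ b ∈ A, a * a = a ∧ b * b = b ∧ a * b = 0 ∧ b * a = 0 ∧ a + b = f ∧ a ≠ 0 ∧
      b ≠ 0 := by
    by_contra hcon
    refine hp ⟨hfA, hf, h0, fun a ha b hb h1 h2 h3 h4 h5 => ?_⟩
    by_contra hcon'
    rw [not_or] at hcon'
    exact hcon ⟨a, ha, b, hb, h1, h2, h3, h4, h5, hcon'.1, hcon'.2⟩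
  obtain ⟨a, haA, b, hbA, ha, hb, hab, hba, hs, ha0, hb0⟩ := this
  have hlt : ∀ a b : R, a * a = a → b * b = b → a * b = 0 → b * a = 0 → a + b = f → b ≠ 0 →
      Module.finrank F (LinearMap.range (LinearMap.mulLeft F a)) < d := by
    intro a b ha hb hab hba hs hb0
    rw [← hd]
    apply Submodule.finrank_lt_finrank_of_lt
    refine lt_of_le_of_ne ?_ fun heq => hb0 ?_
    · rintro _ ⟨x, rfl⟩
      refine ⟨a * x, ?_⟩
      simp only [LinearMap.mulLeft_apply]
      rw [← mul_assoc, ← hs, add_mul, ha, hba, add_zero]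
    · have : b ∈ LinearMap.range (LinearMap.mulLeft F f) := ⟨b, by
        simp only [LinearMap.mulLeft_apply]; rw [← hs, add_mul, hab, hb, zero_add]⟩
      rw [← heq] at this
      obtain ⟨x, hx⟩ := this
      simp only [LinearMap.mulLeft_apply] at hx
      rw [← hb, ← hx, ← mul_assoc, hx, hba, zero_mul]
  obtain ⟨n, η, h1, h2, h3, h4⟩ := ih _ (hlt a b ha hb hab hba hs hb0) a haA ha rfl
  obtain ⟨m, θ, g1, g2, g3, g4⟩ := ih _ (hlt b a hb ha hba hab (by rw [add_comm, hs]) ha0) b hbA hb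
    rfl
  have hfa : f * a = a := by rw [← hs, add_mul, ha, hba, add_zero]
  have hfb : f * b = b := by rw [← hs, add_mul, hb, hab, zero_add]
  have haf : a * f = a := by rw [← hs, mul_add, ha, hab, add_zero]
  have hbf : b * f = b := by rw [← hs, mul_add, hb, hba, zero_add]
  refine ⟨n + m, Fin.append η θ, fun i => ?_, fun i => ?_, fun i j => ?_, ?_⟩
  · refine Fin.addCases (fun i => ?_) (fun i => ?_) i
    · rw [Fin.append_left]; exact h1 i
    · rw [Fin.append_right]; exact g1 i
  · refine Fin.addCases (fun i => ?_) (fun i => ?_) i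
    · rw [Fin.append_left]
      exact ⟨by rw [← (h2 i).1, ← mul_assoc, hfa], by rw [← (h2 i).2, mul_assoc, haf]⟩
    · rw [Fin.append_right]
      exact ⟨by rw [← (g2 i).1, ← mul_assoc, hfb], by rw [← (g2 i).2, mul_assoc, hbf]⟩
  · refine Fin.addCases (fun i => ?_) (fun i => ?_) i <;>
      refine Fin.addCases (fun j => ?_) (fun j => ?_) j <;> intro hij
    · rw [Fin.append_left, Fin.append_left]
      exact h3 i j fun h => hij (by rw [h])
    · rw [Fin.append_left, Fin.append_right, ← (h2 i).2, ← (g2 j).1, mul_assoc, ← mul_assoc a, hab,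
        zero_mul, mul_zero]
    · rw [Fin.append_left, Fin.append_right, ← (g2 i).2, ← (h2 j).1, mul_assoc, ← mul_assoc b, hba,
        zero_mul, mul_zero]
    · rw [Fin.append_right, Fin.append_right]
      exact g3 i j fun h => hij (by rw [h])
  · rw [Fin.sum_univ_add]
    simp only [Fin.append_left, Fin.append_right, h4, g4, hs]

variable {F : Type u} [Field F] {A : Type w} [Ring A] [Algebra F A] [FiniteDimensional F A]

include F in
variable (F) in
/-- Fitting's lemma: if `ε` is a primitive idempotent, then `ε A ε` is local. -/
theorem IsPrimitiveIn.isNilpotent_or_exists_inv {ε x : A} (hε : IsPrimitiveIn Set.univ ε)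
    (h1 : ε * x = x) (h2 : x * ε = x) :
    IsNilpotent x ∨ ∃ y, ε * y = y ∧ y * ε = y ∧ y * x = ε ∧ x * y = ε := by
  classical
  obtain ⟨p, hp0, hp⟩ : ∃ p : Polynomial F, p ≠ 0 ∧ Polynomial.aeval x p = 0 :=
    ⟨minpoly F x, minpoly.ne_zero (Algebra.IsIntegral.isIntegral x), minpoly.aeval F x⟩
  obtain ⟨q, hq, hqn⟩ := Polynomial.exists_eq_pow_rootMultiplicity_mul_and_not_dvd p hp0 0
  rw [map_zero, sub_zero] at hq hqn
  generalize Polynomial.rootMultiplicity 0 p = k at hq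
  have hcop : IsCoprime (Polynomial.X ^ (k + 1)) q :=
    ((Polynomial.irreducible_X.coprime_iff_not_dvd).2 hqn).pow_left
  obtain ⟨r, s, hrs⟩ := hcop
  have hx : x ^ (k + 1) * Polynomial.aeval x q = 0 := by
    have : Polynomial.aeval x (Polynomial.X * p) = 0 := by rw [map_mul, hp, mul_zero]
    rw [hq] at this
    simpa [pow_succ', mul_assoc] using this
  set R := Polynomial.aeval x r with hR
  set S := Polynomial.aeval x s with hS
  set Q := Polynomial.aeval x q with hQ
  have h : R * x ^ (k + 1) + S * Q = 1 := by
    simpa using congrArg (Polynomial.aeval x) hrs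
  have hcomm : ∀ a b : Polynomial F, Polynomial.aeval x a * Polynomial.aeval x b =
      Polynomial.aeval x b * Polynomial.aeval x a := fun a b => by
    rw [← map_mul, mul_comm, map_mul]
  have hxR : x * R = R * x := by simpa using hcomm Polynomial.X r
  have hxkR : x ^ (k + 1) * R = R * x ^ (k + 1) := by simpa using hcomm (Polynomial.X ^ (k + 1)) r
  have hxS : x ^ (k + 1) * S = S * x ^ (k + 1) := by simpa using hcomm (Polynomial.X ^ (k + 1)) s
  have hx' : x ^ (k + 1) * (R * x ^ (k + 1)) = x ^ (k + 1) := by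
    have := congrArg (x ^ (k + 1) * ·) h
    simp only [mul_add, mul_one] at this
    rwa [← mul_assoc _ S, hxS, mul_assoc S, hx, mul_zero, add_zero] at this
  have hf : R * x ^ (k + 1) * (R * x ^ (k + 1)) = R * x ^ (k + 1) := by
    rw [mul_assoc, hx']
  rcases hε.eq_zero_or_eq hf (by rw [← hxkR, pow_succ', ← mul_assoc, ← mul_assoc, h1])
    (by rw [pow_succ, mul_assoc, mul_assoc, h2]) with h0 | h0
  · left
    exact ⟨k + 1, by rw [← hx', h0, mul_zero]⟩
  · right
    have e1 : R * x ^ k * x = ε := by rw [mul_assoc, ← pow_succ, h0]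
    have e2 : x * (R * x ^ k) = ε := by rw [← mul_assoc, hxR, mul_assoc, ← pow_succ', h0]
    have hi := hε.2.1
    refine ⟨ε * (R * x ^ k) * ε, ?_, ?_, ?_, ?_⟩
    · rw [← mul_assoc, ← mul_assoc, hi]
    · rw [mul_assoc, hi]
    · rw [mul_assoc, h1, mul_assoc, e1, hi]
    · rw [← mul_assoc, ← mul_assoc, h2, e2, hi]

include F in
variable (F) in
theorem IsPrimitiveIn.exists_inv_of_smul {ε x : A} (hε : IsPrimitiveIn Set.univ ε)
    (h1 : ε * x = x) (h2 : x * ε = x) {M : Type*} [AddCommGroup M] [Module A M] {m : M}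
    (hm : m ≠ 0) (hx : x • m = m) :
    ∃ y, ε * y = y ∧ y * ε = y ∧ y * x = ε ∧ x * y = ε := by
  refine (hε.isNilpotent_or_exists_inv F h1 h2).resolve_left fun ⟨n, hn⟩ => hm ?_
  have : ∀ n : ℕ, x ^ n • m = m := fun n => by
    induction n with
    | zero => simp
    | succ n ih => rw [pow_succ, mul_smul, hx, ih]
  rw [← this n, hn, zero_smul]

include F in
variable (F) in
/-- The annihilator of a non-zero vector of `ε T`, for a simple module `T` and a primitive
idempotent `ε`, is as large as possible. -/
theorem IsPrimitiveIn.eq_zero_of_smul {ε : A} (hε : IsPrimitiveIn Set.univ ε) {S T : Type*}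
    [AddCommGroup S] [Module A S] [AddCommGroup T] [Module A T] [IsSimpleModule A T]
    {v : S} {t : T} (hv : ε • v = v) (ht : ε • t = t) (a : A) (hat : a • t ≠ 0)
    (hav : a • v = 0) : v = 0 := by
  obtain ⟨b, hb⟩ := IsSimpleModule.toSpanSingleton_surjective A hat t
  rw [LinearMap.toSpanSingleton_apply] at hb
  have hi := hε.2.1
  have ht0 : t ≠ 0 := fun h => hat (by rw [h, smul_zero])
  obtain ⟨y, -, -, h3, -⟩ := hε.exists_inv_of_smul F (x := ε * b * a * ε)
    (by simp only [← mul_assoc, hi]) (by rw [mul_assoc, hi]) ht0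
    (by rw [mul_smul, ht, mul_assoc, mul_smul, mul_smul, hb, ht])
  rw [← hv, ← h3, mul_smul, mul_smul, hv, mul_smul, hav, smul_zero, smul_zero]

include F in
variable (F) in
/-- Two simple modules not annihilated by a primitive idempotent are isomorphic. -/
theorem IsPrimitiveIn.exists_equiv {ε : A} (hε : IsPrimitiveIn Set.univ ε) {S T : Type*}
    [AddCommGroup S] [Module A S] [IsSimpleModule A S] [AddCommGroup T] [Module A T]
    [IsSimpleModule A T] {v : S} {t : T} (hv : ε • v = v) (hv0 : v ≠ 0) (ht : ε • t = t)
    (ht0 : t ≠ 0) : ∃ φ : S ≃ₗ[A] T, φ v = t := by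
  have hker : LinearMap.ker (LinearMap.toSpanSingleton A S v) =
      LinearMap.ker (LinearMap.toSpanSingleton A T t) := by
    ext a
    simp only [LinearMap.mem_ker, LinearMap.toSpanSingleton_apply]
    constructor
    · intro h
      by_contra hcon
      exact hv0 (hε.eq_zero_of_smul F hv ht a hcon h)
    · intro h
      by_contra hcon
      exact ht0 (hε.eq_zero_of_smul F ht hv a hcon h)
  refine ⟨((LinearMap.toSpanSingleton A S v).quotKerEquivOfSurjective
    (IsSimpleModule.toSpanSingleton_surjective A hv0)).symm.trans
    ((Submodule.quotEquivOfEq _ _ hker).trans ((LinearMap.toSpanSingleton A T t).quotKerEquivOfSurjective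
    (IsSimpleModule.toSpanSingleton_surjective A ht0))), ?_⟩
  have h1 : ((LinearMap.toSpanSingleton A S v).quotKerEquivOfSurjective
    (IsSimpleModule.toSpanSingleton_surjective A hv0)).symm v = Submodule.Quotient.mk 1 := by
    rw [LinearEquiv.symm_apply_eq]
    simp
  simp only [LinearEquiv.trans_apply, h1, Submodule.quotEquivOfEq_mk,
    LinearMap.quotKerEquivOfSurjective_apply_mk, LinearMap.toSpanSingleton_apply, one_smul]

theorem IdemEquiv.symm {ε ε' : A} (h : IdemEquiv ε ε') : IdemEquiv ε' ε := by
  obtain ⟨a, b, h1, h2, h3, h4, h5, h6⟩ := h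
  exact ⟨b, a, h3, h4, h1, h2, h6, h5⟩

theorem IdemEquiv.refl {ε : A} (h : ε * ε = ε) : IdemEquiv ε ε := ⟨ε, ε, h, h, h, h, h, h⟩

theorem IdemEquiv.trans {ε ε' ε'' : A} (h : IdemEquiv ε ε') (h' : IdemEquiv ε' ε'') :
    IdemEquiv ε ε'' := by
  obtain ⟨a, b, h1, h2, h3, h4, h5, h6⟩ := h
  obtain ⟨c, d, g1, g2, g3, g4, g5, g6⟩ := h'
  refine ⟨a * c, d * b, ?_, ?_, ?_, ?_, ?_, ?_⟩
  · rw [← mul_assoc, h1]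
  · rw [mul_assoc, g2]
  · rw [← mul_assoc, g3]
  · rw [mul_assoc, h4]
  · rw [mul_assoc, ← mul_assoc c, g5, h3, h5]
  · rw [mul_assoc, ← mul_assoc b, h6, g1, g6]

theorem IdemEquiv.smul_ne_zero {ε ε' : A} (h : IdemEquiv ε ε') {M : Type*} [AddCommGroup M]
    [Module A M] {m : M} (hm : ε • m ≠ 0) : ∃ b : A, (ε' * b) • m ≠ 0 := by
  obtain ⟨a, b, h1, h2, h3, h4, h5, h6⟩ := h
  refine ⟨b, fun h0 => hm ?_⟩
  rw [← h5, mul_smul, ← h3, h0, smul_zero]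

include F in
variable (F) in
/-- Primitive idempotents that act non-trivially on the same simple module are equivalent. -/
theorem IsPrimitiveIn.idemEquiv {ε ε' : A} (hε : IsPrimitiveIn Set.univ ε)
    (hε' : IsPrimitiveIn Set.univ ε') {S : Type*} [AddCommGroup S] [Module A S]
    [IsSimpleModule A S] {v v' : S} (hv : ε • v ≠ 0) (hv' : ε' • v' ≠ 0) : IdemEquiv ε ε' := by
  have hi := hε.2.1
  have hi' := hε'.2.1
  obtain ⟨a, ha⟩ := IsSimpleModule.toSpanSingleton_surjective A hv' (ε • v)
  obtain ⟨b, hb⟩ := IsSimpleModule.toSpanSingleton_surjective A hv (ε' • v')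
  rw [LinearMap.toSpanSingleton_apply] at ha hb
  have e1 : (ε * a * ε' * (ε' * b * ε)) • ε • v = ε • v := by
    simp only [smul_smul, mul_assoc, hi] at ha hb ⊢
    rw [← mul_assoc ε' ε', hi', mul_smul, mul_smul, mul_smul, hb, smul_smul ε' ε', hi',
      smul_smul a, ha, smul_smul, hi]
  obtain ⟨y, h1, h2, h3, h4⟩ := hε.exists_inv_of_smul F (x := ε * a * ε' * (ε' * b * ε))
    (by simp only [← mul_assoc, hi]) (by simp only [mul_assoc, hi]) hv e1
  -- `f = (ε' b ε) y (ε a ε')` is a non-zero idempotent of `ε' A ε'`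
  obtain ⟨c, hc⟩ : ∃ c, c = ε * a * ε' := ⟨_, rfl⟩
  obtain ⟨d, hd⟩ : ∃ d, d = ε' * b * ε * y := ⟨_, rfl⟩
  have hεc : ε * c = c := by rw [hc]; simp only [← mul_assoc, hi]
  have hcε : c * ε' = c := by rw [hc]; simp only [mul_assoc, hi']
  have hεd : ε' * d = d := by rw [hd]; simp only [← mul_assoc, hi']
  have hdε : d * ε = d := by rw [hd, mul_assoc, h2]
  have hcd : c * d = ε := by rw [hc, hd, ← mul_assoc, h4]
  refine ⟨c, d, hεc, hcε, hεd, hdε, hcd, ?_⟩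
  refine (hε'.eq_zero_or_eq (f := d * c) ?_ (by rw [← mul_assoc, hεd])
    (by rw [mul_assoc, hcε])).resolve_left fun h0 => hε.2.2.1 ?_
  · rw [mul_assoc, ← mul_assoc c, hcd, hεc]
  · rw [← hi, ← hcd, mul_assoc, ← mul_assoc d, h0, zero_mul, mul_zero]

end PrimitiveIdempotents

/-! ### Projective indecomposable modules and their simple quotients -/

section ProjectiveIndecomposables

variable {A : Type w} [Ring A]

theorem mem_span_idem {ε : A} (hε : ε * ε = ε) {x : A} : x ∈ Ideal.span {ε} ↔ x * ε = x := by
  rw [Ideal.mem_span_singleton']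
  constructor
  · rintro ⟨a, rfl⟩
    rw [mul_assoc, hε]
  · exact fun h => ⟨x, h⟩

theorem self_mem_span (ε : A) : ε ∈ Ideal.span {ε} := Ideal.mem_span_singleton_self ε

theorem projective_span_idem {ε : A} (hε : ε * ε = ε) :
    Module.Projective A (Ideal.span {ε} : Ideal A) := by
  refine Module.Projective.of_split (M := A) (Submodule.subtype _)
    (LinearMap.codRestrict _ (LinearMap.toSpanSingleton A A ε) fun x =>
      (mem_span_idem hε).2 (by rw [LinearMap.toSpanSingleton_apply, smul_eq_mul, mul_assoc, hε]))
    (LinearMap.ext fun x => Subtype.ext ?_)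
  simpa using (mem_span_idem hε).1 x.2

theorem idemEquiv_iff {ε ε' : A} (hε : ε * ε = ε) (hε' : ε' * ε' = ε') :
    IdemEquiv ε ε' ↔ Nonempty (Ideal.span {ε} ≃ₗ[A] Ideal.span {ε'}) := by
  constructor
  · rintro ⟨a, b, h1, h2, h3, h4, h5, h6⟩
    let f : (Ideal.span {ε} : Ideal A) →ₗ[A] (Ideal.span {ε'} : Ideal A) :=
      LinearMap.codRestrict _ ((LinearMap.toSpanSingleton A A a).domRestrict _) fun x =>
        (mem_span_idem hε').2 (by simp [mul_assoc, h2])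
    let g : (Ideal.span {ε'} : Ideal A) →ₗ[A] (Ideal.span {ε} : Ideal A) :=
      LinearMap.codRestrict _ ((LinearMap.toSpanSingleton A A b).domRestrict _) fun x =>
        (mem_span_idem hε).2 (by simp [mul_assoc, h4])
    refine ⟨LinearEquiv.ofLinearMap f g (LinearMap.ext fun x => Subtype.ext ?_)
      (LinearMap.ext fun x => Subtype.ext ?_)⟩
    · simp [f, g, mul_assoc, h6, (mem_span_idem hε').1 x.2]
    · simp [f, g, mul_assoc, h5, (mem_span_idem hε).1 x.2]
  · rintro ⟨φ⟩
    let s : (Ideal.span {ε} : Ideal A) := ⟨ε, self_mem_span ε⟩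
    let s' : (Ideal.span {ε'} : Ideal A) := ⟨ε', self_mem_span ε'⟩
    have hs : ε • s = s := Subtype.ext hε
    have hs' : ε' • s' = s' := Subtype.ext hε'
    have h2 := (mem_span_idem hε').1 (φ s).2
    have h4 := (mem_span_idem hε).1 (φ.symm s').2
    refine ⟨φ s, φ.symm s', ?_, h2, ?_, h4, ?_, ?_⟩
    · conv_rhs => rw [← hs, map_smul]
      rfl
    · conv_rhs => rw [← hs', map_smul]
      rfl
    · have : (φ s : A) • s' = φ s := Subtype.ext h2
      have := congrArg φ.symm this
      rw [map_smul, φ.symm_apply_apply] at this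
      exact congrArg Subtype.val this
    · have : (φ.symm s' : A) • s = φ.symm s' := Subtype.ext h4
      have := congrArg φ this
      rw [map_smul, φ.apply_symm_apply] at this
      exact congrArg Subtype.val this

/-- A non-zero idempotent acts non-trivially on some simple module. -/
theorem exists_simple_of_idem {f : A} (hf : f * f = f) (hf0 : f ≠ 0) :
    ∃ (S : Type w) (_ : AddCommGroup S) (_ : Module A S) (_ : IsSimpleModule A S) (v : S),
      f • v = v ∧ v ≠ 0 := by
  have hfin : Module.Finite A (Ideal.span {f} : Ideal A) :=
    Module.Finite.of_fg ⟨{f}, by simp⟩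
  let s : (Ideal.span {f} : Ideal A) := ⟨f, self_mem_span f⟩
  have hs : s ≠ 0 := fun h => hf0 (congrArg Subtype.val h)
  have hnt : Nontrivial (Ideal.span {f} : Ideal A) := ⟨s, 0, hs⟩
  obtain h | ⟨N, hN, -⟩ := eq_top_or_exists_le_coatom
    (⊥ : Submodule A (Ideal.span {f} : Ideal A))
  · exact absurd h bot_ne_top
  refine ⟨_ ⧸ N, inferInstance, inferInstance, isSimpleModule_iff_isCoatom.2 hN, N.mkQ s, ?_, ?_⟩
  · rw [← map_smul]
    exact congrArg N.mkQ (Subtype.ext hf)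
  · intro h
    rw [Submodule.mkQ_apply, Submodule.Quotient.mk_eq_zero] at h
    refine hN.1 ((Submodule.eq_top_iff').2 fun x => ?_)
    have : x = (x : A) • s := Subtype.ext ((mem_span_idem hf).1 x.2).symm
    rw [this]
    exact N.smul_mem _ h

theorem isCompl_ker_range {M N : Type*} [AddCommGroup M] [Module A M] [AddCommGroup N] [Module A N]
    (β : M →ₗ[A] N) (σ : N →ₗ[A] M) (h : ∀ z, β (σ z) = z) :
    IsCompl (LinearMap.ker β) (LinearMap.range σ) := by
  constructor
  · rw [Submodule.disjoint_def]
    rintro _ hx ⟨z, rfl⟩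
    rw [LinearMap.mem_ker, h] at hx
    rw [hx, map_zero]
  · rw [codisjoint_iff, Submodule.eq_top_iff']
    intro m
    rw [← sub_add_cancel m (σ (β m))]
    exact Submodule.add_mem_sup (by rw [LinearMap.mem_ker, map_sub, h, sub_self]) ⟨_, rfl⟩

/-- A retract of an indecomposable module is zero or the whole module. -/
theorem IsIndecomposable.bijective_of_split {M N : Type*} [AddCommGroup M] [Module A M]
    [AddCommGroup N] [Module A N] [Nontrivial N] (hM : IsIndecomposable A M) (β : M →ₗ[A] N)
    (σ : N →ₗ[A] M) (h : ∀ z, β (σ z) = z) : Function.Bijective β := by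
  refine ⟨LinearMap.ker_eq_bot.1 ((hM.2 _ _ (isCompl_ker_range β σ h)).resolve_right fun h0 => ?_),
    fun z => ⟨σ z, h z⟩⟩
  obtain ⟨z, hz⟩ := exists_ne (0 : N)
  have : σ z ∈ LinearMap.range σ := ⟨z, rfl⟩
  rw [h0, Submodule.mem_bot] at this
  exact hz (by rw [← h z, this, map_zero])

theorem nontrivial_span {ε : A} (hε : ε ≠ 0) : Nontrivial (Ideal.span {ε} : Ideal A) :=
  ⟨⟨ε, self_mem_span ε⟩, 0, fun h => hε (congrArg Subtype.val h)⟩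

theorem IsPrimitiveIn.isIndecomposable_span {ε : A} (hε : IsPrimitiveIn Set.univ ε) :
    IsIndecomposable A (Ideal.span {ε} : Ideal A) := by
  have hi := hε.2.1
  refine ⟨nontrivial_span hε.2.2.1, fun U W hUW => ?_⟩
  let s : (Ideal.span {ε} : Ideal A) := ⟨ε, self_mem_span ε⟩
  have hs : ε • s = s := Subtype.ext hi
  have hgen : ∀ x : (Ideal.span {ε} : Ideal A), x = (x : A) • s := fun x =>
    Subtype.ext ((mem_span_idem hi).1 x.2).symm
  have key : ∀ U W : Submodule A (Ideal.span {ε} : Ideal A), IsCompl U W →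
      ∀ p q, p ∈ U → q ∈ W → p + q = s → (p : A) = 0 ∨ (q : A) = 0 := by
    intro U W hUW p q hp hq hpq
    have huniq : ∀ p' ∈ U, ∀ q' ∈ W, p' + q' = p + q → p' = p := fun p' hp' q' hq' h => by
      have h1 : p' - p = q - q' := by rw [sub_eq_sub_iff_add_eq_add, h, add_comm]
      have : p' - p ∈ U ⊓ W := ⟨U.sub_mem hp' hp, by rw [h1]; exact W.sub_mem hq hq'⟩
      rw [hUW.inf_eq_bot, Submodule.mem_bot] at this
      exact sub_eq_zero.1 this
    have e1 : ε • p = p := huniq _ (U.smul_mem _ hp) _ (W.smul_mem ε hq) (by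
      rw [← smul_add, hpq, hs])
    have hpp : (p : A) * p = p := by
      have h1 : (p : A) • p + (p : A) • q = p := by
        rw [← smul_add, hpq, ← hgen]
      have : (p : A) • q ∈ U ⊓ W := ⟨by
        rw [← eq_sub_iff_add_eq'] at h1
        rw [h1]; exact U.sub_mem hp (U.smul_mem _ hp), W.smul_mem _ hq⟩
      rw [hUW.inf_eq_bot, Submodule.mem_bot] at this
      rw [this, add_zero] at h1
      exact congrArg Subtype.val h1
    rcases hε.eq_zero_or_eq hpp (congrArg Subtype.val e1) ((mem_span_idem hi).1 p.2) with h | h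
    · exact Or.inl h
    · right
      have : p = s := Subtype.ext h
      rw [this, add_eq_left] at hpq
      rw [hpq]; rfl
  obtain ⟨p, hp, q, hq, hpq⟩ := Submodule.mem_sup.1
    (show s ∈ U ⊔ W by rw [hUW.sup_eq_top]; trivial)
  have fin : ∀ U W : Submodule A (Ideal.span {ε} : Ideal A), IsCompl U W → s ∈ W → U = ⊥ := by
    intro U W hUW hs
    have : W = ⊤ := (Submodule.eq_top_iff').2 fun x => by rw [hgen x]; exact W.smul_mem _ hs
    rw [this] at hUW
    exact eq_bot_of_isCompl_top hUW
  rcases key U W hUW p q hp hq hpq with h | h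
  · have h' : p = 0 := Subtype.ext h
    rw [h', zero_add] at hpq
    exact Or.inl (fin U W hUW (hpq ▸ hq))
  · have h' : q = 0 := Subtype.ext h
    rw [h', add_zero] at hpq
    exact Or.inr (fin W U hUW.symm (hpq ▸ hp))

variable {F : Type u} [Field F] [Algebra F A] [FiniteDimensional F A]

include F in
variable (F) in
/-- A finitely generated projective indecomposable module is isomorphic to `A ε`, for any primitive
idempotent `ε` that does not annihilate its simple quotients. -/
theorem IsIndecomposable.exists_equiv_span {ι : Type*} {ε : ι → A}
    (hε : ∀ i, IsPrimitiveIn Set.univ (ε i)) {M : Type*} [AddCommGroup M] [Module A M]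
    [Module.Finite A M] [Module.Projective A M] (hM : IsIndecomposable A M)
    (h : ∀ N : Submodule A M, IsCoatom N → ∃ i, ∃ t : M ⧸ N, ε i • t ≠ 0) :
    ∃ i, Nonempty (M ≃ₗ[A] (Ideal.span {ε i} : Ideal A)) := by
  have := hM.1
  obtain h0 | ⟨N, hN, -⟩ := eq_top_or_exists_le_coatom (⊥ : Submodule A M)
  · exact absurd h0 bot_ne_top
  obtain ⟨i, t, ht⟩ := h N hN
  have hsimp : IsSimpleModule A (M ⧸ N) := isSimpleModule_iff_isCoatom.2 hN
  obtain ⟨m, rfl⟩ := N.mkQ_surjective t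
  have hi := (hε i).2.1
  let m1 := ε i • m
  have hm1 : ε i • m1 = m1 := by simp only [m1, smul_smul, hi]
  have hv0 : N.mkQ m1 ≠ 0 := by simpa only [m1, map_smul] using ht
  have hv : ε i • N.mkQ m1 = N.mkQ m1 := by rw [← map_smul, hm1]
  obtain ⟨β, hβ⟩ := Module.projective_lifting_property
    ((LinearMap.toSpanSingleton A (M ⧸ N) (N.mkQ m1)).domRestrict (Ideal.span {ε i} : Ideal A))
    N.mkQ (fun z => by
      obtain ⟨a, ha⟩ := IsSimpleModule.toSpanSingleton_surjective A hv0 z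
      refine ⟨⟨a * ε i, Ideal.mem_span_singleton'.2 ⟨a, rfl⟩⟩, ?_⟩
      simp only [LinearMap.domRestrict_apply, LinearMap.toSpanSingleton_apply] at ha ⊢
      rw [mul_smul, hv, ha])
  have hx : (β m1 : A) • N.mkQ m1 = N.mkQ m1 := LinearMap.congr_fun hβ m1
  have hx1 : ε i * β m1 = β m1 := by
    conv_rhs => rw [← hm1, map_smul]
    rfl
  obtain ⟨y, -, hy2, hy, -⟩ := (hε i).exists_inv_of_smul F hx1 ((mem_span_idem hi).1 (β m1).2) hv0 hx
  have := nontrivial_span (hε i).2.2.1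
  exact ⟨i, ⟨LinearEquiv.ofBijective β (hM.bijective_of_split β
    ((LinearMap.toSpanSingleton A M (y • m1)).domRestrict _) fun z => by
      simp only [LinearMap.domRestrict_apply, LinearMap.toSpanSingleton_apply, map_smul]
      refine Subtype.ext ?_
      simp only [Submodule.coe_smul, smul_eq_mul, hy]
      exact (mem_span_idem hi).1 z.2)⟩⟩

/-- Every simple `A`-module (in the universe of `A`) has only scalar endomorphisms. -/
def HasScalarEnds (F : Type u) [Field F] (A : Type w) [Ring A] [Algebra F A] : Prop :=
  ∀ (S : Type w) [AddCommGroup S] [Module A S], IsSimpleModule A S →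
    ∀ f : S →ₗ[A] S, ∃ c : F, ∀ s, f s = algebraMap F A c • s

theorem HasScalarEnds.exists_smul_eq (hA : HasScalarEnds F A) {ε : A}
    (hε : IsPrimitiveIn Set.univ ε) {S : Type w} [AddCommGroup S] [Module A S]
    [IsSimpleModule A S] {v t : S} (hv : ε • v = v) (hv0 : v ≠ 0) (ht : ε • t = t) :
    ∃ c : F, t = algebraMap F A c • v := by
  by_cases ht0 : t = 0
  · exact ⟨0, by simp [ht0]⟩
  obtain ⟨φ, hφ⟩ := hε.exists_equiv F hv hv0 ht ht0
  obtain ⟨c, hc⟩ := hA S inferInstance φ.toLinearMap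
  exact ⟨c, by rw [← hc, ← hφ]; rfl⟩

omit [FiniteDimensional F A] in
theorem algebraMap_smul_injective {S : Type*} [AddCommGroup S] [Module A S] {v : S} (hv0 : v ≠ 0)
    {c d : F} (h : algebraMap F A c • v = algebraMap F A d • v) : c = d := by
  by_contra hcd
  refine hv0 ?_
  have h1 : algebraMap F A (c - d) • v = 0 := by rw [map_sub, sub_smul, h, sub_self]
  have := congrArg (algebraMap F A (c - d)⁻¹ • ·) h1
  simp only [smul_smul, ← map_mul, inv_mul_cancel₀ (sub_ne_zero.2 hcd), map_one, one_smul,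
    smul_zero] at this
  exact this

/-- For a primitive idempotent `ε` of a split algebra `A`, the linear form `τ` on `A` giving the
action of `ε a ε` on the line `ε S`, where `S` is the simple module not annihilated by `ε`. -/
theorem HasScalarEnds.exists_form (hA : HasScalarEnds F A) {ε : A}
    (hε : IsPrimitiveIn Set.univ ε) : ∃ τ : A →ₗ[F] F,
      (∀ (S : Type w) [AddCommGroup S] [Module A S] [IsSimpleModule A S] (s : S) (a : A),
        (ε * a * ε) • s = algebraMap F A (τ a) • ε • s) ∧ τ ε = 1 ∧
      (∀ a b, τ (a * ε * b) = τ a * τ b) ∧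
      ∀ ε', IsPrimitiveIn Set.univ ε' → ¬ IdemEquiv ε ε' → ∀ a b, τ (a * ε' * b) = 0 := by
  obtain ⟨S, _, _, _, v, hv, hv0⟩ := exists_simple_of_idem hε.2.1 hε.2.2.1
  have hi := hε.2.1
  choose τ hτ using fun a => hA.exists_smul_eq hε hv hv0 (t := (ε * a * ε) • v)
    (by rw [smul_smul, ← mul_assoc, ← mul_assoc, hi])
  have huniq : ∀ a c, (ε * a * ε) • v = algebraMap F A c • v → τ a = c := fun a c h =>
    algebraMap_smul_injective (A := A) hv0 ((hτ a).symm.trans h)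
  let τ' : A →ₗ[F] F :=
    { toFun := τ
      map_add' := fun a b => huniq _ _ (by
        rw [mul_add, add_mul, add_smul, hτ, hτ, map_add, add_smul])
      map_smul' := fun c a => huniq _ _ (by
        rw [RingHom.id_apply, smul_eq_mul, map_mul, mul_smul (algebraMap F A c), ← hτ, smul_smul,
          ← Algebra.smul_def, mul_smul_comm, smul_mul_assoc]) }
  refine ⟨τ', fun T _ _ _ t a => ?_, huniq _ _ (by rw [hi, hi, map_one, one_smul, hv]),
    fun a b => huniq _ _ ?_, fun ε' hε' hne a b => huniq _ _ ?_⟩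
  · by_cases ht : ε • t = 0
    · rw [mul_smul, ht, smul_zero, smul_zero]
    · obtain ⟨φ, hφ⟩ := hε.exists_equiv F hv hv0 (t := ε • t) (by rw [smul_smul, hi]) ht
      have := congrArg φ (hτ a)
      rw [map_smul, map_smul, hφ, smul_smul, mul_assoc, hi] at this
      exact this
  · have h1 : ε * (a * ε * b) * ε = (ε * a * ε) * (ε * b * ε) := by
      simp only [mul_assoc, ← mul_assoc ε ε, hi]
    have h2 : algebraMap F A (τ' a * τ' b) = algebraMap F A (τ b) * algebraMap F A (τ a) := by
      rw [mul_comm, map_mul]; rfl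
    rw [h1, mul_smul _ (ε * b * ε), hτ b, h2, mul_smul (algebraMap F A (τ b)), ← hτ a, smul_smul,
      smul_smul, Algebra.commutes]
  · have h0 : (ε' * b * ε) • v = 0 := by
      by_contra h
      rw [mul_assoc, mul_smul] at h
      exact hne (hε.idemEquiv F hε' (v := v) (by rwa [hv]) h)
    rw [map_zero, zero_smul, show ε * (a * ε' * b) * ε = ε * a * (ε' * b * ε) by noncomm_ring,
      mul_smul, h0, smul_zero]

end ProjectiveIndecomposables

/-! ### Additive functions on modules -/

theorem finrank_range_prodMap {F : Type*} [Field F] {M N M' N' : Type*} [AddCommGroup M]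
    [Module F M] [AddCommGroup N] [Module F N] [AddCommGroup M'] [Module F M'] [AddCommGroup N']
    [Module F N'] [Module.Finite F M'] [Module.Finite F N'] (f : M →ₗ[F] M') (g : N →ₗ[F] N') :
    Module.finrank F (LinearMap.range (f.prodMap g)) =
      Module.finrank F (LinearMap.range f) + Module.finrank F (LinearMap.range g) := by
  rw [LinearMap.range_prodMap, ← Module.finrank_prod]
  exact LinearEquiv.finrank_eq
    { toFun := fun x => (⟨x.1.1, x.2.1⟩, ⟨x.1.2, x.2.2⟩)
      map_add' := fun _ _ => rfl
      map_smul' := fun _ _ => rfl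
      invFun := fun x => ⟨(x.1, x.2), x.1.2, x.2.2⟩
      left_inv := fun _ => rfl
      right_inv := fun _ => rfl }

section AdditiveFunctions

variable {F : Type u} [Field F] {A : Type w} [Ring A] [Algebra F A]

/-- The dimension of `x M`. For an idempotent `x`, this is the dimension of `Hom_A(A x, M)`; if in
addition `x` is primitive and `A` is split, it is the multiplicity of the simple quotient of `A x` as
a composition factor of `M`. -/
noncomputable def rankOf (F : Type u) [Field F] {A : Type w} [Ring A] [Algebra F A] (x : A)
    (M : Type*) [AddCommGroup M] [Module F M] [Module A M] [IsScalarTower F A M] : ℕ :=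
  Module.finrank F (LinearMap.range (Algebra.lsmul F F M x))

/-- The trace of the action of `a` on `M`. -/
noncomputable def traceOf (F : Type u) [Field F] {A : Type w} [Ring A] [Algebra F A] (a : A)
    (M : Type*) [AddCommGroup M] [Module F M] [Module A M] [IsScalarTower F A M] : F :=
  LinearMap.trace F M (Algebra.lsmul F F M a)

section

variable {M M' : Type*} [AddCommGroup M] [Module F M] [Module A M] [IsScalarTower F A M]
  [AddCommGroup M'] [Module F M'] [Module A M'] [IsScalarTower F A M']

theorem rankOf_congr_of_comm {x : A} (φ : M ≃ₗ[F] M') (h : ∀ m, φ (x • m) = x • φ m) :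
    rankOf F x M = rankOf F x M' := by
  refine LinearEquiv.finrank_eq ((φ.submoduleMap _).trans (LinearEquiv.ofEq _ _ ?_))
  ext m'
  simp only [Submodule.mem_map, LinearMap.mem_range, Algebra.lsmul_coe]
  constructor
  · rintro ⟨_, ⟨m, rfl⟩, rfl⟩
    exact ⟨φ m, (h m).symm⟩
  · rintro ⟨m, rfl⟩
    exact ⟨x • φ.symm m, ⟨_, rfl⟩, by simp [h]⟩

theorem rankOf_congr {x : A} (φ : M ≃ₗ[A] M') : rankOf F x M = rankOf F x M' :=
  rankOf_congr_of_comm (φ.restrictScalars F) fun m => map_smul φ x m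

theorem traceOf_congr {a : A} (φ : M ≃ₗ[A] M') : traceOf F a M = traceOf F a M' := by
  rw [traceOf, traceOf, ← LinearMap.trace_conj' _ (φ.restrictScalars F)]
  congr 1
  ext m
  simp [LinearEquiv.conj_apply]

theorem rankOf_eq_zero {x : A} (h : ∀ m : M, x • m = 0) : rankOf F x M = 0 := by
  have : Algebra.lsmul F F M x = 0 := LinearMap.ext h
  rw [rankOf, this, LinearMap.range_zero, finrank_bot]

theorem traceOf_eq_zero {x : A} (h : ∀ m : M, x • m = 0) : traceOf F x M = 0 := by
  have : Algebra.lsmul F F M x = 0 := LinearMap.ext h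
  rw [traceOf, this, map_zero]

theorem finite_submodule [Module.Finite F M] (N : Submodule A M) : Module.Finite F N :=
  Module.Finite.of_injective (N.subtype.restrictScalars F) N.subtype_injective

theorem finite_quotient [Module.Finite F M] (N : Submodule A M) : Module.Finite F (M ⧸ N) :=
  Module.Finite.of_surjective (N.mkQ.restrictScalars F) N.mkQ_surjective

theorem rankOf_add [Module.Finite F M] {x : A} (hx : x * x = x) (N : Submodule A M) :
    rankOf F x M = rankOf F x N + rankOf F x (M ⧸ N) := by
  let q : LinearMap.range (Algebra.lsmul F F M x) →ₗ[F] (M ⧸ N) :=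
    (N.mkQ.restrictScalars F).domRestrict _
  rw [rankOf, ← LinearMap.finrank_range_add_finrank_ker q, add_comm]
  congr 1
  · let j : LinearMap.range (Algebra.lsmul F F N x) →ₗ[F] LinearMap.ker q :=
      LinearMap.codRestrict _ (LinearMap.codRestrict _
        ((N.subtype.restrictScalars F).domRestrict _) (by
          rintro ⟨_, n, rfl⟩
          exact ⟨n, rfl⟩)) (by
        rintro ⟨_, n, rfl⟩
        rw [LinearMap.mem_ker]
        exact (Submodule.Quotient.mk_eq_zero N).2 (x • n).2)
    refine (LinearEquiv.finrank_eq (LinearEquiv.ofBijective j ⟨fun a b hab => ?_, ?_⟩)).symm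
    · exact Subtype.ext (Subtype.ext (congrArg
        (fun z : LinearMap.ker q => ((z : LinearMap.range (Algebra.lsmul F F M x)) : M)) hab))
    · rintro ⟨⟨m, m', hm⟩, hm0⟩
      have hmN : m ∈ N := (Submodule.Quotient.mk_eq_zero N).1 hm0
      refine ⟨⟨⟨m, hmN⟩, ⟨m, hmN⟩, Subtype.ext ?_⟩, Subtype.ext (Subtype.ext rfl)⟩
      change x • m = m
      rw [← hm, Algebra.lsmul_coe, smul_smul, hx]
  · refine LinearEquiv.finrank_eq (LinearEquiv.ofEq _ _ ?_)
    ext z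
    simp only [LinearMap.mem_range, Algebra.lsmul_coe]
    constructor
    · rintro ⟨⟨_, m, rfl⟩, rfl⟩
      exact ⟨N.mkQ m, (map_smul N.mkQ x m).symm⟩
    · rintro ⟨m, rfl⟩
      obtain ⟨m, rfl⟩ := N.mkQ_surjective m
      exact ⟨⟨x • m, m, rfl⟩, map_smul N.mkQ x m⟩

theorem traceOf_add [Module.Finite F M] (a : A) (N : Submodule A M) :
    traceOf F a M = traceOf F a N + traceOf F a (M ⧸ N) := by
  have := finite_submodule (F := F) N
  have := finite_quotient (F := F) N
  obtain ⟨s, hs⟩ := LinearMap.exists_rightInverse_of_surjective (N.mkQ.restrictScalars F)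
    (LinearMap.range_eq_top.2 N.mkQ_surjective)
  have hs' : ∀ z, N.mkQ (s z) = z := fun z => LinearMap.congr_fun hs z
  let ι : N →ₗ[F] M := N.subtype.restrictScalars F
  let q : M →ₗ[F] M ⧸ N := N.mkQ.restrictScalars F
  let p : M →ₗ[F] N := LinearMap.codRestrict (N.restrictScalars F) (LinearMap.id - s ∘ₗ q)
    fun m => by
      refine (Submodule.Quotient.mk_eq_zero N).1 ?_
      change N.mkQ (m - s (N.mkQ m)) = 0
      rw [map_sub, hs', sub_self]
  have h : Algebra.lsmul F F M a = (Algebra.lsmul F F M a ∘ₗ ι) ∘ₗ p +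
      (Algebra.lsmul F F M a ∘ₗ s) ∘ₗ q := LinearMap.ext fun m => by
    change a • m = a • (m - s (N.mkQ m)) + a • s (N.mkQ m)
    rw [smul_sub, sub_add_cancel]
  rw [traceOf, h, map_add, LinearMap.trace_comp_comm' p, LinearMap.trace_comp_comm' q]
  congr 1
  · congr 1
    ext n
    change (a • (n : M)) - s (N.mkQ (a • (n : M))) = a • (n : M)
    rw [N.mkQ_apply, (Submodule.Quotient.mk_eq_zero N).2 (N.smul_mem a n.2), map_zero, sub_zero]
  · congr 1
    refine LinearMap.ext fun z => ?_
    change N.mkQ (a • s z) = a • z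
    rw [map_smul, hs']

/-- The dimension of the fixed space of an idempotent is its trace. -/
theorem traceOf_idem [Module.Finite F M] {x : A} (hx : x * x = x) :
    traceOf F x M = (rankOf F x M : F) := by
  refine LinearMap.IsProj.trace ⟨fun m => ⟨m, rfl⟩, ?_⟩
  rintro _ ⟨m, rfl⟩
  simp [smul_smul, hx]

end

/-- A finite family of pairwise inequivalent primitive idempotents of `e A`, for a central
idempotent `e`, such that every primitive idempotent of `e A` is equivalent to a member of the
family. -/
structure IsTopSystem (e : A) {n : ℕ} (ε : Fin n → A) : Prop where
  central : ∀ x, e * x = x * e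
  primitive : ∀ i, IsPrimitiveIn Set.univ (ε i)
  mul_left : ∀ i, e * ε i = ε i
  not_equiv : ∀ i j, IdemEquiv (ε i) (ε j) → i = j
  equiv_of : ∀ η, IsPrimitiveIn Set.univ η → e * η = η → ∃ i, IdemEquiv η (ε i)

/-- `S i` is a simple module not annihilated by `ε i`. -/
structure IsSimpleFamily {n : ℕ} (ε : Fin n → A) (S : Fin n → Type w) [∀ i, AddCommGroup (S i)]
    [∀ i, Module A (S i)] : Prop where
  simple : ∀ i, IsSimpleModule A (S i)
  exists_ne : ∀ i, ∃ s : S i, ε i • s ≠ 0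

section

variable [FiniteDimensional F A] {e : A} {n : ℕ} {ε : Fin n → A}

include F in
variable (F) in
theorem IsTopSystem.exists_smul_ne (h : IsTopSystem e ε) (he : e * e = e) {M : Type*}
    [AddCommGroup M] [Module A M] {m : M} (hm : e • m ≠ 0) : ∃ i b, (ε i * b) • m ≠ 0 := by
  obtain ⟨k, η, h1, h2, -, h4⟩ := exists_primitive_decomposition F Set.univ e trivial he
  rw [← h4, Finset.sum_smul] at hm
  obtain ⟨r, -, hr⟩ := Finset.exists_ne_zero_of_sum_ne_zero hm
  obtain ⟨i, hi⟩ := h.equiv_of (η r) (h1 r) (h2 r).1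
  obtain ⟨b, hb⟩ := hi.smul_ne_zero hr
  exact ⟨i, b, hb⟩

theorem rankOf_simple_self (hA : HasScalarEnds F A) {ε : A} (hε : IsPrimitiveIn Set.univ ε)
    {T : Type w} [AddCommGroup T] [Module F T] [Module A T] [IsScalarTower F A T]
    [IsSimpleModule A T] {t : T} (ht : ε • t ≠ 0) : rankOf F ε T = 1 := by
  have hi := hε.2.1
  refine finrank_eq_one_iff'.2 ⟨⟨ε • t, t, rfl⟩, fun h => ht (congrArg Subtype.val h), ?_⟩
  rintro ⟨_, z, rfl⟩
  obtain ⟨c, hc⟩ := hA.exists_smul_eq hε (v := ε • t) (t := ε • z)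
    (by rw [smul_smul, hi]) ht (by rw [smul_smul, hi])
  refine ⟨c, Subtype.ext ?_⟩
  rw [algebraMap_smul] at hc
  exact hc.symm

theorem rankOf_simple_of_not_equiv {ε η : A} (hη : IsPrimitiveIn Set.univ η)
    (hε : IsPrimitiveIn Set.univ ε) (hne : ¬ IdemEquiv η ε) {T : Type*} [AddCommGroup T]
    [Module F T] [Module A T] [IsScalarTower F A T] [IsSimpleModule A T] {t : T}
    (ht : ε • t ≠ 0) : rankOf F η T = 0 := by
  refine rankOf_eq_zero fun m => ?_
  by_contra hm
  exact hne (hη.idemEquiv F hε hm ht)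

/-- An additive function on finite-dimensional modules is determined by its values on simple
modules, the composition multiplicities being the dimensions of the spaces `ε i M`. -/
theorem IsTopSystem.additive_formula (hA : HasScalarEnds F A) (h : IsTopSystem e ε)
    (he : e * e = e) {S : Fin n → Type w} [∀ i, AddCommGroup (S i)] [∀ i, Module F (S i)]
    [∀ i, Module A (S i)] [∀ i, IsScalarTower F A (S i)] (hS : IsSimpleFamily ε S)
    {R : Type*} [AddCommGroup R]
    (f : ∀ (M : Type w) [AddCommGroup M] [Module F M] [Module A M] [IsScalarTower F A M], R)
    (f_congr : ∀ (M M' : Type w) [AddCommGroup M] [Module F M] [Module A M] [IsScalarTower F A M]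
      [AddCommGroup M'] [Module F M'] [Module A M'] [IsScalarTower F A M'],
        (M ≃ₗ[A] M') → f M = f M')
    (f_zero : ∀ (M : Type w) [AddCommGroup M] [Module F M] [Module A M] [IsScalarTower F A M],
      (∀ m : M, e • m = 0) → f M = 0)
    (f_add : ∀ (M : Type w) [AddCommGroup M] [Module F M] [Module A M] [IsScalarTower F A M]
      [Module.Finite F M] (N : Submodule A M), f M = f N + f (M ⧸ N))
    (M : Type w) [AddCommGroup M] [Module F M] [Module A M] [IsScalarTower F A M]
    [Module.Finite F M] : f M = ∑ i, rankOf F (ε i) M • f (S i) := by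
  have hzero : ∀ (M : Type w) [AddCommGroup M] [Module F M] [Module A M] [IsScalarTower F A M],
      (∀ m : M, e • m = 0) → f M = ∑ i, rankOf F (ε i) M • f (S i) := by
    intro M _ _ _ _ hM
    rw [f_zero M hM, Finset.sum_eq_zero]
    intro i _
    rw [rankOf_eq_zero, zero_smul]
    intro m
    rw [← h.mul_left, h.central, mul_smul, hM, smul_zero]
  suffices key : ∀ (M : Type w) [AddCommGroup M] [Module A M], IsFiniteLength A M →
      ∀ [Module F M] [IsScalarTower F A M] [Module.Finite F M],
        f M = ∑ i, rankOf F (ε i) M • f (S i) from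
    key M (isFiniteLength_iff_isNoetherian_isArtinian.2
      ⟨isNoetherian_of_tower F inferInstance, isArtinian_of_tower F inferInstance⟩)
  intro M _ _ hfl
  induction hfl with
  | of_subsingleton => intro _ _ _; exact hzero _ fun m => Subsingleton.elim _ _
  | @of_simple_quotient M _ _ N hsimp hN ih =>
    intro _ _ _
    have := finite_submodule (F := F) N
    have := finite_quotient (F := F) N
    rw [f_add M N, ih]
    simp only [rankOf_add (h.primitive _).2.1 N, add_smul, Finset.sum_add_distrib]
    congr 1
    by_cases hq : ∀ t : M ⧸ N, e • t = 0
    · exact hzero _ hq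
    push Not at hq
    obtain ⟨t, ht⟩ := hq
    obtain ⟨i, b, hb⟩ := h.exists_smul_ne F he ht
    rw [mul_smul] at hb
    obtain ⟨s, hs⟩ := hS.exists_ne i
    have := hS.simple i
    have hi := (h.primitive i).2.1
    obtain ⟨φ, -⟩ := (h.primitive i).exists_equiv F (v := ε i • b • t) (t := ε i • s)
      (by rw [smul_smul, hi]) hb (by rw [smul_smul, hi]) hs
    rw [f_congr _ _ φ, Finset.sum_eq_single i]
    · rw [rankOf_simple_self hA (h.primitive i) hb, one_smul]
    · intro j _ hj
      rw [rankOf_simple_of_not_equiv (h.primitive j) (h.primitive i)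
        (fun h' => hj (h.not_equiv _ _ h')) hb, zero_smul]
    · simp

/-- Existence of a family of simple modules. -/
theorem IsTopSystem.exists_simpleFamily (h : IsTopSystem e ε) :
    ∃ (S : Fin n → Type w) (_ : ∀ i, AddCommGroup (S i)) (_ : ∀ i, Module A (S i)),
      IsSimpleFamily ε S := by
  choose S h1 h2 h3 v hv hv0 using
    fun i => exists_simple_of_idem (h.primitive i).2.1 (h.primitive i).2.2.1
  exact ⟨S, h1, h2, ⟨h3, fun i => ⟨v i, by rw [hv]; exact hv0 i⟩⟩⟩

include F in
variable (F) in
/-- A central idempotent of a finite-dimensional algebra has a system of representatives of the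
equivalence classes of primitive idempotents below it, which can be chosen orthogonal. -/
theorem exists_topSystem (e : A) (hc : ∀ x, e * x = x * e) (he : e * e = e) :
    ∃ (n : ℕ) (ε : Fin n → A), IsTopSystem e ε ∧ ∀ i j, i ≠ j → ε i * ε j = 0 := by
  classical
  obtain ⟨k, η, h1, h2, h3, h4⟩ := exists_primitive_decomposition F Set.univ e trivial he
  let r : Setoid (Fin k) :=
    { r := fun i j => IdemEquiv (η i) (η j)
      iseqv := ⟨fun i => IdemEquiv.refl (h1 i).2.1, IdemEquiv.symm, IdemEquiv.trans⟩ }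
  obtain ⟨n, ⟨φ⟩⟩ := Finite.exists_equiv_fin (Quotient r)
  refine ⟨n, fun i => η (φ.symm i).out, ⟨hc, fun i => h1 _, fun i => (h2 _).1, fun i j hij => ?_,
    fun ζ hζ heζ => ?_⟩, fun i j hij => h3 _ _ fun h => hij ?_⟩
  · have : (φ.symm i) = φ.symm j := by
      rw [← Quotient.out_eq (φ.symm i), ← Quotient.out_eq (φ.symm j)]
      exact Quotient.sound hij
    exact φ.symm.injective this
  · obtain ⟨S, _, _, _, v, hv, hv0⟩ := exists_simple_of_idem hζ.2.1 hζ.2.2.1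
    have hev : e • v ≠ 0 := by rwa [← hv, smul_smul, heζ, hv]
    rw [← h4, Finset.sum_smul] at hev
    obtain ⟨j, -, hj⟩ := Finset.exists_ne_zero_of_sum_ne_zero hev
    refine ⟨φ (Quotient.mk r j), (hζ.idemEquiv F (h1 j) (by rwa [hv]) hj).trans ?_⟩
    rw [φ.symm_apply_apply]
    exact Quotient.exact (Quotient.out_eq (Quotient.mk r j)).symm
  · have := congrArg (Quotient.mk r) h
    rw [Quotient.out_eq, Quotient.out_eq] at this
    exact φ.symm.injective this

end

end AdditiveFunctions

/-! ### Systems of projective indecomposable modules of a group algebra -/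

section PIMSystems

variable {F : Type u} [Field F] {G : Type v} [Group G]

theorem IsSplittingFor.hasScalarEnds (hF : IsSplittingFor F G) : HasScalarEnds F F[G] := by
  intro S _ _ hS f
  let ψ : F[(⊤ : Subgroup G)] ≃ₐ[F] F[G] := MonoidAlgebra.domCongr F F Subgroup.topEquiv
  let _ : Module F[(⊤ : Subgroup G)] S := Module.compHom S (ψ : F[(⊤ : Subgroup G)] →+* F[G])
  have hsmul : ∀ (a : F[(⊤ : Subgroup G)]) (s : S), a • s = ψ a • s := fun _ _ => rfl
  have : RingHomSurjective (ψ : F[(⊤ : Subgroup G)] →+* F[G]) := ⟨ψ.surjective⟩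
  let g : S →ₛₗ[(ψ : F[(⊤ : Subgroup G)] →+* F[G])] S :=
    { toFun := id, map_add' := fun _ _ => rfl, map_smul' := fun _ _ => rfl }
  have hS' : IsSimpleModule F[(⊤ : Subgroup G)] S :=
    (LinearMap.isSimpleModule_iff_of_bijective g Function.bijective_id).2 hS
  obtain ⟨c, hc⟩ := hF ⊤ S hS'
    { toFun := f, map_add' := map_add f, map_smul' := fun a s => map_smul f (ψ a) s }
  refine ⟨c, fun s => ?_⟩
  have := hc s
  rw [hsmul, ψ.commutes] at this
  exact this

variable [Finite G] {e : CentralIdempotent F G}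

omit [Finite G] in
theorem PIMSystem.isPrimitive {n : ℕ} (s : PIMSystem e n) (i : Fin n) :
    IsPrimitiveIn Set.univ (s.ε i) :=
  isPrimitiveIn_univ_of (s.primitive i).1 (s.primitive i)

omit [Finite G] in
theorem PIMSystem.isTopSystem {n : ℕ} (s : PIMSystem e n) : IsTopSystem e.val s.ε where
  central := e.central
  primitive := s.isPrimitive
  mul_left i := (s.primitive i).1
  not_equiv i j h :=
    s.not_iso i j ((idemEquiv_iff (s.isPrimitive i).2.1 (s.isPrimitive j).2.1).1 h)
  equiv_of η hη he := by
    obtain ⟨i, hi⟩ := s.complete (Ideal.span {η} : Ideal F[G]) (Module.Finite.of_fg ⟨{η}, by simp⟩)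
      (projective_span_idem hη.2.1) hη.isIndecomposable_span fun m => Subtype.ext (by
        rw [Submodule.coe_smul, smul_eq_mul, ← (mem_span_idem hη.2.1).1 m.2, ← mul_assoc, e.central,
          mul_assoc, he])
    exact ⟨i, (idemEquiv_iff hη.2.1 (s.isPrimitive i).2.1).2 hi⟩

theorem IsTopSystem.complete {n : ℕ} {ε : Fin n → F[G]} (h : IsTopSystem e.val ε) (M : Type*)
    [AddCommGroup M] [Module F[G] M] [Module.Finite F[G] M] [Module.Projective F[G] M]
    (hM : IsIndecomposable F[G] M) (he : ∀ m : M, e.val • m = m) :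
    ∃ i, Nonempty (M ≃ₗ[F[G]] Ideal.span {ε i}) := by
  refine hM.exists_equiv_span F h.primitive fun N hN => ?_
  have := isSimpleModule_iff_isCoatom.2 hN
  obtain ⟨t, ht⟩ := @exists_ne _ (IsSimpleModule.nontrivial F[G] (M ⧸ N)) 0
  obtain ⟨m, rfl⟩ := N.mkQ_surjective t
  obtain ⟨i, b, hb⟩ := h.exists_smul_ne F e.idem (m := N.mkQ m) (by rwa [← map_smul, he])
  exact ⟨i, b • N.mkQ m, by rwa [← mul_smul]⟩

theorem IsTopSystem.card_eq {n : ℕ} {ε : Fin n → F[G]} (h : IsTopSystem e.val ε) :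
    numSimple e = n := by
  choose S h1 h2 h3 v hv hv0 using
    fun i => exists_simple_of_idem (h.primitive i).2.1 (h.primitive i).2.2.1
  let T : Fin n → SimpleMod e := fun i =>
    ⟨S i, h3 i, by
      have := h3 i
      intro s
      obtain ⟨a, rfl⟩ := IsSimpleModule.toSpanSingleton_surjective F[G] (hv0 i) s
      rw [LinearMap.toSpanSingleton_apply, ← hv i, smul_smul, smul_smul, e.central,
        mul_assoc, h.mul_left, mul_smul]⟩
  have hbij : Function.Bijective fun i => Quotient.mk (SimpleMod.setoid e) (T i) := by
    constructor
    · intro i j hij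
      obtain ⟨φ⟩ := Quotient.exact hij
      have hs := h3 i
      refine h.not_equiv i j ((h.primitive i).idemEquiv F (h.primitive j) (S := S i) (v := v i)
        (v' := φ.symm (v j)) (by rw [hv]; exact hv0 i) ?_)
      rw [← map_smul]
      intro h0
      exact hv0 j (by rw [← hv j]; exact φ.symm.map_eq_zero_iff.1 h0)
    · rintro ⟨M⟩
      have hM := M.simple
      obtain ⟨t, ht⟩ := @exists_ne _ (IsSimpleModule.nontrivial F[G] M.carrier) 0
      obtain ⟨i, b, hb⟩ := h.exists_smul_ne F e.idem (m := t) (by rwa [M.e_smul])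
      have := h3 i
      obtain ⟨φ, -⟩ := (h.primitive i).exists_equiv F (hv i) (hv0 i) (t := (ε i * b) • t)
        (by rw [smul_smul, ← mul_assoc, (h.primitive i).2.1]) hb
      exact ⟨i, Quotient.sound ⟨φ⟩⟩
  rw [numSimple, ← Nat.card_congr (Equiv.ofBijective _ hbij), Nat.card_fin]

theorem nonempty_pimSystem (e : CentralIdempotent F G) : Nonempty (PIMSystem e (numSimple e)) := by
  obtain ⟨n, ε, h, ho⟩ := exists_topSystem F e.val e.central e.idem
  rw [h.card_eq]
  exact ⟨⟨ε, fun i => isPrimitiveIn_of_univ (h.mul_left i) (h.primitive i), ho,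
    fun i j hij => h.not_equiv i j ((idemEquiv_iff (h.primitive i).2.1 (h.primitive j).2.1).2 hij),
    fun M _ _ _ _ hM he => h.complete M hM he⟩⟩

end PIMSystems

/-! ### Primitive idempotents of `F[G × G]` -/

section Forms

variable {F : Type u} [Field F] {A : Type w} [Ring A] [Algebra F A]

theorem isPrimitiveIn_of_form {E : A} (hE : E * E = E) (τ : A →ₗ[F] F) (hτ : τ E = 1)
    (h : ∀ (S : Type w) [AddCommGroup S] [Module A S] [IsSimpleModule A S] (s : S) (a : A),
      (E * a * E) • s = algebraMap F A (τ a) • E • s) : IsPrimitiveIn Set.univ E := by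
  refine ⟨trivial, hE, fun h0 => by simp [h0] at hτ, ?_⟩
  have key : ∀ a : A, a * a = a → E * a = a → a * E = a → a ≠ 0 → τ a = 1 := by
    intro a haa hEa haE ha
    obtain ⟨S, _, _, _, v, hv, hv0⟩ := exists_simple_of_idem haa ha
    have h1 := h S v a
    rw [hEa, haE, hv] at h1
    have h2 : v = algebraMap F A (τ a) • v := by
      conv_lhs => rw [← hv, h1]
      rw [smul_smul, smul_smul, ← Algebra.commutes, mul_assoc, haE, mul_smul, hv]
    have h3 : algebraMap F A (τ a - 1) • v = 0 := by
      rw [map_sub, map_one, sub_smul, one_smul, ← h2, sub_self]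
    by_contra hne
    apply hv0
    rw [← one_smul A v, ← map_one (algebraMap F A), ← inv_mul_cancel₀ (sub_ne_zero.2 hne), map_mul,
      mul_smul, h3, smul_zero]
  intro a _ b _ ha hb hab hba hsum
  by_contra! hne
  have h1 := key a ha (by rw [← hsum, add_mul, ha, hba, add_zero])
    (by rw [← hsum, mul_add, ha, hab, add_zero]) hne.1
  have h2 := key b hb (by rw [← hsum, add_mul, hb, hab, zero_add])
    (by rw [← hsum, mul_add, hb, hba, zero_add]) hne.2
  rw [← hsum, map_add, h1, h2] at hτ
  exact one_ne_zero (α := F) (by linear_combination hτ)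

/-- If an element `x` of `A` and its multiples annihilate the simple `A`-modules, then the image of
`x` annihilates the simple modules of an algebra `B` generated by the image of `A` and its
centralizer: the vectors annihilated by the ideal of `x` form a non-zero `B`-submodule. -/
theorem smul_eq_zero_of_simple [FiniteDimensional F A] {B : Type w} [Ring B] [Algebra F B]
    [FiniteDimensional F B] (φ : A →ₐ[F] B)
    (hB : AddSubmonoid.closure {y | ∃ a c, (∀ a', φ a' * c = c * φ a') ∧ y = φ a * c} = ⊤)
    {x : A} (hx : ∀ (S : Type w) [AddCommGroup S] [Module A S] [IsSimpleModule A S] (s : S)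
      (a b : A), (a * x * b) • s = 0) (T : Type w) [AddCommGroup T] [Module B T]
    [IsSimpleModule B T] (t : T) : φ x • t = 0 := by
  let K : Submodule B T :=
    { carrier := {t | ∀ a b, φ (a * x * b) • t = 0}
      zero_mem' := fun _ _ => smul_zero _
      add_mem' := fun hs ht a b => by rw [smul_add, hs, ht, add_zero]
      smul_mem' := fun y t ht => by
        have hy : y ∈ AddSubmonoid.closure
            {y | ∃ a c, (∀ a', φ a' * c = c * φ a') ∧ y = φ a * c} := hB ▸ AddSubmonoid.mem_top y
        induction hy using AddSubmonoid.closure_induction with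
        | zero => intro a b; simp
        | add y z _ _ h1 h2 => intro a b; rw [add_smul, smul_add, h1, h2, add_zero]
        | mem y hy =>
          obtain ⟨d, c, hc, rfl⟩ := hy
          intro a b
          rw [smul_smul, ← mul_assoc, ← map_mul, mul_assoc _ b d, hc, mul_smul, ht, smul_zero] }
  have hK : K = ⊤ := by
    refine (eq_bot_or_eq_top K).resolve_left fun hbot => ?_
    let _ : Module A T := Module.compHom T (φ : A →+* B)
    have hsm : ∀ (a : A) (t : T), a • t = φ a • t := fun _ _ => rfl
    let _ : Module F T := Module.compHom T (algebraMap F A)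
    have : IsScalarTower F A T := ⟨fun c a t => by
      rw [Algebra.smul_def, mul_smul]; rfl⟩
    have : Nontrivial T := IsSimpleModule.nontrivial B T
    have : Module.Finite B T := inferInstance
    let _ : IsScalarTower F B T := ⟨fun c b t => by
      rw [Algebra.smul_def, mul_smul, ← φ.commutes]
      rfl⟩
    have : Module.Finite F T := Module.Finite.trans B T
    have : IsArtinian A T := isArtinian_of_tower F inferInstance
    obtain ⟨S, hS⟩ := IsAtomic.exists_atom (Submodule A T)
    have hS' := isSimpleModule_iff_isAtom.2 hS
    obtain ⟨s, hs, hs0⟩ := (Submodule.ne_bot_iff S).1 hS.1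
    have hsK : s ∈ K := fun a b => congrArg Subtype.val (hx S ⟨s, hs⟩ a b)
    rw [hbot] at hsK
    exact hs0 hsK
  have ht : t ∈ K := hK ▸ Submodule.mem_top
  have := ht 1 1
  rwa [one_mul, mul_one] at this

end Forms

section Involution

variable {F : Type u} [Field F] {G : Type v} [Group G]

theorem invol_single (g : G) (c : F) :
    invol (MonoidAlgebra.single g c) = MonoidAlgebra.single g⁻¹ c :=
  MonoidAlgebra.mapDomain_single ..

theorem invol_zero : invol (0 : F[G]) = 0 := MonoidAlgebra.mapDomain_zero _

theorem invol_add (x y : F[G]) : invol (x + y) = invol x + invol y :=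
  MonoidAlgebra.mapDomain_add ..

theorem invol_mul (x y : F[G]) : invol (x * y) = invol y * invol x := by
  induction x using MonoidAlgebra.induction_linear with
  | zero => simp [invol_zero]
  | add x z hx hz => rw [add_mul, invol_add, hx, hz, invol_add, mul_add]
  | single g c =>
    induction y using MonoidAlgebra.induction_linear with
    | zero => simp [invol_zero]
    | add x z hx hz => rw [mul_add, invol_add, hx, hz, invol_add, add_mul]
    | single h d =>
      rw [MonoidAlgebra.single_mul_single, invol_single, invol_single, invol_single,
        MonoidAlgebra.single_mul_single, mul_inv_rev, mul_comm]

theorem invol_invol (x : F[G]) : invol (invol x) = x := by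
  induction x using MonoidAlgebra.induction_linear with
  | zero => simp [invol_zero]
  | add x z hx hz => rw [invol_add, invol_add, hx, hz]
  | single g c => rw [invol_single, invol_single, inv_inv]

theorem invol_injective : Function.Injective (invol (F := F) (G := G)) :=
  Function.LeftInverse.injective invol_invol

theorem IdemEquiv.invol {ε ε' : F[G]} (h : IdemEquiv ε ε') :
    IdemEquiv (invol ε) (invol ε') := by
  obtain ⟨a, b, h1, h2, h3, h4, h5, h6⟩ := h
  exact ⟨PPermutation.invol b, PPermutation.invol a, by rw [← invol_mul, h4],
    by rw [← invol_mul, h3], by rw [← invol_mul, h2], by rw [← invol_mul, h1],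
    by rw [← invol_mul, h5], by rw [← invol_mul, h6]⟩

theorem IsPrimitiveIn.invol {ε : F[G]} (h : IsPrimitiveIn Set.univ ε) :
    IsPrimitiveIn Set.univ (invol ε) := by
  refine ⟨trivial, by rw [← invol_mul, h.2.1], fun h0 => h.2.2.1 ?_, ?_⟩
  · rw [← invol_invol ε, h0, invol_zero]
  · intro a _ b _ ha hb hab hba hsum
    refine (h.2.2.2 (PPermutation.invol a) trivial (PPermutation.invol b) trivial
      (by rw [← invol_mul, ha]) (by rw [← invol_mul, hb]) (by rw [← invol_mul, hba, invol_zero])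
      (by rw [← invol_mul, hab, invol_zero]) (by rw [← invol_add, hsum, invol_invol])).imp
      (fun h => ?_) (fun h => ?_)
    · rw [← invol_invol a, h, invol_zero]
    · rw [← invol_invol b, h, invol_zero]

theorem IsTopSystem.invol {e : F[G]} {n : ℕ} {ε : Fin n → F[G]} (h : IsTopSystem e ε) :
    IsTopSystem (invol e) fun i => PPermutation.invol (ε i) where
  central x := by rw [← invol_invol x, ← invol_mul, ← invol_mul, h.central]
  primitive i := (h.primitive i).invol
  mul_left i := by rw [← invol_mul, ← h.central, h.mul_left]
  not_equiv i j hij := h.not_equiv i j (by simpa only [invol_invol] using hij.invol)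
  equiv_of η hη he := by
    obtain ⟨i, hi⟩ := h.equiv_of (PPermutation.invol η) hη.invol (by
      rw [h.central, ← invol_invol (PPermutation.invol η * e), invol_mul, invol_invol, he])
    exact ⟨i, by simpa only [invol_invol] using hi.invol⟩

/-- The embedding of `F[G]` into `F[G × G]` as the group algebra of `G × 1`. -/
noncomputable def leftEmb (F : Type u) [Field F] (G : Type v) [Group G] : F[G] →ₐ[F] F[G × G] :=
  MonoidAlgebra.mapDomainAlgHom F F (MonoidHom.inl G G)

/-- The embedding of `F[G]` into `F[G × G]` as the group algebra of `1 × G`. -/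
noncomputable def rightEmb (F : Type u) [Field F] (G : Type v) [Group G] : F[G] →ₐ[F] F[G × G] :=
  MonoidAlgebra.mapDomainAlgHom F F (MonoidHom.inr G G)

theorem leftEmb_single (g : G) (c : F) :
    leftEmb F G (MonoidAlgebra.single g c) = MonoidAlgebra.single (g, 1) c :=
  MonoidAlgebra.mapDomain_single ..

theorem rightEmb_single (g : G) (c : F) :
    rightEmb F G (MonoidAlgebra.single g c) = MonoidAlgebra.single (1, g) c :=
  MonoidAlgebra.mapDomain_single ..

theorem emb_comm (x y : F[G]) : leftEmb F G x * rightEmb F G y = rightEmb F G y * leftEmb F G x := by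
  induction x using MonoidAlgebra.induction_linear with
  | zero => simp
  | add x z hx hz => rw [map_add, add_mul, mul_add, hx, hz]
  | single g c =>
    induction y using MonoidAlgebra.induction_linear with
    | zero => simp
    | add x z hx hz => rw [map_add, add_mul, mul_add, hx, hz]
    | single h d =>
      rw [leftEmb_single, rightEmb_single, MonoidAlgebra.single_mul_single,
        MonoidAlgebra.single_mul_single, mul_comm c]
      simp

theorem single_eq_emb (g : G × G) (c : F) : MonoidAlgebra.single g c =
    c • (leftEmb F G (MonoidAlgebra.single g.1 1) * rightEmb F G (MonoidAlgebra.single g.2 1)) := by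
  rw [leftEmb_single, rightEmb_single, MonoidAlgebra.single_mul_single, MonoidAlgebra.smul_single]
  simp

theorem leftEmb_closure : AddSubmonoid.closure {y : F[G × G] | ∃ a c,
    (∀ a', leftEmb F G a' * c = c * leftEmb F G a') ∧ y = leftEmb F G a * c} = ⊤ := by
  refine eq_top_iff.2 fun y _ => ?_
  induction y using MonoidAlgebra.induction_linear with
  | zero => exact zero_mem _
  | add x z hx hz => exact add_mem (hx trivial) (hz trivial)
  | single g c =>
    refine AddSubmonoid.subset_closure ⟨MonoidAlgebra.single g.1 1,
      rightEmb F G (c • MonoidAlgebra.single g.2 1), fun a' => emb_comm _ _, ?_⟩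
    rw [single_eq_emb, map_smul, mul_smul_comm]

theorem rightEmb_closure : AddSubmonoid.closure {y : F[G × G] | ∃ a c,
    (∀ a', rightEmb F G a' * c = c * rightEmb F G a') ∧ y = rightEmb F G a * c} = ⊤ := by
  refine eq_top_iff.2 fun y _ => ?_
  induction y using MonoidAlgebra.induction_linear with
  | zero => exact zero_mem _
  | add x z hx hz => exact add_mem (hx trivial) (hz trivial)
  | single g c =>
    refine AddSubmonoid.subset_closure ⟨MonoidAlgebra.single g.2 1,
      leftEmb F G (c • MonoidAlgebra.single g.1 1), fun a' => (emb_comm _ _).symm, ?_⟩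
    rw [single_eq_emb, map_smul, mul_smul_comm, emb_comm]

variable [Finite G]

/-- For primitive idempotents `ε` and `η` of `F[G]`, every element of the corner of `F[G × G]` at
the idempotent `ε ⊗ η` acts on the simple modules by a scalar multiple of `ε ⊗ η`, because this
holds for the corners at `ε` and `η`. -/
theorem IsPrimitiveIn.emb (hF : HasScalarEnds F F[G]) {ε η : F[G]}
    (hε : IsPrimitiveIn Set.univ ε) (hη : IsPrimitiveIn Set.univ η) :
    IsPrimitiveIn Set.univ (leftEmb F G ε * rightEmb F G η) := by
  obtain ⟨τ, hτ, hτ1, hτm, -⟩ := hF.exists_form hε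
  obtain ⟨σ, hσ, hσ1, hσm, -⟩ := hF.exists_form hη
  have hl : ∀ (a : F[G]) (T : Type (max u v)) [AddCommGroup T] [Module F[G × G] T]
      [IsSimpleModule F[G × G] T] (t : T), leftEmb F G (ε * a * ε - τ a • ε) • t = 0 := by
    intro a T _ _ _ t
    refine smul_eq_zero_of_simple (leftEmb F G) leftEmb_closure (fun S _ _ _ s b c => ?_) T t
    rw [mul_smul, mul_smul, sub_smul, hτ, ← mul_smul, ← Algebra.smul_def, sub_self, smul_zero]
  have hr : ∀ (a : F[G]) (T : Type (max u v)) [AddCommGroup T] [Module F[G × G] T]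
      [IsSimpleModule F[G × G] T] (t : T), rightEmb F G (η * a * η - σ a • η) • t = 0 := by
    intro a T _ _ _ t
    refine smul_eq_zero_of_simple (rightEmb F G) rightEmb_closure (fun S _ _ _ s b c => ?_) T t
    rw [mul_smul, mul_smul, sub_smul, hσ, ← mul_smul, ← Algebra.smul_def, sub_self, smul_zero]
  let ξ : F[G × G] →ₗ[F] F := linExt fun g =>
    τ (MonoidAlgebra.single g.1 1) * σ (MonoidAlgebra.single g.2 1)
  have hξ : ∀ a b, ξ (leftEmb F G a * rightEmb F G b) = τ a * σ b := by
    intro a b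
    induction a using MonoidAlgebra.induction_linear with
    | zero => simp
    | add x z hx hz => rw [map_add, add_mul, map_add, hx, hz, map_add, add_mul]
    | single g c =>
      induction b using MonoidAlgebra.induction_linear with
      | zero => simp
      | add x z hx hz => rw [map_add, mul_add, map_add, hx, hz, map_add, mul_add]
      | single h d =>
        rw [leftEmb_single, rightEmb_single, MonoidAlgebra.single_mul_single, linExt_single,
          Prod.mk_mul_mk, mul_one, one_mul, ← mul_one c, ← mul_one d, ← smul_eq_mul c,
          ← smul_eq_mul d, ← MonoidAlgebra.smul_single, ← MonoidAlgebra.smul_single, map_smul,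
          map_smul]
        simp only [smul_eq_mul, mul_one]
        ring
  refine isPrimitiveIn_of_form ?_ ξ (by rw [hξ, hτ1, hσ1, mul_one]) ?_
  · rw [mul_assoc, ← mul_assoc (rightEmb F G η), ← emb_comm, mul_assoc, ← map_mul, hη.2.1,
      ← mul_assoc, ← map_mul, hε.2.1]
  · intro S _ _ _ s a
    induction a using MonoidAlgebra.induction_linear with
    | zero => simp
    | add x z hx hz =>
      rw [mul_add, add_mul, add_smul, hx, hz, ← add_smul, map_add, map_add]
    | single g c =>
      have h1 : leftEmb F G ε * rightEmb F G η * MonoidAlgebra.single g c *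
          (leftEmb F G ε * rightEmb F G η) =
          leftEmb F G (ε * (c • MonoidAlgebra.single g.1 1) * ε) *
            rightEmb F G (η * MonoidAlgebra.single g.2 1 * η) := by
        rw [single_eq_emb]
        simp only [map_mul, map_smul, mul_smul_comm, smul_mul_assoc, mul_assoc]
        congr 2
        rw [← mul_assoc (rightEmb F G η), ← emb_comm, mul_assoc]
        congr 1
        rw [← mul_assoc _ (leftEmb F G ε), ← emb_comm, mul_assoc, ← mul_assoc, ← emb_comm,
          mul_assoc]
      have h2 : ξ (MonoidAlgebra.single g c) = τ (c • MonoidAlgebra.single g.1 1) *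
          σ (MonoidAlgebra.single g.2 1) := by
        rw [single_eq_emb, map_smul, hξ, map_smul, smul_mul_assoc]
      have h3 := hr (MonoidAlgebra.single g.2 1) S s
      have h4 := hl (c • MonoidAlgebra.single g.1 1) S (rightEmb F G η • s)
      rw [map_sub, sub_smul, sub_eq_zero] at h3 h4
      rw [h1, h2, mul_smul, h3]
      generalize τ (c • MonoidAlgebra.single g.1 1) = x at *
      generalize σ (MonoidAlgebra.single g.2 1) = y at *
      rw [map_smul, Algebra.smul_def y, mul_smul, smul_smul (leftEmb F G _), ← Algebra.commutes,
        mul_smul, h4, map_smul, Algebra.smul_def x, mul_smul, smul_smul (algebraMap F _ y),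
        ← map_mul, mul_comm y, smul_smul (leftEmb F G ε)]

end Involution

/-! ### Projective bimodules -/

section Representations

variable {F : Type u} [Field F] {Γ : Type v} [Group Γ]

theorem single_smul_asModule {V : Type*} [AddCommGroup V] [Module F V]
    (ρ : Representation F Γ V) (g : Γ) (v : ρ.asModule) :
    MonoidAlgebra.single g (1 : F) • v = ρ.asModuleEquiv.symm (ρ g (ρ.asModuleEquiv v)) := by
  rw [Representation.single_smul, one_smul]; rfl

/-- The `F[Γ]`-linear map on the module of a representation given by an equivariant map. -/
noncomputable def asModuleLift {V M : Type*} [AddCommGroup V] [Module F V]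
    (ρ : Representation F Γ V) [AddCommGroup M] [Module F M] [Module F[Γ] M]
    [IsScalarTower F F[Γ] M] (f : V →ₗ[F] M)
    (hf : ∀ g v, f (ρ g v) = MonoidAlgebra.single g (1 : F) • f v) : ρ.asModule →ₗ[F[Γ]] M where
  toFun v := f (ρ.asModuleEquiv v)
  map_add' v w := by rw [map_add, map_add]
  map_smul' x v := by
    rw [Representation.asModuleEquiv_map_smul, RingHom.id_apply]
    induction x using MonoidAlgebra.induction_linear with
    | zero => simp
    | add x y hx hy => rw [map_add, LinearMap.add_apply, map_add, hx, hy, add_smul]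
    | single g c =>
      rw [Representation.asAlgebraHom_single, LinearMap.smul_apply, map_smul, hf, ← smul_assoc,
        MonoidAlgebra.smul_single, smul_eq_mul, mul_one]

theorem nonempty_equiv_of_asModule {V W : Type*} [AddCommGroup V] [Module F V] [AddCommGroup W]
    [Module F W] {ρ : Representation F Γ V} {σ : Representation F Γ W}
    (φ : ρ.asModule ≃ₗ[F[Γ]] σ.asModule) : Nonempty (ρ.Equiv σ) := by
  refine ⟨Representation.Equiv.mk (φ.restrictScalars F) fun g => LinearMap.ext fun v => ?_⟩
  have := φ.map_smul (MonoidAlgebra.single g (1 : F)) (ρ.asModuleEquiv.symm v)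
  rw [single_smul_asModule, single_smul_asModule] at this
  exact this

theorem nonempty_asModule_equiv {V W : Type*} [AddCommGroup V] [Module F V] [AddCommGroup W]
    [Module F W] {ρ : Representation F Γ V} {σ : Representation F Γ W}
    (h : Nonempty (ρ.Equiv σ)) : Nonempty (ρ.asModule ≃ₗ[F[Γ]] σ.asModule) := by
  obtain ⟨φ⟩ := h
  exact ⟨LinearEquiv.ofLinearMap
    (Representation.IntertwiningMap.equivLinearMapAsModule ρ σ φ.toIntertwiningMap)
    (Representation.IntertwiningMap.equivLinearMapAsModule σ ρ φ.symm.toIntertwiningMap)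
    (LinearMap.ext fun v => φ.toLinearEquiv.apply_symm_apply v)
    (LinearMap.ext fun v => φ.toLinearEquiv.symm_apply_apply v)⟩

theorem projective_congr {V W : Type*} [AddCommGroup V] [Module F V] [AddCommGroup W]
    [Module F W] {ρ : Representation F Γ V} {σ : Representation F Γ W}
    (h : Nonempty (ρ.Equiv σ)) (hρ : Module.Projective F[Γ] ρ.asModule) :
    Module.Projective F[Γ] σ.asModule := by
  obtain ⟨φ⟩ := nonempty_asModule_equiv h
  exact Module.Projective.of_equiv φ

/-- The subspace underlying a submodule of the module of a representation. -/
noncomputable def subSpace {V : Type*} [AddCommGroup V] [Module F V] (ρ : Representation F Γ V)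
    (U : Submodule F[Γ] ρ.asModule) : Submodule F V :=
  (U.restrictScalars F).comap ρ.asModuleEquiv.symm.toLinearMap

/-- The representation on a submodule of the module of a representation. -/
noncomputable def subRep {V : Type*} [AddCommGroup V] [Module F V] (ρ : Representation F Γ V)
    (U : Submodule F[Γ] ρ.asModule) : Representation F Γ (subSpace ρ U) :=
  ρ.subrepresentation (subSpace ρ U) fun g v hv => by
    have := U.smul_mem (MonoidAlgebra.single g (1 : F)) (x := ρ.asModuleEquiv.symm v) hv
    rwa [single_smul_asModule] at this

theorem nonempty_prod_equiv_of_isCompl {V : Type*} [AddCommGroup V] [Module F V]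
    (ρ : Representation F Γ V) {U W : Submodule F[Γ] ρ.asModule} (h : IsCompl U W) :
    Nonempty (((subRep ρ U).prod (subRep ρ W)).Equiv ρ) := by
  have h' : IsCompl (subSpace ρ U) (subSpace ρ W) := by
    rw [isCompl_iff, Submodule.disjoint_def, codisjoint_iff] at h ⊢
    refine ⟨fun x hx hx' => h.1 (ρ.asModuleEquiv.symm x) hx hx', eq_top_iff.2 fun x _ => ?_⟩
    obtain ⟨y, hy, z, hz, hyz⟩ := Submodule.mem_sup.1
      (h.2 ▸ Submodule.mem_top : ρ.asModuleEquiv.symm x ∈ U ⊔ W)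
    exact Submodule.mem_sup.2 ⟨y, hy, z, hz, hyz⟩
  refine ⟨Representation.Equiv.mk (Submodule.prodEquivOfIsCompl _ _ h') fun g =>
    LinearMap.ext fun v => ?_⟩
  exact (map_add (ρ g) (v.1 : V) (v.2 : V)).symm

theorem projective_subRep {V : Type*} [AddCommGroup V] [Module F V] [Finite Γ]
    (ρ : Representation F Γ V) (hρ : Module.Projective F[Γ] ρ.asModule)
    {U W : Submodule F[Γ] ρ.asModule} (h : IsCompl U W) :
    Module.Projective F[Γ] (subRep ρ U).asModule := by
  obtain ⟨φ⟩ := nonempty_prod_equiv_of_isCompl ρ h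
  exact projective_of_retract (projective_congr ⟨φ.symm⟩ hρ)
    ⟨LinearMap.inl F _ _, fun g => LinearMap.ext fun v => Prod.ext rfl (map_zero (subRep ρ W g)).symm⟩
    ⟨LinearMap.fst F _ _, fun g => rfl⟩ fun v => rfl

theorem nonempty_equiv_span_of_retract {V : Type*} [AddCommGroup V] [Module F V]
    (ρ : Representation F Γ V) {E : F[Γ]} (hE : E * E = E) (f : V →ₗ[F] F[Γ]) (r : F[Γ] →ₗ[F] V)
    (hrf : ∀ v, r (f v) = v) (hfr : ∀ y, f (r y) = y * E)
    (hf : ∀ g v, f (ρ g v) = MonoidAlgebra.single g (1 : F) * f v) :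
    Nonempty (ρ.asModule ≃ₗ[F[Γ]] Ideal.span {E}) := by
  have hfE : ∀ v, f v * E = f v := fun v => by rw [← hfr, hrf]
  refine ⟨LinearEquiv.ofBijective ((asModuleLift ρ f hf).codRestrict (Ideal.span {E})
    fun v => (mem_span_idem hE).2 (hfE v)) ⟨?_, ?_⟩⟩
  · intro x y hxy
    have h1 : r (f x) = r (f y) := congrArg (fun z => r z.1) hxy
    exact (hrf x).symm.trans (h1.trans (hrf y))
  · rintro ⟨y, hy⟩
    exact ⟨r y, Subtype.ext ((hfr y).trans ((mem_span_idem hE).1 hy))⟩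

/-- The direct sum of `c` copies of a representation. -/
noncomputable def powRep {V : Type*} [AddCommGroup V] [Module F V] (ρ : Representation F Γ V)
    (c : ℕ) : Representation F Γ (Fin c → V) where
  toFun g := (ρ g).compLeft (Fin c)
  map_one' := LinearMap.ext fun v => funext fun i => by simp
  map_mul' g h := LinearMap.ext fun v => funext fun i => by simp

theorem nonempty_powRep_succ {V : Type*} [AddCommGroup V] [Module F V] (ρ : Representation F Γ V)
    (c : ℕ) : Nonempty ((ρ.prod (powRep ρ c)).Equiv (powRep ρ (c + 1))) := by
  refine ⟨Representation.Equiv.mk (Fin.consLinearEquiv F (fun _ : Fin (c + 1) => V)) fun g =>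
    LinearMap.ext fun v => funext fun i => ?_⟩
  refine Fin.cases ?_ (fun i => ?_) i <;> rfl

end Representations

section Actions

variable {F : Type u} [Field F] {G : Type v} [Group G] {V : Type w} [AddCommGroup V] [Module F V]
  (ρ : Representation F (G × G) V)

theorem leftAct_eq (x : F[G]) : leftAct ρ x = ρ.asAlgebraHom (leftEmb F G x) := by
  induction x using MonoidAlgebra.induction_linear with
  | zero => simp
  | add x y hx hy => rw [map_add, map_add, ← hx, ← hy]; exact map_add _ _ _
  | single g c =>
    rw [leftEmb_single, leftAct, Representation.asAlgebraHom_single, Representation.asAlgebraHom_single]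
    rfl

theorem rightRep_asAlgebraHom (x : F[G]) :
    (rightRep ρ).asAlgebraHom x = ρ.asAlgebraHom (rightEmb F G x) := by
  induction x using MonoidAlgebra.induction_linear with
  | zero => simp
  | add x y hx hy => rw [map_add, map_add, map_add, hx, hy]
  | single g c =>
    rw [rightEmb_single, Representation.asAlgebraHom_single, Representation.asAlgebraHom_single]
    rfl

theorem intertwine_asAlgebraHom {Γ : Type v} [Group Γ] {V W : Type*} [AddCommGroup V] [Module F V]
    [AddCommGroup W] [Module F W] {ρ : Representation F Γ V} {σ : Representation F Γ W}
    (f : ρ.IntertwiningMap σ) (x : F[Γ]) (v : V) :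
    f (ρ.asAlgebraHom x v) = σ.asAlgebraHom x (f v) := by
  induction x using MonoidAlgebra.induction_linear with
  | zero => simp
  | add x y hx hy => rw [map_add, map_add, LinearMap.add_apply, LinearMap.add_apply, map_add, hx, hy]
  | single g c =>
    rw [Representation.asAlgebraHom_single, Representation.asAlgebraHom_single,
      LinearMap.smul_apply, LinearMap.smul_apply, map_smul, intertwine]

theorem IsPerfectPPermutation.of_retract [Finite G] {e : F[G]} {W : Type w} [AddCommGroup W]
    [Module F W] {σ : Representation F (G × G) W} {ρ : Representation F (G × G) V}
    (hσ : IsPerfectPPermutation e σ) (i : ρ.IntertwiningMap σ) (r : σ.IntertwiningMap ρ)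
    (h : ∀ v, r (i v) = v) : IsPerfectPPermutation e ρ where
  finite := by
    have := hσ.finite
    exact Module.Finite.of_surjective r.toLinearMap fun v => ⟨i v, h v⟩
  pPermutation := hσ.pPermutation.of_retract i r h
  left_projective := projective_of_retract hσ.left_projective
    ⟨i.toLinearMap, fun g => i.isIntertwining' _⟩ ⟨r.toLinearMap, fun g => r.isIntertwining' _⟩ h
  right_projective := projective_of_retract hσ.right_projective
    ⟨i.toLinearMap, fun g => i.isIntertwining' _⟩ ⟨r.toLinearMap, fun g => r.isIntertwining' _⟩ h
  left_e v := by
    rw [← h (leftAct ρ e v), leftAct_eq, intertwine_asAlgebraHom, ← leftAct_eq, hσ.left_e, h]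
  right_e v := by
    rw [← h (rightAct ρ e v), rightAct, rightRep_asAlgebraHom, intertwine_asAlgebraHom,
      ← rightRep_asAlgebraHom]
    exact (congrArg r (hσ.right_e _)).trans (h v)

end Actions

section PairModules

variable {F : Type u} [Field F] {G : Type v} [Group G]

/-- The bimodule `FG a ⊗ b FG` is isomorphic to the left ideal of `F[G × G]` generated by the
idempotent `a ⊗ b`. -/
theorem nonempty_pairRep_equiv_span {a b : F[G]} (ha : a * a = a) (hb : b * b = b) :
    Nonempty ((pairRep a b).asModule ≃ₗ[F[G × G]]
      Ideal.span {leftEmb F G a * rightEmb F G (invol b)}) := by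
  set E := leftEmb F G a * rightEmb F G (invol b) with hEdef
  have hb' : invol b * invol b = invol b := by rw [← invol_mul, hb]
  have hE : E * E = E := by
    rw [hEdef, mul_assoc, ← mul_assoc (rightEmb F G _), ← emb_comm, mul_assoc, ← map_mul, hb',
      ← mul_assoc, ← map_mul, ha]
  let inv : F[G] →ₗ[F] F[G] := linExt fun g => MonoidAlgebra.single g⁻¹ 1
  have hinv : ∀ x, inv x = invol x := fun x => by
    induction x using MonoidAlgebra.induction_linear with
    | zero => simp [invol_zero]
    | add x y hx hy => rw [map_add, hx, hy, invol_add]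
    | single g c =>
      rw [linExt_single, invol_single, MonoidAlgebra.smul_single, smul_eq_mul, mul_one]
  let f : PairSpace a b →ₗ[F] F[G × G] := plift
    ((LinearMap.mul F F[G × G]).compl₁₂ ((leftEmb F G).toLinearMap ∘ₗ (leftIdeal a).subtype)
      ((rightEmb F G).toLinearMap ∘ₗ inv ∘ₗ (rightIdeal b).subtype))
  have hf : ∀ x y, f (pmk a b x y) = leftEmb F G x * rightEmb F G (invol y) := fun x y => by
    rw [← hinv]; rfl
  let r : F[G × G] →ₗ[F] PairSpace a b := linExt fun z =>
    pmk a b (projL a (MonoidAlgebra.single z.1 1)) (projR b (MonoidAlgebra.single z.2⁻¹ 1))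
  have hr : ∀ x y, r (leftEmb F G x * rightEmb F G y) = pmk a b (projL a x) (projR b (invol y)) := by
    intro x y
    induction x using MonoidAlgebra.induction_linear with
    | zero => simp
    | add x z hx hz => rw [map_add, add_mul, map_add, hx, hz, map_add, map_add]; rfl
    | single g c =>
      induction y using MonoidAlgebra.induction_linear with
      | zero => simp [invol_zero]
      | add x z hx hz => rw [map_add, mul_add, map_add, hx, hz, invol_add, map_add, map_add]
      | single h d =>
        rw [leftEmb_single, rightEmb_single, MonoidAlgebra.single_mul_single, linExt_single,
          Prod.mk_mul_mk, mul_one, one_mul, invol_single, ← mul_one c, ← mul_one d,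
          ← smul_eq_mul c, ← smul_eq_mul d, ← MonoidAlgebra.smul_single,
          ← MonoidAlgebra.smul_single, map_smul, map_smul, map_smul, map_smul, LinearMap.smul_apply,
          smul_smul, smul_eq_mul, smul_eq_mul, mul_one, mul_one, mul_comm d]
  have hrf : r ∘ₗ f = LinearMap.id := pair_ext fun x y => by
    rw [LinearMap.comp_apply, hf, hr, invol_invol]
    exact congrArg₂ (fun s t => pmk a b s t) (Subtype.ext ((mem_leftIdeal ha).1 x.2))
      (Subtype.ext ((mem_rightIdeal hb).1 y.2))
  have hfg : ∀ (g : G × G) v, f (pairRep a b g v) = MonoidAlgebra.single g 1 * f v := fun g =>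
    LinearMap.congr_fun (f := f ∘ₗ pairRep a b g)
      (g := LinearMap.mulLeft F (MonoidAlgebra.single g 1) ∘ₗ f) (pair_ext fun x y => by
        rw [LinearMap.comp_apply, LinearMap.comp_apply, pairRep_pmk, hf, hf, coe_leftIdealRep,
          coe_rightIdealRep, invol_mul, invol_single, inv_inv, map_mul, map_mul,
          LinearMap.mulLeft_apply, single_eq_emb g, one_smul, mul_assoc, mul_assoc,
          ← mul_assoc (leftEmb F G (x : F[G])), emb_comm (x : F[G]), mul_assoc])
  have hfr : ∀ y, f (r y) = y * E := fun y => by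
    induction y using MonoidAlgebra.induction_linear with
    | zero => simp
    | add x z hx hz => rw [map_add, map_add, hx, hz, add_mul]
    | single g c =>
      rw [single_eq_emb, map_smul, map_smul, hr, hf, coe_projL, coe_projR, invol_mul, invol_invol,
        map_mul, map_mul, smul_mul_assoc, hEdef, mul_assoc, mul_assoc,
        ← mul_assoc (leftEmb F G a), emb_comm a, mul_assoc]
  exact nonempty_equiv_span_of_retract (pairRep a b) hE f r (LinearMap.congr_fun hrf) hfr hfg

end PairModules

/-! ### The ideal `Pr(B,B)` -/

section TensorProjective

variable {F : Type u} [Field F] {G : Type v} [Group G] [Finite G] {V W : Type w} [AddCommGroup V]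
  [Module F V] [AddCommGroup W] [Module F W]
  {ρ : Representation F (G × G) V} {σ : Representation F (G × G) W}

theorem tensor_projective_of_right (hρ : Module.Projective F[G] (leftRep ρ).asModule)
    (hσ : Module.Projective F[G × G] σ.asModule) :
    Module.Projective F[G × G] (tensorRep ρ σ).asModule := by
  cases nonempty_fintype G
  rw [projective_iff] at hρ hσ ⊢
  obtain ⟨θ, hθ⟩ := hρ
  obtain ⟨η, hη⟩ := hσ
  simp only [MonoidHom.comp_apply, MonoidHom.inl_apply] at hθ
  refine ⟨tensorAvg θ η, fun v => ?_⟩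
  have key : ∑ g : G × G, (tensorRep ρ σ g) ∘ₗ tensorAvg θ η ∘ₗ (tensorRep ρ σ g⁻¹)
      = LinearMap.id := tensor_ext fun v w => by
    simp only [LinearMap.sum_apply, LinearMap.comp_apply, tensorRep_tmk, tensorAvg_tmk, map_sum,
      LinearMap.id_apply, Prod.fst_inv, Prod.snd_inv, ← rep_comm ρ]
    rw [Fintype.sum_prod_type]
    have h1 : ∀ a b h : G, tmk ρ σ (ρ (a, 1) (θ (ρ (a⁻¹, 1) (ρ (1, h) v))))
        (σ (1, b) (η (σ (h, 1) (σ (1, b⁻¹) w)))) =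
        (tmk ρ σ).flip (σ (1, b) (η (σ (h, b⁻¹) w))) (ρ (a, 1) (θ (ρ (a⁻¹, 1) (ρ (1, h) v)))) :=
      fun a b h => by rw [← rep_split σ h, LinearMap.flip_apply]
    simp only [h1]
    rw [Finset.sum_comm]
    simp_rw [Finset.sum_comm (s := Finset.univ (α := G)) (t := Finset.univ (α := G))
      (f := fun a h => (tmk ρ σ).flip _ (ρ (a, 1) (θ (ρ (a⁻¹, 1) (ρ (1, h) v)))))]
    simp only [← map_sum, hθ]
    have h2 : ∀ b h : G, (tmk ρ σ).flip (σ (1, b) (η (σ (h, b⁻¹) w))) (ρ (1, h) v) =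
        tmk ρ σ v (σ (h⁻¹, b) (η (σ (h⁻¹, b)⁻¹ w))) := fun b h => by
      rw [LinearMap.flip_apply, ← tmk_balanced ρ σ h v (σ (h⁻¹, b) _), ← Module.End.mul_apply (σ (h, 1)),
        ← map_mul, Prod.mk_mul_mk, mul_inv_cancel, one_mul, Prod.inv_mk, inv_inv]
    simp only [h2, ← map_sum]
    congr 1
    rw [Finset.sum_comm]
    refine (Equiv.sum_comp (Equiv.inv G) fun g => ∑ b, σ (g, b) (η (σ (g, b)⁻¹ w))).trans ?_
    rw [← Fintype.sum_prod_type', hη]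
  have := LinearMap.congr_fun key v
  simpa only [LinearMap.sum_apply, LinearMap.comp_apply, LinearMap.id_apply] using this

theorem tensor_projective_of_left (hρ : Module.Projective F[G × G] ρ.asModule)
    (hσ : Module.Projective F[G] (rightRep σ).asModule) :
    Module.Projective F[G × G] (tensorRep ρ σ).asModule := by
  cases nonempty_fintype G
  rw [projective_iff] at hρ hσ ⊢
  obtain ⟨η, hη⟩ := hρ
  obtain ⟨θ, hθ⟩ := hσ
  simp only [MonoidHom.comp_apply, MonoidHom.inr_apply] at hθ
  refine ⟨tensorAvg η θ, fun v => ?_⟩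
  have key : ∑ g : G × G, (tensorRep ρ σ g) ∘ₗ tensorAvg η θ ∘ₗ (tensorRep ρ σ g⁻¹)
      = LinearMap.id := tensor_ext fun v w => by
    simp only [LinearMap.sum_apply, LinearMap.comp_apply, tensorRep_tmk, tensorAvg_tmk, map_sum,
      LinearMap.id_apply, Prod.fst_inv, Prod.snd_inv, rep_comm σ]
    rw [Fintype.sum_prod_type]
    have h1 : ∀ a h : G, ρ (1, h) (ρ (a⁻¹, 1) v) = ρ (a⁻¹, h) v := fun a h => by
      rw [← rep_comm, ← rep_split]
    simp_rw [Finset.sum_comm (s := Finset.univ (α := G)) (t := Finset.univ (α := G))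
      (f := fun b h => tmk ρ σ _ (σ (1, b) (θ (σ (1, b⁻¹) (σ (h, 1) w)))))]
    simp only [← map_sum, hθ, h1]
    have h2 : ∀ a h : G, tmk ρ σ (ρ (a, 1) (η (ρ (a⁻¹, h) v))) (σ (h, 1) w) =
        (tmk ρ σ).flip w (ρ (a, h⁻¹) (η (ρ (a, h⁻¹)⁻¹ v))) := fun a h => by
      rw [LinearMap.flip_apply, ← tmk_balanced ρ σ h (ρ (a, h⁻¹) _), ← Module.End.mul_apply (ρ (1, h)),
        ← map_mul, Prod.mk_mul_mk, mul_inv_cancel, one_mul, Prod.inv_mk, inv_inv]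
    simp only [h2, ← map_sum]
    rw [LinearMap.flip_apply]
    congr 2
    refine (Finset.sum_congr rfl fun a _ => Equiv.sum_comp (Equiv.inv G) fun b =>
      ρ (a, b) (η (ρ (a, b)⁻¹ v))).trans ?_
    rw [← Fintype.sum_prod_type', hη]
  have := LinearMap.congr_fun key v
  simpa only [LinearMap.sum_apply, LinearMap.comp_apply, LinearMap.id_apply] using this

end TensorProjective

section Classes

variable {F : Type u} [Field F] {G : Type v} [Group G] [Finite G] {e : CentralIdempotent F G}

theorem PerfectBimod.cls_congr {M N : PerfectBimod e} (h : Nonempty (M.rep.Equiv N.rep)) :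
    M.cls = N.cls :=
  congrArg (Algebra.GrothendieckAddGroup.of (M := IsoClass e)) (Quotient.sound h)

theorem PerfectBimod.cls_add (M N : PerfectBimod e) : (M.add N).cls = M.cls + N.cls :=
  (map_add (Algebra.GrothendieckAddGroup.of (M := IsoClass e)) (show IsoClass e from ⟦M⟧)
    (show IsoClass e from ⟦N⟧) :)

theorem PerfectBimod.cls_mul (M N : PerfectBimod e) : (M.mul N).cls = M.cls * N.cls :=
  (grothendieckMul_of (S := IsoClass e) (Quotient.mk _ M) (Quotient.mk _ N)).symm

theorem PerfectBimod.cls_of_subsingleton (M : PerfectBimod e) [Subsingleton M.carrier] :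
    M.cls = 0 := by
  have h : M.cls = (PerfectBimod.zero e).cls := cls_congr (subsingleton_iso _ _)
  rw [h]
  exact map_zero (Algebra.GrothendieckAddGroup.of (M := IsoClass e))

theorem TDelta.closure_cls :
    AddSubgroup.closure (Set.range (PerfectBimod.cls (e := e))) = ⊤ := by
  set S := AddSubgroup.closure (Set.range (PerfectBimod.cls (e := e)))
  have h : QuotientAddGroup.mk' S = 0 := grothendieck_ext (S := IsoClass e) fun x => by
    induction x using Quotient.inductionOn with
    | h M => exact (QuotientAddGroup.eq_zero_iff _).2 (AddSubgroup.subset_closure ⟨M, rfl⟩)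
  exact eq_top_iff.2 fun x _ => (QuotientAddGroup.eq_zero_iff x).1 (DFunLike.congr_fun h x)

/-- An invariant of bimodules that is additive on direct sums extends to `T^Δ(B,B)`. -/
theorem TDelta.exists_lift {A : Type*} [AddCommGroup A] (f : PerfectBimod e → A)
    (hf : ∀ M N : PerfectBimod e, Nonempty (M.rep.Equiv N.rep) → f M = f N)
    (hadd : ∀ M N : PerfectBimod e, f (M.add N) = f M + f N) :
    ∃ φ : TDelta e →+ A, ∀ M : PerfectBimod e, φ M.cls = f M := by
  let g : IsoClass e →+ A := AddMonoidHom.mk' (M := IsoClass e) (G := A) (Quotient.lift f hf) (by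
    rintro ⟨M⟩ ⟨N⟩
    exact hadd M N)
  exact ⟨Algebra.GrothendieckAddGroup.lift g, fun M =>
    DFunLike.congr_fun (Algebra.GrothendieckAddGroup.lift.symm_apply_apply g) _⟩

variable {n : ℕ} (s : PIMSystem e n)

/-- The bimodule `P_{ij} = FG εᵢ ⊗ εⱼ FG`. -/
noncomputable def PIMSystem.bimod (i j : Fin n) : PerfectBimod e :=
  ⟨PairSpace (s.ε i) (s.ε j), pairRep (s.ε i) (s.ε j),
    pairRep_perfect e (s.primitive i).2.1 (s.primitive j).2.1 (s.primitive i).1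
      (s.primitive j).1⟩

theorem PIMSystem.cls_bimod (i j : Fin n) : (s.bimod i j).cls = s.cls i j := rfl

end Classes

theorem IsIndecomposable.congr {R : Type*} [Ring R] {M N : Type*} [AddCommGroup M] [Module R M]
    [AddCommGroup N] [Module R N] (φ : M ≃ₗ[R] N) (h : IsIndecomposable R M) :
    IsIndecomposable R N := by
  have := h.1
  refine ⟨φ.symm.toEquiv.nontrivial, fun U W hUW => ?_⟩
  have h2 := h.2 _ _ (hUW.map (Submodule.orderIsoMapComap φ).symm)
  rwa [map_eq_bot_iff, map_eq_bot_iff] at h2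

section Basis

variable {F : Type u} [Field F] {G : Type v} [Group G] [Finite G] {e : CentralIdempotent F G}
  {n : ℕ} (s : PIMSystem e n)

theorem PIMSystem.nonempty_equiv_span (i j : Fin n) :
    Nonempty ((s.bimod i j).rep.asModule ≃ₗ[F[G × G]]
      Ideal.span {leftEmb F G (s.ε i) * rightEmb F G (invol (s.ε j))}) :=
  nonempty_pairRep_equiv_span (s.primitive i).2.1 (s.primitive j).2.1

theorem PIMSystem.isPrimitive_emb (hF : HasScalarEnds F F[G]) (i j : Fin n) :
    IsPrimitiveIn Set.univ (leftEmb F G (s.ε i) * rightEmb F G (invol (s.ε j))) :=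
  (s.isPrimitive i).emb hF (s.isPrimitive j).invol

theorem PIMSystem.projective_bimod (hF : HasScalarEnds F F[G]) (i j : Fin n) :
    Module.Projective F[G × G] (s.bimod i j).rep.asModule := by
  obtain ⟨φ⟩ := s.nonempty_equiv_span i j
  have := projective_span_idem (s.isPrimitive_emb hF i j).2.1
  exact Module.Projective.of_equiv φ.symm

theorem PIMSystem.isIndecomposable_bimod (hF : HasScalarEnds F F[G]) (i j : Fin n) :
    IsIndecomposable F[G × G] (s.bimod i j).rep.asModule := by
  obtain ⟨φ⟩ := s.nonempty_equiv_span i j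
  exact (s.isPrimitive_emb hF i j).isIndecomposable_span.congr φ.symm

theorem PIMSystem.exists_equiv_bimod (hF : HasScalarEnds F F[G]) (M : PerfectBimod e)
    (hM : Module.Projective F[G × G] M.rep.asModule)
    (hM' : IsIndecomposable F[G × G] M.rep.asModule) :
    ∃ i j, Nonempty (M.rep.Equiv (s.bimod i j).rep) := by
  have := M.perfect.finite
  have : Module.Finite F[G × G] M.rep.asModule :=
    Module.Finite.of_restrictScalars_finite F F[G × G] M.rep.asModule
  obtain ⟨⟨i, j⟩, ⟨φ⟩⟩ := hM'.exists_equiv_span F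
    (ε := fun z : Fin n × Fin n => leftEmb F G (s.ε z.1) * rightEmb F G (invol (s.ε z.2)))
    (fun z => s.isPrimitive_emb hF z.1 z.2) fun N hN => by
      have := isSimpleModule_iff_isCoatom.2 hN
      obtain ⟨t, ht⟩ := @exists_ne _ (IsSimpleModule.nontrivial F[G × G] (_ ⧸ N)) 0
      have hl : ∀ t : M.rep.asModule ⧸ N, leftEmb F G e.val • t = t := fun t => by
        obtain ⟨m, rfl⟩ := N.mkQ_surjective t
        rw [← map_smul]
        congr 1
        exact (LinearMap.congr_fun (leftAct_eq M.rep e.val) _).symm.trans (M.perfect.left_e m)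
      have hr : ∀ t : M.rep.asModule ⧸ N, rightEmb F G (invol e.val) • t = t := fun t => by
        obtain ⟨m, rfl⟩ := N.mkQ_surjective t
        rw [← map_smul]
        congr 1
        exact (LinearMap.congr_fun (rightRep_asAlgebraHom M.rep _) _).symm.trans
          (M.perfect.right_e m)
      obtain ⟨i, b, hb⟩ : ∃ i b, leftEmb F G (s.ε i * b) • t ≠ 0 := by
        let _ : Module F[G] (M.rep.asModule ⧸ N) :=
          Module.compHom _ (leftEmb F G : F[G] →+* F[G × G])
        refine s.isTopSystem.exists_smul_ne F e.idem (m := t) ?_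
        change leftEmb F G e.val • t ≠ 0
        rwa [hl]
      obtain ⟨j, c, hc⟩ : ∃ j c, rightEmb F G (invol (s.ε j) * c) •
          leftEmb F G (s.ε i * b) • t ≠ 0 := by
        let _ : Module F[G] (M.rep.asModule ⧸ N) :=
          Module.compHom _ (rightEmb F G : F[G] →+* F[G × G])
        refine s.isTopSystem.invol.exists_smul_ne F (by rw [← invol_mul, e.idem])
          (m := leftEmb F G (s.ε i * b) • t) ?_
        change rightEmb F G (invol e.val) • leftEmb F G (s.ε i * b) • t ≠ 0
        rwa [hr]
      refine ⟨(i, j), (rightEmb F G c * leftEmb F G b) • t, ?_⟩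
      rwa [smul_smul, mul_assoc, ← mul_assoc (rightEmb F G _) (rightEmb F G _), ← map_mul,
        ← mul_assoc, emb_comm, mul_assoc, ← map_mul, mul_smul]
  obtain ⟨ψ⟩ := s.nonempty_equiv_span i j
  exact ⟨i, j, nonempty_equiv_of_asModule (φ.trans ψ.symm)⟩

theorem PIMSystem.cls_mem_span (hF : HasScalarEnds F F[G]) (M : PerfectBimod e)
    (hM : Module.Projective F[G × G] M.rep.asModule) :
    M.cls ∈ Submodule.span ℤ (Set.range fun z : Fin n × Fin n => s.cls z.1 z.2) := by
  induction hd : Module.finrank F M.carrier using Nat.strong_induction_on generalizing M with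
  | _ d ih =>
  by_cases hMs : Subsingleton M.carrier
  · rw [M.cls_of_subsingleton]
    exact zero_mem _
  by_cases hMi : IsIndecomposable F[G × G] M.rep.asModule
  · obtain ⟨i, j, h⟩ := s.exists_equiv_bimod hF M hM hMi
    rw [PerfectBimod.cls_congr h]
    exact Submodule.subset_span ⟨(i, j), rfl⟩
  have hMn : Nontrivial M.rep.asModule := not_subsingleton_iff_nontrivial.1 hMs
  simp only [IsIndecomposable, hMn, true_and, not_forall, not_or] at hMi
  obtain ⟨U, W, hUW, hU, hW⟩ := hMi
  have := M.perfect.finite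
  obtain ⟨φ⟩ := nonempty_prod_equiv_of_isCompl M.rep hUW
  let P : PerfectBimod e := ⟨subSpace M.rep U, subRep M.rep U, M.perfect.of_retract
    (φ.toIntertwiningMap.comp ⟨LinearMap.inl F _ _, fun g => LinearMap.ext fun v =>
      Prod.ext rfl (map_zero (subRep M.rep W g)).symm⟩)
    ((⟨LinearMap.fst F _ _, fun g => rfl⟩ : ((subRep M.rep U).prod (subRep M.rep W)).IntertwiningMap
      (subRep M.rep U)).comp φ.symm.toIntertwiningMap)
    fun v => congrArg Prod.fst (φ.toLinearEquiv.symm_apply_apply (v, 0))⟩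
  let Q : PerfectBimod e := ⟨subSpace M.rep W, subRep M.rep W, M.perfect.of_retract
    (φ.toIntertwiningMap.comp ⟨LinearMap.inr F _ _, fun g => LinearMap.ext fun v =>
      Prod.ext (map_zero (subRep M.rep U g)).symm rfl⟩)
    ((⟨LinearMap.snd F _ _, fun g => rfl⟩ : ((subRep M.rep U).prod (subRep M.rep W)).IntertwiningMap
      (subRep M.rep W)).comp φ.symm.toIntertwiningMap)
    fun v => congrArg Prod.snd (φ.toLinearEquiv.symm_apply_apply (0, v))⟩
  have hcls : M.cls = P.cls + Q.cls := by
    rw [← PerfectBimod.cls_add]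
    exact PerfectBimod.cls_congr ⟨φ.symm⟩
  have hdim : Module.finrank F (subSpace M.rep U) + Module.finrank F (subSpace M.rep W) = d := by
    rw [← hd, ← φ.toLinearEquiv.finrank_eq, Module.finrank_prod]
  have hpos : ∀ U : Submodule F[G × G] M.rep.asModule, U ≠ ⊥ →
      0 < Module.finrank F (subSpace M.rep U) := fun U hU => by
    obtain ⟨x, hx, hx0⟩ := (Submodule.ne_bot_iff U).1 hU
    have : Nontrivial (subSpace M.rep U) := ⟨⟨⟨x, hx⟩, 0, fun h => hx0 (congrArg Subtype.val h)⟩⟩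
    exact Module.finrank_pos
  have h1 := hpos U hU
  have h2 := hpos W hW
  rw [hcls]
  exact add_mem (ih (Module.finrank F (subSpace M.rep U)) (by omega) P
      (projective_subRep M.rep hM hUW) rfl)
    (ih (Module.finrank F (subSpace M.rep W)) (by omega) Q
      (projective_subRep M.rep hM hUW.symm) rfl)

theorem PIMSystem.Pr_eq_span (hF : HasScalarEnds F F[G]) :
    Pr e = Submodule.span ℤ (Set.range fun z : Fin n × Fin n => s.cls z.1 z.2) := by
  refine le_antisymm (Submodule.span_le.2 ?_) (Submodule.span_mono ?_)
  · rintro _ ⟨M, hM, -, rfl⟩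
    exact s.cls_mem_span hF M hM
  · rintro _ ⟨z, rfl⟩
    exact ⟨s.bimod z.1 z.2, s.projective_bimod hF _ _, s.isIndecomposable_bimod hF _ _, rfl⟩

theorem Pr_ideal (hF : HasScalarEnds F F[G]) (t x : TDelta e) (hx : x ∈ Pr e) :
    t * x ∈ Pr e ∧ x * t ∈ Pr e := by
  obtain ⟨s⟩ := nonempty_pimSystem e
  have ht : t ∈ AddSubgroup.closure (Set.range (PerfectBimod.cls (e := e))) :=
    (TDelta.closure_cls (e := e)).symm ▸ AddSubgroup.mem_top t
  induction ht using AddSubgroup.closure_induction with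
  | zero => rw [zero_mul, mul_zero]; exact ⟨zero_mem _, zero_mem _⟩
  | add a b _ _ ha hb =>
    rw [add_mul, mul_add]
    exact ⟨add_mem ha.1 hb.1, add_mem ha.2 hb.2⟩
  | neg a _ ha =>
    rw [neg_mul, mul_neg]
    exact ⟨neg_mem ha.1, neg_mem ha.2⟩
  | mem t ht =>
    obtain ⟨M, rfl⟩ := ht
    induction hx using Submodule.span_induction with
    | zero => rw [zero_mul, mul_zero]; exact ⟨zero_mem _, zero_mem _⟩
    | add a b _ _ ha hb =>
      rw [add_mul, mul_add]
      exact ⟨add_mem ha.1 hb.1, add_mem ha.2 hb.2⟩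
    | smul c a _ ha =>
      rw [smul_mul_assoc, mul_smul_comm]
      exact ⟨Submodule.smul_mem _ c ha.1, Submodule.smul_mem _ c ha.2⟩
    | mem x hx =>
      obtain ⟨N, hN, -, rfl⟩ := hx
      rw [← PerfectBimod.cls_mul, ← PerfectBimod.cls_mul, s.Pr_eq_span hF]
      exact ⟨s.cls_mem_span hF _ (tensor_projective_of_right M.perfect.left_projective hN),
        s.cls_mem_span hF _ (tensor_projective_of_left hN M.perfect.right_projective)⟩

end Basis

/-! ### The multiplication of `Pr(B,B)` -/

section PowClass

variable {F : Type u} [Field F] {G : Type v} [Group G] [Finite G] {e : CentralIdempotent F G}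

theorem cls_powRep (M : PerfectBimod e) (c : ℕ) :
    ∃ h : IsPerfectPPermutation e.val (powRep M.rep c),
      PerfectBimod.cls ⟨Fin c → M.carrier, powRep M.rep c, h⟩ = c • M.cls := by
  induction c with
  | zero =>
    refine ⟨.of_subsingleton _, ?_⟩
    rw [zero_smul]
    exact @PerfectBimod.cls_of_subsingleton _ _ _ _ _ _ _
      (inferInstanceAs (Subsingleton (Fin 0 → M.carrier)))
  | succ c ih =>
    obtain ⟨h, hc⟩ := ih
    obtain ⟨φ⟩ := nonempty_powRep_succ M.rep c
    have h' : IsPerfectPPermutation e.val (powRep M.rep (c + 1)) :=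
      (M.perfect.prod h).of_retract φ.symm.toIntertwiningMap φ.toIntertwiningMap
        φ.toLinearEquiv.apply_symm_apply
    refine ⟨h', ?_⟩
    rw [succ_nsmul', ← hc, ← PerfectBimod.cls_add]
    exact PerfectBimod.cls_congr ⟨φ.symm⟩

end PowClass

section Product

variable {F : Type u} [Field F] {G : Type v} [Group G] [Finite G]

/-- The subspace `a FG b` of the group algebra. -/
noncomputable def cornerSpace (a b : F[G]) : Submodule F F[G] :=
  LinearMap.range (LinearMap.mulLeft F a ∘ₗ LinearMap.mulRight F b)

omit [Finite G] in
theorem mul_mem_cornerSpace {a b : F[G]} (ha : a * a = a) (hb : b * b = b) (x : rightIdeal a)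
    (y : leftIdeal b) : (x * y : F[G]) ∈ cornerSpace a b := ⟨x * y, by
  rw [LinearMap.comp_apply, LinearMap.mulRight_apply, LinearMap.mulLeft_apply, ← mul_assoc,
    ← mul_assoc, (mem_rightIdeal ha).1 x.2, mul_assoc, (mem_leftIdeal hb).1 y.2]⟩

/-- The isomorphism `(FGa ⊗ bFG) ⊗_{FG} (FGa' ⊗ b'FG) ≅ bFGa' ⊗ (FGa ⊗ b'FG)`, in terms of a
basis of `bFGa'`. -/
theorem nonempty_tensorRep_pairRep {a b a' b' : F[G]} (hb : b * b = b)
    (ha' : a' * a' = a') :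
    Nonempty ((tensorRep (pairRep a b) (pairRep a' b')).Equiv
      (powRep (pairRep a b') (Module.finrank F (cornerSpace b a')))) := by
  let c := Module.finrank F (cornerSpace b a')
  let β : Module.Basis (Fin c) F (cornerSpace b a') := Module.finBasis F (cornerSpace b a')
  let γ : rightIdeal b →ₗ[F] leftIdeal a' →ₗ[F] (Fin c → F) := LinearMap.mk₂ F
    (fun y z => β.equivFun ⟨y * z, mul_mem_cornerSpace hb ha' y z⟩)
    (fun y y' z => by rw [← map_add]; congr 1; exact Subtype.ext (add_mul _ _ _))
    (fun r y z => by rw [← map_smul]; congr 1; exact Subtype.ext (smul_mul_assoc _ _ _))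
    (fun y z z' => by rw [← map_add]; congr 1; exact Subtype.ext (mul_add _ _ _))
    (fun r y z => by rw [← map_smul]; congr 1; exact Subtype.ext (mul_smul_comm _ _ _))
  have hγ : ∀ y z, γ y z = β.equivFun ⟨y * z, mul_mem_cornerSpace hb ha' y z⟩ := fun _ _ => rfl
  let f1 : leftIdeal a →ₗ[F] rightIdeal b →ₗ[F] PairSpace a' b' →ₗ[F] (Fin c → PairSpace a b') := LinearMap.mk₂ F
    (fun x y => plift (LinearMap.mk₂ F (fun z w t => γ y z t • pmk a b' x w)
      (fun z z' w => funext fun t => by simp [add_smul])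
      (fun r z w => funext fun t => by simp [mul_smul])
      (fun z w w' => funext fun t => by simp)
      (fun r z w => funext fun t => by simp [smul_comm r])))
    (fun x x' y => pair_ext fun z w => funext fun t => by simp [plift_pmk])
    (fun r x y => pair_ext fun z w => funext fun t => by simp [plift_pmk, smul_comm r])
    (fun x y y' => pair_ext fun z w => funext fun t => by simp [plift_pmk, add_smul])
    (fun r x y => pair_ext fun z w => funext fun t => by simp [plift_pmk, mul_smul])
  have hf1 : ∀ x y z w, f1 x y (pmk a' b' z w) = fun t => γ y z t • pmk a b' x w :=
    fun _ _ _ _ => rfl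
  clear_value f1
  have hbal : ∀ (h : G) v w, plift f1 (pairRep a b (1, h) v) (pairRep a' b' (h, 1) w) =
      plift f1 v w := fun h v w => by
    refine LinearMap.congr_fun (LinearMap.congr_fun (f := (plift f1).compl₁₂ (pairRep a b (1, h))
      (pairRep a' b' (h, 1))) (g := plift f1) (pair_ext fun x y => pair_ext fun z w => ?_) v) w
    rw [LinearMap.compl₁₂_apply, pairRep_pmk, pairRep_pmk, plift_pmk, plift_pmk, hf1, hf1, map_one,
      map_one, hγ, hγ]
    have : ((rightIdealRep b h y : F[G]) * (leftIdealRep a' h z : F[G])) = y * z := by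
      rw [coe_rightIdealRep, coe_leftIdealRep, mul_assoc, ← mul_assoc (MonoidAlgebra.single _ _),
        MonoidAlgebra.single_mul_single, inv_mul_cancel, one_mul, ← MonoidAlgebra.one_def, one_mul]
    simp only [this]
    rfl
  obtain ⟨f, hf⟩ : ∃ f : TensorSpace (pairRep a b) (pairRep a' b') →ₗ[F] (Fin c → PairSpace a b'), ∀ x y z w,
      f (tmk _ _ (pmk a b x y) (pmk a' b' z w)) = fun t => γ y z t • pmk a b' x w :=
    ⟨tlift (plift f1) hbal, fun x y z w => by rw [tlift_tmk, plift_pmk, hf1]⟩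
  let ι : cornerSpace b a' →ₗ[F] rightIdeal b := Submodule.inclusion (by
    rintro _ ⟨x, rfl⟩
    exact ⟨_, rfl⟩)
  have hι : ∀ x : cornerSpace b a', (ι x : F[G]) = x := fun _ => rfl
  let η : leftIdeal a' := projL a' 1
  have hη : (η : F[G]) = a' := by rw [coe_projL, one_mul]
  let g1 : Fin c → PairSpace a b' →ₗ[F] TensorSpace (pairRep a b) (pairRep a' b') := fun t =>
    plift ((tmk (pairRep a b) (pairRep a' b')).compl₁₂ ((pmk a b).flip (ι (β t))) (pmk a' b' η))
  have hg1 : ∀ t x w, g1 t (pmk a b' x w) = tmk _ _ (pmk a b x (ι (β t))) (pmk a' b' η w) :=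
    fun _ _ _ => rfl
  clear_value g1
  let g : (Fin c → PairSpace a b') →ₗ[F] TensorSpace (pairRep a b) (pairRep a' b') := LinearMap.lsum F _ F g1
  have hg : ∀ v, g v = ∑ t, g1 t (v t) := fun v => by
    simp only [g, LinearMap.lsum_apply, LinearMap.sum_apply, LinearMap.comp_apply]
    rfl
  have hγβ : ∀ t, γ (ι (β t)) η = Pi.single t 1 := fun t => by
    refine (?_ : γ (ι (β t)) η = β.equivFun (β t)).trans ?_
    swap
    · funext t'
      rw [β.equivFun_self, Pi.single_apply]
      simp only [eq_comm]
    refine congrArg β.equivFun (Subtype.ext ?_)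
    obtain ⟨y, hy⟩ := (β t).2
    change (ι (β t) : F[G]) * (η : F[G]) = β t
    rw [hι, hη, ← hy, LinearMap.comp_apply, LinearMap.mulRight_apply, LinearMap.mulLeft_apply,
      mul_assoc, mul_assoc, ha']
  have ext4 : ∀ {Y : Type (max u v)} [AddCommGroup Y] [Module F Y]
      {p q : TensorSpace (pairRep a b) (pairRep a' b') →ₗ[F] Y},
      (∀ x y z w, p (tmk _ _ (pmk a b x y) (pmk a' b' z w)) =
        q (tmk _ _ (pmk a b x y) (pmk a' b' z w))) → p = q := fun {Y} _ _ {p q} h =>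
    tensor_ext fun v w => LinearMap.congr_fun (LinearMap.congr_fun
      (f := (tmk (pairRep a b) (pairRep a' b')).compr₂ p)
      (g := (tmk (pairRep a b) (pairRep a' b')).compr₂ q)
      (pair_ext fun x y => pair_ext fun z w => h x y z w) v) w
  refine equiv_of_inverse f g (fun h => ext4 fun x y z w => ?_) ?_ (ext4 fun x y z w => ?_)
  · rw [LinearMap.comp_apply, LinearMap.comp_apply, tensorRep_tmk, pairRep_pmk, pairRep_pmk, hf, hf,
      map_one, map_one]
    refine funext fun t => ?_
    change _ = pairRep a b' h (γ y z t • pmk a b' x w)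
    rw [map_smul, pairRep_pmk]
    rfl
  · refine LinearMap.pi_ext' fun t => pair_ext fun x w => ?_
    have : g (Pi.single t (pmk a b' x w)) = g1 t (pmk a b' x w) := by
      rw [hg, Finset.sum_eq_single t (fun t' _ h => by rw [Pi.single_eq_of_ne h, map_zero])
        (fun h => absurd (Finset.mem_univ t) h), Pi.single_eq_same]
    rw [LinearMap.comp_apply, LinearMap.comp_apply, LinearMap.single_apply, this, hg1, hf, hγβ]
    refine funext fun t' => ?_
    by_cases h : t' = t
    · subst h; simp
    · simp [Pi.single_eq_of_ne h]
  · rw [LinearMap.comp_apply, hf, hg]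
    have h1 : ∀ t, g1 t (γ y z t • pmk a b' x w) =
        (tmk (pairRep a b) (pairRep a' b')).flip (pmk a' b' η w)
          (pmk a b x (ι (γ y z t • β t))) := fun t => by
      rw [map_smul, hg1, map_smul, map_smul, map_smul, LinearMap.flip_apply]
    simp only [h1]
    rw [← map_sum, ← map_sum, ← map_sum, hγ, β.sum_equivFun, LinearMap.flip_apply]
    have h2 : pmk a b x (ι ⟨y * z, mul_mem_cornerSpace hb ha' y z⟩) =
        rightAct (pairRep a b) z (pmk a b x y) := by
      rw [rightAct_pairRep]
      congr 1
      exact Subtype.ext (rightIdealRep_act b z y).symm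
    rw [h2, tmk_act, leftAct_pairRep, LinearMap.id_apply]
    refine congrArg (fun u => tmk _ _ (pmk a b x y) (pmk a' b' u w)) (Subtype.ext ?_)
    rw [leftIdealRep_act, hη]
    exact (mem_leftIdeal ha').1 z.2

variable {e : CentralIdempotent F G} {n : ℕ} (s : PIMSystem e n)

/-- The entry `c_{ij} = dim εᵢ FG εⱼ` of the Cartan matrix. -/
noncomputable def PIMSystem.cartanNat (i j : Fin n) : ℕ :=
  Module.finrank F (cornerSpace (s.ε i) (s.ε j))

theorem PIMSystem.cls_mul_cls (i j k l : Fin n) :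
    s.cls i j * s.cls k l = s.cartanNat j k • s.cls i l := by
  obtain ⟨h, hc⟩ := cls_powRep (s.bimod i l) (s.cartanNat j k)
  rw [← s.cls_bimod, ← s.cls_bimod, ← s.cls_bimod, ← PerfectBimod.cls_mul, ← hc]
  exact PerfectBimod.cls_congr (nonempty_tensorRep_pairRep (s.primitive j).2.1
    (s.primitive k).2.1)

end Product

/-! ### Coordinates on `Pr(B,B)` -/

section Coordinates

variable {F : Type u} [Field F] {G : Type v} [Group G] [Finite G]

omit [Finite G] in
theorem invol_smul (c : F) (x : F[G]) : invol (c • x) = c • invol x := by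
  rw [Algebra.smul_def, invol_mul, Algebra.smul_def, Algebra.commutes]
  congr 1
  rw [MonoidAlgebra.coe_algebraMap, Function.comp_apply, invol_single, inv_one]

omit [Finite G] in
/-- Every linear form on the group algebra is of the shape `a ↦ λ(z a)`, where `λ` is the
coefficient at the identity. -/
theorem exists_coeffOne_mul [Fintype G] (τ : F[G] →ₗ[F] F) :
    ∃ z : F[G], ∀ a, coeffOne F G (z * a) = τ a := by
  refine ⟨∑ g : G, τ (MonoidAlgebra.single g 1) • MonoidAlgebra.single g⁻¹ 1, fun a => ?_⟩
  rw [Finset.sum_mul, map_sum]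
  simp only [smul_mul_assoc, map_smul, smul_eq_mul]
  conv_rhs => rw [← sum_coeffOne_left a, map_sum]
  exact Finset.sum_congr rfl fun g _ => by rw [map_smul, smul_eq_mul, mul_comm]

omit [Finite G] in
theorem eq_of_coeffOne_mul [Fintype G] {x y : F[G]}
    (h : ∀ b, coeffOne F G (x * b) = coeffOne F G (y * b)) : x = y := by
  rw [← sum_coeffOne_right x, ← sum_coeffOne_right y]
  simp only [h]

/-- An element `z` such that `z ε` spans the socle of `FG ε`, and `z` annihilates the modules
`FG η` for the other primitive idempotents `η`. -/
theorem exists_socle_element (hF : HasScalarEnds F F[G]) {ε : F[G]}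
    (hε : IsPrimitiveIn Set.univ ε) :
    ∃ z : F[G], z * ε ≠ 0 ∧ (∀ a, ∃ c : F, z * a * ε = c • (z * ε)) ∧
      ∀ η : F[G], IsPrimitiveIn Set.univ η → ¬ IdemEquiv ε η → ∀ a, z * a * η = 0 := by
  cases nonempty_fintype G
  obtain ⟨τ, -, hτ1, hτm, hτ0⟩ := hF.exists_form hε
  obtain ⟨z, hz⟩ := exists_coeffOne_mul τ
  refine ⟨z, fun h0 => ?_, fun a => ⟨τ a, eq_of_coeffOne_mul fun b => ?_⟩, fun η hη hne a =>
    eq_of_coeffOne_mul fun b => ?_⟩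
  · have := hz ε
    rw [h0, map_zero, hτ1] at this
    exact zero_ne_one this
  · have h1 : τ (ε * b) = τ b := by
      rw [← hε.2.1, hτm, hτ1, one_mul]
    rw [mul_assoc, mul_assoc, hz, ← mul_assoc, hτm, smul_mul_assoc, mul_assoc, map_smul, hz, h1,
      smul_eq_mul]
  · rw [mul_assoc, mul_assoc, hz, ← mul_assoc, hτ0 η hη hne, zero_mul, map_zero]

variable {e : CentralIdempotent F G}

theorem TDelta.exists_rank (x : F[G × G]) : ∃ φ : TDelta e →+ ℤ, ∀ M : PerfectBimod e,
    φ M.cls = Module.finrank F (LinearMap.range (M.rep.asAlgebraHom x)) := by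
  refine TDelta.exists_lift _ (fun M N h => ?_) fun M N => ?_
  · obtain ⟨φ⟩ := h
    have h1 : (LinearMap.range (M.rep.asAlgebraHom x)).map (φ.toLinearEquiv : _ →ₗ[F] _) =
        LinearMap.range (N.rep.asAlgebraHom x) := by
      have h2 : ∀ m, φ.toLinearEquiv (M.rep.asAlgebraHom x m) =
        N.rep.asAlgebraHom x (φ.toLinearEquiv m) := intertwine_asAlgebraHom φ.toIntertwiningMap x
      ext y
      constructor
      · rintro ⟨_, ⟨m, rfl⟩, rfl⟩
        exact ⟨φ.toLinearEquiv m, (h2 m).symm⟩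
      · rintro ⟨m, rfl⟩
        refine ⟨_, ⟨φ.toLinearEquiv.symm m, rfl⟩, ?_⟩
        rw [LinearEquiv.coe_coe, h2, LinearEquiv.apply_symm_apply]
    rw [← h1, LinearEquiv.finrank_map_eq]
  · have := M.perfect.finite
    have := N.perfect.finite
    have h1 : (M.add N).rep.asAlgebraHom x =
        (M.rep.asAlgebraHom x).prodMap (N.rep.asAlgebraHom x) :=
      LinearMap.ext fun v => asAlgebraHom_prod M.rep N.rep x v
    rw [h1, ← Nat.cast_add]
    exact congrArg _ (finrank_range_prodMap _ _)

omit [Finite G] in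
theorem pmk_ne_zero {a b : F[G]} {x : leftIdeal a} {y : rightIdeal b} (hx : x ≠ 0) (hy : y ≠ 0) :
    pmk a b x y ≠ 0 := by
  intro h
  refine hx ((Module.forall_dual_apply_eq_zero_iff F x).1 fun f => ?_)
  have h1 := congrArg (plift (LinearMap.lsmul F (rightIdeal b) ∘ₗ f)) h
  rw [map_zero, plift_pmk] at h1
  exact (smul_eq_zero.1 h1).resolve_right hy

omit [Finite G] in
theorem pairRep_emb {a b : F[G]} (ha : a * a = a) (hb : b * b = b) (z z' : F[G])
    (x : leftIdeal a) (y : rightIdeal b) :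
    (pairRep a b).asAlgebraHom (leftEmb F G z * rightEmb F G z') (pmk a b x y) =
      pmk a b (projL a (z * x)) (projR b (y * invol z')) := by
  have h1 := leftAct_pairRep a b z x ((rightIdealRep b).asAlgebraHom z' y)
  have h2 := rightAct_pairRep a b (invol z') x y
  rw [leftAct_eq] at h1
  rw [rightAct, rightRep_asAlgebraHom, invol_invol] at h2
  rw [map_mul, Module.End.mul_apply]
  refine (congrArg _ h2).trans (h1.trans (congrArg₂ (fun s t => pmk a b s t)
    (Subtype.ext ?_) (Subtype.ext ?_)))
  · rw [leftIdealRep_act, coe_projL, mul_assoc, (mem_leftIdeal ha).1 x.2]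
  · have := rightIdealRep_act b (invol z') y
    rw [invol_invol] at this
    rw [this, coe_projR, ← mul_assoc, (mem_rightIdeal hb).1 y.2]

omit [Finite G] in
theorem coe_projR_invol {b : F[G]} (z : F[G]) (y : rightIdeal b) :
    (projR b (y * invol z) : F[G]) = invol (z * invol y * invol b) := by
  rw [coe_projR, invol_mul, invol_mul, invol_invol, invol_invol]

omit [Finite G] in
theorem finrank_range_pairRep_emb_eq_zero {a b z z' : F[G]} (ha : a * a = a) (hb : b * b = b)
    (h : (∀ x, z * x * a = 0) ∨ ∀ x, z' * x * invol b = 0) :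
    Module.finrank F (LinearMap.range
      ((pairRep a b).asAlgebraHom (leftEmb F G z * rightEmb F G z'))) = 0 := by
  rw [show (pairRep a b).asAlgebraHom (leftEmb F G z * rightEmb F G z') = 0 from ?_,
    LinearMap.range_zero, finrank_bot]
  refine pair_ext fun x y => ?_
  rw [pairRep_emb ha hb, LinearMap.zero_apply]
  rcases h with h | h
  · rw [show projL a (z * x) = 0 from Subtype.ext (h x), map_zero]
    rfl
  · rw [show projR b (y * invol z') = 0 from Subtype.ext (by
      rw [coe_projR_invol, h, invol_zero]; rfl), map_zero]

omit [Finite G] in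
theorem finrank_range_pairRep_emb {a b z z' : F[G]} (ha : a * a = a) (hb : b * b = b)
    (h0 : z * a ≠ 0) (h1 : ∀ x, ∃ c : F, z * x * a = c • (z * a)) (h0' : z' * invol b ≠ 0)
    (h1' : ∀ x, ∃ c : F, z' * x * invol b = c • (z' * invol b)) :
    Module.finrank F (LinearMap.range
      ((pairRep a b).asAlgebraHom (leftEmb F G z * rightEmb F G z'))) = 1 := by
  set p := pmk a b (projL a z) (projR b (invol z')) with hpdef
  have hproj : (projR b (invol z') : F[G]) = invol (z' * invol b) := by
    rw [coe_projR, invol_mul, invol_invol]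
  have hp : p ≠ 0 := by
    refine pmk_ne_zero (fun h => h0 (congrArg Subtype.val h)) fun h => h0' (invol_injective ?_)
    rw [← hproj, h, invol_zero]
    rfl
  have : LinearMap.range ((pairRep a b).asAlgebraHom (leftEmb F G z * rightEmb F G z')) =
      Submodule.span F {p} := by
    refine le_antisymm ?_ ((Submodule.span_singleton_le_iff_mem _ _).2
      ⟨pmk a b (projL a 1) (projR b 1), ?_⟩)
    · rintro _ ⟨v, rfl⟩
      refine (Submodule.Quotient.mk_eq_zero _).1 (LinearMap.congr_fun
        (f := (Submodule.span F {p}).mkQ ∘ₗ (pairRep a b).asAlgebraHom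
          (leftEmb F G z * rightEmb F G z')) (g := 0) (pair_ext fun x y => ?_) v)
      rw [LinearMap.comp_apply, pairRep_emb ha hb]
      obtain ⟨c, hc⟩ := h1 x
      obtain ⟨d, hd⟩ := h1' (invol y)
      have e1 : projL a (z * x) = c • projL a z := Subtype.ext hc
      have e2 : projR b (y * invol z') = d • projR b (invol z') := Subtype.ext (by
        rw [coe_projR_invol, hd, Submodule.coe_smul, hproj, invol_smul])
      rw [e1, e2, map_smul (pmk a b), LinearMap.smul_apply, map_smul, map_smul, map_smul, ← hpdef,
        Submodule.mkQ_apply, (Submodule.Quotient.mk_eq_zero _).2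
          (Submodule.mem_span_singleton_self p), smul_zero, smul_zero, LinearMap.zero_apply]
    · rw [pairRep_emb ha hb]
      refine congrArg₂ (fun s t => pmk a b s t) (Subtype.ext ?_) (Subtype.ext ?_)
      · rw [coe_projL, coe_projL, coe_projL, one_mul, mul_assoc, ha]
      · rw [coe_projR, coe_projR, coe_projR, mul_one, ← mul_assoc, hb]
  rw [this, finrank_span_singleton hp]

variable {n : ℕ} (s : PIMSystem e n)

/-- Linear forms on `T^Δ(B,B)` dual to the classes of the bimodules `P_{ij}`: the rank of a suitable
element of `F[G × G]`. -/
theorem PIMSystem.exists_coord (hF : HasScalarEnds F F[G]) (i j : Fin n) :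
    ∃ φ : TDelta e →+ ℤ, ∀ k l, φ (s.cls k l) = if k = i ∧ l = j then 1 else 0 := by
  obtain ⟨z, hz0, hz1, hz2⟩ := exists_socle_element hF (s.isPrimitive i)
  obtain ⟨z', hz0', hz1', hz2'⟩ := exists_socle_element hF (s.isPrimitive j).invol
  obtain ⟨φ, hφ⟩ := TDelta.exists_rank (e := e) (leftEmb F G z * rightEmb F G z')
  refine ⟨φ, fun k l => ?_⟩
  have hk := (s.primitive k).2.1
  have hl := (s.primitive l).2.1
  refine (hφ (s.bimod k l)).trans ?_
  split_ifs with hkl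
  · obtain ⟨rfl, rfl⟩ := hkl
    exact congrArg Nat.cast (finrank_range_pairRep_emb hk hl hz0 hz1 hz0' hz1')
  · rw [not_and_or] at hkl
    exact congrArg Nat.cast (finrank_range_pairRep_emb_eq_zero hk hl (hkl.imp
      (fun h => hz2 _ (s.isPrimitive k) fun h' => h (s.isTopSystem.not_equiv _ _ h').symm)
      fun h => hz2' _ (s.isPrimitive l).invol
        fun h' => h (s.isTopSystem.invol.not_equiv _ _ h').symm))

end Coordinates

/-! ### Finite sets with a group action -/

section GSets

open MulAction

section Abelian

variable {A : Type*} [CommGroup A] {X Y : Type*} [MulAction A X] [MulAction A Y]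

theorem stabilizer_smul_of_comm (a : A) (x : X) : stabilizer A (a • x) = stabilizer A x := by
  ext b
  rw [mem_stabilizer_iff, mem_stabilizer_iff, smul_smul, mul_comm, mul_smul, smul_left_cancel_iff]

theorem stabilizer_out (x : X) :
    stabilizer A (Quotient.mk (orbitRel A X) x).out = stabilizer A x := by
  obtain ⟨a, ha⟩ := (orbitRel A X).symm (Quotient.mk_out (s := orbitRel A X) x)
  conv_rhs => rw [← ha]
  exact (stabilizer_smul_of_comm a (Quotient.mk (orbitRel A X) x).out).symm

theorem fixedPoints_bot : fixedPoints (⊥ : Subgroup A) X = Set.univ := by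
  ext z
  simp only [mem_fixedPoints, Set.mem_univ, iff_true]
  rintro ⟨a, ha⟩
  rw [Subgroup.mem_bot] at ha
  rw [Subgroup.mk_smul, ha, one_smul]

open Classical in
theorem card_fixedPoints_eq_sum [Fintype (Subgroup A)] [Finite X] (H : Subgroup A) :
    Nat.card (fixedPoints H X) = Nat.card {x : X // stabilizer A x = H} +
      ∑ K ∈ Finset.univ.filter (H < ·), Nat.card {x : X // stabilizer A x = K} := by
  have := Fintype.ofFinite X
  have h1 : Nat.card (fixedPoints H X) =
      (Finset.univ.filter fun z : X => H ≤ stabilizer A z).card := by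
    rw [Nat.card_eq_fintype_card, Fintype.card_of_subtype]
    intro z
    simp only [Finset.mem_filter, Finset.mem_univ, true_and]
    exact ⟨fun hz a => hz a.2, fun hz a ha => hz ⟨a, ha⟩⟩
  rw [h1, Finset.card_eq_sum_card_fiberwise (f := stabilizer A)
    (t := insert H (Finset.univ.filter (H < ·))), Finset.sum_insert (by simp)]
  · congr 1
    · rw [Nat.card_eq_fintype_card, Fintype.card_subtype, Finset.filter_filter]
      congr 1
      ext z
      simp only [Finset.mem_filter, Finset.mem_univ, true_and]
      exact ⟨fun h => h.2, fun h => ⟨h.ge, h⟩⟩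
    · refine Finset.sum_congr rfl fun K hK => ?_
      rw [Nat.card_eq_fintype_card, Fintype.card_subtype, Finset.filter_filter]
      congr 1
      ext z
      simp only [Finset.mem_filter, Finset.mem_univ, true_and] at hK ⊢
      exact ⟨fun h => h.2, fun h => ⟨h ▸ hK.le, h⟩⟩
  · intro z hz
    simp only [Finset.coe_filter, Finset.mem_univ, true_and, Set.mem_ofPred_eq] at hz
    simpa [eq_comm, le_iff_eq_or_lt] using hz

variable [Finite A] [Finite X] [Finite Y]

theorem card_stabilizer_eq_of_card_fixedPoints
    (h : ∀ H : Subgroup A, Nat.card (fixedPoints H X) = Nat.card (fixedPoints H Y))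
    (H : Subgroup A) :
    Nat.card {x : X // stabilizer A x = H} = Nat.card {y : Y // stabilizer A y = H} := by
  classical
  have := Fintype.ofFinite X
  have := Fintype.ofFinite Y
  have := Fintype.ofFinite (Subgroup A)
  induction H using WellFoundedGT.induction with
  | ind H ih =>
    have hX := card_fixedPoints_eq_sum (X := X) H
    rw [h, card_fixedPoints_eq_sum (X := Y)] at hX
    have hs := Finset.sum_congr (rfl : Finset.univ.filter (H < ·) = _) fun K hK =>
      ih K (Finset.mem_filter.1 hK).2
    rw [hs] at hX
    exact (Nat.add_right_cancel hX).symm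

omit [Finite A] in
theorem card_stabilizer_eq_mul (H : Subgroup A) : Nat.card {x : X // stabilizer A x = H} =
    Nat.card {ω : orbitRel.Quotient A X // stabilizer A ω.out = H} * H.index := by
  classical
  have := Fintype.ofFinite X
  have : Fintype (orbitRel.Quotient A X) := Fintype.ofFinite _
  rw [Nat.card_eq_fintype_card, Fintype.card_subtype, Nat.card_eq_fintype_card,
    Fintype.card_subtype, Finset.card_eq_sum_card_fiberwise
      (f := fun x => (Quotient.mk (orbitRel A X) x))
      (t := Finset.univ.filter fun ω : orbitRel.Quotient A X => stabilizer A ω.out = H)]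
  · rw [Finset.sum_const_nat]
    intro ω hω
    rw [Finset.mem_filter] at hω
    rw [← hω.2, index_stabilizer, Set.ncard_eq_toFinset_card']
    congr 1
    ext x
    simp only [Finset.mem_filter, Finset.mem_univ, true_and, Set.mem_toFinset]
    constructor
    · rintro ⟨-, rfl⟩
      exact (orbitRel A X).symm (Quotient.mk_out (s := orbitRel A X) x)
    · intro hx
      have : Quotient.mk (orbitRel A X) x = ω := by
        rw [← Quotient.out_eq ω]
        exact Quotient.sound hx
      rw [← stabilizer_out, this]
      exact ⟨rfl, rfl⟩
  · intro x hx
    simp only [Finset.coe_filter, Finset.mem_univ, true_and, Set.mem_ofPred_eq] at hx ⊢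
    rw [stabilizer_out, hx]

/-- A finite set with an action of a finite abelian group is determined up to isomorphism by the
numbers of fixed points of the subgroups. -/
theorem exists_equivariant_equiv_of_card_fixedPoints
    (h : ∀ H : Subgroup A, Nat.card (fixedPoints H X) = Nat.card (fixedPoints H Y)) :
    ∃ φ : X ≃ Y, ∀ (a : A) (x : X), φ (a • x) = a • φ x := by
  have h1 : ∀ H : Subgroup A, Nonempty
      ({ω : orbitRel.Quotient A X // stabilizer A ω.out = H} ≃
        {ω : orbitRel.Quotient A Y // stabilizer A ω.out = H}) := fun H => by
    rw [← Finite.card_eq]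
    have := card_stabilizer_eq_of_card_fixedPoints h H
    rw [card_stabilizer_eq_mul, card_stabilizer_eq_mul] at this
    exact Nat.eq_of_mul_eq_mul_right (Nat.pos_of_ne_zero Subgroup.index_ne_zero_of_finite) this
  let ψ := Equiv.ofFiberEquiv fun H => (h1 H).some
  have hψ : ∀ ω, stabilizer A (ψ ω).out = stabilizer A ω.out :=
    fun ω => Equiv.ofFiberEquiv_map (fun H => (h1 H).some) ω
  have h2 : ∀ x : X, ∃ a : A, a • (Quotient.mk (orbitRel A X) x).out = x := fun x =>
    (orbitRel A X).symm (Quotient.mk_out (s := orbitRel A X) x)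
  choose c hc using h2
  let Φ : X → Y := fun x => c x • (ψ (Quotient.mk (orbitRel A X) x)).out
  have hΦ : ∀ (a : A) (ω : orbitRel.Quotient A X), Φ (a • ω.out) = a • (ψ ω).out := by
    intro a ω
    have h3 : Quotient.mk (orbitRel A X) (a • ω.out) = ω := by
      conv_rhs => rw [← Quotient.out_eq ω]
      exact Quotient.sound ⟨a, rfl⟩
    have h4 := hc (a • ω.out)
    change c (a • ω.out) • (ψ (Quotient.mk (orbitRel A X) (a • ω.out))).out = _
    rw [h3] at h4 ⊢
    rw [← inv_smul_eq_iff, smul_smul, ← mem_stabilizer_iff] at h4 ⊢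
    rwa [hψ]
  have hex : ∀ x : X, ∃ (a : A) (ω : orbitRel.Quotient A X), x = a • ω.out :=
    fun x => ⟨c x, _, (hc x).symm⟩
  have hcard : Nat.card X = Nat.card Y := by
    have := h ⊥
    rw [fixedPoints_bot, fixedPoints_bot] at this
    simpa using this
  have hinj : Function.Injective Φ := by
    intro x x' hxx
    obtain ⟨a, ω, rfl⟩ := hex x
    obtain ⟨a', ω', rfl⟩ := hex x'
    rw [hΦ, hΦ] at hxx
    have h5 : ω = ω' := by
      apply ψ.injective
      rw [← Quotient.out_eq (ψ ω), ← Quotient.out_eq (ψ ω')]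
      refine Quotient.sound ⟨a⁻¹ * a', ?_⟩
      change (a⁻¹ * a') • _ = _
      rw [mul_smul, ← hxx, inv_smul_smul]
    subst h5
    rw [← inv_smul_eq_iff, smul_smul, ← mem_stabilizer_iff] at hxx ⊢
    rwa [hψ] at hxx
  have := Fintype.ofFinite X
  have := Fintype.ofFinite Y
  refine ⟨Equiv.ofBijective Φ ((Fintype.bijective_iff_injective_and_card Φ).2
    ⟨hinj, by simpa only [Nat.card_eq_fintype_card] using hcard⟩), fun a x => ?_⟩
  obtain ⟨b, ω, rfl⟩ := hex x
  rw [Equiv.ofBijective_apply, Equiv.ofBijective_apply, smul_smul, hΦ, hΦ, mul_smul]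

end Abelian

variable {G : Type v} [Group G] [Finite G]

/-- As `K`, take the `q`-hyperelementary subgroup of Brauer's induction theorem: the extension of the
group generated by the `q'`-part of `x` by a Sylow `q`-subgroup of its normalizer quotient. -/
theorem exists_subgroup_card_fixedBy {p q : ℕ} [Fact p.Prime] [Fact q.Prime] (hpq : q ≠ p) (x : G)
    (hx : ¬ p ∣ orderOf x) :
    ∃ K : Subgroup G, ¬ p ∣ Nat.card K ∧ ¬ q ∣ Nat.card (fixedBy (G ⧸ K) x) := by
  classical
  have hq := (Fact.out : q.Prime)
  obtain ⟨n, m, hm, hnm⟩ := Nat.exists_eq_pow_mul_and_not_dvd (orderOf_pos x).ne' q hq.one_lt.ne'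
  have hy : orderOf (x ^ q ^ n) = m := by
    rw [orderOf_pow_of_dvd (pow_ne_zero _ hq.pos.ne') ⟨m, hnm⟩, hnm,
      Nat.mul_div_cancel_left _ (pow_pos hq.pos _)]
  set y := x ^ q ^ n with hydef
  let Z := Subgroup.zpowers y
  let N := Subgroup.normalizer (Z : Set G)
  let S : Sylow q (N ⧸ Z.subgroupOf N) := default
  let H : Subgroup N := (S : Subgroup (N ⧸ Z.subgroupOf N)).comap (QuotientGroup.mk' _)
  let K := H.map N.subtype
  have hKN : K ≤ N := Subgroup.map_subtype_le H
  have hZK : Z ≤ K := by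
    intro z hz
    refine ⟨⟨z, Subgroup.le_normalizer hz⟩, ?_, rfl⟩
    change QuotientGroup.mk _ ∈ (S : Subgroup (N ⧸ Z.subgroupOf N))
    rw [(QuotientGroup.eq_one_iff _).2 (Subgroup.mem_subgroupOf.2 hz)]
    exact one_mem _
  have hK : ∀ h ∈ K, ∃ k, h ^ q ^ k ∈ Z := by
    rintro _ ⟨h, hh, rfl⟩
    obtain ⟨k, hk⟩ := S.2 ⟨_, hh⟩
    refine ⟨k, ?_⟩
    have h1 : (QuotientGroup.mk (h ^ q ^ k) : N ⧸ Z.subgroupOf N) = 1 := congrArg Subtype.val hk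
    rw [QuotientGroup.eq_one_iff, Subgroup.mem_subgroupOf] at h1
    exact h1
  have hZm : ∀ z ∈ Z, z ^ m = 1 := by
    rintro _ ⟨i, rfl⟩
    change (y ^ i) ^ m = 1
    rw [← zpow_natCast, zpow_comm, zpow_natCast, ← hy, pow_orderOf_eq_one, one_zpow]
  have hpm : ¬ p ∣ m := fun h => hx (hnm ▸ dvd_mul_of_dvd_right h _)
  refine ⟨K, fun hp => ?_, ?_⟩
  · obtain ⟨⟨h, hh⟩, hord⟩ := exists_prime_orderOf_dvd_card' p hp
    rw [Subgroup.orderOf_mk] at hord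
    obtain ⟨k, hk⟩ := hK h hh
    have h1 : p ∣ q ^ k * m := by
      rw [← hord]
      apply orderOf_dvd_of_pow_eq_one
      rw [pow_mul, hZm _ hk]
    rcases (Nat.Prime.dvd_mul Fact.out).1 h1 with h2 | h2
    · exact hpq ((Nat.prime_dvd_prime_iff_eq Fact.out hq).1
        ((Fact.out : p.Prime).dvd_of_dvd_pow h2)).symm
    · exact hpm h2
  have hfix : ∀ g : G, (y • (g : G ⧸ K) = g ↔ g ∈ N) := by
    intro g
    have h0 : y • (g : G ⧸ K) = g ↔ g⁻¹ * y * g ∈ K := by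
      rw [eq_comm]
      change ((g : G ⧸ K) = ((y * g : G) : G ⧸ K)) ↔ _
      rw [QuotientGroup.eq, mul_assoc]
    rw [h0]
    constructor
    · intro hg
      -- an element of `K` of order prime to `q` lies in `⟨y⟩`
      have h1 : g⁻¹ * y * g ∈ Z := by
        obtain ⟨k, hk⟩ := hK _ hg
        have h2 : Nat.Coprime (orderOf (g⁻¹ * y * g)) (q ^ k) := by
          have : orderOf (g⁻¹ * y * g) = m := by
            rw [← hy]
            have := (MulAut.conj g⁻¹).orderOf_eq y
            rwa [MulAut.conj_apply, inv_inv] at this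
          rw [this]
          exact ((Nat.Prime.coprime_pow_of_not_dvd hq hm))
        obtain ⟨j, hj⟩ := exists_pow_eq_self_of_coprime h2.symm
        rw [← hj]
        exact pow_mem hk j
      have hle : Z.map (MulAut.conj g⁻¹).toMonoidHom ≤ Z := by
        rintro _ ⟨_, ⟨i, rfl⟩, rfl⟩
        change MulAut.conj g⁻¹ (y ^ i) ∈ Z
        rw [map_zpow, MulAut.conj_apply, inv_inv]
        exact zpow_mem h1 i
      have heq : Z.map (MulAut.conj g⁻¹).toMonoidHom = Z :=
        Subgroup.eq_of_le_of_card_ge hle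
          (Subgroup.card_map_of_injective (MulAut.conj g⁻¹).injective).ge
      rw [← inv_mem_iff]
      refine Subgroup.mem_normalizer_iff.2 fun z => ?_
      constructor
      · intro hz
        rw [← heq]
        exact ⟨z, hz, rfl⟩
      · intro hz
        rw [← heq] at hz
        obtain ⟨z', hz', h3⟩ := hz
        have := (MulAut.conj g⁻¹).injective (h3.trans (MulAut.conj_apply g⁻¹ z).symm)
        rwa [← this]
    · intro hg
      have := (Subgroup.mem_normalizer_iff.1 (inv_mem hg) y).1 (Subgroup.mem_zpowers y)
      rw [inv_inv] at this
      exact hZK this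
  have hcard : Nat.card (fixedBy (G ⧸ K) y) = (S : Subgroup (N ⧸ Z.subgroupOf N)).index := by
    have h1 := Nat.card_congr (QuotientGroup.preimageMkEquivSubgroupProdSet K (fixedBy (G ⧸ K) y))
    have h2 : (QuotientGroup.mk ⁻¹' (fixedBy (G ⧸ K) y) : Set G) = N := by
      ext g
      exact hfix g
    rw [h2, Nat.card_prod] at h1
    have h3 : Nat.card K = Nat.card H := Subgroup.card_map_of_injective N.subtype_injective
    have h4 := H.card_mul_index
    rw [Subgroup.index_comap_of_surjective _ (QuotientGroup.mk'_surjective _)] at h4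
    rw [← h3] at h4
    exact Nat.eq_of_mul_eq_mul_left Nat.card_pos (h1.symm.trans h4.symm)
  intro hdvd
  apply S.not_dvd_index
  rw [← hcard]
  have := Fintype.ofFinite (fixedBy (G ⧸ K) y)
  let f : Function.End (fixedBy (G ⧸ K) y) := fun z => ⟨x • z.1, by
    have hz : y • z.1 = z.1 := z.2
    change y • x • z.1 = x • z.1
    rw [smul_smul, (Commute.pow_self x _).eq, mul_smul]
    exact congrArg (x • ·) hz⟩
  have hf : ∀ (j : ℕ) z, ((f ^ j) z).1 = x ^ j • z.1 := by
    intro j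
    induction j with
    | zero => intro z; rw [pow_zero, pow_zero, one_smul]; rfl
    | succ j ih =>
      intro z
      rw [pow_succ', pow_succ', mul_smul, ← ih]; rfl
  have hmod := Equiv.Perm.card_fixedPoints_modEq (f := f) (p := q) (n := n)
    (funext fun z => Subtype.ext (by rw [hf, ← hydef]; exact z.2))
  rw [← Nat.card_eq_fintype_card, ← Nat.card_eq_fintype_card] at hmod
  have hcf : Nat.card (Function.fixedPoints f) = Nat.card (fixedBy (G ⧸ K) x) := by
    refine Nat.card_congr ⟨fun z => ⟨z.1.1, congrArg Subtype.val z.2⟩, fun z => ⟨⟨z.1, ?_⟩,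
      Subtype.ext z.2⟩, fun _ => rfl, fun _ => rfl⟩
    have : z.1 ∈ fixedBy (G ⧸ K) x := z.2
    exact (mem_stabilizer_iff.1 (pow_mem (mem_stabilizer_iff.2 this) (q ^ n)))
  rw [hcf] at hmod
  exact (hmod.dvd_iff dvd_rfl).2 hdvd

end GSets

/-! ### Virtual `G`-sets with stabilizers of order prime to `p` -/

section VirtualGSets

open MulAction

section

variable {G : Type v} [Group G] {X Y : Type*} [MulAction G X] [MulAction G Y] [Finite X] [Finite Y]

theorem card_fixedBy_sum (g : G) :
    Nat.card (fixedBy (X ⊕ Y) g) = Nat.card (fixedBy X g) + Nat.card (fixedBy Y g) := by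
  rw [← Nat.card_sum]
  refine Nat.card_congr ⟨fun z => ?_, fun z => ?_, ?_, ?_⟩
  · exact match z with
      | ⟨.inl x, hx⟩ => .inl ⟨x, Sum.inl_injective hx⟩
      | ⟨.inr y, hy⟩ => .inr ⟨y, Sum.inr_injective hy⟩
  · exact match z with
      | .inl x => ⟨.inl x.1, congrArg Sum.inl x.2⟩
      | .inr y => ⟨.inr y.1, congrArg Sum.inr y.2⟩
  · rintro ⟨_ | _, _⟩ <;> rfl
  · rintro (_ | _) <;> rfl

omit [Finite X] [Finite Y] in
theorem card_fixedBy_prod (g : G) :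
    Nat.card (fixedBy (X × Y) g) = Nat.card (fixedBy X g) * Nat.card (fixedBy Y g) := by
  rw [← Nat.card_prod]
  exact Nat.card_congr ⟨fun z => (⟨z.1.1, congrArg Prod.fst z.2⟩, ⟨z.1.2, congrArg Prod.snd z.2⟩),
    fun z => ⟨(z.1.1, z.2.1), Prod.ext z.1.2 z.2.2⟩, fun _ => rfl, fun _ => rfl⟩

end

/-- All stabilizers of the action of `G` on `X` have order prime to `p`. -/
def HasRegularStabilizers (p : ℕ) (G : Type*) [Group G] (X : Type*) [MulAction G X] : Prop :=
  ∀ x : X, ¬ p ∣ Nat.card (stabilizer G x)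

section

variable {p : ℕ} {G : Type v} [Group G] [Finite G] {X Y : Type*} [MulAction G X] [MulAction G Y]

omit [Finite G] in
theorem HasRegularStabilizers.sum (hX : HasRegularStabilizers p G X)
    (hY : HasRegularStabilizers p G Y) : HasRegularStabilizers p G (X ⊕ Y) := by
  rintro (x | y)
  · have : stabilizer G (Sum.inl x : X ⊕ Y) = stabilizer G x := by
      ext g
      exact Sum.inl_injective.eq_iff
    rw [this]
    exact hX x
  · have : stabilizer G (Sum.inr y : X ⊕ Y) = stabilizer G y := by
      ext g
      exact Sum.inr_injective.eq_iff
    rw [this]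
    exact hY y

omit [Finite G] in
theorem HasRegularStabilizers.prod (hX : HasRegularStabilizers p G X) :
    HasRegularStabilizers p G (X × Y) := by
  intro z h
  refine hX z.1 (h.trans (Subgroup.card_dvd_of_le fun g hg => ?_))
  exact congrArg Prod.fst hg

omit [Finite G] in
theorem hasRegularStabilizers_quotient {K : Subgroup G} (hK : ¬ p ∣ Nat.card K) :
    HasRegularStabilizers p G (G ⧸ K) := by
  intro z
  obtain ⟨g, rfl⟩ := QuotientGroup.mk_surjective z
  have h1 : ((g : G) : G ⧸ K) = g • ((1 : G) : G ⧸ K) := by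
    change _ = ((g * 1 : G) : G ⧸ K)
    rw [mul_one]
  rw [h1, stabilizer_smul_eq_stabilizer_map_conj,
    Subgroup.card_map_of_injective (MulAut.conj g).injective]
  rwa [stabilizer_quotient]

variable (p G) in
/-- The functions `g ↦ |X^g| - |Y^g|`, for finite `G`-sets `X` and `Y` with stabilizers of order
prime to `p`. -/
def regularMarks : AddSubgroup (G → ℤ) where
  carrier := {f | ∃ (X Y : Type v) (_ : Finite X) (_ : Finite Y) (_ : MulAction G X)
    (_ : MulAction G Y), HasRegularStabilizers p G X ∧ HasRegularStabilizers p G Y ∧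
      ∀ g, f g = Nat.card (fixedBy X g) - Nat.card (fixedBy Y g)}
  zero_mem' := ⟨PEmpty, PEmpty, inferInstance, inferInstance,
    { smul := fun _ => id, one_smul := fun _ => rfl, mul_smul := fun _ _ _ => rfl },
    { smul := fun _ => id, one_smul := fun _ => rfl, mul_smul := fun _ _ _ => rfl },
    fun x => x.elim, fun x => x.elim, fun g => by simp⟩
  add_mem' := by
    rintro f f' ⟨X, Y, _, _, _, _, hX, hY, hf⟩ ⟨X', Y', _, _, _, _, hX', hY', hf'⟩
    refine ⟨X ⊕ X', Y ⊕ Y', inferInstance, inferInstance, inferInstance, inferInstance,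
      hX.sum hX', hY.sum hY', fun g => ?_⟩
    rw [Pi.add_apply, hf, hf', card_fixedBy_sum, card_fixedBy_sum]
    push_cast
    ring
  neg_mem' := by
    rintro f ⟨X, Y, _, _, _, _, hX, hY, hf⟩
    exact ⟨Y, X, inferInstance, inferInstance, inferInstance, inferInstance, hY, hX, fun g => by
      rw [Pi.neg_apply, hf, neg_sub]⟩

omit [Finite G] in
theorem mul_mem_regularMarks {f f' : G → ℤ} (hf : f ∈ regularMarks p G)
    (hf' : f' ∈ regularMarks p G) : f * f' ∈ regularMarks p G := by
  obtain ⟨X, Y, _, _, _, _, hX, hY, hf⟩ := hf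
  obtain ⟨X', Y', _, _, _, _, hX', hY', hf'⟩ := hf'
  refine ⟨(X × X') ⊕ (Y × Y'), (X × Y') ⊕ (Y × X'), inferInstance, inferInstance, inferInstance,
    inferInstance, hX.prod.sum hY.prod, hX.prod.sum hY.prod, fun g => ?_⟩
  rw [Pi.mul_apply, hf, hf', card_fixedBy_sum, card_fixedBy_sum, card_fixedBy_prod,
    card_fixedBy_prod, card_fixedBy_prod, card_fixedBy_prod]
  push_cast
  ring

/-- The values of `regularMarks` at `x` form an ideal of `ℤ`. By `exists_subgroup_card_fixedBy`, its
generator is not divisible by primes other than `p`. -/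
theorem exists_regularMarks_apply_eq [Fact p.Prime] (x : G) (hx : ¬ p ∣ orderOf x) :
    ∃ f ∈ regularMarks p G, ∃ a : ℕ, f x = p ^ a := by
  let I : AddSubgroup ℤ := (regularMarks p G).map (Pi.evalAddMonoidHom (fun _ : G => ℤ) x)
  obtain ⟨d, hd⟩ := Int.subgroup_cyclic I
  have hq : ∀ q : ℕ, q.Prime → q ≠ p → ¬ (q : ℤ) ∣ d := by
    intro q hq hqp hqd
    have := Fact.mk hq
    obtain ⟨K, hK1, hK2⟩ := exists_subgroup_card_fixedBy hqp x hx
    have hI : (Nat.card (fixedBy (G ⧸ K) x) : ℤ) ∈ I := by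
      refine ⟨fun g => Nat.card (fixedBy (G ⧸ K) g), ⟨G ⧸ K, PEmpty, inferInstance, inferInstance,
        inferInstance,
        { smul := fun _ => id, one_smul := fun _ => rfl, mul_smul := fun _ _ _ => rfl },
        hasRegularStabilizers_quotient hK1, fun x => x.elim, fun g => by simp⟩, rfl⟩
    rw [hd, AddSubgroup.mem_closure_singleton] at hI
    obtain ⟨c, hc⟩ := hI
    apply hK2
    rw [← Int.natCast_dvd_natCast, ← hc, smul_eq_mul]
    exact dvd_mul_of_dvd_right hqd c
  have hd0 : d ≠ 0 := by
    rintro rfl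
    obtain ⟨q, hq1, hq2⟩ := Nat.exists_infinite_primes (p + 1)
    exact hq q hq2 (by omega) (dvd_zero _)
  have hpow : d.natAbs = p ^ (d.natAbs.primeFactorsList.length) := by
    refine Nat.eq_prime_pow_of_unique_prime_dvd (Int.natAbs_ne_zero.2 hd0) fun {q} h1 h2 => ?_
    by_contra h3
    exact hq q h1 h3 (Int.natCast_dvd.2 h2)
  have hmem : (d.natAbs : ℤ) ∈ I := by
    have : d ∈ I := hd ▸ AddSubgroup.subset_closure rfl
    rcases Int.natAbs_eq d with h | h
    · rwa [← h]
    · rw [← neg_mem_iff, ← h]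
      exact this
  obtain ⟨f, hf, hfx⟩ := hmem
  exact ⟨f, hf, _, by rw [← Nat.cast_pow, ← hpow]; exact hfx⟩

/-- The combination `p ^ b f + p ^ a f' - f f'` is `p ^ (a + b)` wherever `f` equals `p ^ a` or `f'`
equals `p ^ b`, so that the elements of `G` can be treated one by one. -/
theorem exists_regularMarks_eq [Fact p.Prime] :
    ∃ f ∈ regularMarks p G, ∃ a : ℕ, ∀ x : G, ¬ p ∣ orderOf x → f x = p ^ a := by
  classical
  have := Fintype.ofFinite G
  have key : ∀ s : Finset G, ∃ f ∈ regularMarks p G, ∃ a : ℕ,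
      ∀ x ∈ s, ¬ p ∣ orderOf x → f x = p ^ a := by
    intro s
    induction s using Finset.induction_on with
    | empty => exact ⟨0, zero_mem _, 0, by simp⟩
    | insert x s _ ih =>
      obtain ⟨f, hf, a, ha⟩ := ih
      by_cases hx : p ∣ orderOf x
      · refine ⟨f, hf, a, fun y hy hpy => ?_⟩
        rcases Finset.mem_insert.1 hy with rfl | hy
        · exact absurd hx hpy
        · exact ha y hy hpy
      obtain ⟨f', hf', b, hb⟩ := exists_regularMarks_apply_eq x hx
      refine ⟨p ^ b • f + p ^ a • f' - f * f', sub_mem (add_mem (nsmul_mem hf _) (nsmul_mem hf' _))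
        (mul_mem_regularMarks hf hf'), a + b, fun y hy hpy => ?_⟩
      change p ^ b • f y + p ^ a • f' y - f y * f' y = _
      rw [nsmul_eq_mul, nsmul_eq_mul, Nat.cast_pow, Nat.cast_pow]
      rcases Finset.mem_insert.1 hy with rfl | hy
      · rw [hb]; ring
      · rw [ha y hy hpy]; ring
  obtain ⟨f, hf, a, ha⟩ := key Finset.univ
  exact ⟨f, hf, a, fun x => ha x (Finset.mem_univ x)⟩

/-- There are finite `G`-sets `X` and `Y` with stabilizers of order prime to `p` such that, on
restriction to each cyclic subgroup of order prime to `p`, `X` is isomorphic to the disjoint union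
of `Y` and a trivial `G`-set whose cardinality is a power of `p` that does not depend on the
subgroup. -/
theorem exists_gSets (p : ℕ) [Fact p.Prime] (G : Type v) [Group G] [Finite G] :
    ∃ (X Y : Type v) (_ : Finite X) (_ : Finite Y) (_ : MulAction G X) (_ : MulAction G Y) (a : ℕ),
      HasRegularStabilizers p G X ∧ HasRegularStabilizers p G Y ∧
      ∀ g : G, ¬ p ∣ orderOf g → ∃ φ : X ≃ Y ⊕ Fin (p ^ a),
        ∀ x, φ (g • x) = Sum.map (g • ·) id (φ x) := by
  obtain ⟨f, ⟨X, Y, _, _, _, _, hX, hY, hf⟩, a, ha⟩ := exists_regularMarks_eq (p := p) (G := G)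
  refine ⟨X, Y, inferInstance, inferInstance, inferInstance, inferInstance, a, hX, hY,
    fun g hg => ?_⟩
  let _ : MulAction (Subgroup.zpowers g) (Fin (p ^ a)) :=
    { smul := fun _ => id, one_smul := fun _ => rfl, mul_smul := fun _ _ _ => rfl }
  let _ : CommGroup (Subgroup.zpowers g) := IsCyclic.commGroup
  obtain ⟨φ, hφ⟩ := exists_equivariant_equiv_of_card_fixedPoints (A := Subgroup.zpowers g) (X := X)
    (Y := Y ⊕ Fin (p ^ a)) fun H => by
      obtain ⟨h, hh⟩ := (isCyclic_iff_exists_zpowers_eq_top (α := H)).1 inferInstance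
      have key : ∀ (Z : Type v) [MulAction (Subgroup.zpowers g) Z],
          fixedPoints H Z = fixedBy Z (h : Subgroup.zpowers g) := by
        intro Z _
        ext z
        constructor
        · intro hz
          exact hz h
        · intro hz b
          have hb : b ∈ Subgroup.zpowers h := hh ▸ Subgroup.mem_top b
          obtain ⟨i, rfl⟩ := hb
          exact (stabilizer H z).zpow_mem (mem_stabilizer_iff.2 hz) i
      rw [key, key, card_fixedBy_sum]
      have h1 : ¬ p ∣ orderOf (h : G) := fun h2 => hg (h2.trans
        (orderOf_dvd_of_mem_zpowers (h : Subgroup.zpowers g).2))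
      have h2 := ha _ h1
      rw [hf] at h2
      have h3 : fixedBy (Fin (p ^ a)) (h : Subgroup.zpowers g) = Set.univ :=
        Set.eq_univ_of_forall fun _ => rfl
      rw [h3, Nat.card_coe_set_eq, Nat.card_coe_set_eq, Nat.card_coe_set_eq, Set.ncard_univ,
        Nat.card_fin]
      rw [Nat.card_coe_set_eq, Nat.card_coe_set_eq] at h2
      have h4 : (fixedBy X (h : Subgroup.zpowers g)) = fixedBy X (h : G) := rfl
      have h5 : (fixedBy Y (h : Subgroup.zpowers g)) = fixedBy Y (h : G) := rfl
      rw [h4, h5]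
      zify
      linarith
  refine ⟨φ, fun x => (hφ ⟨g, Subgroup.mem_zpowers g⟩ x).trans ?_⟩
  rcases φ x with y | i <;> rfl

end

end VirtualGSets

/-! ### Permutation modules with coefficients -/

section Weights

variable {F : Type*} [Field F] {G : Type*} [Group G] [Fintype G]

open MulAction in
/-- An invariant function on a finite `G`-set is a trace, if it vanishes at the points whose
stabilizers have order zero in `F`. -/
theorem exists_weight {X : Type*} [MulAction G X] (c : X → F) (hc : ∀ (g : G) x, c (g • x) = c x)
    (h0 : ∀ x, (Nat.card (stabilizer G x) : F) = 0 → c x = 0) :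
    ∃ w : X → F, ∀ x, ∑ g : G, w (g • x) = c x := by
  classical
  refine ⟨fun x => if x = (Quotient.mk (orbitRel G X) x).out then
    c x / Nat.card (stabilizer G x) else 0, fun x => ?_⟩
  obtain ⟨b, hb⟩ := (orbitRel G X).symm (Quotient.mk_out (s := orbitRel G X) x)
  set r := (Quotient.mk (orbitRel G X) x).out with hr
  have hmk : ∀ g : G, Quotient.mk (orbitRel G X) (g • r) = Quotient.mk (orbitRel G X) x :=
    fun g => by
      conv_rhs => rw [← Quotient.out_eq (Quotient.mk (orbitRel G X) x), ← hr]
      exact Quotient.sound ⟨g, rfl⟩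
  rw [← hb] at hmk ⊢
  simp only [smul_smul] at hmk ⊢
  change ∑ g : G, (if (g * b) • r = (Quotient.mk (orbitRel G X) ((g * b) • r)).out then
    c ((g * b) • r) / Nat.card (stabilizer G ((g * b) • r)) else 0) = c (b • r)
  refine (Equiv.sum_comp (Equiv.mulRight b) (fun g : G => if g • r =
    (Quotient.mk (orbitRel G X) (g • r)).out then
      c (g • r) / Nat.card (stabilizer G (g • r)) else 0)).trans ?_
  have h1 : ∀ g : G, (Quotient.mk (orbitRel G X) (g • r)).out = r := fun g => by
    rw [hmk]
    exact congrArg (fun y => (Quotient.mk (orbitRel G X) y).out) hb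
  have h2 : ∀ g : G, (if g • r = (Quotient.mk (orbitRel G X) (g • r)).out then
      c (g • r) / Nat.card (stabilizer G (g • r)) else 0) =
      if g ∈ stabilizer G r then c r / Nat.card (stabilizer G r) else 0 := by
    intro g
    rw [h1]
    by_cases hg : g • r = r
    · rw [if_pos hg, if_pos (mem_stabilizer_iff.2 hg), hg]
    · rw [if_neg hg, if_neg (mt mem_stabilizer_iff.1 hg)]
  rw [Finset.sum_congr rfl fun g _ => h2 g, ← Finset.sum_filter, Finset.sum_const, hc, nsmul_eq_mul]
  have h3 : (Finset.univ.filter fun g : G => g ∈ stabilizer G r).card =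
      Nat.card (stabilizer G r) := by
    rw [Nat.card_eq_fintype_card, Fintype.card_of_subtype]
    simp
  rw [h3]
  by_cases h : (Nat.card (stabilizer G r) : F) = 0
  · rw [h0 r h, zero_div, mul_zero]
  · rw [mul_div_cancel₀ _ h]

end Weights

section PermutationModules

variable {F : Type u} [Field F] {G : Type v} [Group G]

/-- The representation of `G` on the space `F[X] ⊗ S` of functions from a `G`-set `X` to an
`F[G]`-module `S`. -/
noncomputable def permRep (X : Type*) [MulAction G X] (S : Type*) [AddCommGroup S] [Module F S]
    [Module F[G] S] [IsScalarTower F F[G] S] : Representation F G (X → S) where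
  toFun g :=
    { toFun := fun f x => MonoidAlgebra.single g (1 : F) • f (g⁻¹ • x)
      map_add' := fun f f' => funext fun x => smul_add _ _ _
      map_smul' := fun c f => funext fun x => smul_algebra_smul_comm c _ _ }
  map_one' := LinearMap.ext fun f => funext fun x => by
    change MonoidAlgebra.single (1 : G) (1 : F) • f ((1 : G)⁻¹ • x) = f x
    rw [inv_one, one_smul, ← MonoidAlgebra.one_def, one_smul]
  map_mul' g h := LinearMap.ext fun f => funext fun x => by
    change MonoidAlgebra.single (g * h) (1 : F) • f ((g * h)⁻¹ • x) =
      MonoidAlgebra.single g (1 : F) • MonoidAlgebra.single h (1 : F) • f (h⁻¹ • g⁻¹ • x)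
    rw [smul_smul, smul_smul, MonoidAlgebra.single_mul_single, one_mul, mul_inv_rev]

section

variable (X : Type*) [MulAction G X] (S : Type*) [AddCommGroup S] [Module F S]
  [Module F[G] S] [IsScalarTower F F[G] S]

theorem permRep_apply (g : G) (f : X → S) (x : X) :
    permRep (F := F) X S g f x = MonoidAlgebra.single g (1 : F) • f (g⁻¹ • x) := rfl

/-- The linear map in Higman's criterion is the multiplication with a function on `X` whose trace is
`1`. -/
theorem projective_permRep [Finite G] {p : ℕ} [Fact p.Prime] [CharP F p]
    (hX : HasRegularStabilizers p G X) :
    Module.Projective F[G] (permRep (F := F) (G := G) X S).asModule := by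
  have := Fintype.ofFinite G
  obtain ⟨w, hw⟩ := exists_weight (F := F) (G := G) (X := X) (fun _ => 1) (fun _ _ => rfl)
    fun x hx => (hX x ((CharP.cast_eq_zero_iff F p _).1 hx)).elim
  let θ : (X → S) →ₗ[F] X → S := LinearMap.pi fun x => w x • LinearMap.proj x
  have hθ : ∀ f x, θ f x = w x • f x := fun _ _ => rfl
  refine (projective_iff _).2 ⟨θ, fun f => ?_⟩
  funext x
  rw [Finset.sum_apply]
  have h1 : ∀ g : G, permRep (F := F) X S g (θ (permRep (F := F) X S g⁻¹ f)) x = w (g⁻¹ • x) • f x := by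
    intro g
    rw [permRep_apply, hθ, permRep_apply, smul_algebra_smul_comm, smul_smul, MonoidAlgebra.single_mul_single,
      mul_inv_cancel, one_mul, ← MonoidAlgebra.one_def, one_smul, inv_inv, smul_inv_smul]
  have h2 : ∑ g : G, w (g⁻¹ • x) = 1 :=
    (Equiv.sum_comp (Equiv.inv G) fun g => w (g • x)).trans (hw x)
  rw [Finset.sum_congr rfl fun g _ => h1 g, ← Finset.sum_smul, h2, one_smul]

end

section

variable {A : Type*} [Ring A] [Algebra F A]

theorem rankOf_prod (x : A) (M N : Type*) [AddCommGroup M] [Module F M] [Module A M]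
    [IsScalarTower F A M] [AddCommGroup N] [Module F N] [Module A N] [IsScalarTower F A N]
    [Module.Finite F M] [Module.Finite F N] :
    rankOf F x (M × N) = rankOf F x M + rankOf F x N :=
  finrank_range_prodMap (Algebra.lsmul F F M x) (Algebra.lsmul F F N x)

theorem rankOf_fin (x : A) (M : Type*) [AddCommGroup M] [Module F M] [Module A M]
    [IsScalarTower F A M] [Module.Finite F M] (n : ℕ) :
    rankOf F x (Fin n → M) = n * rankOf F x M := by
  have h : rankOf F x (Fin n → M) =
      Module.finrank F (Fin n → LinearMap.range (Algebra.lsmul F F M x)) := by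
    refine LinearEquiv.finrank_eq
      { toFun := fun z i => ⟨z.1 i, by
          obtain ⟨_, y, rfl⟩ := z
          exact ⟨y i, rfl⟩⟩
        map_add' := fun _ _ => rfl
        map_smul' := fun _ _ => rfl
        invFun := fun z => ⟨fun i => z i, fun i => (z i).2.choose,
          funext fun i => (z i).2.choose_spec⟩
        left_inv := fun _ => rfl
        right_inv := fun _ => rfl }
  rw [h, Module.finrank_pi_fintype, Finset.sum_const, Finset.card_univ, Fintype.card_fin,
    smul_eq_mul]
  rfl

end

end PermutationModules

/-! ### The ranks of idempotents on projective modules -/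

section ProjectiveRanks

variable {F : Type u} [Field F] {G : Type v} [Group G] [Finite G] {e : CentralIdempotent F G}
  {n : ℕ} (s : PIMSystem e n)

omit [Finite G] in
theorem PIMSystem.rankOf_span (i j : Fin n) :
    rankOf F (s.ε i) (Ideal.span {s.ε j} : Ideal F[G]) = s.cartanNat i j := by
  have hj := (s.primitive j).2.1
  rw [PIMSystem.cartanNat, rankOf]
  refine LinearEquiv.finrank_eq (LinearEquiv.ofBijective
    (LinearMap.codRestrict (cornerSpace (s.ε i) (s.ε j))
      (((Submodule.subtype (Ideal.span {s.ε j})).restrictScalars F).domRestrict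
        (LinearMap.range (Algebra.lsmul F F (Ideal.span {s.ε j} : Ideal F[G]) (s.ε i)))) ?_)
    ⟨fun a b hab => ?_, ?_⟩)
  · rintro ⟨_, z, rfl⟩
    refine ⟨z.1, ?_⟩
    rw [LinearMap.comp_apply, LinearMap.mulRight_apply, (mem_span_idem hj).1 z.2]
    rfl
  · exact Subtype.ext (Subtype.ext (congrArg (fun z : cornerSpace (s.ε i) (s.ε j) => (z : F[G])) hab))
  · rintro ⟨_, z, rfl⟩
    exact ⟨⟨_, ⟨z * s.ε j, (mem_span_idem hj).2 (by rw [mul_assoc, hj])⟩, rfl⟩, rfl⟩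

/-- On a projective module, the ranks of the idempotents `ε i` are the entries of an integral
combination of the columns of the Cartan matrix. -/
theorem PIMSystem.exists_rankOf_eq (Q : Type*) [AddCommGroup Q] [Module F Q] [Module F[G] Q]
    [IsScalarTower F F[G] Q] [Module.Finite F Q] [Module.Projective F[G] Q] :
    ∃ d : Fin n → ℕ, ∀ i, rankOf F (s.ε i) Q = ∑ m, s.cartanNat i m * d m := by
  classical
  induction hN : Module.finrank F Q using Nat.strong_induction_on generalizing Q with
  | _ N ih =>
    by_cases hnt : Nontrivial Q
    swap
    · rw [not_nontrivial_iff_subsingleton] at hnt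
      exact ⟨0, fun i => by rw [rankOf_eq_zero fun m => Subsingleton.elim _ _]; simp⟩
    by_cases hdec : ∀ U W : Submodule F[G] Q, IsCompl U W → U = ⊥ ∨ W = ⊥
    · have hind : IsIndecomposable F[G] Q := ⟨hnt, hdec⟩
      have hfin : Module.Finite F[G] Q := Module.Finite.of_restrictScalars_finite F F[G] Q
      have hU : IsCompl (LinearMap.ker (IsLinearMap.mk' (fun m : Q => e.val • m)
          ⟨smul_add _, fun a m => by rw [smul_smul, smul_smul, e.central]⟩))
          (LinearMap.range (IsLinearMap.mk' (fun m : Q => e.val • m)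
          ⟨smul_add _, fun a m => by rw [smul_smul, smul_smul, e.central]⟩)) := by
        constructor
        · rw [Submodule.disjoint_def]
          rintro _ hm ⟨m, rfl⟩
          change e.val • e.val • m = 0 at hm
          rwa [smul_smul, e.idem] at hm
        · rw [codisjoint_iff, eq_top_iff]
          intro m _
          refine Submodule.mem_sup.2 ⟨m - e.val • m, ?_, e.val • m, ⟨m, rfl⟩, by abel⟩
          change e.val • (m - e.val • m) = 0
          rw [smul_sub, smul_smul, e.idem, sub_self]
      rcases hdec _ _ hU with h | h
      · have he : ∀ m : Q, e.val • m = m := fun m => by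
          have : m - e.val • m ∈ (⊥ : Submodule F[G] Q) := by
            rw [← h]
            change e.val • (m - e.val • m) = 0
            rw [smul_sub, smul_smul, e.idem, sub_self]
          exact (sub_eq_zero.1 this).symm
        obtain ⟨j, ⟨φ⟩⟩ := s.isTopSystem.complete Q hind he
        refine ⟨Pi.single j 1, fun i => ?_⟩
        rw [rankOf_congr φ, s.rankOf_span, Finset.sum_eq_single j]
        · simp
        · intro m _ hm
          rw [Pi.single_eq_of_ne hm, mul_zero]
        · simp
      · refine ⟨0, fun i => ?_⟩
        rw [rankOf_eq_zero]
        · simp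
        · intro m
          rw [← (s.primitive i).1, e.central, mul_smul]
          have : e.val • m ∈ (⊥ : Submodule F[G] Q) := h ▸ ⟨m, rfl⟩
          rw [(Submodule.mem_bot _).1 this, smul_zero]
    · push Not at hdec
      obtain ⟨U, W, hUW, hU, hW⟩ := hdec
      have hfU := finite_submodule (F := F) U
      have hfW := finite_submodule (F := F) W
      have hpU : Module.Projective F[G] U := Module.Projective.of_split U.subtype
        (U.projectionOnto W hUW) (Submodule.projectionOnto_comp_subtype hUW)
      have hpW : Module.Projective F[G] W := Module.Projective.of_split W.subtype
        (W.projectionOnto U hUW.symm) (Submodule.projectionOnto_comp_subtype hUW.symm)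
      have hsum : Module.finrank F U + Module.finrank F W = Module.finrank F Q := by
        rw [← Module.finrank_prod]
        exact LinearEquiv.finrank_eq ((Submodule.prodEquivOfIsCompl U W hUW).restrictScalars F)
      have hntU := Submodule.nontrivial_iff_ne_bot.2 hU
      have hntW := Submodule.nontrivial_iff_ne_bot.2 hW
      have h1 := Module.finrank_pos (R := F) (M := U)
      have h2 := Module.finrank_pos (R := F) (M := W)
      obtain ⟨d, hd⟩ := ih _ (by omega) U rfl
      obtain ⟨d', hd'⟩ := ih _ (by omega) W rfl
      refine ⟨d + d', fun i => ?_⟩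
      rw [← rankOf_congr (Submodule.prodEquivOfIsCompl U W hUW), rankOf_prod, hd, hd',
        ← Finset.sum_add_distrib]
      exact Finset.sum_congr rfl fun m _ => (mul_add _ _ _).symm

end ProjectiveRanks

/-! ### Traces of group elements -/

section Traces

variable {F : Type u} [Field F]

section

variable {A : Type w} [Ring A] [Algebra F A]

theorem traceOf_isNilpotent {a : A} (ha : IsNilpotent a) (M : Type*) [AddCommGroup M] [Module F M]
    [Module A M] [IsScalarTower F A M] : traceOf F a M = 0 :=
  IsNilpotent.eq_zero (LinearMap.isNilpotent_trace_of_isNilpotent (ha.map (Algebra.lsmul F F M)))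

/-- In a split commutative algebra, every element is a combination of idempotents up to a nilpotent
element. -/
theorem exists_idempotents_of_comm [FiniteDimensional F A] (hA : HasScalarEnds F A)
    (hcomm : ∀ x y : A, x * y = y * x) (a : A) : ∃ (k : ℕ) (c : Fin k → F) (η : Fin k → A),
      (∀ i, η i * η i = η i) ∧ IsNilpotent (a - ∑ i, c i • η i) := by
  obtain ⟨k, η, h1, h2, h3, h4⟩ := exists_primitive_decomposition F Set.univ (1 : A) trivial
    (one_mul 1)
  choose τ hτ hτ1 hτ2 using fun i => hA.exists_form (h1 i)
  refine ⟨k, fun i => τ i a, η, fun i => (h1 i).2.1, ?_⟩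
  have hsum : a - ∑ i, τ i a • η i = ∑ i, (η i * a * η i - τ i a • η i) := by
    rw [Finset.sum_sub_distrib]
    congr 1
    have : ∀ i, η i * a * η i = η i * a := fun i => by
      rw [mul_assoc, hcomm a, ← mul_assoc, (h1 i).2.1]
    simp only [this]
    rw [← Finset.sum_mul, h4, one_mul]
  rw [hsum]
  refine Commute.isNilpotent_sum (fun i _ => ?_) fun i j _ _ => hcomm _ _
  have hi := (h1 i).2.1
  refine ((h1 i).isNilpotent_or_exists_inv F (x := η i * a * η i - τ i a • η i) ?_ ?_).resolve_right
    ?_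
  · rw [mul_sub, mul_smul_comm, hi, ← mul_assoc, ← mul_assoc, hi]
  · rw [sub_mul, smul_mul_assoc, hi, mul_assoc, hi]
  · rintro ⟨y, -, -, hy, -⟩
    obtain ⟨S, _, _, _, v, hv, hv0⟩ := exists_simple_of_idem hi (h1 i).2.2.1
    apply hv0
    rw [← hv, ← hy, mul_smul, sub_smul, hτ, Algebra.smul_def, mul_smul, sub_self, smul_zero]

end

variable {G : Type v} [Group G] [Finite G] {p : ℕ} [Fact p.Prime] [CharP F p]

omit [Finite G] in
/-- The difference of two elements of the group algebra that commute, and have the same power with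
exponent a power of `p`, is nilpotent. -/
theorem isNilpotent_single_sub {g h : G} (hgh : Commute g h) {N : ℕ}
    (hpow : g ^ p ^ N = h ^ p ^ N) :
    IsNilpotent (MonoidAlgebra.single g (1 : F) - MonoidAlgebra.single h (1 : F)) := by
  refine ⟨p ^ N, ?_⟩
  have : CharP F[G] p := charP_of_injective_algebraMap (algebraMap F F[G]).injective p
  rw [sub_pow_char_pow_of_commute, MonoidAlgebra.single_pow, MonoidAlgebra.single_pow, hpow,
    sub_self]
  rw [commute_iff_eq, MonoidAlgebra.single_mul_single, MonoidAlgebra.single_mul_single, hgh.eq]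

/-- The `p'`-part of an element of a finite group. -/
theorem exists_regular_part (p : ℕ) [Fact p.Prime] (g : G) :
    ∃ h : G, Commute g h ∧ ¬ p ∣ orderOf h ∧ ∃ N, g ^ p ^ N = h ^ p ^ N := by
  have hp := (Fact.out : p.Prime)
  obtain ⟨N, m, hm, hNm⟩ := Nat.exists_eq_pow_mul_and_not_dvd (orderOf_pos g).ne' p hp.one_lt.ne'
  obtain ⟨k, hk1, hk2⟩ := Nat.chineseRemainder
    (Nat.Prime.coprime_pow_of_not_dvd (m := N) hp hm).symm 0 1
  refine ⟨g ^ k, Commute.self_pow g k, fun h => hm (h.trans (orderOf_dvd_of_pow_eq_one ?_)), N, ?_⟩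
  · rw [← pow_mul, ← orderOf_dvd_iff_pow_eq_one, hNm]
    exact Nat.mul_dvd_mul_right ((Nat.modEq_zero_iff_dvd).1 hk1) m
  · rw [← pow_mul, pow_eq_pow_iff_modEq, hNm, mul_comm k]
    have := (Nat.ModEq.mul_left' (p ^ N) hk2).symm
    rwa [mul_one] at this

/-- Let `M` and `N` be `F[G]`-modules that become isomorphic on restriction to each cyclic subgroup
of order prime to `p`. Then they have the same composition factors. -/
theorem rankOf_eq_of_regular (hF : IsSplittingFor F G) {M N : Type (max u v)}
    [AddCommGroup M] [Module F M] [Module F[G] M] [IsScalarTower F F[G] M] [Module.Finite F M]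
    [AddCommGroup N] [Module F N] [Module F[G] N] [IsScalarTower F F[G] N] [Module.Finite F N]
    (h : ∀ g : G, ¬ p ∣ orderOf g → ∃ φ : M ≃ₗ[F] N, ∀ m,
      φ (MonoidAlgebra.single g (1 : F) • m) = MonoidAlgebra.single g (1 : F) • φ m)
    {x : F[G]} (hx : x * x = x) : rankOf F x M = rankOf F x N := by
  classical
  have hA := hF.hasScalarEnds
  obtain ⟨n, ε, hε, -⟩ := exists_topSystem F (1 : F[G]) (fun x => by rw [one_mul, mul_one])
    (one_mul 1)
  obtain ⟨S, _, _, hS⟩ := hε.exists_simpleFamily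
  let _ : ∀ i, Module F (S i) := fun i => Module.compHom (S i) (algebraMap F F[G])
  have : ∀ i, IsScalarTower F F[G] (S i) := fun i => ⟨fun c a s => by
    rw [Algebra.smul_def, mul_smul]; rfl⟩
  have hfin : ∀ i, Module.Finite F (S i) := fun i => by
    have := hS.simple i
    have : Module.Finite F[G] (S i) := inferInstance
    exact Module.Finite.trans F[G] (S i)
  have formula : ∀ y : F[G], y * y = y → ∀ (M : Type (max u v)) [AddCommGroup M] [Module F M]
      [Module F[G] M] [IsScalarTower F F[G] M] [Module.Finite F M],
        (rankOf F y M : ℤ) = ∑ i, rankOf F (ε i) M • (rankOf F y (S i) : ℤ) := by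
    intro y hy M _ _ _ _ _
    refine hε.additive_formula hA (one_mul 1) hS
      (fun (M : Type (max u v)) _ _ _ _ => (rankOf F y M : ℤ)) ?_ ?_ ?_ M
    · intro M M' _ _ _ _ _ _ _ _ φ
      rw [rankOf_congr φ]
    · intro M _ _ _ _ h0
      rw [rankOf_eq_zero fun m => by rw [← one_smul F[G] m, h0, smul_zero], Nat.cast_zero]
    · intro M _ _ _ _ _ N
      rw [rankOf_add hy N, Nat.cast_add]
  -- the vectors `d` of multiplicities that vanish on restriction to the cyclic subgroups of order
  -- prime to `p`: the traces show that `p` divides `d`, and then `d / p` has the same property, so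
  -- that `d` is zero
  let P : (Fin n → ℤ) → Prop := fun d => ∀ g : G, ¬ p ∣ orderOf g →
    ∀ y : F[Subgroup.zpowers g], y * y = y → ∑ i, d i * rankOf F
      (MonoidAlgebra.mapDomainAlgHom F F (Subgroup.zpowers g).subtype y) (S i) = 0
  have hdvd : ∀ d, P d → ∀ i, (p : ℤ) ∣ d i := by
    intro d hd j
    have htr : ∀ a : F[G], ∑ i, (d i : F) * traceOf F a (S i) = 0 := by
      intro a
      induction a using MonoidAlgebra.induction_linear with
      | zero => simp [traceOf]
      | add a b ha hb =>
        have : ∀ i, traceOf F (a + b) (S i) = traceOf F a (S i) + traceOf F b (S i) := fun i => by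
          rw [traceOf, map_add, map_add]; rfl
        simp only [this, mul_add, Finset.sum_add_distrib, ha, hb, add_zero]
      | single g c =>
        have hsm : ∀ (b : F[G]) i, traceOf F (c • b) (S i) = c * traceOf F b (S i) :=
          fun b i => by rw [traceOf, map_smul, map_smul]; rfl
        rw [← mul_one c, ← smul_eq_mul, ← MonoidAlgebra.smul_single]
        simp only [hsm, mul_left_comm _ c]
        rw [← Finset.mul_sum]
        obtain ⟨h, hgh, hph, N, hN⟩ := exists_regular_part p g
        have hgh' : ∀ i, traceOf F (MonoidAlgebra.single g (1 : F)) (S i) =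
            traceOf F (MonoidAlgebra.single h (1 : F)) (S i) := fun i => by
          have h2 := traceOf_isNilpotent (F := F) (isNilpotent_single_sub (F := F) hgh hN) (S i)
          rwa [traceOf, map_sub, map_sub, sub_eq_zero] at h2
        simp only [hgh']
        clear hgh' hgh hN
        have hcomm : ∀ x y : F[Subgroup.zpowers h], x * y = y * x := by
          let _ : CommGroup (Subgroup.zpowers h) := IsCyclic.commGroup
          exact fun x y => mul_comm x y
        obtain ⟨k, c', η, hη, hnil⟩ := exists_idempotents_of_comm (hF (Subgroup.zpowers h)) hcomm
          (MonoidAlgebra.single ⟨h, Subgroup.mem_zpowers h⟩ 1)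
        let ι := MonoidAlgebra.mapDomainAlgHom F F (Subgroup.zpowers h).subtype
        have h1 : ∀ i, traceOf F (MonoidAlgebra.single h (1 : F)) (S i) =
            ∑ r, c' r * (rankOf F (ι (η r)) (S i) : F) := by
          intro i
          have h2 := traceOf_isNilpotent (F := F) (hnil.map ι) (S i)
          rw [map_sub, map_sum, traceOf, map_sub, map_sub, sub_eq_zero] at h2
          have h3 : ι (MonoidAlgebra.single ⟨h, Subgroup.mem_zpowers h⟩ 1) =
              MonoidAlgebra.single h (1 : F) := MonoidAlgebra.mapDomain_single ..
          rw [h3, map_sum, map_sum] at h2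
          rw [traceOf, h2]
          refine Finset.sum_congr rfl fun r _ => ?_
          rw [← traceOf_idem (by rw [← map_mul, hη]), traceOf, map_smul, map_smul, map_smul]
          rfl
        have h5 : ∑ i, (d i : F) * traceOf F (MonoidAlgebra.single h (1 : F)) (S i) = 0 := by
          simp only [h1, Finset.mul_sum]
          rw [Finset.sum_comm, Finset.sum_eq_zero]
          intro r _
          have h4 := congrArg (Int.cast : ℤ → F) (hd h hph (η r) (hη r))
          push_cast at h4
          simp only [mul_left_comm _ (c' r)]
          rw [← Finset.mul_sum, h4, mul_zero]
        rw [h5, mul_zero]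
    have h1 := htr (ε j)
    have h2 : ∀ i, traceOf F (ε j) (S i) = if i = j then 1 else 0 := by
      intro i
      have := hS.simple i
      obtain ⟨s, hs⟩ := hS.exists_ne i
      rw [traceOf_idem (hε.primitive j).2.1]
      split_ifs with hij
      · subst hij
        rw [rankOf_simple_self hA (hε.primitive i) hs, Nat.cast_one]
      · rw [rankOf_simple_of_not_equiv (hε.primitive j) (hε.primitive i)
          (fun h' => hij (hε.not_equiv _ _ h').symm) hs, Nat.cast_zero]
    simp only [h2, mul_ite, mul_one, mul_zero, Finset.sum_ite_eq', Finset.mem_univ, if_true] at h1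
    exact (CharP.intCast_eq_zero_iff F p _).1 h1
  have hpow : ∀ (k : ℕ) d, P d → ∀ i, (p : ℤ) ^ k ∣ d i := by
    intro k
    induction k with
    | zero => simp
    | succ k ih =>
      intro d hd i
      choose d' hd' using hdvd d hd
      have hP : P d' := by
        intro g hg y hy
        have h1 := hd g hg y hy
        simp only [hd', mul_assoc] at h1
        rw [← Finset.mul_sum] at h1
        exact (mul_eq_zero.1 h1).resolve_left (by exact_mod_cast (Fact.out : p.Prime).ne_zero)
      rw [hd', pow_succ']
      exact mul_dvd_mul_left _ (ih d' hP i)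
  have hzero : ∀ d, P d → ∀ i, d i = 0 := by
    intro d hd i
    refine Int.eq_zero_of_abs_lt_dvd (hpow (d i).natAbs d hd i) ?_
    rw [Int.abs_eq_natAbs]
    exact_mod_cast Nat.lt_pow_self (Fact.out : p.Prime).one_lt
  have hPd : P fun i => (rankOf F (ε i) M : ℤ) - rankOf F (ε i) N := by
    intro g hg y hy
    obtain ⟨φ, hφ⟩ := h g hg
    set ι := MonoidAlgebra.mapDomainAlgHom F F (Subgroup.zpowers g).subtype
    have hι : ι y * ι y = ι y := by rw [← map_mul, hy]
    have hcomm : ∀ (z : F[Subgroup.zpowers g]) (m : M), φ (ι z • m) = ι z • φ m := by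
      intro z
      induction z using MonoidAlgebra.induction_linear with
      | zero => simp
      | add z z' hz hz' => intro m; rw [map_add, add_smul, map_add, hz, hz', add_smul]
      | single k c =>
        obtain ⟨k, hk⟩ := k
        obtain ⟨i, rfl⟩ := (mem_powers_iff_mem_zpowers).2 hk
        intro m
        have h3 : ι (MonoidAlgebra.single ⟨g ^ i, hk⟩ c) =
            algebraMap F F[G] c * MonoidAlgebra.single g (1 : F) ^ i := by
          refine (MonoidAlgebra.mapDomain_single ..).trans ?_
          rw [MonoidAlgebra.single_pow, one_pow, ← Algebra.smul_def, MonoidAlgebra.smul_single,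
            smul_eq_mul, mul_one]
          rfl
        have h4 : ∀ (i : ℕ) (m : M), φ (MonoidAlgebra.single g (1 : F) ^ i • m) =
            MonoidAlgebra.single g (1 : F) ^ i • φ m := by
          intro i
          induction i with
          | zero => intro m; rw [pow_zero, one_smul, one_smul]
          | succ i ih => intro m; rw [pow_succ, mul_smul, ih, hφ, mul_smul]
        rw [h3, mul_smul, mul_smul, algebraMap_smul, algebraMap_smul, map_smul, h4]
    have h1 := formula (ι y) hι M
    have h2 := formula (ι y) hι N
    rw [rankOf_congr_of_comm φ (hcomm y), h2] at h1
    simp only [nsmul_eq_mul] at h1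
    simp only [sub_mul, Finset.sum_sub_distrib]
    rw [h1, sub_self]
  have h1 := formula x hx M
  have h2 := formula x hx N
  have h3 : (rankOf F x M : ℤ) = rankOf F x N := by
    rw [h1, h2]
    refine Finset.sum_congr rfl fun i _ => ?_
    rw [nsmul_eq_mul, nsmul_eq_mul, sub_eq_zero.1 (hzero _ hPd i)]
  exact_mod_cast h3

end Traces

/-! ### The Cartan matrix -/

section Cartan

variable {F : Type u} [Field F] {G : Type v} [Group G] {e : CentralIdempotent F G} {n : ℕ}

/-- The Cartan matrix with entries in `ℤ`. -/
noncomputable def PIMSystem.cartanInt (s : PIMSystem e n) : Matrix (Fin n) (Fin n) ℤ :=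
  .of fun i j => (s.cartanNat i j : ℤ)

theorem PIMSystem.cartan_eq (s : PIMSystem e n) (k : Type*) [Field k] :
    s.cartan k = s.cartanInt.map (Int.castRingHom k) := by
  ext i j
  exact (Int.cast_natCast _).symm

/-- An equivalence of `X` with the union of `Y` and `N` points, compatible with the action of `g`,
induces one of `F[X] ⊗ S` with the sum of `F[Y] ⊗ S` and `N` copies of `S`. -/
theorem exists_permRep_equiv {X Y : Type*} [MulAction G X] [MulAction G Y] {S : Type*}
    [AddCommGroup S] [Module F S] [Module F[G] S] [IsScalarTower F F[G] S] {N : ℕ} {g : G}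
    (ψ : X ≃ Y ⊕ Fin N) (hψ : ∀ x, ψ (g • x) = Sum.map (g • ·) id (ψ x)) :
    ∃ φ : (permRep (F := F) (G := G) X S).asModule ≃ₗ[F]
        (permRep (F := F) (G := G) Y S).asModule × (Fin N → S),
      ∀ m, φ (MonoidAlgebra.single g (1 : F) • m) = MonoidAlgebra.single g (1 : F) • φ m := by
  have hinl : ∀ y, g⁻¹ • ψ.symm (.inl y) = ψ.symm (.inl (g⁻¹ • y)) := fun y => by
    rw [inv_smul_eq_iff, Equiv.symm_apply_eq, hψ, Equiv.apply_symm_apply]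
    exact congrArg Sum.inl (smul_inv_smul g y).symm
  have hinr : ∀ i, g⁻¹ • ψ.symm (.inr i) = ψ.symm (.inr i) := fun i => by
    rw [inv_smul_eq_iff, Equiv.symm_apply_eq, hψ, Equiv.apply_symm_apply]
    rfl
  let σ := permRep (F := F) (G := G) X S
  let τ := permRep (F := F) (G := G) Y S
  refine ⟨
    { toFun := fun f => (τ.asModuleEquiv.symm fun y => σ.asModuleEquiv f (ψ.symm (.inl y)),
        fun i => σ.asModuleEquiv f (ψ.symm (.inr i)))
      map_add' := fun _ _ => rfl
      map_smul' := fun _ _ => rfl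
      invFun := fun f => σ.asModuleEquiv.symm fun x =>
        Sum.elim (τ.asModuleEquiv f.1) f.2 (ψ x)
      left_inv := fun f => ?_
      right_inv := fun f => ?_ }, fun f => ?_⟩
  · refine funext fun x => ?_
    obtain ⟨z, rfl⟩ := ψ.symm.surjective x
    rcases z with y | i
    · change Sum.elim _ _ (ψ (ψ.symm (.inl y))) = _
      rw [ψ.apply_symm_apply]; rfl
    · change Sum.elim _ _ (ψ (ψ.symm (.inr i))) = _
      rw [ψ.apply_symm_apply]; rfl
  · refine Prod.ext (funext fun y => ?_) (funext fun i => ?_)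
    · change Sum.elim _ _ (ψ (ψ.symm (.inl y))) = _
      rw [ψ.apply_symm_apply]; rfl
    · change Sum.elim _ _ (ψ (ψ.symm (.inr i))) = _
      rw [ψ.apply_symm_apply]; rfl
  · rw [single_smul_asModule]
    refine Prod.ext ?_ (funext fun i => ?_)
    · refine Eq.trans ?_ (single_smul_asModule _ _ _).symm
      refine funext fun y => ?_
      change MonoidAlgebra.single g (1 : F) • σ.asModuleEquiv f (g⁻¹ • ψ.symm (.inl y)) =
        MonoidAlgebra.single g (1 : F) • σ.asModuleEquiv f (ψ.symm (.inl (g⁻¹ • y)))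
      rw [hinl]
    · change MonoidAlgebra.single g (1 : F) • σ.asModuleEquiv f (g⁻¹ • ψ.symm (.inr i)) =
        MonoidAlgebra.single g (1 : F) • σ.asModuleEquiv f (ψ.symm (.inr i))
      rw [hinr]

variable [Finite G] {p : ℕ} [Fact p.Prime] [CharP F p]

/-- The Cartan matrix divides a power of `p`: tensoring a simple module with the virtual permutation
module of `exists_gSets` gives a virtual projective module with composition factors a power of `p`
times the given one. -/
theorem PIMSystem.exists_cartanInt_mul (hF : IsSplittingFor F G) (s : PIMSystem e n) :
    ∃ (a : ℕ) (D : Matrix (Fin n) (Fin n) ℤ), s.cartanInt * D = (p : ℤ) ^ a • 1 := by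
  have hA := hF.hasScalarEnds
  obtain ⟨X, Y, _, _, _, _, a, hX, hY, hXY⟩ := exists_gSets p G
  have hε := s.isTopSystem
  obtain ⟨S, _, _, hS⟩ := hε.exists_simpleFamily
  let _ : ∀ i, Module F (S i) := fun i => Module.compHom (S i) (algebraMap F F[G])
  have : ∀ i, IsScalarTower F F[G] (S i) := fun i => ⟨fun c a s => by
    rw [Algebra.smul_def, mul_smul]; rfl⟩
  have hfin : ∀ i, Module.Finite F (S i) := fun i => by
    have := hS.simple i
    have : Module.Finite F[G] (S i) := inferInstance
    exact Module.Finite.trans F[G] (S i)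
  have hfX : ∀ j, Module.Finite F (permRep (F := F) (G := G) X (S j)).asModule := fun j =>
    inferInstanceAs (Module.Finite F (X → S j))
  have hfY : ∀ j, Module.Finite F (permRep (F := F) (G := G) Y (S j)).asModule := fun j =>
    inferInstanceAs (Module.Finite F (Y → S j))
  have hpX := fun j => projective_permRep (F := F) X (S j) hX
  have hpY := fun j => projective_permRep (F := F) Y (S j) hY
  choose dX hdX using fun j => s.exists_rankOf_eq (permRep (F := F) (G := G) X (S j)).asModule
  choose dY hdY using fun j => s.exists_rankOf_eq (permRep (F := F) (G := G) Y (S j)).asModule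
  refine ⟨a, .of fun m j => (dX j m : ℤ) - dY j m, ?_⟩
  ext i j
  have h1 : rankOf F (s.ε i) (permRep (F := F) (G := G) X (S j)).asModule =
      rankOf F (s.ε i) ((permRep (F := F) (G := G) Y (S j)).asModule × (Fin (p ^ a) → S j)) :=
    rankOf_eq_of_regular hF (fun g hg => by
      obtain ⟨ψ, hψ⟩ := hXY g hg
      exact exists_permRep_equiv ψ hψ) (s.primitive i).2.1
  have h2 : rankOf F (s.ε i) (S j) = if i = j then 1 else 0 := by
    have := hS.simple j
    obtain ⟨t, ht⟩ := hS.exists_ne j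
    split_ifs with hij
    · subst hij
      exact rankOf_simple_self hA (hε.primitive i) ht
    · exact rankOf_simple_of_not_equiv (hε.primitive i) (hε.primitive j)
        (fun h' => hij (hε.not_equiv _ _ h')) ht
  rw [rankOf_prod, rankOf_fin, hdX, hdY, h2] at h1
  have h3 := congrArg (Nat.cast : ℕ → ℤ) h1
  push_cast at h3
  rw [Matrix.mul_apply, Matrix.smul_apply, Matrix.one_apply]
  simp only [Matrix.of_apply, PIMSystem.cartanInt, mul_sub, Finset.sum_sub_distrib, h3, smul_eq_mul]
  ring

theorem PIMSystem.isUnit_cartan (hF : IsSplittingFor F G) (s : PIMSystem e n) (k : Type*) [Field k]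
    (hk : ringChar k ≠ p) : IsUnit (s.cartan k) := by
  obtain ⟨a, D, hD⟩ := s.exists_cartanInt_mul (p := p) hF
  have hpk : (p : k) ≠ 0 := fun h => by
    rcases (Nat.dvd_prime (Fact.out : p.Prime)).1 ((ringChar.spec k p).1 h) with h1 | h1
    · exact CharP.ringChar_ne_one h1
    · exact hk h1
  have h1 := congrArg (fun M => M.map (Int.castRingHom k)) hD
  rw [Matrix.map_mul, ← s.cartan_eq] at h1
  refine IsUnit.of_mul_eq_one (((p : k) ^ a)⁻¹ • D.map (Int.castRingHom k)) ?_
  rw [Matrix.mul_smul, h1]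
  ext i j
  rw [Matrix.smul_apply, Matrix.map_apply, Matrix.smul_apply, Matrix.one_apply, Matrix.one_apply]
  split_ifs
  · simp [hpk]
  · simp

end Cartan

/-! ### Primitive idempotents of matrix algebras -/

section MatrixIdempotents

variable {k : Type*} [Field k] {n : ℕ}

open Matrix

theorem vecMulVec_mul_vecMulVec' (v w v' w' : Fin n → k) :
    vecMulVec v w * vecMulVec v' w' = (w ⬝ᵥ v') • vecMulVec v w' := by
  rw [vecMulVec_mul_vecMulVec, vecMulVec_smul]

theorem vecMulVec_ne_zero {v w : Fin n → k} (h : w ⬝ᵥ v = 1) : vecMulVec v w ≠ 0 := by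
  intro h0
  have h1 := congrArg (fun M => M *ᵥ v) h0
  simp only [vecMulVec_mulVec, zero_mulVec, h] at h1
  rw [MulOpposite.op_one, one_smul] at h1
  rw [h1, dotProduct_zero] at h
  exact zero_ne_one h

/-- The primitive idempotents of a matrix algebra are the idempotents of rank one. -/
theorem isPrimitiveIn_matrix_iff {M : Matrix (Fin n) (Fin n) k} :
    IsPrimitiveIn Set.univ M ↔ ∃ v w : Fin n → k, w ⬝ᵥ v = 1 ∧ M = vecMulVec v w := by
  constructor
  · rintro ⟨-, hM, hM0, h⟩
    obtain ⟨i, j, hij⟩ : ∃ i j, M i j ≠ 0 := by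
      by_contra! h0
      exact hM0 (Matrix.ext h0)
    let v : Fin n → k := fun a => M a j
    let w : Fin n → k := fun b => (M i j)⁻¹ * M i b
    have hv : M *ᵥ v = v := funext fun a => congrFun (congrFun hM a) j
    have hw : w ᵥ* M = w := funext fun b => by
      have := congrFun (congrFun hM i) b
      rw [mul_apply] at this
      simp only [w, vecMul, dotProduct, mul_assoc]
      rw [← Finset.mul_sum, this]
    have hwv : w ⬝ᵥ v = 1 := by
      have := congrFun hv i
      simp only [mulVec, dotProduct] at this
      simp only [w, dotProduct, mul_assoc]
      rw [← Finset.mul_sum, this]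
      exact inv_mul_cancel₀ hij
    have h1 : M * vecMulVec v w = vecMulVec v w := by rw [mul_vecMulVec, hv]
    have h2 : vecMulVec v w * M = vecMulVec v w := by rw [vecMulVec_mul, hw]
    have h3 : vecMulVec v w * vecMulVec v w = vecMulVec v w := by
      rw [vecMulVec_mul_vecMulVec', hwv, one_smul]
    refine ⟨v, w, hwv, ?_⟩
    have h4 := h (M - vecMulVec v w) trivial (vecMulVec v w) trivial
      (by rw [sub_mul, mul_sub, mul_sub, hM, h1, h2, h3, sub_self, sub_zero]) h3
      (by rw [sub_mul, h1, h3, sub_self]) (by rw [mul_sub, h2, h3, sub_self]) (sub_add_cancel _ _)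
    exact sub_eq_zero.1 (h4.resolve_right (vecMulVec_ne_zero hwv))
  · rintro ⟨v, w, hwv, rfl⟩
    refine ⟨trivial, by rw [vecMulVec_mul_vecMulVec', hwv, one_smul], vecMulVec_ne_zero hwv, ?_⟩
    intro a _ b _ ha _ hab hba hsum
    -- the corner at a rank one idempotent consists of its scalar multiples
    have h1 : a = vecMulVec v w * a * vecMulVec v w := by
      rw [← hsum, add_mul, ha, hba, add_zero, mul_add, ha, hab, add_zero]
    rw [vecMulVec_mul, vecMulVec_mul_vecMulVec'] at h1
    set c := w ᵥ* a ⬝ᵥ v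
    have h2 : (c * c - c) • vecMulVec v w = 0 := by
      have := ha
      rw [h1, smul_mul_smul_comm, vecMulVec_mul_vecMulVec', hwv, one_smul] at this
      rw [sub_smul, this, sub_self]
    rcases smul_eq_zero.1 h2 with h3 | h3
    · rcases mul_eq_zero.1 (show c * (c - 1) = 0 by linear_combination h3) with h4 | h4
      · left; rw [h1, h4, zero_smul]
      · right
        rw [sub_eq_zero.1 h4, one_smul] at h1
        rw [h1] at hsum
        exact left_eq_add.1 hsum.symm
    · exact (vecMulVec_ne_zero hwv h3).elim

theorem card_eq_of_primitive_decomposition (s : Finset (Matrix (Fin n) (Fin n) k))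
    (h1 : ∀ x ∈ s, IsPrimitiveIn Set.univ x) (h2 : ∀ x ∈ s, ∀ y ∈ s, x ≠ y → x * y = 0)
    (h3 : ∑ x ∈ s, x = 1) : s.card = n := by
  classical
  choose v w hvw hx using fun x : s => isPrimitiveIn_matrix_iff.1 (h1 x.1 x.2)
  let V : Matrix (Fin n) s k := .of fun i x => v x i
  let W : Matrix s (Fin n) k := .of fun x i => w x i
  have hVW : V * W = 1 := by
    rw [← h3, ← Finset.sum_coe_sort]
    ext i j
    rw [mul_apply, Matrix.sum_apply]
    refine Finset.sum_congr rfl fun x _ => ?_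
    rw [hx x]
    rfl
  have hWV : W * V = 1 := by
    ext x y
    change w x ⬝ᵥ v y = _
    rw [one_apply]
    split_ifs with hxy
    · rw [hxy, hvw]
    · have := h2 x.1 x.2 y.1 y.2 fun h => hxy (Subtype.ext h)
      rw [hx x, hx y, vecMulVec_mul_vecMulVec'] at this
      refine (smul_eq_zero.1 this).resolve_right fun h0 => ?_
      obtain ⟨i, hi⟩ : ∃ i, v x i ≠ 0 := by
        by_contra! h
        have := hvw x
        rw [show v x = 0 from funext h, dotProduct_zero] at this
        exact zero_ne_one this
      obtain ⟨j, hj⟩ : ∃ j, w y j ≠ 0 := by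
        by_contra! h
        have := hvw y
        rw [show w y = 0 from funext h, zero_dotProduct] at this
        exact zero_ne_one this
      exact mul_ne_zero hi hj (congrFun (congrFun h0 i) j)
  have := Matrix.square_of_invertible V W hVW hWV
  simpa using this.symm

theorem exists_equiv_of_functional {V : Type*} [AddCommGroup V] [Module k V] [Module.Finite k V]
    (ℓ ℓ' : V →ₗ[k] k) {v v' : V} (hv : ℓ v = 1) (hv' : ℓ' v' = 1) :
    ∃ f : V ≃ₗ[k] V, f v = v' ∧ ∀ x, ℓ' (f x) = ℓ x := by
  have key : ∀ (ℓ : V →ₗ[k] k) (v : V), ℓ v = 1 → ∃ φ : V ≃ₗ[k] k × LinearMap.ker ℓ,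
      φ v = (1, 0) ∧ ∀ x, (φ x).1 = ℓ x := by
    intro ℓ v hv
    let q : V →ₗ[k] LinearMap.ker ℓ := LinearMap.codRestrict _
      (LinearMap.id - ℓ.smulRight v) fun x => by simp [hv]
    refine ⟨LinearEquiv.ofLinearMap (ℓ.prod q)
      ((LinearMap.toSpanSingleton k V v).coprod (LinearMap.ker ℓ).subtype) ?_ ?_, ?_,
        fun x => rfl⟩
    · refine LinearMap.ext fun z => ?_
      have hz : ℓ (z.1 • v + z.2) = z.1 := by
        rw [map_add, map_smul, hv, z.2.2, smul_eq_mul, mul_one, add_zero]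
      refine Prod.ext hz (Subtype.ext ?_)
      change (z.1 • v + z.2) - ℓ (z.1 • v + z.2) • v = z.2
      rw [hz, add_sub_cancel_left]
    · refine LinearMap.ext fun x => ?_
      change ℓ x • v + (x - ℓ x • v) = x
      abel
    · refine Prod.ext hv (Subtype.ext ?_)
      change v - ℓ v • v = 0
      rw [hv, one_smul, sub_self]
  obtain ⟨φ, hφ, hφ1⟩ := key ℓ v hv
  obtain ⟨φ', hφ', hφ1'⟩ := key ℓ' v' hv'
  have hdim : Module.finrank k (LinearMap.ker ℓ) = Module.finrank k (LinearMap.ker ℓ') := by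
    have h1 := φ.finrank_eq
    have h2 := φ'.finrank_eq
    rw [Module.finrank_prod] at h1 h2
    omega
  let ψ := (LinearEquiv.refl k k).prodCongr (LinearEquiv.ofFinrankEq _ _ hdim)
  refine ⟨(φ.trans ψ).trans φ'.symm, ?_, fun x => ?_⟩
  · rw [LinearEquiv.trans_apply, LinearEquiv.symm_apply_eq, hφ', LinearEquiv.trans_apply, hφ]
    exact Prod.ext rfl (LinearEquiv.map_zero (LinearEquiv.ofFinrankEq _ _ hdim))
  · rw [LinearEquiv.trans_apply, ← hφ1', LinearEquiv.apply_symm_apply, LinearEquiv.trans_apply,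
      ← hφ1]
    rfl

theorem exists_conj_of_primitive {M N : Matrix (Fin n) (Fin n) k}
    (hM : IsPrimitiveIn Set.univ M) (hN : IsPrimitiveIn Set.univ N) :
    ∃ a b : Matrix (Fin n) (Fin n) k, a * b = 1 ∧ b * a = 1 ∧ a * M * b = N := by
  obtain ⟨v, w, hvw, rfl⟩ := isPrimitiveIn_matrix_iff.1 hM
  obtain ⟨v', w', hvw', rfl⟩ := isPrimitiveIn_matrix_iff.1 hN
  obtain ⟨f, hf, hfw⟩ := exists_equiv_of_functional (dotProductBilin k k w)
    (dotProductBilin k k w') hvw hvw'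
  have hba : LinearMap.toMatrix' f.symm.toLinearMap * LinearMap.toMatrix' f.toLinearMap = 1 := by
    rw [← LinearMap.toMatrix'_comp, LinearEquiv.symm_comp, LinearMap.toMatrix'_id]
  refine ⟨LinearMap.toMatrix' f.toLinearMap, LinearMap.toMatrix' f.symm.toLinearMap,
    mul_eq_one_comm.1 hba, hba, ?_⟩
  rw [mul_vecMulVec, vecMulVec_mul, LinearMap.toMatrix'_mulVec]
  congr 1
  refine dotProduct_eq _ _ fun x => ?_
  rw [← dotProduct_mulVec, LinearMap.toMatrix'_mulVec]
  have := hfw (f.symm x)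
  rw [f.apply_symm_apply] at this
  exact this.symm

theorem isPrimitiveIn_single (i : Fin n) :
    IsPrimitiveIn Set.univ (Matrix.single i i (1 : k)) :=
  isPrimitiveIn_matrix_iff.2 ⟨Pi.single i 1, Pi.single i 1, by simp,
    single_eq_single_vecMulVec_single i i⟩

/-- A matrix algebra of positive size has no central idempotents other than `0` and `1`. -/
theorem eq_zero_or_one_of_central {M : Matrix (Fin n) (Fin n) k} (hM : M * M = M)
    (hc : ∀ N, M * N = N * M) : M = 0 ∨ M = 1 := by
  obtain ⟨c, rfl⟩ := mem_range_scalar_iff_commute_single'.2 fun i j => (hc _).symm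
  rcases Nat.eq_zero_or_pos n with rfl | hn
  · exact .inl (Subsingleton.elim _ _)
  have h1 := congrFun (congrFun hM ⟨0, hn⟩) ⟨0, hn⟩
  rw [← map_mul, scalar_apply, scalar_apply, diagonal_apply_eq, diagonal_apply_eq] at h1
  rcases mul_eq_zero.1 (show c * (c - 1) = 0 by linear_combination h1) with h | h
  · left; rw [h, map_zero]
  · right; rw [sub_eq_zero.1 h, map_one]

end MatrixIdempotents

/-! ### Ideals isomorphic to matrix algebras -/

section MatrixIdeals

variable {k : Type*} [Field k] {n : ℕ} {A : Type*} [Ring A] [Algebra k A]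

/-- An ideal `K` of an algebra that is isomorphic to a matrix algebra, through `Θ`. -/
structure IsMatrixIdeal (K : Submodule k A) (Θ : Matrix (Fin n) (Fin n) k →ₗ[k] A) : Prop where
  injective : Function.Injective Θ
  map_mul : ∀ M N, Θ (M * N) = Θ M * Θ N
  range_eq : LinearMap.range Θ = K
  mul_mem : ∀ (a : A), ∀ x ∈ K, a * x ∈ K ∧ x * a ∈ K

namespace IsMatrixIdeal

variable {K : Submodule k A} {Θ : Matrix (Fin n) (Fin n) k →ₗ[k] A} (h : IsMatrixIdeal K Θ)

include h

theorem mem (M : Matrix (Fin n) (Fin n) k) : Θ M ∈ K := h.range_eq ▸ ⟨M, rfl⟩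

theorem exists_eq {x : A} (hx : x ∈ K) : ∃ M, Θ M = x := by
  rw [← h.range_eq] at hx
  exact hx

theorem isPrimitiveIn_iff {M : Matrix (Fin n) (Fin n) k} :
    IsPrimitiveIn (K : Set A) (Θ M) ↔ IsPrimitiveIn Set.univ M := by
  constructor
  · rintro ⟨-, h1, h2, h3⟩
    refine ⟨trivial, h.injective (by rw [h.map_mul, h1]), fun h0 => h2 (by rw [h0, map_zero]),
      fun a _ b _ ha hb hab hba hsum => ?_⟩
    refine (h3 (Θ a) (h.mem a) (Θ b) (h.mem b) (by rw [← h.map_mul, ha]) (by rw [← h.map_mul, hb])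
      (by rw [← h.map_mul, hab, map_zero]) (by rw [← h.map_mul, hba, map_zero])
      (by rw [← map_add, hsum])).imp (fun h0 => h.injective ?_) fun h0 => h.injective ?_
    · rw [h0, map_zero]
    · rw [h0, map_zero]
  · rintro ⟨-, h1, h2, h3⟩
    refine ⟨h.mem M, by rw [← h.map_mul, h1], fun h0 => h2 (h.injective (by rw [h0, map_zero])),
      fun a ha b hb haa hbb hab hba hsum => ?_⟩
    obtain ⟨a, rfl⟩ := h.exists_eq ha
    obtain ⟨b, rfl⟩ := h.exists_eq hb
    rw [← h.map_mul] at haa hbb hab hba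
    refine (h3 a trivial b trivial (h.injective haa) (h.injective hbb)
      (h.injective (by rw [hab, map_zero])) (h.injective (by rw [hba, map_zero]))
      (h.injective (by rw [map_add, hsum]))).imp (fun h0 => ?_) fun h0 => ?_
    · rw [h0, map_zero]
    · rw [h0, map_zero]

theorem one_mul_eq {x : A} (hx : x ∈ K) : Θ 1 * x = x ∧ x * Θ 1 = x := by
  obtain ⟨M, rfl⟩ := h.exists_eq hx
  rw [← h.map_mul, ← h.map_mul, one_mul, mul_one]
  exact ⟨rfl, rfl⟩

theorem one_central (a : A) : Θ 1 * a = a * Θ 1 := by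
  have h1 := (h.one_mul_eq (h.mul_mem a _ (h.mem 1)).1).1
  rw [← h1, ← mul_assoc, (h.one_mul_eq (h.mul_mem a _ (h.mem 1)).2).2]

theorem mem_iff {x : A} : x ∈ K ↔ ∃ t, t * Θ 1 = x :=
  ⟨fun hx => ⟨x, (h.one_mul_eq hx).2⟩, fun ⟨t, ht⟩ => ht ▸ (h.mul_mem t _ (h.mem 1)).1⟩

theorem isPrimitiveIn_center (hn : n ≠ 0) : IsPrimitiveIn (Set.center A) (Θ 1) := by
  refine ⟨Semigroup.mem_center_iff.2 fun a => (h.one_central a).symm,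
    (h.one_mul_eq (h.mem 1)).1, fun h0 => ?_, fun a ha b _ haa _ hab _ hsum => ?_⟩
  · have := Fin.pos_iff_nonempty.1 (Nat.pos_of_ne_zero hn)
    exact one_ne_zero (α := Matrix (Fin n) (Fin n) k) (h.injective (by rw [h0, map_zero]))
  · have h1 : a * Θ 1 = a := by rw [← hsum, mul_add, haa, hab, add_zero]
    obtain ⟨M, rfl⟩ := h.exists_eq (h.mem_iff.2 ⟨a, h1⟩)
    rcases eq_zero_or_one_of_central (M := M) (h.injective (by rw [h.map_mul, haa]))
      (fun N => h.injective (by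
        rw [h.map_mul, h.map_mul, Semigroup.mem_center_iff.1 ha])) with h0 | h0
    · left; rw [h0, map_zero]
    · right
      rw [h0] at hsum
      exact add_eq_left.1 hsum

theorem card_eq (s : Finset A) (h1 : ∀ x ∈ s, IsPrimitiveIn (K : Set A) x)
    (h2 : ∀ x ∈ s, ∀ y ∈ s, x ≠ y → x * y = 0) (h3 : ∑ x ∈ s, x = Θ 1) : s.card = n := by
  classical
  let Θ' : Matrix (Fin n) (Fin n) k ↪ A := ⟨Θ, h.injective⟩
  obtain ⟨t, rfl⟩ : ∃ t : Finset (Matrix (Fin n) (Fin n) k), t.map Θ' = s := by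
    refine ⟨s.preimage Θ h.injective.injOn, ?_⟩
    ext x
    simp only [Finset.mem_map, Finset.mem_preimage]
    constructor
    · rintro ⟨M, hM, rfl⟩
      exact hM
    · intro hx
      obtain ⟨M, rfl⟩ := h.exists_eq (h1 x hx).1
      exact ⟨M, hx, rfl⟩
  rw [Finset.card_map]
  have hmem : ∀ M ∈ t, Θ M ∈ t.map Θ' := fun M hM => Finset.mem_map_of_mem Θ' hM
  refine card_eq_of_primitive_decomposition t (fun M hM => h.isPrimitiveIn_iff.1 (h1 _ (hmem M hM)))
    (fun M hM N hN hMN => h.injective ?_) (h.injective ?_)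
  · rw [h.map_mul, map_zero]
    exact h2 _ (hmem M hM) _ (hmem N hN) fun h0 => hMN (h.injective h0)
  · rw [← h3, Finset.sum_map, map_sum]
    rfl

theorem exists_conj {x y : A} (hx : IsPrimitiveIn (K : Set A) x)
    (hy : IsPrimitiveIn (K : Set A) y) :
    ∃ a ∈ K, ∃ b ∈ K, a * b = Θ 1 ∧ b * a = Θ 1 ∧ a * x * b = y := by
  obtain ⟨M, rfl⟩ := h.exists_eq hx.1
  obtain ⟨N, rfl⟩ := h.exists_eq hy.1
  obtain ⟨a, b, h1, h2, h3⟩ := exists_conj_of_primitive (h.isPrimitiveIn_iff.1 hx)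
    (h.isPrimitiveIn_iff.1 hy)
  exact ⟨Θ a, h.mem a, Θ b, h.mem b, by rw [← h.map_mul, h1], by rw [← h.map_mul, h2],
    by rw [← h.map_mul, ← h.map_mul, h3]⟩

theorem exists_equiv : ∃ φ : K ≃ₗ[k] Matrix (Fin n) (Fin n) k,
    ∀ x y z : K, (x : A) * y = z → φ x * φ y = φ z := by
  let φ := (LinearEquiv.ofInjective Θ h.injective).trans (LinearEquiv.ofEq _ _ h.range_eq)
  have hφ : ∀ x : K, Θ (φ.symm x) = x := fun x =>
    congrArg Subtype.val (φ.apply_symm_apply x)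
  refine ⟨φ.symm, fun x y z hxyz => h.injective ?_⟩
  rw [h.map_mul, hφ, hφ, hφ, hxyz]

end IsMatrixIdeal

end MatrixIdeals

/-! ### Extension of scalars -/

section BaseChange

variable {F : Type u} [Field F] {G : Type v} [Group G] [Finite G] {e : CentralIdempotent F G}
  {n : ℕ} (s : PIMSystem e n) (k : Type w) [Field k]

/-- The linear map `X ↦ ∑ X i j [P_{ij}]`. -/
noncomputable def PIMSystem.clsMap : Matrix (Fin n) (Fin n) k →ₗ[k] kTDelta k e where
  toFun X := ∑ i, ∑ j, X i j ⊗ₜ[ℤ] s.cls i j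
  map_add' X Y := by
    simp only [Matrix.add_apply, TensorProduct.add_tmul, Finset.sum_add_distrib]
  map_smul' c X := by
    simp only [Matrix.smul_apply, Finset.smul_sum, TensorProduct.smul_tmul', RingHom.id_apply]

theorem PIMSystem.clsMap_apply (X : Matrix (Fin n) (Fin n) k) :
    s.clsMap k X = ∑ i, ∑ j, X i j ⊗ₜ[ℤ] s.cls i j := rfl

theorem PIMSystem.clsMap_mul (X Y : Matrix (Fin n) (Fin n) k) :
    s.clsMap k X * s.clsMap k Y = s.clsMap k (X * s.cartan k * Y) := by
  have h1 : ∀ i j a b, X i j ⊗ₜ[ℤ] s.cls i j * Y a b ⊗ₜ[ℤ] s.cls a b =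
      (X i j * s.cartan k j a * Y a b) ⊗ₜ[ℤ] s.cls i b := by
    intro i j a b
    rw [Algebra.TensorProduct.tmul_mul_tmul, s.cls_mul_cls, ← TensorProduct.smul_tmul, nsmul_eq_mul]
    congr 1
    change (s.cartanNat j a : k) * _ = X i j * (s.cartanNat j a : k) * _
    ring
  rw [PIMSystem.clsMap_apply, PIMSystem.clsMap_apply, PIMSystem.clsMap_apply]
  simp only [Finset.sum_mul]
  simp only [Finset.mul_sum, h1]
  simp only [Matrix.mul_apply, Finset.sum_mul, TensorProduct.sum_tmul]
  refine Finset.sum_congr rfl fun i _ => ?_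
  rw [Finset.sum_comm]
  conv_rhs => rw [Finset.sum_comm]
  exact Finset.sum_congr rfl fun a _ => Finset.sum_comm

/-- The extension of scalars of an integral form on `T^Δ(B,B)`. -/
noncomputable def coordMap (φ : TDelta e →+ ℤ) : kTDelta k e →ₗ[k] k :=
  (TensorProduct.AlgebraTensorModule.rid ℤ k k).toLinearMap ∘ₗ
    LinearMap.baseChange k φ.toIntLinearMap

theorem coordMap_tmul (φ : TDelta e →+ ℤ) (c : k) (x : TDelta e) :
    coordMap k φ (c ⊗ₜ[ℤ] x) = (φ x : k) * c := by
  simp [coordMap]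

theorem PIMSystem.exists_coordMap (hF : HasScalarEnds F F[G]) (i j : Fin n) :
    ∃ ξ : kTDelta k e →ₗ[k] k, ∀ X, ξ (s.clsMap k X) = X i j := by
  obtain ⟨φ, hφ⟩ := s.exists_coord hF i j
  refine ⟨coordMap k φ, fun X => ?_⟩
  simp only [PIMSystem.clsMap_apply, map_sum, coordMap_tmul, hφ]
  rw [Finset.sum_eq_single i, Finset.sum_eq_single j]
  · simp
  · intro b _ hb
    simp [hb]
  · simp
  · intro a _ ha
    simp [ha]
  · simp

theorem PIMSystem.clsMap_injective (hF : HasScalarEnds F F[G]) :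
    Function.Injective (s.clsMap k) := by
  intro X Y hXY
  ext i j
  obtain ⟨ξ, hξ⟩ := s.exists_coordMap k hF i j
  rw [← hξ X, hXY, hξ]

theorem PIMSystem.tmul_mem_range (hF : HasScalarEnds F F[G]) (c : k) (x : TDelta e)
    (hx : x ∈ Pr e) : ∃ X, s.clsMap k X = c ⊗ₜ[ℤ] x := by
  rw [s.Pr_eq_span hF, Submodule.mem_span_range_iff_exists_fun] at hx
  obtain ⟨m, rfl⟩ := hx
  refine ⟨.of fun i j => (m (i, j) : k) * c, ?_⟩
  rw [PIMSystem.clsMap_apply, TensorProduct.tmul_sum, Fintype.sum_prod_type]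
  refine Finset.sum_congr rfl fun i _ => Finset.sum_congr rfl fun j _ => ?_
  rw [← TensorProduct.smul_tmul, Matrix.of_apply, zsmul_eq_mul]

theorem PIMSystem.range_clsMap (hF : HasScalarEnds F F[G]) :
    LinearMap.range (s.clsMap k) = kPr k e := by
  refine le_antisymm ?_ ?_
  · rintro _ ⟨X, rfl⟩
    rw [PIMSystem.clsMap_apply]
    refine Submodule.sum_mem _ fun i _ => Submodule.sum_mem _ fun j _ => ?_
    refine Submodule.tmul_mem_baseChange_of_mem _ ?_
    rw [s.Pr_eq_span hF]
    exact Submodule.subset_span ⟨(i, j), rfl⟩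
  · rw [kPr, Submodule.baseChange_eq_span, Submodule.span_le]
    rintro _ ⟨x, hx, rfl⟩
    exact s.tmul_mem_range k hF 1 x hx

theorem baseChange_subtype_injective (hF : HasScalarEnds F F[G]) :
    Function.Injective ((Pr e).subtype.baseChange k) := by
  obtain ⟨s⟩ := nonempty_pimSystem e
  have hmem : ∀ i j, s.cls i j ∈ Pr e := fun i j => by
    rw [s.Pr_eq_span hF]
    exact Submodule.subset_span ⟨(i, j), rfl⟩
  have hrep : ∀ z : k ⊗[ℤ] Pr e, ∃ X : Matrix (Fin (numSimple e)) (Fin (numSimple e)) k,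
      z = ∑ i, ∑ j, X i j ⊗ₜ[ℤ] (⟨s.cls i j, hmem i j⟩ : Pr e) := by
    intro z
    induction z using TensorProduct.induction_on with
    | zero => exact ⟨0, by simp⟩
    | add z z' hz hz' =>
      obtain ⟨X, rfl⟩ := hz
      obtain ⟨Y, rfl⟩ := hz'
      exact ⟨X + Y, by simp only [Matrix.add_apply, TensorProduct.add_tmul, Finset.sum_add_distrib]⟩
    | tmul c x =>
      obtain ⟨x, hx⟩ := x
      have hx' := hx
      rw [s.Pr_eq_span hF, Submodule.mem_span_range_iff_exists_fun] at hx'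
      obtain ⟨m, hm⟩ := hx'
      have h1 : (⟨x, hx⟩ : Pr e) = ∑ z : Fin (numSimple e) × Fin (numSimple e),
          m z • ⟨s.cls z.1 z.2, hmem z.1 z.2⟩ := Subtype.ext (by
        rw [Submodule.coe_sum]
        exact hm.symm)
      refine ⟨.of fun i j => (m (i, j) : k) * c, ?_⟩
      rw [h1, TensorProduct.tmul_sum, Fintype.sum_prod_type]
      refine Finset.sum_congr rfl fun i _ => Finset.sum_congr rfl fun j _ => ?_
      rw [← TensorProduct.smul_tmul, Matrix.of_apply, zsmul_eq_mul]
  rw [injective_iff_map_eq_zero]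
  intro z hz
  obtain ⟨X, rfl⟩ := hrep z
  have h1 : s.clsMap k X = 0 := by
    rw [← hz, PIMSystem.clsMap_apply, map_sum]
    refine Finset.sum_congr rfl fun i _ => ?_
    rw [map_sum]
    rfl
  have h2 : X = 0 := s.clsMap_injective k hF (by rw [h1, map_zero])
  simp [h2]

theorem kPr_ideal (hF : HasScalarEnds F F[G]) (t : kTDelta k e) (x : kTDelta k e)
    (hx : x ∈ kPr k e) : t * x ∈ kPr k e ∧ x * t ∈ kPr k e := by
  rw [kPr, Submodule.baseChange_eq_span] at hx ⊢
  induction hx using Submodule.span_induction with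
  | zero => rw [mul_zero, zero_mul]; exact ⟨zero_mem _, zero_mem _⟩
  | add a b _ _ ha hb =>
    rw [mul_add, add_mul]
    exact ⟨add_mem ha.1 hb.1, add_mem ha.2 hb.2⟩
  | smul c a _ ha =>
    rw [mul_smul_comm, smul_mul_assoc]
    exact ⟨Submodule.smul_mem _ c ha.1, Submodule.smul_mem _ c ha.2⟩
  | mem x hx =>
    obtain ⟨x, hx, rfl⟩ := hx
    rw [← Submodule.baseChange_eq_span]
    induction t using TensorProduct.induction_on with
    | zero => rw [mul_zero, zero_mul]; exact ⟨zero_mem _, zero_mem _⟩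
    | add a b ha hb =>
      rw [mul_add, add_mul]
      exact ⟨add_mem ha.1 hb.1, add_mem ha.2 hb.2⟩
    | tmul c t =>
      rw [TensorProduct.mk_apply, Algebra.TensorProduct.tmul_mul_tmul,
        Algebra.TensorProduct.tmul_mul_tmul]
      exact ⟨Submodule.tmul_mem_baseChange_of_mem _ (Pr_ideal hF t x hx).1,
        Submodule.tmul_mem_baseChange_of_mem _ (Pr_ideal hF t x hx).2⟩

/-- If the Cartan matrix is invertible over `k`, then `X ↦ ∑ (X C⁻¹) i j [P_{ij}]` is an isomorphism
from the matrix algebra onto `k Pr(B,B)`. -/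
theorem PIMSystem.isMatrixIdeal (hF : HasScalarEnds F F[G]) (hC : IsUnit (s.cartan k)) :
    IsMatrixIdeal (kPr k e) (s.clsMap k ∘ₗ LinearMap.mulRight k (s.cartan k)⁻¹) where
  injective := by
    intro X Y hXY
    have h1 := s.clsMap_injective k hF hXY
    have h2 := congrArg (· * s.cartan k) h1
    simpa only [LinearMap.mulRight_apply, mul_assoc,
      Matrix.nonsing_inv_mul _ ((Matrix.isUnit_iff_isUnit_det _).1 hC), mul_one] using h2
  map_mul M N := by
    simp only [LinearMap.comp_apply, LinearMap.mulRight_apply]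
    rw [s.clsMap_mul, mul_assoc M _ (s.cartan k),
      Matrix.nonsing_inv_mul _ ((Matrix.isUnit_iff_isUnit_det _).1 hC), mul_one, mul_assoc]
  range_eq := by
    rw [← s.range_clsMap k hF]
    refine le_antisymm (LinearMap.range_comp_le_range _ _) ?_
    rintro _ ⟨X, rfl⟩
    refine ⟨X * s.cartan k, ?_⟩
    rw [LinearMap.comp_apply, LinearMap.mulRight_apply, mul_assoc,
      Matrix.mul_nonsing_inv _ ((Matrix.isUnit_iff_isUnit_det _).1 hC), mul_one]
  mul_mem a x hx := kPr_ideal k hF a x hx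

theorem PIMSystem.clsMap_single_mul (X : Matrix (Fin n) (Fin n) k) (i : Fin n) :
    s.clsMap k (Matrix.single i i 1 * X) = ∑ j, X i j ⊗ₜ[ℤ] s.cls i j := by
  rw [PIMSystem.clsMap_apply, Finset.sum_eq_single i]
  · simp
  · intro a _ ha
    simp [Matrix.single_mul_apply_of_ne _ _ _ _ _ ha]
  · simp

theorem numSimple_ne_zero (he : e.val ≠ 0) : numSimple e ≠ 0 := by
  obtain ⟨s⟩ := nonempty_pimSystem e
  obtain ⟨i, -⟩ := s.isTopSystem.exists_smul_ne F e.idem (m := (1 : F[G]))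
    (by rwa [smul_eq_mul, mul_one])
  exact fun h => (Fin.cast h i).elim0

end BaseChange

/-! ### Coefficients of `p`-power powers -/

section PowerCoefficients

variable {F : Type u} [Field F] {p : ℕ} [Fact p.Prime] [CharP F p]

/-- In characteristic `p`, only the fixed points contribute to the sum of an invariant function over
a set with an action of a cyclic `p`-group. -/
theorem sum_eq_sum_fixed {X : Type*} [Fintype X] [DecidableEq X] (σ : X → X) (k : ℕ)
    (hσ : σ^[p ^ k] = id) (f : X → F) (hf : ∀ x, f (σ x) = f x) :
    ∑ x, f x = ∑ x ∈ Finset.univ.filter (fun x => σ x = x), f x := by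
  classical
  rw [← Finset.sum_fiberwise_of_maps_to (g := f) (t := Finset.univ.image f)
    fun x _ => Finset.mem_image_of_mem f (Finset.mem_univ x),
    ← Finset.sum_fiberwise_of_maps_to (s := Finset.univ.filter fun x => σ x = x) (g := f)
    (t := Finset.univ.image f) fun x _ => Finset.mem_image_of_mem f (Finset.mem_univ x)]
  refine Finset.sum_congr rfl fun c _ => ?_
  rw [Finset.sum_congr rfl fun x hx => (Finset.mem_filter.1 hx).2, Finset.sum_const,
    Finset.sum_congr rfl fun x hx => (Finset.mem_filter.1 hx).2, Finset.sum_const, nsmul_eq_mul,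
    nsmul_eq_mul]
  congr 1
  rw [CharP.cast_eq_iff_mod_eq F p]
  let τ : Function.End {x // f x = c} := fun x => ⟨σ x, (hf x).trans x.2⟩
  have hτ : ∀ (j : ℕ) x, ((τ ^ j) x).1 = σ^[j] x.1 := by
    intro j
    induction j with
    | zero => intro x; rfl
    | succ j ih =>
      intro x
      rw [pow_succ', Function.iterate_succ', Function.comp_apply, ← ih]
      rfl
  have h1 := Equiv.Perm.card_fixedPoints_modEq (f := τ) (p := p) (n := k)
    (funext fun x => Subtype.ext (by rw [hτ, hσ]; rfl))
  rw [Fintype.card_subtype] at h1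
  have h2 : Fintype.card (Function.fixedPoints τ) =
      ((Finset.univ.filter fun x => σ x = x).filter fun x => f x = c).card := by
    rw [← Fintype.card_coe]
    refine Fintype.card_congr ⟨fun x => ⟨x.1.1, ?_⟩, fun x => ⟨⟨x.1, ?_⟩, ?_⟩, fun _ => rfl,
      fun _ => rfl⟩
    · simp only [Finset.mem_filter, Finset.mem_univ, true_and]
      exact ⟨congrArg Subtype.val x.2, x.1.2⟩
    · exact (Finset.mem_filter.1 x.2).2
    · exact Subtype.ext (Finset.mem_filter.1 (Finset.mem_filter.1 x.2).1).2
  rw [h2] at h1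
  exact h1

variable {G : Type v} [Group G]

omit [Fact p.Prime] [CharP F p] in
theorem coeff_pow_eq_sum [Fintype G] [DecidableEq G] (y : F[G]) (n : ℕ) (g : G) :
    (y ^ n).coeff g = ∑ f : Fin n → G,
      if (List.ofFn f).prod = g then ∏ i, y.coeff (f i) else 0 := by
  have hy : y = ∑ h : G, MonoidAlgebra.single h (y.coeff h) := by
    ext g
    simp
  have key : y ^ n = ∑ f : Fin n → G, MonoidAlgebra.single (List.ofFn f).prod
      (∏ i, y.coeff (f i)) := by
    induction n with
    | zero =>
      rw [pow_zero, Fintype.sum_unique]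
      simp [MonoidAlgebra.one_def]
    | succ n ih =>
      rw [← (Fin.consEquiv fun _ : Fin (n + 1) => G).sum_comp, Fintype.sum_prod_type, pow_succ', ih]
      conv_lhs => rw [hy]
      rw [Finset.sum_mul_sum]
      refine Finset.sum_congr rfl fun h _ => Finset.sum_congr rfl fun f _ => ?_
      rw [MonoidAlgebra.single_mul_single]
      simp [Fin.consEquiv, Fin.prod_univ_succ, List.ofFn_succ]
  rw [key]
  simp [Finsupp.single_apply]

/-- The rotation of tuples that is twisted by the conjugation with `u`. -/
def twistedRotate (u : G) {m : ℕ} (f : Fin (m + 1) → G) : Fin (m + 1) → G :=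
  Fin.snoc (α := fun _ => G) (fun i : Fin m => f i.succ) (u⁻¹ * f 0 * u)

/-- The extension of a tuple to a sequence which is periodic up to conjugation with `u`. -/
def twistedExtend (u : G) {m : ℕ} (f : Fin (m + 1) → G) (k : ℕ) : G :=
  (u⁻¹) ^ (k / (m + 1)) * f ⟨k % (m + 1), Nat.mod_lt _ m.succ_pos⟩ * u ^ (k / (m + 1))

theorem twistedExtend_add (u : G) {m : ℕ} (f : Fin (m + 1) → G) (i : Fin (m + 1)) (q : ℕ) :
    twistedExtend u f (i + (m + 1) * q) = (u⁻¹) ^ q * f i * u ^ q := by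
  have h1 : (i + (m + 1) * q) / (m + 1) = q := by
    rw [Nat.add_mul_div_left _ _ m.succ_pos, Nat.div_eq_of_lt i.2, zero_add]
  have h2 : (⟨(i + (m + 1) * q) % (m + 1), Nat.mod_lt _ m.succ_pos⟩ : Fin (m + 1)) = i :=
    Fin.ext (by
      change (i + (m + 1) * q) % (m + 1) = i
      rw [Nat.add_mul_mod_self_left, Nat.mod_eq_of_lt i.2])
  rw [twistedExtend, h1, h2]

theorem twistedExtend_rotate (u : G) {m : ℕ} (f : Fin (m + 1) → G) (k : ℕ) :
    twistedExtend u (twistedRotate u f) k = twistedExtend u f (k + 1) := by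
  obtain ⟨i, q, rfl⟩ : ∃ (i : Fin (m + 1)) (q : ℕ), k = i + (m + 1) * q :=
    ⟨⟨k % (m + 1), Nat.mod_lt _ m.succ_pos⟩, k / (m + 1), (Nat.mod_add_div k (m + 1)).symm⟩
  rw [twistedExtend_add]
  induction i using Fin.lastCases with
  | last =>
    have := twistedExtend_add u f 0 (q + 1)
    rw [show (Fin.last m : ℕ) + (m + 1) * q + 1 = ((0 : Fin (m + 1)) : ℕ) + (m + 1) * (q + 1) by
      simp only [Fin.val_last, Fin.val_zero]; ring, this, twistedRotate, Fin.snoc_last, pow_succ,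
      pow_succ']
    simp only [mul_assoc]
  | cast i =>
    have := twistedExtend_add u f i.succ q
    rw [show (i.castSucc : ℕ) + (m + 1) * q + 1 = ((i.succ : Fin (m + 1)) : ℕ) + (m + 1) * q by
      simp only [Fin.val_castSucc, Fin.val_succ]; ring, this, twistedRotate, Fin.snoc_castSucc]

theorem twistedRotate_iterate (u : G) {m : ℕ} (q : ℕ) (hu : u ^ q = 1) (f : Fin (m + 1) → G) :
    (twistedRotate u)^[(m + 1) * q] f = f := by
  have key : ∀ (j k : ℕ) (f : Fin (m + 1) → G), twistedExtend u ((twistedRotate u)^[j] f) k =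
      twistedExtend u f (k + j) := by
    intro j
    induction j with
    | zero => intro k f; rfl
    | succ j ih =>
      intro k f
      rw [Function.iterate_succ_apply, ih, twistedExtend_rotate, add_assoc]
  funext i
  have h1 := key ((m + 1) * q) i f
  rw [twistedExtend_add, hu, inv_pow, hu, inv_one, one_mul, mul_one] at h1
  have h2 := twistedExtend_add u ((twistedRotate u)^[(m + 1) * q] f) i 0
  rw [mul_zero, add_zero, pow_zero, pow_zero, one_mul, mul_one] at h2
  rw [← h2, h1]

theorem prod_twistedRotate_eq_iff (u : G) {m : ℕ} (f : Fin (m + 1) → G) :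
    (List.ofFn (twistedRotate u f)).prod = u ↔ (List.ofFn f).prod = u := by
  rw [List.ofFn_succ', List.ofFn_succ, List.concat_eq_append, List.prod_append, List.prod_cons,
    List.prod_cons, List.prod_nil, mul_one]
  simp only [twistedRotate, Fin.snoc_castSucc, Fin.snoc_last]
  generalize (List.ofFn fun i => f i.succ).prod = x
  constructor
  · intro h
    have h1 : f 0 * x = f 0 * (x * (u⁻¹ * f 0 * u)) * (u⁻¹ * (f 0)⁻¹ * u) := by group
    rw [h1, h]
    group
  · rintro rfl
    group

theorem eq_const_of_twistedRotate_eq {u : G} {m : ℕ} {f : Fin (m + 1) → G}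
    (h : twistedRotate u f = f) : ∀ i, f i = f 0 := by
  intro i
  induction i using Fin.induction with
  | zero => rfl
  | succ i ih =>
    rw [← ih]
    conv_rhs => rw [← h]
    rw [twistedRotate, Fin.snoc_castSucc]

/-- The coefficients of a `p`-power power of an element `y` of the group algebra at a `p`-element
`u` that commutes with `y`: the tuples of group elements which contribute to it are permuted by a
twisted rotation. -/
theorem coeff_pow_char_pow [Fintype G] [DecidableEq G] {u : G} {q : ℕ} (hu : u ^ p ^ q = 1)
    (y : F[G]) (hy : ∀ h, y.coeff (u⁻¹ * h * u) = y.coeff h) (n : ℕ) :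
    (y ^ p ^ n).coeff u = ∑ h ∈ Finset.univ.filter (fun h => h ^ p ^ n = u), y.coeff h ^ p ^ n := by
  obtain ⟨m, hm⟩ : ∃ m, p ^ n = m + 1 :=
    ⟨p ^ n - 1, (Nat.succ_pred_eq_of_pos (pow_pos (Fact.out : p.Prime).pos n)).symm⟩
  have hiter : (twistedRotate u (m := m))^[p ^ (n + q)] = id := by
    funext f
    rw [pow_add, hm]
    exact twistedRotate_iterate u (p ^ q) hu f
  rw [coeff_pow_eq_sum, hm, sum_eq_sum_fixed (twistedRotate u) _ hiter]
  · symm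
    refine Finset.sum_of_injOn (fun h _ => h) (fun a _ b _ hab => congrFun hab 0) ?_ ?_ ?_
    · intro h hh
      simp only [Finset.coe_filter, Finset.mem_univ, true_and, Set.mem_ofPred_eq] at hh ⊢
      funext i
      induction i using Fin.lastCases with
      | last =>
        rw [twistedRotate, Fin.snoc_last, ← hh]
        group
      | cast i => rw [twistedRotate, Fin.snoc_castSucc]
    · intro f hf hf'
      have h1 := eq_const_of_twistedRotate_eq (Finset.mem_filter.1 hf).2
      have h2 : f = fun _ => f 0 := funext h1
      refine if_neg fun h3 => hf' ⟨f 0, ?_, h2.symm⟩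
      rw [h2] at h3
      rw [List.ofFn_const, List.prod_replicate] at h3
      exact Finset.mem_coe.2 (Finset.mem_filter.2 ⟨Finset.mem_univ _, h3⟩)
    · intro h hh
      have h1 : h ^ (m + 1) = u := (Finset.mem_filter.1 hh).2
      rw [if_pos (by rwa [List.ofFn_const, List.prod_replicate])]
      simp
  · intro f
    simp only [prod_twistedRotate_eq_iff]
    split_ifs
    · rw [Fin.prod_univ_castSucc, Fin.prod_univ_succ, mul_comm]
      simp only [twistedRotate, Fin.snoc_castSucc, Fin.snoc_last, hy]
    · rfl

end PowerCoefficients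

/-! ### The trace map of the group algebra -/

section FullTrace

variable {F : Type u} [Field F] {G : Type v} [Group G] [Fintype G]

/-- The trace `∑ g a g⁻¹` of an element of the group algebra. -/
noncomputable def fullTrace (a : F[G]) : F[G] :=
  ∑ g : G, MonoidAlgebra.single g (1 : F) * a * MonoidAlgebra.single g⁻¹ (1 : F)

omit [Fintype G] in
theorem coeff_conj (a : F[G]) (g x : G) :
    (MonoidAlgebra.single g (1 : F) * a * MonoidAlgebra.single g⁻¹ (1 : F)).coeff x =
      a.coeff (g⁻¹ * x * g) := by
  rw [MonoidAlgebra.coeff_mul_single_apply, MonoidAlgebra.coeff_single_mul_apply, mul_one, one_mul,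
    inv_inv, mul_assoc]

theorem coeff_fullTrace (a : F[G]) (x : G) :
    (fullTrace a).coeff x = ∑ g : G, a.coeff (g⁻¹ * x * g) := by
  rw [fullTrace, MonoidAlgebra.coeff_sum, Finsupp.finsetSum_apply]
  exact Finset.sum_congr rfl fun g _ => coeff_conj a g x

theorem fullTrace_mul_central (a : F[G]) {z : F[G]} (hz : ∀ x, z * x = x * z) :
    fullTrace (a * z) = fullTrace a * z := by
  rw [fullTrace, fullTrace, Finset.sum_mul]
  refine Finset.sum_congr rfl fun g _ => ?_
  rw [mul_assoc, mul_assoc, hz, mul_assoc, mul_assoc]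

omit [Fintype G] in
theorem coeff_conj_of_central {z : F[G]} (hz : ∀ x, z * x = x * z) (g x : G) :
    z.coeff (g⁻¹ * x * g) = z.coeff x := by
  rw [← coeff_conj, ← hz, mul_assoc, MonoidAlgebra.single_mul_single, mul_inv_cancel, one_mul,
    ← MonoidAlgebra.one_def, mul_one]

theorem relTrace_bot (a : F[G]) : relTrace ⊥ a = fullTrace a := by
  have : Fintype (G ⧸ (⊥ : Subgroup G)) := Fintype.ofFinite _
  rw [relTrace, finsum_eq_sum_of_fintype, fullTrace]
  refine (Fintype.sum_equiv (QuotientGroup.quotientBot (G := G)).symm.toEquiv _ _ fun g => ?_).symm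
  have : (QuotientGroup.quotientBot.symm g : G ⧸ (⊥ : Subgroup G)).out = g := by
    have h1 := QuotientGroup.out_eq' (QuotientGroup.quotientBot.symm g : G ⧸ (⊥ : Subgroup G))
    have h2 : (QuotientGroup.quotientBot.symm g : G ⧸ (⊥ : Subgroup G)) = (g : G ⧸ (⊥ : Subgroup G)) :=
      rfl
    rw [h2] at h1 ⊢
    have h3 := QuotientGroup.eq.1 h1
    rw [Subgroup.mem_bot, inv_mul_eq_one] at h3
    exact h3
  change _ = MonoidAlgebra.single (QuotientGroup.quotientBot.symm g : G ⧸ (⊥ : Subgroup G)).out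
    (1 : F) * a * MonoidAlgebra.single (QuotientGroup.quotientBot.symm g : G ⧸ (⊥ : Subgroup G)).out⁻¹
      (1 : F)
  rw [this]

theorem inTraceIdeal_bot_iff (b : F[G]) : InTraceIdeal ⊥ b ↔ ∃ a, fullTrace a = b := by
  refine exists_congr fun a => ?_
  rw [relTrace_bot, and_iff_right_iff_imp]
  rintro - d hd
  rw [Subgroup.mem_bot.1 hd, inv_one, ← MonoidAlgebra.one_def, one_mul, mul_one]

/-- A block has defect zero if and only if its idempotent is a trace, as the trivial subgroup is
then automatically minimal. -/
theorem hasDefect_zero_iff (p : ℕ) (b : F[G]) : HasDefect p b 0 ↔ ∃ a, fullTrace a = b := by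
  rw [← inTraceIdeal_bot_iff]
  constructor
  · rintro ⟨D, hD, hcard⟩
    rw [pow_zero, Subgroup.card_eq_one] at hcard
    subst hcard
    exact hD.1
  · intro h
    exact ⟨⊥, ⟨h, fun _ _ _ => bot_le⟩, by rw [pow_zero, Subgroup.card_bot]⟩

/-- Higman's criterion: `a` itself provides the linear endomorphism whose trace is the identity. -/
theorem projective_of_fullTrace {a e : F[G]} (h : fullTrace a = e) (M : Type w) [AddCommGroup M]
    [Module F M] [Module F[G] M] [IsScalarTower F F[G] M] (he : ∀ m : M, e • m = m) :
    Module.Projective F[G] M := by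
  refine module_projective_iff.2 ⟨Algebra.lsmul F F M a, fun m => ?_⟩
  simp only [Algebra.lsmul_coe, smul_smul, ← mul_assoc]
  rw [← Finset.sum_smul]
  exact (congrArg (· • m) h).trans (he m)

/-- On a projective module, the linear trace of `a` is the trace of the product of `∑ g a g⁻¹` with an
endomorphism given by Higman's criterion. -/
theorem traceOf_projective {a : F[G]} (ha : fullTrace a = 0) (Q : Type w) [AddCommGroup Q]
    [Module F Q] [Module F[G] Q] [IsScalarTower F F[G] Q] [Module.Projective F[G] Q] :
    traceOf F a Q = 0 := by
  obtain ⟨θ, hθ⟩ := module_projective_iff.1 (inferInstance : Module.Projective F[G] Q)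
  let L := Algebra.lsmul F F Q (A := F[G])
  have h1 : (1 : Module.End F Q) = ∑ g : G, L (MonoidAlgebra.single g 1) * θ *
      L (MonoidAlgebra.single g⁻¹ 1) := by
    refine LinearMap.ext fun m => ?_
    rw [LinearMap.sum_apply]
    exact (hθ m).symm
  have h2 : ∑ g : G, L (MonoidAlgebra.single g⁻¹ (1 : F) * a * MonoidAlgebra.single g (1 : F)) =
      0 := by
    rw [← map_sum]
    have : ∑ g : G, MonoidAlgebra.single g⁻¹ (1 : F) * a * MonoidAlgebra.single g (1 : F) =
        fullTrace a := by
      refine Fintype.sum_equiv (Equiv.inv G) _ _ fun g => ?_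
      rw [Equiv.inv_apply, inv_inv]
    rw [this, ha, map_zero]
  rw [traceOf, ← mul_one (Algebra.lsmul F F Q a), h1, Finset.mul_sum, map_sum]
  have h3 : ∀ g : G, LinearMap.trace F Q (L a * (L (MonoidAlgebra.single g 1) * θ *
      L (MonoidAlgebra.single g⁻¹ 1))) = LinearMap.trace F Q
        (L (MonoidAlgebra.single g⁻¹ (1 : F) * a * MonoidAlgebra.single g (1 : F)) * θ) := by
    intro g
    rw [← mul_assoc, LinearMap.trace_mul_comm, map_mul L, map_mul L]
    simp only [mul_assoc]
  refine (Finset.sum_congr rfl fun g _ => h3 g).trans ?_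
  rw [← map_sum, ← Finset.sum_mul, h2, zero_mul, map_zero]

/-- The summands of `∑ g x g⁻¹` are permuted freely by the translations with `z`. -/
theorem fullTrace_single_eq_zero {p : ℕ} [Fact p.Prime] [CharP F p] {x z : G} (hz : Commute x z)
    (hzp : orderOf z = p) : fullTrace (MonoidAlgebra.single x (1 : F)) = 0 := by
  classical
  ext y
  rw [coeff_fullTrace, sum_eq_sum_fixed (p := p) (fun g : G => g * z) 1]
  · have h1 : z ≠ 1 := by
      rintro rfl
      rw [orderOf_one] at hzp
      exact (Fact.out : p.Prime).one_lt.ne hzp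
    rw [Finset.sum_eq_zero]
    · rfl
    · intro g hg
      exact (h1 (mul_eq_left.1 (Finset.mem_filter.1 hg).2)).elim
  · funext g
    have : ∀ j : ℕ, (fun g : G => g * z)^[j] g = g * z ^ j := by
      intro j
      induction j with
      | zero => simp
      | succ j ih => rw [Function.iterate_succ_apply', ih, pow_succ, mul_assoc]
    rw [this, pow_one, ← hzp, pow_orderOf_eq_one, mul_one]
    rfl
  · intro g
    rw [MonoidAlgebra.coeff_single, Finsupp.single_apply, Finsupp.single_apply]
    refine if_congr ?_ rfl rfl
    have h2 : z * x * z⁻¹ = x := by rw [← hz.eq, mul_inv_cancel_right]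
    have h3 : (g * z)⁻¹ * y * (g * z) = z⁻¹ * (g⁻¹ * y * g) * z := by group
    rw [h3]
    constructor
    · intro h
      rw [← h2, h]
      group
    · intro h
      rw [← h, mul_assoc, hz.eq, inv_mul_cancel_left]

open MulAction in
/-- A central element is a trace, if it vanishes at the elements whose centralizers have order
divisible by `p`. -/
theorem exists_fullTrace_eq {p : ℕ} [Fact p.Prime] [CharP F p] {z : F[G]}
    (hz : ∀ x, z * x = x * z)
    (h : ∀ g w : G, Commute g w → orderOf w = p → z.coeff g = 0) : ∃ a, fullTrace a = z := by
  have : Fintype (ConjAct G) := ‹Fintype G›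
  obtain ⟨w, hw⟩ := exists_weight (G := ConjAct G) (X := G) (fun g => z.coeff g)
    (fun k g => by
      rw [ConjAct.smul_def]
      have := coeff_conj_of_central hz (ConjAct.ofConjAct k)⁻¹ g
      rwa [inv_inv] at this)
    (fun g hg => by
      obtain ⟨c, hc⟩ := exists_prime_orderOf_dvd_card' p ((CharP.cast_eq_zero_iff F p _).1 hg)
      refine h g (ConjAct.ofConjAct (c : ConjAct G)) ?_ ?_
      · have h1 : (c : ConjAct G) • g = g := c.2
        rw [ConjAct.smul_def, mul_inv_eq_iff_eq_mul] at h1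
        exact h1.symm
      · rw [← Subgroup.orderOf_coe] at hc
        exact ((ConjAct.ofConjAct (G := G)).orderOf_eq _).trans hc)
  refine ⟨∑ g : G, MonoidAlgebra.single g (w g), ?_⟩
  ext x
  rw [coeff_fullTrace]
  have h1 : ∀ g : G, (∑ g : G, MonoidAlgebra.single g (w g)).coeff g = w g := by
    classical
    intro g
    simp [Finsupp.single_apply]
  simp only [h1]
  rw [← hw]
  refine Fintype.sum_equiv ((Equiv.inv G).trans (ConjAct.toConjAct (G := G)).toEquiv) _ _ fun g => ?_
  change _ = w (ConjAct.toConjAct g⁻¹ • x)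
  rw [ConjAct.toConjAct_smul, inv_inv]

end FullTrace

/-! ### Coefficients of central idempotents -/

section CentralCoefficients

variable {F : Type u} [Field F] {G : Type v} [Group G] [Finite G] {p : ℕ} [Fact p.Prime]

/-- Raising to the `p ^ n`-th power, where `p ^ n` is the `p`-part of the order of `G`,
annihilates the `p`-elements. -/
theorem exists_exponent (p : ℕ) [Fact p.Prime] (G : Type v) [Group G] [Finite G] :
    ∃ n, ∀ (h : G) (k : ℕ), h ^ p ^ k = 1 → h ^ p ^ n = 1 := by
  have hp := (Fact.out : p.Prime)
  obtain ⟨n, m, hm, hnm⟩ := Nat.exists_eq_pow_mul_and_not_dvd (Nat.card_pos (α := G)).ne' p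
    hp.one_lt.ne'
  refine ⟨n, fun h k hk => ?_⟩
  rw [← orderOf_dvd_iff_pow_eq_one] at hk ⊢
  obtain ⟨j, -, hj⟩ := (Nat.dvd_prime_pow hp).1 hk
  have h1 := orderOf_dvd_natCard h
  rw [hnm] at h1
  refine Nat.Coprime.dvd_of_dvd_mul_right ?_ h1
  rw [hj]
  exact (Nat.Prime.coprime_pow_of_not_dvd hp hm).symm

omit [Finite G] in
theorem exists_root {g : G} (hg : ¬ p ∣ orderOf g) (n : ℕ) : ∃ k, (g ^ k) ^ p ^ n = g := by
  obtain ⟨k, hk⟩ := exists_pow_eq_self_of_coprime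
    (Nat.Prime.coprime_pow_of_not_dvd (m := n) (Fact.out : p.Prime) hg).symm
  exact ⟨k, by rw [← pow_mul, mul_comm, pow_mul, hk]⟩

variable [CharP F p] (e : CentralIdempotent F G)

omit [Finite G] in
/-- Since `(e t⁻¹) ^ p ^ n = e s⁻¹`, the coefficient of `e` at `u s` is obtained from the formula for
coefficients of powers. -/
theorem coeff_eq_sum_roots [Fintype G] [DecidableEq G] {u s t : G} {n q : ℕ} (ht : t ^ p ^ n = s)
    (hut : Commute u t) (hu : u ^ p ^ q = 1) : e.val.coeff (u * s) =
      ∑ h ∈ Finset.univ.filter (fun h => h ^ p ^ n = u), e.val.coeff (h * t) ^ p ^ n := by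
  have hy : ∀ h, (e.val * MonoidAlgebra.single t⁻¹ (1 : F)).coeff h = e.val.coeff (h * t) :=
    fun h => by rw [MonoidAlgebra.coeff_mul_single_apply, mul_one, inv_inv]
  have hidem : IsIdempotentElem e.val := e.idem
  have h1 := coeff_pow_char_pow hu (e.val * MonoidAlgebra.single t⁻¹ (1 : F)) (fun h => by
    rw [hy, hy, mul_assoc, hut.eq, ← coeff_conj_of_central e.central u (h * t)]
    simp only [mul_assoc]) n
  have h2 : (e.val * MonoidAlgebra.single t⁻¹ (1 : F)) ^ p ^ n =
      e.val * MonoidAlgebra.single s⁻¹ (1 : F) := by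
    rw [Commute.mul_pow (e.central _), MonoidAlgebra.single_pow, one_pow, inv_pow, ht,
      hidem.pow_eq (pow_pos (Fact.out : p.Prime).pos n).ne']
  rw [h2, MonoidAlgebra.coeff_mul_single_apply, mul_one, inv_inv] at h1
  simpa only [hy] using h1

/-- Central idempotents are supported on the elements of order prime to `p`. -/
theorem coeff_eq_zero_of_dvd_orderOf {g : G} (hg : p ∣ orderOf g) : e.val.coeff g = 0 := by
  classical
  have := Fintype.ofFinite G
  obtain ⟨s, hgs, hs, N, hN⟩ := exists_regular_part p g
  obtain ⟨n, hn⟩ := exists_exponent p G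
  obtain ⟨k, hk⟩ := exists_root hs n
  have hu : (g * s⁻¹) ^ p ^ N = 1 := by
    rw [hgs.inv_right.mul_pow, inv_pow, hN, mul_inv_cancel]
  have h1 := coeff_eq_sum_roots e hk
    (((hgs.mul_left (Commute.inv_left (Commute.refl s))).pow_right k)) hu
  rw [inv_mul_cancel_right] at h1
  rw [h1, Finset.sum_eq_zero]
  intro h hh
  have hh' := (Finset.mem_filter.1 hh).2
  have h2 := hn h (n + N) (by rw [pow_add, pow_mul, hh', hu])
  rw [h2, eq_comm, mul_inv_eq_one] at hh'
  exact (hs (hh' ▸ hg)).elim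

variable {e}

/-- If the Cartan matrix is invertible over `F`, an element with trace zero has trace zero on all
modules of `B`: this is true for projective modules, the classes of which then span. -/
theorem PIMSystem.traceOf_eq_zero [Fintype G] {n : ℕ} (s : PIMSystem e n)
    (hF : HasScalarEnds F F[G]) (hC : IsUnit (s.cartan F)) {a : F[G]} (ha : fullTrace a = 0)
    (M : Type (max u v)) [AddCommGroup M] [Module F M] [Module F[G] M] [IsScalarTower F F[G] M]
    [Module.Finite F M] : traceOf F (a * e.val) M = 0 := by
  have hε := s.isTopSystem
  obtain ⟨S, _, _, hS⟩ := hε.exists_simpleFamily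
  let _ : ∀ i, Module F (S i) := fun i => Module.compHom (S i) (algebraMap F F[G])
  have : ∀ i, IsScalarTower F F[G] (S i) := fun i => ⟨fun c a s => by
    rw [Algebra.smul_def, mul_smul]; rfl⟩
  have formula := hε.additive_formula hF e.idem hS
    (fun (M : Type (max u v)) _ _ _ _ => traceOf F (a * e.val) M)
    (fun M M' _ _ _ _ _ _ _ _ φ => traceOf_congr φ)
    (fun M _ _ _ _ h0 => PPermutation.traceOf_eq_zero fun m => by rw [mul_smul, h0, smul_zero])
    (fun M _ _ _ _ _ N => traceOf_add _ N)
  have hproj : ∀ j, traceOf F (a * e.val) (Ideal.span {s.ε j} : Ideal F[G]) = 0 := fun j => by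
    have := projective_span_idem (s.primitive j).2.1
    refine traceOf_projective ?_ _
    rw [fullTrace_mul_central a e.central, ha, zero_mul]
  have hzero : (fun i => traceOf F (a * e.val) (S i)) = 0 := by
    refine Matrix.vecMul_injective_iff_isUnit.2 hC ?_
    funext j
    have := finite_submodule (F := F) (M := F[G]) (Ideal.span {s.ε j})
    have h1 := formula (Ideal.span {s.ε j} : Ideal F[G])
    rw [hproj] at h1
    simp only [s.rankOf_span, nsmul_eq_mul] at h1
    refine Eq.trans ?_ (h1.symm.trans (congrFun (Matrix.zero_vecMul (s.cartan F)) j).symm)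
    change ∑ i, traceOf F (a * e.val) (S i) * (s.cartanNat i j : F) = _
    exact Finset.sum_congr rfl fun i _ => mul_comm _ _
  rw [formula M, Finset.sum_eq_zero]
  intro i _
  rw [congrFun hzero i, Pi.zero_apply, smul_zero]

omit [Finite G] [CharP F p] [Fact p.Prime] in
theorem traceOf_ofMulAction {X : Type v} [Fintype X] [DecidableEq X] [MulAction G X] (g : G) :
    traceOf F (MonoidAlgebra.single g (1 : F)) (Representation.ofMulAction F G X).asModule =
      ((Finset.univ.filter fun x : X => g • x = x).card : F) := by
  let ρ := Representation.ofMulAction F G X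
  have h1 : traceOf F (MonoidAlgebra.single g (1 : F)) ρ.asModule =
      LinearMap.trace F (F[X]) (ρ g) := by
    refine congrArg (LinearMap.trace F (F[X])) (LinearMap.ext fun m => ?_)
    exact single_smul_asModule ρ g m
  let b : Module.Basis X F F[X] := .ofRepr (MonoidAlgebra.coeffLinearEquiv F)
  rw [h1, LinearMap.trace_eq_matrix_trace F b, Matrix.trace, Finset.card_filter, Nat.cast_sum]
  refine Finset.sum_congr rfl fun x _ => ?_
  have hb : b x = MonoidAlgebra.single x 1 := rfl
  rw [Matrix.diag_apply, LinearMap.toMatrix_apply, hb, Representation.ofMulAction_single]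
  change (MonoidAlgebra.single (g • x) (1 : F)).coeff x = _
  rw [MonoidAlgebra.coeff_single, Finsupp.single_apply]
  push_cast
  rfl

/-- The trace of an element of the group algebra on the permutation module on the cosets of a Sylow
subgroup: only `p`-elements have fixed points, and modulo `p` their number is the index. -/
theorem traceOf_sylow [Fintype G] [DecidableEq G] {n : ℕ}
    (hn : ∀ (h : G) (k : ℕ), h ^ p ^ k = 1 → h ^ p ^ n = 1) (P : Sylow p G) (a : F[G]) :
    traceOf F a (Representation.ofMulAction F G (G ⧸ (P : Subgroup G))).asModule =
      ∑ h ∈ Finset.univ.filter (fun h : G => h ^ p ^ n = 1), a.coeff h * (P : Subgroup G).index := by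
  classical
  have : Fintype (G ⧸ (P : Subgroup G)) := Fintype.ofFinite _
  have hy : a = ∑ h : G, a.coeff h • MonoidAlgebra.single h (1 : F) := by
    ext g
    simp
  conv_lhs => rw [hy]
  rw [traceOf, map_sum, map_sum, Finset.sum_filter]
  refine Finset.sum_congr rfl fun h _ => ?_
  rw [map_smul, map_smul, smul_eq_mul]
  have h1 := traceOf_ofMulAction (F := F) (X := G ⧸ (P : Subgroup G)) h
  rw [traceOf] at h1
  rw [h1]
  split_ifs with hh
  · have h2 := sum_eq_sum_fixed (F := F) (p := p) (X := G ⧸ (P : Subgroup G)) (fun x => h • x) n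
      (by rw [smul_iterate, hh]; exact funext fun x => one_smul _ x) (fun _ => 1) fun _ => rfl
    rw [Finset.sum_const, Finset.sum_const, Finset.card_univ, nsmul_one, nsmul_one,
      ← Nat.card_eq_fintype_card] at h2
    rw [← h2]
    rfl
  · rw [Finset.card_eq_zero.2, Nat.cast_zero, mul_zero]
    refine Finset.filter_eq_empty_iff.2 fun x _ hx => hh ?_
    induction x using QuotientGroup.induction_on with
    | H x =>
      have h2 : x⁻¹ * h * x ∈ (P : Subgroup G) := by
        rw [mul_assoc]
        exact QuotientGroup.eq.1 hx.symm
      obtain ⟨k, hk⟩ := P.isPGroup' ⟨_, h2⟩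
      have h3 : (x⁻¹ * h * x) ^ p ^ k = 1 := congrArg Subtype.val hk
      refine hn h k ?_
      have h4 : (x⁻¹ * h * x⁻¹⁻¹) ^ p ^ k = 1 := by rwa [inv_inv]
      rw [conj_pow] at h4
      exact conj_eq_one_iff.1 h4

include p in
/-- If the Cartan matrix is invertible over `F`, then `e` is a trace: its coefficients vanish at the
elements that commute with an element of order `p`. -/
theorem PIMSystem.exists_fullTrace_eq [Fintype G] {n : ℕ} (s : PIMSystem e n)
    (hF : HasScalarEnds F F[G]) (hC : IsUnit (s.cartan F)) : ∃ a, fullTrace a = e.val := by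
  classical
  refine PPermutation.exists_fullTrace_eq (p := p) e.central fun g w hgw hw => ?_
  by_cases hg : p ∣ orderOf g
  · exact coeff_eq_zero_of_dvd_orderOf e hg
  obtain ⟨m, hm⟩ := exists_exponent p G
  obtain ⟨k, hk⟩ := exists_root hg m
  -- the trace of `e t⁻¹` for `t = g ^ k` is a non-zero multiple of the sum of the coefficients of `e`
  -- at the elements `h t` with `h` a `p`-element, and the power of this sum is the coefficient at `g`
  obtain ⟨P⟩ : Nonempty (Sylow p G) := inferInstance
  have h1 := s.traceOf_eq_zero hF hC
    (fullTrace_single_eq_zero (F := F) ((hgw.pow_left k).inv_left) hw)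
    (Representation.ofMulAction F G (G ⧸ (P : Subgroup G))).asModule
  rw [← e.central, traceOf_sylow hm P, ← Finset.sum_mul] at h1
  have hP : ((P : Subgroup G).index : F) ≠ 0 := fun h0 =>
    P.not_dvd_index ((CharP.cast_eq_zero_iff F p _).1 h0)
  have h2 := coeff_eq_sum_roots e hk (Commute.one_left _) (q := 0) (one_pow _)
  rw [one_mul, ← sum_pow_char_pow] at h2
  have h3 := (mul_eq_zero.1 h1).resolve_right hP
  simp only [MonoidAlgebra.coeff_mul_single_apply, inv_inv, mul_one] at h3
  rw [h2, h3, zero_pow (pow_pos (Fact.out : p.Prime).pos m).ne']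

end CentralCoefficients

/-! ### Blocks of defect zero and the integral identity element -/

section DefectZero

variable {F : Type u} [Field F] {G : Type v} [Group G] [Finite G] {e : CentralIdempotent F G}

omit [Finite G] in
theorem fullTrace_sum [Fintype G] {ι : Type*} (t : Finset ι) (a : ι → F[G]) :
    fullTrace (∑ i ∈ t, a i) = ∑ i ∈ t, fullTrace (a i) := by
  simp only [fullTrace, Finset.mul_sum, Finset.sum_mul]
  exact Finset.sum_comm

theorem forall_hasDefect_zero_iff [Fintype G] (p : ℕ) (e : CentralIdempotent F G) :
    (∀ b : F[G], IsBlockIdempotent b → b * e.val = b → HasDefect p b 0) ↔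
      ∃ a, fullTrace a = e.val := by
  constructor
  · intro h
    obtain ⟨k, η, h1, h2, -, h4⟩ := exists_primitive_decomposition F (Set.center F[G]) e.val
      (Semigroup.mem_center_iff.2 fun x => (e.central x).symm) e.idem
    choose a ha using fun i => (hasDefect_zero_iff p (η i)).1 (h (η i) (h1 i) (h2 i).2)
    refine ⟨∑ i, a i, ?_⟩
    rw [fullTrace_sum, ← h4]
    exact Finset.sum_congr rfl fun i _ => ha i
  · rintro ⟨a, ha⟩ b hb hbe
    refine (hasDefect_zero_iff p b).2 ⟨a * b, ?_⟩
    rw [fullTrace_mul_central a fun x => (Semigroup.mem_center_iff.1 hb.1 x).symm, ha, e.central,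
      hbe]

variable {n : ℕ} (s : PIMSystem e n)

/-- If `e` is a trace, then all `B`-modules are projective. Expressing the composition factors of
simple modules through the Cartan matrix then inverts this matrix. -/
theorem PIMSystem.isUnit_cartanInt [Fintype G] (hF : HasScalarEnds F F[G]) {a : F[G]}
    (ha : fullTrace a = e.val) : IsUnit s.cartanInt := by
  have hε := s.isTopSystem
  obtain ⟨S, _, _, hS⟩ := hε.exists_simpleFamily
  let _ : ∀ i, Module F (S i) := fun i => Module.compHom (S i) (algebraMap F F[G])
  have : ∀ i, IsScalarTower F F[G] (S i) := fun i => ⟨fun c a s => by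
    rw [Algebra.smul_def, mul_smul]; rfl⟩
  have hfin : ∀ i, Module.Finite F (S i) := fun i => by
    have := hS.simple i
    have : Module.Finite F[G] (S i) := inferInstance
    exact Module.Finite.trans F[G] (S i)
  have hproj : ∀ i, Module.Projective F[G] (S i) := fun i => by
    have := hS.simple i
    refine projective_of_fullTrace ha (S i) fun m => ?_
    obtain ⟨t, ht⟩ := hS.exists_ne i
    have h1 : Submodule.span F[G] {s.ε i • t} = ⊤ :=
      (IsSimpleOrder.eq_bot_or_eq_top _).resolve_left fun h => ht (Submodule.span_singleton_eq_bot.1 h)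
    obtain ⟨x, rfl⟩ := Submodule.mem_span_singleton.1 (h1 ▸ Submodule.mem_top : m ∈ _)
    rw [smul_smul, smul_smul, e.central, mul_assoc, (s.primitive i).1]
    simp only [smul_smul]
  choose d hd using fun j => s.exists_rankOf_eq (S j)
  refine IsUnit.of_mul_eq_one (.of fun m j => (d j m : ℤ)) ?_
  ext i j
  have h2 : rankOf F (s.ε i) (S j) = if i = j then 1 else 0 := by
    have := hS.simple j
    obtain ⟨t, ht⟩ := hS.exists_ne j
    split_ifs with hij
    · subst hij
      exact rankOf_simple_self hF (hε.primitive i) ht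
    · exact rankOf_simple_of_not_equiv (hε.primitive i) (hε.primitive j)
        (fun h' => hij (hε.not_equiv _ _ h')) ht
  rw [hd] at h2
  rw [Matrix.mul_apply, Matrix.one_apply]
  simp only [Matrix.of_apply, PIMSystem.cartanInt]
  exact_mod_cast h2

theorem PIMSystem.sum_cls_mul (X : Matrix (Fin n) (Fin n) ℤ) (k l : Fin n) :
    (∑ i, ∑ j, X i j • s.cls i j) * s.cls k l = ∑ i, (X * s.cartanInt) i k • s.cls i l := by
  simp only [Finset.sum_mul, smul_mul_assoc, s.cls_mul_cls, Matrix.mul_apply, Finset.sum_smul]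
  refine Finset.sum_congr rfl fun i _ => Finset.sum_congr rfl fun j _ => ?_
  rw [mul_smul, PIMSystem.cartanInt, Matrix.of_apply, natCast_zsmul]

theorem PIMSystem.cls_mul_sum (X : Matrix (Fin n) (Fin n) ℤ) (k l : Fin n) :
    s.cls k l * (∑ i, ∑ j, X i j • s.cls i j) = ∑ j, (s.cartanInt * X) l j • s.cls k j := by
  simp only [Finset.mul_sum, mul_smul_comm, s.cls_mul_cls, Matrix.mul_apply, Finset.sum_smul]
  rw [Finset.sum_comm]
  refine Finset.sum_congr rfl fun j _ => Finset.sum_congr rfl fun i _ => ?_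
  rw [mul_comm, mul_smul, PIMSystem.cartanInt, Matrix.of_apply, natCast_zsmul]

theorem PIMSystem.exists_one_iff (hF : HasScalarEnds F F[G]) :
    (∃ u ∈ Pr e, ∀ x ∈ Pr e, u * x = x ∧ x * u = x) ↔ IsUnit s.cartanInt := by
  have hmem : ∀ i j, s.cls i j ∈ Pr e := fun i j => by
    rw [s.Pr_eq_span hF]
    exact Submodule.subset_span ⟨(i, j), rfl⟩
  constructor
  · rintro ⟨u, hu, h⟩
    rw [s.Pr_eq_span hF, Submodule.mem_span_range_iff_exists_fun] at hu
    obtain ⟨m, rfl⟩ := hu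
    rw [Fintype.sum_prod_type] at h
    refine IsUnit.of_mul_eq_one_right (Matrix.of fun i j => m (i, j)) ?_
    ext i k
    obtain ⟨φ, hφ⟩ := s.exists_coord hF i k
    have h1 := congrArg φ ((s.sum_cls_mul (.of fun i j => m (i, j)) k k).symm.trans
      (h _ (hmem k k)).1)
    simp only [map_sum, map_zsmul, hφ, and_true, smul_eq_mul, mul_ite, mul_one, mul_zero,
      Finset.sum_ite_eq', Finset.mem_univ, if_true] at h1
    rw [h1, Matrix.one_apply]
    exact if_congr eq_comm rfl rfl
  · intro h
    obtain ⟨D, hD, hD'⟩ := isUnit_iff_exists.1 h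
    refine ⟨∑ i, ∑ j, D i j • s.cls i j, Submodule.sum_mem _ fun i _ => Submodule.sum_mem _
      fun j _ => Submodule.smul_mem _ _ (hmem i j), fun x hx => ?_⟩
    rw [s.Pr_eq_span hF] at hx
    induction hx using Submodule.span_induction with
    | zero => rw [mul_zero, zero_mul]; exact ⟨rfl, rfl⟩
    | add a b _ _ ha hb => rw [mul_add, add_mul, ha.1, ha.2, hb.1, hb.2]; exact ⟨rfl, rfl⟩
    | smul c a _ ha => rw [mul_smul_comm, smul_mul_assoc, ha.1, ha.2]; exact ⟨rfl, rfl⟩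
    | mem x hx =>
      obtain ⟨⟨k, l⟩, rfl⟩ := hx
      rw [s.sum_cls_mul, s.cls_mul_sum, hD, hD']
      simp [Matrix.one_apply]

/-- `Pr(B,B)` has an identity element if and only if the Cartan matrix is invertible over `ℤ`, which
is the case if and only if it is invertible over `F`, or equivalently if `e` is a trace. -/
theorem exists_one_iff_forall_hasDefect_zero {p : ℕ} [Fact p.Prime] [CharP F p]
    (hF : HasScalarEnds F F[G]) (e : CentralIdempotent F G) :
    (∃ u ∈ Pr e, ∀ x ∈ Pr e, u * x = x ∧ x * u = x) ↔
      ∀ b : F[G], IsBlockIdempotent b → b * e.val = b → HasDefect p b 0 := by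
  have := Fintype.ofFinite G
  obtain ⟨s⟩ := nonempty_pimSystem e
  rw [s.exists_one_iff hF, forall_hasDefect_zero_iff]
  constructor
  · intro h
    refine s.exists_fullTrace_eq (p := p) hF ?_
    rw [s.cartan_eq]
    exact h.map (Int.castRingHom F).mapMatrix
  · rintro ⟨a, ha⟩
    exact s.isUnit_cartanInt hF ha

end DefectZero

end PPermutation

theorem theoremB {p : ℕ} [Fact p.Prime] {F : Type u} [Field F] [CharP F p] {G : Type v} [Group G]
    [Finite G] (hF : IsSplittingFor F G) (e : CentralIdempotent F G) :
    -- `Pr(B,B)` is an ideal of `T^Δ(B,B)`, and systems of idempotents `ε₁, …, ε_l` as below exist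
    (∀ t : TDelta e, ∀ x ∈ Pr e, t * x ∈ Pr e ∧ x * t ∈ Pr e) ∧
    Nonempty (PIMSystem e (numSimple e)) ∧
    (∀ (k : Type w) [Field k], ringChar k ≠ p →
      -- `k ⊗ Pr(B,B)` is embedded into `k T^Δ(B,B)`
      Function.Injective ((Pr e).subtype.baseChange k) ∧
      -- `k Pr(B,B)` is isomorphic to `Mat_l(k)`
      (∃ φ : kPr k e ≃ₗ[k] Matrix (Fin (numSimple e)) (Fin (numSimple e)) k,
        ∀ x y z : kPr k e, (x : kTDelta k e) * y = z → φ x * φ y = φ z) ∧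
      ∃ u ∈ kPr k e,
        -- `u` is the identity element of `k Pr(B,B)`, and a central idempotent of `k T^Δ(B,B)`
        (∀ x ∈ kPr k e, u * x = x ∧ x * u = x) ∧
        u * u = u ∧ u ∈ Set.center (kTDelta k e) ∧
        -- `k Pr(B,B)` is the ideal generated by `u`, a block algebra of `k T^Δ(B,B)` if `B ≠ 0`
        (∀ x, x ∈ kPr k e ↔ ∃ t : kTDelta k e, t * u = x) ∧
        (e.val ≠ 0 → IsPrimitiveIn (Set.center (kTDelta k e)) u) ∧
        -- primitive decompositions of `u` in `k Pr(B,B)` have length `l`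
        (∀ s : Finset (kTDelta k e), (∀ x ∈ s, IsPrimitiveIn (kPr k e : Set (kTDelta k e)) x) →
          (∀ x ∈ s, ∀ y ∈ s, x ≠ y → x * y = 0) → ∑ x ∈ s, x = u → s.card = numSimple e) ∧
        -- primitive idempotents of `k Pr(B,B)` are conjugate by units of `k Pr(B,B)`
        (∀ x y : kTDelta k e, IsPrimitiveIn (kPr k e : Set (kTDelta k e)) x →
          IsPrimitiveIn (kPr k e : Set (kTDelta k e)) y →
          ∃ a ∈ kPr k e, ∃ b ∈ kPr k e, a * b = u ∧ b * a = u ∧ a * x * b = y) ∧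
        -- the explicit formula for `u`, and the explicit primitive decomposition of `u`
        ∀ s : PIMSystem e (numSimple e),
          IsUnit (s.cartan k) ∧
          u = ∑ i, ∑ j, (s.cartan k)⁻¹ i j ⊗ₜ[ℤ] s.cls i j ∧
          (∀ i, IsPrimitiveIn (kPr k e : Set (kTDelta k e))
            (∑ j, (s.cartan k)⁻¹ i j ⊗ₜ[ℤ] s.cls i j)) ∧
          (∀ i i', i ≠ i' → (∑ j, (s.cartan k)⁻¹ i j ⊗ₜ[ℤ] s.cls i j) *
            (∑ j, (s.cartan k)⁻¹ i' j ⊗ₜ[ℤ] s.cls i' j) = (0 : kTDelta k e))) ∧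
    -- `Pr(B,B)` has an identity element iff all blocks of `B` have defect `0`
    ((∃ u ∈ Pr e, ∀ x ∈ Pr e, u * x = x ∧ x * u = x) ↔
      ∀ b : F[G], IsBlockIdempotent b → b * e.val = b → HasDefect p b 0) := by
  have hA := hF.hasScalarEnds
  refine ⟨Pr_ideal hA, nonempty_pimSystem e, fun k _ hk => ?_,
    exists_one_iff_forall_hasDefect_zero hA e⟩
  have hC := fun s : PIMSystem e (numSimple e) => s.isUnit_cartan (p := p) hF k hk
  have hΘ := fun s => PIMSystem.isMatrixIdeal s k hA (hC s)
  have hrow : ∀ (s : PIMSystem e (numSimple e)) i, ∑ j, (s.cartan k)⁻¹ i j ⊗ₜ[ℤ] s.cls i j =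
      (s.clsMap k ∘ₗ LinearMap.mulRight k (s.cartan k)⁻¹) (Matrix.single i i 1) := fun s i =>
    (s.clsMap_single_mul k _ i).symm
  obtain ⟨s₀⟩ := nonempty_pimSystem e
  have h := hΘ s₀
  refine ⟨baseChange_subtype_injective k hA, h.exists_equiv, _, h.mem 1, fun x => h.one_mul_eq,
    (h.one_mul_eq (h.mem 1)).1, Semigroup.mem_center_iff.2 fun x => (h.one_central x).symm,
    fun x => h.mem_iff, fun he => h.isPrimitiveIn_center (numSimple_ne_zero he), h.card_eq,
    fun x y => h.exists_conj, fun s => ⟨hC s, ?_, fun i => ?_, fun i i' hi => ?_⟩⟩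
  · have h1 := ((hΘ s).one_mul_eq (h.mem 1)).1
    rw [(h.one_mul_eq ((hΘ s).mem 1)).2] at h1
    rw [← h1, LinearMap.comp_apply, LinearMap.mulRight_apply, one_mul, s.clsMap_apply]
  · rw [hrow, (hΘ s).isPrimitiveIn_iff]
    exact isPrimitiveIn_single i
  · rw [hrow, hrow, ← (hΘ s).map_mul, Matrix.single_mul_single_of_ne _ _ _ _ hi, map_zero]
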